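/- **Setting.** Let $X$ be a smooth manifold modelled on a real normed space (in Chern–Simons theory $X=BG$ for a compact Lie group $G$), $\{U_\alpha\}_{\alpha\in I}$ an open covering of $X$, and $\mu=(g,\omega^1,\omega^2,\omega^3)$ a normalized Čech 3-cocycle of the covering with values in the Deligne complex $\underline{\mathbb T}\xrightarrow{\frac1{\sqrt{-1}}d\log}\underline A^1\xrightarrow{d}\underline A^2\xrightarrow{d}\underline A^3$ (in Chern–Simons theory: a cocycle representing the class $c_u$ with $\frac1{2\pi}d\omega^3_\alpha=\frac1{8\pi^2}\mathrm{Tr}(F_u\wedge F_u)|_{U_\alpha}$). That is, $g_{\alpha\beta\gamma\delta}$ are smooth $\mathbb T$-valued functions and $\omega^1_{\alpha\beta\gamma},\omega^2_{\alpha\beta},\omega^3_\alpha$ smooth forms of degrees $1,2,3$ on the intersections of the corresponding sets, trivial when two consecutive indices coincide, with $$\delta g=1,\qquad \delta\omega^1=\tfrac1{\sqrt{-1}}d\log g,\qquad \delta\omega^2=-d\omega^1,\qquad \delta\omega^3=d\omega^2 .$$ Let $M$ be a compact oriented smooth 3-manifold with non-empty boundary $\Sigma=\partial M$, with the boundary orientation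 (outward normal first). Fix a smooth triangulation of $M$, i.e. a bijection $h:P\to M$ from the polyhedron $P$ of a finite simplicial complex in a real normed space that is a smooth immersion on each closed simplex. A *triangulation of $M$* means a finite simplicial complex $K$ with $|K|=P$ such that $h$ is a smooth immersion on each closed simplex; triangulations of $\Sigma$ are defined in the same way with $P_\Sigma=h^{-1}(\Sigma)$ and $h|_{P_\Sigma}$. Simplices are identified with their images. For a pair $A=\{K,\phi\}$ of a triangulation $K$ of $N=M$ or $N=\Sigma$ and a map $\phi:K\to I$, $\sigma\mapsto\phi_\sigma$, let $\mathcal W_A$ (for $N=M$), $\mathcal U_A$ (for $N=\Sigma$) be the set of the smooth maps $\gamma:N\to X$ with $\gamma(\sigma)\subset U_{\phi_\sigma}$ for all $\sigma\in K$. On a subdivision $K'$ of $K$ the induced map is $\phi'_{\sigma'}=\phi_\sigma$ with $\sigma$ the smallest simplex of $K$ containing $\sigma'$. For a $d$-dimensional $K$, $F_K(p)$ is the set of flags $\sigma_p\subset\dots\subset\sigma_d$ of simplices of $K$ ($\dim\sigma_i=i$), and $\sigma_p$ carries the orientation induced from that of $\sigma_d$ by passing successively to boundaries; products over $F_K(0)$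 are taken with exponent $\pm1$ according to the orientation of the point $\sigma_0$. For $A=\{K,\phi\}$ and $\gamma\in\mathcal W_A$ put, with $\phi_p=\phi_{\sigma_p}$, $$\mathcal A_{M;A}(\gamma)=\exp\sqrt{-1}\Big\{\sum_{F_K(3)}\int_{\sigma_3}\gamma^*\omega^3_{\phi_3}-\sum_{F_K(2)}\int_{\sigma_2}\gamma^*\omega^2_{\phi_2\phi_3}-\sum_{F_K(1)}\int_{\sigma_1}\gamma^*\omega^1_{\phi_1\phi_2\phi_3}\Big\}\prod_{F_K(0)}g_{\phi_0\phi_1\phi_2\phi_3}(\gamma(\sigma_0))\in\mathbb T .$$ For pairs $A_0,A_1$ on $\Sigma$ and $\gamma\in\mathcal U_{A_0}\cap\mathcal U_{A_1}$ put, with $K$ a common subdivision of the two triangulations and $\phi^0,\phi^1$ the induced maps on $K$, $$G_{A_0A_1}(\gamma)=\exp\sqrt{-1}\Big\{-\sum_{F_K(2)}\int_{\sigma_2}\gamma^*\omega^2_{\phi^0_2\phi^1_2}-\sum_{F_K(1)}\int_{\sigma_1}\gamma^*\big(\omega^1_{\phi^0_1\phi^0_2\phi^1_2}-\omega^1_{\phi^0_1\phi^1_1\phi^1_2}\big)\Big\}\prod_{F_K(0)}\Big\{g_{\phi^0_0\phi^0_1\phi^0_2\phi^1_2}\,g_{\phi^0_0\phi^0_1\phi^1_1\phi^1_2}^{-1}\,g_{\phi^0_0\phi^1_0\phi^1_1\phi^1_2}\Big\}(\gamma(\sigma_0)).$$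 The Chern–Simons line bundle $\mathcal L_\Sigma\to\mathrm{Map}(\Sigma,X)$ over the set of smooth maps is $\coprod_A(\mathcal U_A\times\mathbb C)/\!\sim$, where $\sim$ is generated by $(\gamma,z_0)\sim(\gamma,z_1)$ for $z_0=G_{A_0A_1}(\gamma)z_1$, $(\gamma,z_i)\in\mathcal U_{A_i}\times\mathbb C$; its Hermitian metric is given by the usual metric of $\mathbb C$. Let $r:\mathrm{Map}(M,X)\to\mathrm{Map}(\Sigma,X)$ be the restriction map. For a pair $\tilde A=\{\tilde K,\tilde\phi\}$ on $M$ and a pair $A=\{K,\phi\}$ on $\Sigma$ write $\partial\tilde A=A$ if $K=\partial\tilde K$ is the complex of the simplices of $\tilde K$ contained in $\Sigma$ and $\phi=\tilde\phi|_{\partial\tilde K}$. **Theorem.** 1. The sets $\mathcal U_A$ cover $\mathrm{Map}(\Sigma,X)$, and for every $A$ and every $\gamma\in\mathcal U_A$ the map $z\mapsto[(\gamma,z)]$ from $\mathbb C$ (using the chart $\mathcal U_A\times\mathbb C$) to the fibre $\mathcal L_\Sigma|_\gamma$ is bijective. 2. The sets $\mathcal W_{\tilde A}$ cover $\mathrm{Map}(M,X)$;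 for every $\tilde A$ there is a pair $A$ on $\Sigma$ with $\partial\tilde A=A$, and then $\mathcal W_{\tilde A}\subset r^{-1}\mathcal U_A$. If the triangulation of $A$ is $\partial\tilde K$, or a subdivision of $\partial\tilde K$, for some triangulation $\tilde K$ of $M$, then $r^{-1}\mathcal U_A=\bigcup_{\partial\tilde A=A}\mathcal W_{\tilde A}$. 3. If $\partial\tilde A_0=\partial\tilde A_1=A$, then $\mathcal A_{M;\tilde A_0}=\mathcal A_{M;\tilde A_1}$ on $\mathcal W_{\tilde A_0}\cap\mathcal W_{\tilde A_1}$. 4. There is exactly one section $\mathcal A_M$ of $r^*\mathcal L_\Sigma$ over $\mathrm{Map}(M,X)$ such that $\mathcal A_M(\gamma)=[(r(\gamma),\mathcal A_{M;\tilde A}(\gamma))]$ (in the chart $\mathcal U_A\times\mathbb C$) whenever $\partial\tilde A=A$ and $\gamma\in\mathcal W_{\tilde A}$, and it has unit norm: $\|\mathcal A_M(\gamma)\|=1$ for all $\gamma$. -/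

import Mathlib

open scoped Manifold ContDiff Topology
open Set

namespace ChernSimons

noncomputable section

/-! ### Differential forms and Deligne cocycles on a smooth manifold -/

section Forms

variable {E : Type*} [NormedAddCommGroup E] [NormedSpace ℝ E]
  {X : Type*} [TopologicalSpace X] [ChartedSpace E X]

variable (E X) in
/-- A (not necessarily smooth) field of alternating `p`-forms on the manifold `X`. -/
abbrev Form (p : ℕ) : Type _ :=
  ∀ x : X, (TangentSpace 𝓘(ℝ, E) x) [⋀^Fin p]→L[ℝ] ℝ

/-- The expression of a form in the preferred chart around `x₀`: its pullback along the inverse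
of that chart. -/
def Form.inChart {p : ℕ} (η : Form E X p) (x₀ : X) : E → E [⋀^Fin p]→L[ℝ] ℝ := fun y =>
  (η ((extChartAt 𝓘(ℝ, E) x₀).symm y)).compContinuousLinearMap
    (mfderiv 𝓘(ℝ, E) 𝓘(ℝ, E) (extChartAt 𝓘(ℝ, E) x₀).symm y)

/-- Smoothness of a form on a subset `U` (meant to be open): all its chart expressions are
smooth on the part of the chart domain that corresponds to `U`. -/
def Form.SmoothOn {p : ℕ} (η : Form E X p) (U : Set X) : Prop :=
  ∀ x₀ : X, ContDiffOn ℝ ∞ (η.inChart x₀)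
    ((extChartAt 𝓘(ℝ, E) x₀).target ∩ (extChartAt 𝓘(ℝ, E) x₀).symm ⁻¹' U)

/-- The exterior derivative of a form, computed at `x` in the preferred chart around `x`
(this chart induces the identification `TangentSpace 𝓘(ℝ, E) x = E`). -/
def Form.d {p : ℕ} (η : Form E X p) : Form E X (p + 1) := fun x =>
  extDeriv (E := E) (η.inChart x) (extChartAt 𝓘(ℝ, E) x x)

variable (E) in
/-- A Čech cocycle of degree `3` for the covering `U` with values in the Deligne complex
`𝕋 → A¹ → A² → A³` (first arrow `(1/√-1) d log`, then `d`). The total differential is `δ` plus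
or minus the internal differential, with alternating signs. The cochains are normalized: they are
trivial as soon as two consecutive indices coincide (as is automatic for alternating cochains).
Only the values on the relevant intersections of members of `U` matter. -/
structure DeligneCocycle {ι : Type*} (U : ι → Set X) where
  /-- the component in `Č³(U, 𝕋)` -/
  g : ι → ι → ι → ι → X → Circle
  /-- the component in `Č²(U, A¹)` -/
  η₁ : ι → ι → ι → Form E X 1
  /-- the component in `Č¹(U, A²)` -/
  η₂ : ι → ι → Form E X 2
  /-- the component in `Č⁰(U, A³)` -/
  η₃ : ι → Form E X 3
  g_smooth : ∀ a b c e, ContMDiffOn 𝓘(ℝ, E) 𝓘(ℝ, ℂ) ∞ (fun x => (g a b c e x : ℂ))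
    (U a ∩ U b ∩ U c ∩ U e)
  η₁_smooth : ∀ a b c, (η₁ a b c).SmoothOn (U a ∩ U b ∩ U c)
  η₂_smooth : ∀ a b, (η₂ a b).SmoothOn (U a ∩ U b)
  η₃_smooth : ∀ a, (η₃ a).SmoothOn (U a)
  g_normalized : ∀ a b c, ∀ x ∈ U a ∩ U b ∩ U c,
    g a a b c x = 1 ∧ g a b b c x = 1 ∧ g a b c c x = 1
  η₁_normalized : ∀ a b, ∀ x ∈ U a ∩ U b, η₁ a a b x = 0 ∧ η₁ a b b x = 0
  η₂_normalized : ∀ a, ∀ x ∈ U a, η₂ a a x = 0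
  /-- `δ g = 1` -/
  cocycle_g : ∀ a b c e f, ∀ x ∈ U a ∩ U b ∩ U c ∩ U e ∩ U f,
    g b c e f x * (g a c e f x)⁻¹ * g a b e f x * (g a b c f x)⁻¹ * g a b c e x = 1
  /-- `(1/√-1) d log g = δ η₁`, written as `d g = √-1 g δ η₁` -/
  cocycle_η₁ : ∀ a b c e, ∀ x ∈ U a ∩ U b ∩ U c ∩ U e, ∀ v : TangentSpace 𝓘(ℝ, E) x,
    (mfderiv 𝓘(ℝ, E) 𝓘(ℝ, ℂ) (fun y => (g a b c e y : ℂ)) x v : ℂ) =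
      Complex.I * (g a b c e x : ℂ) *
        (((η₁ b c e x - η₁ a c e x + η₁ a b e x - η₁ a b c x) (fun _ => v) : ℝ) : ℂ)
  /-- `d η₁ = - δ η₂` -/
  cocycle_η₂ : ∀ a b c, ∀ x ∈ U a ∩ U b ∩ U c,
    (η₁ a b c).d x = -(η₂ b c x - η₂ a c x + η₂ a b x)
  /-- `d η₂ = δ η₃` -/
  cocycle_η₃ : ∀ a b, ∀ x ∈ U a ∩ U b, (η₂ a b).d x = η₃ b x - η₃ a x

end Forms

/-! ### Orientations of manifolds -/

section Orientation

variable {n : ℕ} {H : Type*} [TopologicalSpace H]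
  (I : ModelWithCorners ℝ (EuclideanSpace ℝ (Fin n)) H)
  (N : Type*) [TopologicalSpace N] [ChartedSpace H N]

/-- An orientation of an `n`-manifold. Recall that the tangent space at `x` is identified with
`ℝⁿ` by the preferred chart around `x`. The orientation of the tangent space at `x` is recorded
by a sign that says whether the standard basis of `ℝⁿ` is positive, and the orientations vary
continuously: near `x` they are compared in the preferred chart around `x`. -/
structure ManifoldOrientation [IsManifold I 1 N] where
  /-- the sign of the standard frame at `x` -/
  sgn : N → ℤˣ
  locally_constant : ∀ x : N, ∀ᶠ y in 𝓝 x,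
    0 < (((sgn x * sgn y : ℤˣ) : ℤ) : ℝ) * (tangentCoordChange I y x y).det

variable {I N} [IsManifold I 1 N]

/-- The determinant of a frame at `x`, multiplied by the sign of the orientation: it is positive
exactly for positively oriented frames. -/
def ManifoldOrientation.frameDet (o : ManifoldOrientation I N) (x : N)
    (w : Fin n → EuclideanSpace ℝ (Fin n)) : ℝ :=
  ((o.sgn x : ℤ) : ℝ) * (Matrix.of fun i j => w j i).det

end Orientation

/-- The orientation `oS` of the surface `S` is the boundary orientation induced by the orientation
`oM` of the 3-manifold `M`, where `j : S → M` parametrizes the boundary ("outward normal first").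
In the coordinates of the half-space `{x | 0 ≤ x 0}`, the outward vectors are those with negative
coordinate `0`. -/
def IsBoundaryOrientation {M S : Type*}
    [TopologicalSpace M] [ChartedSpace (EuclideanHalfSpace 3) M] [IsManifold (𝓡∂ 3) 1 M]
    [TopologicalSpace S] [ChartedSpace (EuclideanSpace ℝ (Fin 2)) S] [IsManifold (𝓡 2) 1 S]
    (oM : ManifoldOrientation (𝓡∂ 3) M) (oS : ManifoldOrientation (𝓡 2) S) (j : S → M) : Prop :=
  ∀ (x : S) (w : Fin 2 → EuclideanSpace ℝ (Fin 2)) (ν : EuclideanSpace ℝ (Fin 3)),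
    0 < oS.frameDet x w → ν 0 < 0 →
      0 < oM.frameDet (j x)
        ![ν, mfderiv (𝓡 2) (𝓡∂ 3) j x (w 0), mfderiv (𝓡 2) (𝓡∂ 3) j x (w 1)]

/-! ### Simplices, triangulations and subdivisions -/

section Simplices

variable {V : Type*} [NormedAddCommGroup V] [NormedSpace ℝ V]

/-- The standard `p`-simplex `{t ∈ ℝᵖ | tᵢ ≥ 0, ∑ tᵢ ≤ 1}`. -/
def stdSimp (p : ℕ) : Set (Fin p → ℝ) := {t | (∀ i, 0 ≤ t i) ∧ ∑ i, t i ≤ 1}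

/-- The barycenter of the standard `p`-simplex. -/
def stdBary (p : ℕ) : Fin p → ℝ := fun _ => 1 / ((p : ℝ) + 1)

/-- The affine parametrization of the simplex with vertices `v 0, …, v p`. -/
def simplexParam {p : ℕ} (v : Fin (p + 1) → V) (t : Fin p → ℝ) : V :=
  v 0 + ∑ i, t i • (v i.succ - v 0)

/-- The set of vertices of a tuple. -/
def vertexSet {m : ℕ} (v : Fin m → V) : Finset V := (Set.finite_range v).toFinset

/-- The `p`-simplices of `K` together with an ordering of their vertices. -/
def orderedSimplices (K : Geometry.SimplicialComplex ℝ V) (p : ℕ) : Set (Fin (p + 1) → V) :=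
  {v | Function.Injective v ∧ vertexSet v ∈ K.faces}

/-- `K'` is a subdivision of `K`. -/
def IsSubdivision (K' K : Geometry.SimplicialComplex ℝ V) : Prop :=
  K'.space = K.space ∧
    ∀ s' ∈ K'.faces, ∃ s ∈ K.faces, convexHull ℝ (s' : Set V) ⊆ convexHull ℝ (s : Set V)

/-- `s` is the smallest simplex of `K` that contains the simplex `s'`. -/
def IsCarrier (K : Geometry.SimplicialComplex ℝ V) (s' s : Finset V) : Prop :=
  s ∈ K.faces ∧ convexHull ℝ (s' : Set V) ⊆ convexHull ℝ (s : Set V) ∧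
    ∀ u ∈ K.faces, convexHull ℝ (s' : Set V) ⊆ convexHull ℝ (u : Set V) → s ⊆ u

variable {EN H : Type*} [NormedAddCommGroup EN] [NormedSpace ℝ EN] [TopologicalSpace H]
  {N : Type*} [TopologicalSpace N] [ChartedSpace H N]

/-- The finite simplicial complex `K` with underlying polyhedron `P` is, together with the map
`h`, a smooth triangulation of the manifold `N`: `h` maps `P` bijectively onto `N`, and it is a
smooth immersion on every closed simplex. (When `N` is Hausdorff, `h` is then a homeomorphism of
`P` onto `N`.) Only the restriction of `h` to `P` matters. -/
structure IsSmoothTriangulation (I : ModelWithCorners ℝ EN H) (P : Set V) (h : V → N)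
    (K : Geometry.SimplicialComplex ℝ V) : Prop where
  finite : K.faces.Finite
  space_eq : K.space = P
  bijOn : BijOn h P univ
  smooth : ∀ (p : ℕ), ∀ v ∈ orderedSimplices K p,
    ContMDiffOn 𝓘(ℝ, Fin p → ℝ) I ∞ (h ∘ simplexParam v) (stdSimp p)
  immersive : ∀ (p : ℕ), ∀ v ∈ orderedSimplices K p, ∀ t ∈ stdSimp p,
    Function.Injective
      (mfderivWithin 𝓘(ℝ, Fin p → ℝ) I (h ∘ simplexParam v) (stdSimp p) t)

/-- A pair `A = {K, φ}`: a smooth triangulation `K` of `N` with underlying polyhedron `P`, and a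
map `φ` from the simplices of `K` to the index set `ι` of a covering (only the values of `φ` on
simplices of `K` matter). -/
structure Pair (I : ModelWithCorners ℝ EN H) (P : Set V) (h : V → N) (ι : Type*) where
  /-- the triangulation -/
  K : Geometry.SimplicialComplex ℝ V
  isSmoothTriangulation : IsSmoothTriangulation I P h K
  /-- the map to the index set -/
  φ : Finset V → ι

variable {I : ModelWithCorners ℝ EN H} {P : Set V} {h : V → N} {ι : Type*}

/-- `A'` is a subdivision of `A`, with the induced map to the index set. -/
def Pair.Refines (A' A : Pair I P h ι) : Prop :=
  IsSubdivision A'.K A.K ∧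
    ∀ s' ∈ A'.K.faces, ∀ s, IsCarrier A.K s' s → A'.φ s' = A.φ s

/-- The open set of the maps `γ : N → X` that send every simplex `σ` of `K` into `U (φ σ)`. -/
def Pair.Dom {X : Type*} (U : ι → Set X) (A : Pair I P h ι) : Set (N → X) :=
  {γ | ∀ s ∈ A.K.faces, MapsTo (γ ∘ h) (convexHull ℝ (s : Set V)) (U (A.φ s))}

end Simplices

/-! ### Integration over flags -/

section Integration

variable {V : Type*} [NormedAddCommGroup V] [NormedSpace ℝ V]
  {E : Type*} [NormedAddCommGroup E] [NormedSpace ℝ E]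
  {X : Type*} [TopologicalSpace X] [ChartedSpace E X]

/-- The integral of `f^* η` over the simplex with vertices `v 0, …, v p`, oriented by this
ordering of the vertices. -/
def simplexIntegral {p : ℕ} (f : V → X) (v : Fin (p + 1) → V) (η : Form E X p) : ℝ :=
  ∫ t in stdSimp p, η (f (simplexParam v t)) fun i =>
    mfderivWithin 𝓘(ℝ, Fin p → ℝ) 𝓘(ℝ, E) (f ∘ simplexParam v) (stdSimp p) t (Pi.single i 1)

variable {n : ℕ} {H : Type*} [TopologicalSpace H]
  {I : ModelWithCorners ℝ (EuclideanSpace ℝ (Fin n)) H}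
  {N : Type*} [TopologicalSpace N] [ChartedSpace H N] [IsManifold I 1 N]

/-- The sign (`1` or `-1`) that compares the orientation of a top-dimensional simplex given by the
ordering `v` of its vertices with the orientation of the manifold. -/
def orientSign (o : ManifoldOrientation I N) (h : V → N) (v : Fin (n + 1) → V) : ℤ :=
  (SignType.sign (o.frameDet (h (simplexParam v (stdBary n))) fun i =>
    mfderivWithin 𝓘(ℝ, Fin n → ℝ) I (h ∘ simplexParam v) (stdSimp n) (stdBary n)
      (Pi.single i 1)) : ℤ)

end Integration

/-! ### The local action and the transition functions

An ordering `v = (v₀, …, v_d)` of the vertices of a `d`-simplex determines for each `p` the flag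
`σ_p ⊂ … ⊂ σ_d` in which `σ_q` is spanned by the last `q + 1` vertices; the orientation of `σ_p`
that is induced from `σ_d` by passing successively to the boundary is that of
`(v_{d-p}, …, v_d)` times the sign of `v`. Each flag in `F(p)` comes in this way from exactly
`(p + 1)!` orderings, which all give the same term, so that a sum over `F(p)` is the sum over the
orderings divided by `(p + 1)!`. A point `σ₀` with negative induced orientation contributes the
inverse to a product over `F(0)`. -/

section Action

variable {V : Type*} [NormedAddCommGroup V] [NormedSpace ℝ V]
  {E : Type*} [NormedAddCommGroup E] [NormedSpace ℝ E]
  {X : Type*} [TopologicalSpace X] [ChartedSpace E X]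
  {ι : Type*} {U : ι → Set X}

/-- The local Chern-Simons action `𝒜_{M;A}(γ)` of a 3-manifold:
`exp √-1 {∑_{F(3)} ∫ γ^*η₃ - ∑_{F(2)} ∫ γ^*η₂ - ∑_{F(1)} ∫ γ^*η₁} × ∏_{F(0)} g`. -/
def localAction {H : Type*} [TopologicalSpace H]
    {I : ModelWithCorners ℝ (EuclideanSpace ℝ (Fin 3)) H}
    {M : Type*} [TopologicalSpace M] [ChartedSpace H M] [IsManifold I 1 M]
    (μ : DeligneCocycle E U) (o : ManifoldOrientation I M)
    {P : Set V} {h : V → M} (A : Pair I P h ι) (γ : M → X) : Circle :=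
  let σ₃ (v : Fin 4 → V) : Fin 4 → V := v
  let σ₂ (v : Fin 4 → V) : Fin 3 → V := ![v 1, v 2, v 3]
  let σ₁ (v : Fin 4 → V) : Fin 2 → V := ![v 2, v 3]
  let σ₀ (v : Fin 4 → V) : Fin 1 → V := ![v 3]
  let φ {m : ℕ} (s : Fin m → V) : ι := A.φ (vertexSet s)
  Circle.exp
    (∑ᶠ v ∈ orderedSimplices A.K 3, (orientSign o h v : ℝ) *
      ((1 / 24) * simplexIntegral (γ ∘ h) (σ₃ v) (μ.η₃ (φ (σ₃ v)))
        - (1 / 6) * simplexIntegral (γ ∘ h) (σ₂ v) (μ.η₂ (φ (σ₂ v)) (φ (σ₃ v)))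
        - (1 / 2) * simplexIntegral (γ ∘ h) (σ₁ v)
            (μ.η₁ (φ (σ₁ v)) (φ (σ₂ v)) (φ (σ₃ v)))))
  * ∏ᶠ v ∈ orderedSimplices A.K 3,
      (μ.g (φ (σ₀ v)) (φ (σ₁ v)) (φ (σ₂ v)) (φ (σ₃ v)) (γ (h (v 3)))) ^ orientSign o h v

variable {S : Type*} [TopologicalSpace S] [ChartedSpace (EuclideanSpace ℝ (Fin 2)) S]
  [IsManifold (𝓡 2) 1 S]

/-- The expression that defines the transition function `G_{A₀A₁}(γ)` for two maps `φ⁰ = A₀.φ`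
and `φ¹ = A₁.φ` on the same triangulation `K = A₀.K` of a surface:
`exp √-1 {∑_{F(2)} ∫ γ^*(-η₂_{φ⁰₂φ¹₂}) - ∑_{F(1)} ∫ γ^*(η₁_{φ⁰₁φ⁰₂φ¹₂} - η₁_{φ⁰₁φ¹₁φ¹₂})}
× ∏_{F(0)} g_{φ⁰₀φ⁰₁φ⁰₂φ¹₂} g_{φ⁰₀φ⁰₁φ¹₁φ¹₂}⁻¹ g_{φ⁰₀φ¹₀φ¹₁φ¹₂}`. -/
def transition (μ : DeligneCocycle E U) (o : ManifoldOrientation (𝓡 2) S)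
    {P : Set V} {h : V → S} (A₀ A₁ : Pair (𝓡 2) P h ι) (γ : S → X) : Circle :=
  let σ₂ (v : Fin 3 → V) : Fin 3 → V := v
  let σ₁ (v : Fin 3 → V) : Fin 2 → V := ![v 1, v 2]
  let σ₀ (v : Fin 3 → V) : Fin 1 → V := ![v 2]
  let a {m : ℕ} (s : Fin m → V) : ι := A₀.φ (vertexSet s)
  let b {m : ℕ} (s : Fin m → V) : ι := A₁.φ (vertexSet s)
  Circle.exp
    (∑ᶠ v ∈ orderedSimplices A₀.K 2, (orientSign o h v : ℝ) *
      ((1 / 6) * simplexIntegral (γ ∘ h) (σ₂ v)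
          (fun x => -μ.η₂ (a (σ₂ v)) (b (σ₂ v)) x)
        - (1 / 2) * simplexIntegral (γ ∘ h) (σ₁ v)
          (fun x => μ.η₁ (a (σ₁ v)) (a (σ₂ v)) (b (σ₂ v)) x
            - μ.η₁ (a (σ₁ v)) (b (σ₁ v)) (b (σ₂ v)) x)))
  * ∏ᶠ v ∈ orderedSimplices A₀.K 2,
      (μ.g (a (σ₀ v)) (a (σ₁ v)) (a (σ₂ v)) (b (σ₂ v)) (γ (h (v 2)))
        * (μ.g (a (σ₀ v)) (a (σ₁ v)) (b (σ₁ v)) (b (σ₂ v)) (γ (h (v 2))))⁻¹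
        * μ.g (a (σ₀ v)) (b (σ₀ v)) (b (σ₁ v)) (b (σ₂ v)) (γ (h (v 2)))) ^ orientSign o h v

/-! ### The Chern-Simons line bundle of a closed oriented surface -/

/-- A point `(γ, z)` of the disjoint union of the sets `𝒰_A × ℂ`, where `𝒰_A` is the set of the
smooth maps `γ : S → X` that are adapted to `A`. -/
structure LocalPoint (μ : DeligneCocycle E U) (o : ManifoldOrientation (𝓡 2) S)
    (P : Set V) (h : V → S) where
  /-- the index of the summand -/
  A : Pair (𝓡 2) P h ι
  /-- the base point -/
  γ : C^∞⟮𝓡 2, S; 𝓘(ℝ, E), X⟯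
  mem_dom : ⇑γ ∈ A.Dom U
  /-- the fibre coordinate -/
  z : ℂ

variable {μ : DeligneCocycle E U} {o : ManifoldOrientation (𝓡 2) S} {P : Set V} {h : V → S}

/-- `(γ, z₀) ∈ 𝒰_{A₀} × ℂ` and `(γ, z₁) ∈ 𝒰_{A₁} × ℂ` are identified when
`z₀ = G_{A₀A₁}(γ) z₁`, where `G_{A₀A₁}` is computed on a common subdivision of the triangulations
of `A₀` and `A₁`, with the induced maps to the index set. -/
def Glue (q₀ q₁ : LocalPoint μ o P h) : Prop :=
  q₀.γ = q₁.γ ∧ ∃ A₀' A₁' : Pair (𝓡 2) P h ι,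
    A₀'.K = A₁'.K ∧ A₀'.Refines q₀.A ∧ A₁'.Refines q₁.A ∧
      q₀.z = (transition μ o A₀' A₁' q₀.γ : ℂ) * q₁.z

variable (μ o P h) in
/-- The total space of the Chern-Simons line bundle `ℒ_S` over the space of smooth maps from `S`
to `X`. -/
def LineBundle : Type _ := Quot (Glue (μ := μ) (o := o) (P := P) (h := h))

/-- The bundle projection of `ℒ_S`. -/
def LineBundle.proj : LineBundle μ o P h → C^∞⟮𝓡 2, S; 𝓘(ℝ, E), X⟯ :=
  Quot.lift (fun q => q.γ) fun _ _ hq => hq.1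

/-- The norm of the Hermitian metric of `ℒ_S`, which is given by the usual metric of `ℂ`. -/
def LineBundle.norm : LineBundle μ o P h → ℝ :=
  Quot.lift (fun q => ‖q.z‖) fun q₀ q₁ hq => by
    obtain ⟨-, A₀', A₁', -, -, -, hz⟩ := hq
    rw [hz, norm_mul, Circle.norm_coe, one_mul]

variable (μ o P h) in
/-- The fibre of `ℒ_S` over `γ`. -/
def Fibre (γ : C^∞⟮𝓡 2, S; 𝓘(ℝ, E), X⟯) : Type _ := {l : LineBundle μ o P h // l.proj = γ}

/-- The point of the fibre of `ℒ_S` over `γ` that is represented by `(γ, z) ∈ 𝒰_A × ℂ`. -/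
def Fibre.mk (A : Pair (𝓡 2) P h ι) (γ : C^∞⟮𝓡 2, S; 𝓘(ℝ, E), X⟯) (hγ : ⇑γ ∈ A.Dom U) (z : ℂ) :
    Fibre μ o P h γ :=
  ⟨Quot.mk _ ⟨A, γ, hγ, z⟩, rfl⟩

end Action

/-! ### The boundary of a triangulated 3-manifold -/

section Boundary

variable {V : Type*} [NormedAddCommGroup V] [NormedSpace ℝ V]
  {M : Type*} [TopologicalSpace M] [ChartedSpace (EuclideanHalfSpace 3) M]
  {S : Type*} [TopologicalSpace S] [ChartedSpace (EuclideanSpace ℝ (Fin 2)) S]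
  {ι : Type*}

/-- The part of the polyhedron `P` that corresponds to the boundary of `M`. -/
def boundaryPoly (P : Set V) (h : V → M) : Set V := {x ∈ P | h x ∈ (𝓡∂ 3).boundary M}

/-- The restriction of `h` to the boundary, as a map to the surface `S` that is identified with
`∂M` by the injective map `j : S → M`. Only its values on `boundaryPoly P h` matter. -/
def boundaryMap [Nonempty S] (h : V → M) (j : S → M) : V → S := Function.invFun j ∘ h

/-- The subcomplex `∂K` of the simplices of `K` that lie in the boundary of `M`. -/
def boundaryComplex (h : V → M) (K : Geometry.SimplicialComplex ℝ V) :
    Geometry.SimplicialComplex ℝ V where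
  faces := {s ∈ K.faces | MapsTo h (convexHull ℝ (s : Set V)) ((𝓡∂ 3).boundary M)}
  isRelLowerSet_faces := by
    rintro s ⟨hs, hsb⟩
    exact ⟨K.nonempty_of_mem_faces hs, fun t hts ht =>
      ⟨K.down_closed hs hts ht,
        hsb.mono_left (convexHull_mono (Finset.coe_subset.2 hts))⟩⟩
  indep hs := K.indep hs.1
  inter_subset_convexHull hs ht := K.inter_subset_convexHull hs.1 ht.1

/-- The relation `∂Ã = A`: the triangulation of `A` is the boundary of that of `Ã`, and the map of
`A` is the restriction of that of `Ã`. -/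
def IsBoundaryPair [Nonempty S] {P : Set V} {h : V → M} {j : S → M}
    (B : Pair (𝓡∂ 3) P h ι) (A : Pair (𝓡 2) (boundaryPoly P h) (boundaryMap h j) ι) : Prop :=
  A.K = boundaryComplex h B.K ∧ ∀ s ∈ A.K.faces, A.φ s = B.φ s

/-- The restriction map `r : Map(M, X) → Map(S, X)`. -/
def restrict {E : Type*} [NormedAddCommGroup E] [NormedSpace ℝ E]
    {X : Type*} [TopologicalSpace X] [ChartedSpace E X]
    (j : C^∞⟮𝓡 2, S; 𝓡∂ 3, M⟯) (γ : C^∞⟮𝓡∂ 3, M; 𝓘(ℝ, E), X⟯) : C^∞⟮𝓡 2, S; 𝓘(ℝ, E), X⟯ :=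
  γ.comp j

/-- A section `s` of the pullback `r^* ℒ_S` (whose fibre at `γ` is the fibre of `ℒ_S` over `r γ`)
is given by the local actions: `s γ` is represented by `(r γ, 𝒜_{M;Ã}(γ)) ∈ 𝒰_A × ℂ` whenever
`∂Ã = A` and `γ` is adapted to `Ã`. -/
def IsActionSection {E : Type*} [NormedAddCommGroup E] [NormedSpace ℝ E]
    {X : Type*} [TopologicalSpace X] [ChartedSpace E X] {U : ι → Set X}
    [IsManifold (𝓡∂ 3) 1 M] [IsManifold (𝓡 2) 1 S] [Nonempty S]
    (μ : DeligneCocycle E U) (oM : ManifoldOrientation (𝓡∂ 3) M)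
    (oS : ManifoldOrientation (𝓡 2) S) (j : C^∞⟮𝓡 2, S; 𝓡∂ 3, M⟯) (P : Set V) (h : V → M)
    (s : ∀ γ : C^∞⟮𝓡∂ 3, M; 𝓘(ℝ, E), X⟯,
      Fibre μ oS (boundaryPoly P h) (boundaryMap h j) (restrict j γ)) : Prop :=
  ∀ (B : Pair (𝓡∂ 3) P h ι) (A : Pair (𝓡 2) (boundaryPoly P h) (boundaryMap h j) ι)
    (γ : C^∞⟮𝓡∂ 3, M; 𝓘(ℝ, E), X⟯),
    IsBoundaryPair B A → ⇑γ ∈ B.Dom U → ∀ hγ : ⇑(restrict j γ) ∈ A.Dom U,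
      s γ = Fibre.mk A (restrict j γ) hγ (localAction μ oM B γ : ℂ)

end Boundary

end

end ChernSimons

namespace ChernSimons
noncomputable section
open Geometry MeasureTheory
open Geometry.SimplicialComplex (mem_space_iff convexHull_subset_space)
open Finset (sum_congr mul_sum sum_add_distrib sum_sub_distrib sum_eq_zero sum_nonneg sum_eq_single
  smul_sum sum_comm sum_const single_le_sum sum_smul eq_of_subset_of_card_le)
open Function (Injective comp_apply)
open Finsupp (mem_support_iff)
open Pi (single)
open Equiv (swap Perm)
open SignType (sign)
open ContinuousLinearMap (proj)
open Fin (tail cons sum_univ_succ tail_cons)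
set_option linter.unusedSectionVars false

/-- The closed simplex spanned by a finite set. -/
local notation "Δ" s:max => convexHull ℝ (SetLike.coe s)
/-- The affine parametrization of a simplex. -/
local notation "ρ" => simplexParam
/-- The ordered simplices of a complex. -/
local notation "ordS" => orderedSimplices
/-- The coordinates of a Euclidean space. -/
local notation:max "𝓔" m:max => EuclideanSpace.equiv (Fin m) ℝ
/-- The coordinate functions. -/
local notation:max "pr" m:max => proj (R := ℝ) (φ := fun _ : Fin m => ℝ)
/-- Euclidean spaces. -/
local notation:max "𝔼" m:max => EuclideanSpace ℝ (Fin m)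
/-- The model with corners of a space of tuples. -/
local notation:max "𝓜" m:max => 𝓘(ℝ, Fin m → ℝ)
/-- Real simplicial complexes. -/
local notation "Cpx" => SimplicialComplex ℝ
/-- The model of a half space. -/
local notation:max "𝓗" m:max => 𝓡∂ (m + 1)

section Weights

variable {V : Type*} [AddCommGroup V] [Module ℝ V]

/-- The linear combination `∑ w v • v`. -/
def cmb : (V →₀ ℝ) →ₗ[ℝ] V := Finsupp.linearCombination ℝ id

/-- The total mass `∑ w v`. -/
def tot : (V →₀ ℝ) →ₗ[ℝ] ℝ := Finsupp.linearCombination ℝ fun _ => (1 : ℝ)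

lemma cmb_eq_sum {w : V →₀ ℝ} {s : Finset V} (h : w.support ⊆ s) : cmb w = ∑ v ∈ s, w v • v :=
  Finsupp.sum_of_support_subset _ h _ (by simp)

lemma tot_eq_sum {w : V →₀ ℝ} {s : Finset V} (h : w.support ⊆ s) : tot w = ∑ v ∈ s, w v := by
  have := Finsupp.sum_of_support_subset w h (fun _ a => a • (1 : ℝ)) (by simp)
  simpa [tot, Finsupp.linearCombination_apply] using this

@[simp] lemma cmb_single (v : V) (a : ℝ) : cmb (Finsupp.single v a) = a • v := by simp [cmb]

@[simp] lemma tot_single (v : V) (a : ℝ) : tot (Finsupp.single v a) = a := by simp [tot]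

lemma exists_finsupp (s : Finset V) (f : V → ℝ) :
    ∃ w : V →₀ ℝ, w.support ⊆ s ∧ (∀ v ∈ s, w v = f v) := by
  classical
  refine ⟨Finsupp.onFinset s (fun v => if v ∈ s then f v else 0) (by aesop), ?_, ?_⟩
  · exact Finsupp.support_onFinset_subset
  · intro v hv; simp [hv]

lemma mem_convexHull_iff_weights {s : Finset V} {x : V} : x ∈ Δ s ↔
      ∃ w : V →₀ ℝ, 0 ≤ w ∧ w.support ⊆ s ∧ tot w = 1 ∧ cmb w = x := by
  rw [Finset.mem_convexHull']
  constructor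
  · rintro ⟨f, hf, hf1, hfx⟩
    obtain ⟨w, hw, hwf⟩ := exists_finsupp s f
    refine ⟨w, fun v => ?_, hw, ?_, ?_⟩
    · by_cases hv : v ∈ s
      · simpa [hwf v hv] using hf v hv
      · have : w v = 0 := by
          by_contra h; exact hv (hw (mem_support_iff.2 h))
        simp [this]
    · rw [tot_eq_sum hw, ← hf1]; exact sum_congr rfl hwf
    · rw [cmb_eq_sum hw, ← hfx]; exact sum_congr rfl fun v hv => by rw [hwf v hv]
  · rintro ⟨w, hw0, hw, hw1, hwx⟩
    exact ⟨w, fun v _ => hw0 v, by rw [← hw1, tot_eq_sum hw], by rw [← hwx, cmb_eq_sum hw]⟩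

lemma eq_zero_of_tot_eq_zero {w : V →₀ ℝ} (h0 : 0 ≤ w) (h : tot w = 0) : w = 0 := by
  rw [tot_eq_sum (Finset.Subset.refl _), Finset.sum_eq_zero_iff_of_nonneg fun v _ => h0 v] at h
  ext v
  by_cases hv : v ∈ w.support
  · exact h v hv
  · simpa using hv

lemma tot_nonneg {w : V →₀ ℝ} (h0 : 0 ≤ w) : 0 ≤ tot w := by
  rw [tot_eq_sum (Finset.Subset.refl _)]; exact sum_nonneg fun v _ => h0 v

lemma weights_unique_of_indep {s : Finset V} (hs : AffineIndependent ℝ ((↑) : s → V))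
    {w w' : V →₀ ℝ} (hw : w.support ⊆ s) (hw' : w'.support ⊆ s) (ht : tot w = tot w')
    (hc : cmb w = cmb w') : w = w' := by
  classical
  have hd : (w - w').support ⊆ s := Finsupp.support_sub.trans (Finset.union_subset hw hw')
  have h0 : tot (w - w') = 0 := by simp [ht]
  have h1 : cmb (w - w') = 0 := by simp [hc]
  rw [tot_eq_sum hd, ← Finset.sum_coe_sort] at h0
  rw [cmb_eq_sum hd, ← Finset.sum_coe_sort] at h1
  have := affineIndependent_iff.1 hs Finset.univ (fun i => (w - w') i) h0 h1
  rw [← sub_eq_zero]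
  ext v
  by_cases hv : v ∈ s
  · exact this ⟨v, hv⟩ (Finset.mem_univ _)
  · by_contra h; exact hv (hd (mem_support_iff.2 h))

/-- Non-negative weights that are supported on one of the faces, or vanish. -/
def IsWeight (F : Set (Finset V)) (w : V →₀ ℝ) : Prop := 0 ≤ w ∧ (w = 0 ∨ w.support ∈ F)

lemma IsWeight.of_subset {K : Cpx V} {w : V →₀ ℝ} {s : Finset V}
    (h0 : 0 ≤ w) (hs : s ∈ K.faces) (hws : w.support ⊆ s) : IsWeight K.faces w := by
  refine ⟨h0, ?_⟩
  by_cases h : w = 0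
  · exact Or.inl h
  · exact Or.inr (K.down_closed hs hws (Finsupp.support_nonempty_iff.2 h))

lemma IsWeight.unique {K : Cpx V} {w w' : V →₀ ℝ} (hw : IsWeight K.faces w)
    (hw' : IsWeight K.faces w') (ht : tot w = tot w') (hc : cmb w = cmb w') : w = w' := by
  classical
  by_cases hr : tot w = 0
  · rw [eq_zero_of_tot_eq_zero hw.1 hr, eq_zero_of_tot_eq_zero hw'.1 (ht ▸ hr)]
  have hrpos : 0 < tot w := lt_of_le_of_ne (tot_nonneg hw.1) (Ne.symm hr)
  have hs := hw.2.resolve_left (fun h => hr (by simp [h]))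
  have hs' := hw'.2.resolve_left (fun h => hr (by simp [ht, h]))
  set r := tot w with hrdef
  have key : ∀ u : V →₀ ℝ, 0 ≤ u → tot u = r → r⁻¹ • cmb u ∈ convexHull ℝ (u.support : Set V) := by
    intro u hu hur
    rw [mem_convexHull_iff_weights]
    refine ⟨r⁻¹ • u, smul_nonneg (inv_nonneg.2 hrpos.le) hu, Finsupp.support_smul, ?_, ?_⟩
    · rw [map_smul, hur, smul_eq_mul, inv_mul_cancel₀ hr]
    · rw [map_smul]
  have h1 := key w hw.1 rfl
  have h2 := key w' hw'.1 ht.symm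
  rw [← hc] at h2
  have h3 := K.inter_subset_convexHull hs hs' ⟨h1, h2⟩
  rw [← Finset.coe_inter, mem_convexHull_iff_weights] at h3
  obtain ⟨u, hu0, hus, hu1, huc⟩ := h3
  have hcu : cmb (r • u) = cmb w := by rw [map_smul, huc, smul_smul, mul_inv_cancel₀ hr, one_smul]
  have htu : tot (r • u) = r := by rw [map_smul, hu1, smul_eq_mul, mul_one]
  have e1 : r • u = w := weights_unique_of_indep (K.indep hs)
    (Finsupp.support_smul.trans (hus.trans Finset.inter_subset_left)) (Finset.Subset.refl _)
    htu hcu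
  have e2 : r • u = w' := weights_unique_of_indep (K.indep hs')
    (Finsupp.support_smul.trans (hus.trans Finset.inter_subset_right)) (Finset.Subset.refl _)
    (htu.trans ht) (hcu.trans hc)
  exact e1.symm.trans e2

/-- A simplicial complex from a down-closed set of faces in which points have unique weights. -/
def complexOfWeights (F : Set (Finset V)) (hne : ∀ s ∈ F, s.Nonempty)
    (hdown : ∀ s ∈ F, ∀ t ⊆ s, t.Nonempty → t ∈ F)
    (huniq : ∀ w w', IsWeight F w → IsWeight F w' → tot w = tot w' → cmb w = cmb w' → w = w') : Cpx
    V where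
  faces := F
  isRelLowerSet_faces := by
    intro s hs
    exact ⟨hne s hs, fun t hts ht => hdown s hs t hts ht⟩
  indep := by
    classical
    intro s hs
    rw [affineIndependent_iff]
    intro T f h0 h1 i hi
    obtain ⟨w, hw, hwf⟩ := exists_finsupp (T.map (Function.Embedding.subtype _))
      (fun v => if h : v ∈ s then f ⟨v, h⟩ else 0)
    have hTs : T.map (Function.Embedding.subtype _) ⊆ s := by
      intro v hv
      simp only [Finset.mem_map, Function.Embedding.subtype_apply] at hv
      obtain ⟨a, -, rfl⟩ := hv
      exact a.2
    have hws : w.support ⊆ s := hw.trans hTs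
    have ht : tot w = 0 := by
      rw [tot_eq_sum hw, ← h0, Finset.sum_map]
      exact sum_congr rfl fun a ha => by
        rw [hwf _ (Finset.mem_map_of_mem _ ha)]; simp
    have hc : cmb w = 0 := by
      rw [cmb_eq_sum hw, ← h1, Finset.sum_map]
      exact sum_congr rfl fun a ha => by
        rw [hwf _ (Finset.mem_map_of_mem _ ha)]; simp
    have hwt : ∀ u : V →₀ ℝ, 0 ≤ u → u.support ⊆ s → IsWeight F u := by
      intro u hu hus
      refine ⟨hu, ?_⟩
      by_cases h : u = 0
      · exact Or.inl h
      · exact Or.inr (hdown s hs _ hus (Finsupp.support_nonempty_iff.2 h))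
    set p : V →₀ ℝ := w.mapRange (fun a => max a 0) (by simp) with hp
    set q : V →₀ ℝ := w.mapRange (fun a => max (-a) 0) (by simp) with hq
    have hpq : p - q = w := by
      ext v
      simp only [hp, hq, Finsupp.coe_sub, Pi.sub_apply, Finsupp.mapRange_apply]
      rcases le_total (w v) 0 with h | h
      · rw [max_eq_right h, max_eq_left (by linarith)]; ring
      · rw [max_eq_left h, max_eq_right (by linarith)]; ring
    have hp0 : 0 ≤ p := fun v => by simp [hp]
    have hq0 : 0 ≤ q := fun v => by simp [hq]
    have hps : p.support ⊆ s := Finsupp.support_mapRange.trans hws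
    have hqs : q.support ⊆ s := Finsupp.support_mapRange.trans hws
    have := huniq p q (hwt p hp0 hps) (hwt q hq0 hqs)
      (by rw [← sub_eq_zero, ← map_sub, hpq, ht]) (by rw [← sub_eq_zero, ← map_sub, hpq, hc])
    rw [this, sub_self] at hpq
    have hwi := hwf _ (Finset.mem_map_of_mem _ hi)
    rw [← hpq] at hwi
    simpa using hwi.symm
  inter_subset_convexHull := by
    classical
    rintro s t hs ht x ⟨hxs, hxt⟩
    rw [mem_convexHull_iff_weights] at hxs hxt
    obtain ⟨w, hw0, hws, hw1, hwx⟩ := hxs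
    obtain ⟨w', hw0', hws', hw1', hwx'⟩ := hxt
    have hwt : ∀ (r : Finset V) (u : V →₀ ℝ), r ∈ F → 0 ≤ u → u.support ⊆ r → IsWeight F u := by
      intro r u hr hu hus
      refine ⟨hu, ?_⟩
      by_cases h : u = 0
      · exact Or.inl h
      · exact Or.inr (hdown r hr _ hus (Finsupp.support_nonempty_iff.2 h))
    have := huniq w w' (hwt s w hs hw0 hws) (hwt t w' ht hw0' hws') (hw1.trans hw1'.symm)
      (hwx.trans hwx'.symm)
    subst this
    rw [← Finset.coe_inter, mem_convexHull_iff_weights]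
    exact ⟨w, hw0, Finset.subset_inter hws hws', hw1, hwx⟩

lemma exists_weights {K : Cpx V} {x : V} (hx : x ∈ K.space) :
    ∃ w : V →₀ ℝ, 0 ≤ w ∧ w.support ∈ K.faces ∧ tot w = 1 ∧ cmb w = x := by
  obtain ⟨s, hs, hxs⟩ := mem_space_iff.1 hx
  obtain ⟨w, h0, hws, h1, hc⟩ := mem_convexHull_iff_weights.1 hxs
  refine ⟨w, h0, (IsWeight.of_subset h0 hs hws).2.resolve_left ?_, h1, hc⟩
  rintro rfl
  simp at h1

lemma support_subset_of_mem_convexHull {K : Cpx V} {w : V →₀ ℝ}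
    {s : Finset V} (h0 : 0 ≤ w) (hw : w.support ∈ K.faces) (h1 : tot w = 1) (hs : s ∈ K.faces)
    (hx : cmb w ∈ Δ s) : w.support ⊆ s := by
  obtain ⟨u, hu0, hus, hu1, huc⟩ := mem_convexHull_iff_weights.1 hx
  rw [← IsWeight.unique (.of_subset hu0 hs hus) ⟨h0, Or.inr hw⟩ (hu1.trans h1.symm) huc]
  exact hus

/-- The faces of a simplex are extreme. -/
lemma convexHull_subset_of_relint {s t s' : Finset V} (hs : AffineIndependent ℝ ((↑) : s → V))
    (hts : t ⊆ s) (hs' : (s' : Set V) ⊆ Δ s) {w : V →₀ ℝ} (h0 : 0 ≤ w) (hw : w.support = s')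
    (h1 : tot w = 1) (hx : cmb w ∈ Δ t) : Δ s' ⊆ Δ t := by
  refine convexHull_min ?_ (convex_convexHull ℝ _)
  have hb : ∀ v : V, ∃ b : V →₀ ℝ, v ∈ s' → (0 ≤ b ∧ b.support ⊆ s ∧ tot b = 1 ∧ cmb b = v) := by
    intro v
    by_cases hv : v ∈ s'
    · obtain ⟨b, hb⟩ := mem_convexHull_iff_weights.1 (hs' hv)
      exact ⟨b, fun _ => hb⟩
    · exact ⟨0, fun h => absurd h hv⟩
  choose b hb using hb
  obtain ⟨u, hu0, hut, hu1, huc⟩ := mem_convexHull_iff_weights.1 hx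
  have hsum : ∑ v ∈ s', w v • b v = u := by
    refine weights_unique_of_indep hs ?_ (hut.trans hts) ?_ ?_
    · intro y hy
      by_contra hys
      rw [mem_support_iff, Finsupp.finsetSum_apply] at hy
      refine hy (sum_eq_zero fun v hv => ?_)
      have : b v y = 0 := by
        by_contra h; exact hys ((hb v hv).2.1 (mem_support_iff.2 h))
      simp [this]
    · rw [map_sum, hu1, ← h1, tot_eq_sum hw.subset]
      exact sum_congr rfl fun v hv => by rw [map_smul, (hb v hv).2.2.1]; simp
    · rw [map_sum, huc, cmb_eq_sum hw.subset]
      exact sum_congr rfl fun v hv => by rw [map_smul, (hb v hv).2.2.2]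
  intro v hv
  rw [mem_convexHull_iff_weights]
  have hv' : v ∈ s' := hv
  refine ⟨b v, (hb v hv').1, ?_, (hb v hv').2.2⟩
  intro y hy
  by_contra hyt
  have h2 : u y = 0 := by
    by_contra h; exact hyt (hut (mem_support_iff.2 h))
  rw [← hsum, Finsupp.finsetSum_apply, Finset.sum_eq_zero_iff_of_nonneg] at h2
  · have h3 := h2 v hv'
    simp only [Finsupp.coe_smul, Pi.smul_apply, smul_eq_mul, mul_eq_zero] at h3
    rcases h3 with h3 | h3
    · rw [← hw] at hv'; exact mem_support_iff.1 hv' h3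
    · exact mem_support_iff.1 hy h3
  · intro z hz
    exact mul_nonneg (h0 z) ((hb z hz).1 y)

/-- Weights whose support is a given nonempty set. -/
lemma exists_relint (s : Finset V) (hs : s.Nonempty) :
    ∃ w : V →₀ ℝ, 0 ≤ w ∧ w.support = s ∧ tot w = 1 ∧ cmb w ∈ Δ s := by
  classical
  obtain ⟨w, hws, hw⟩ := exists_finsupp s fun _ => (s.card : ℝ)⁻¹
  have hpos : (0 : ℝ) < (s.card : ℝ)⁻¹ := by
    have := hs.card_pos; positivity
  have h0 : 0 ≤ w := by
    intro v
    by_cases hv : v ∈ s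
    · rw [hw v hv]; exact hpos.le
    · have : w v = 0 := by
        by_contra h; exact hv (hws (mem_support_iff.2 h))
      rw [this]; simp
  have h1 : tot w = 1 := by
    rw [tot_eq_sum hws, sum_congr rfl hw]
    have : (s.card : ℝ) ≠ 0 := by exact_mod_cast hs.card_pos.ne'
    simp [this]
  refine ⟨w, h0, le_antisymm hws ?_, h1, mem_convexHull_iff_weights.2 ⟨w, h0, hws, h1, rfl⟩⟩
  intro v hv
  rw [mem_support_iff, hw v hv]
  exact hpos.ne'

end Weights

section Star

open scoped Classical

variable {V : Type*} [AddCommGroup V] [Module ℝ V]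

/-- Replace the mass at `x` by the weights `c`. -/
def spread (x : V) (c w : V →₀ ℝ) : V →₀ ℝ := w - Finsupp.single x (w x) + (w x) • c

lemma spread_tot {x : V} {c : V →₀ ℝ} (hc1 : tot c = 1) (w : V →₀ ℝ) :
    tot (spread x c w) = tot w := by
  simp [spread, hc1]

lemma spread_cmb {x : V} {c : V →₀ ℝ} (hcx : cmb c = x) (w : V →₀ ℝ) :
    cmb (spread x c w) = cmb w := by
  simp [spread, hcx]

lemma spread_apply_of_ne {x v : V} {c w : V →₀ ℝ} (h : v ≠ x) :
    spread x c w v = w v + w x * c v := by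
  simp [spread, Finsupp.single_eq_of_ne h]

lemma spread_nonneg {x : V} {c w : V →₀ ℝ} (hc : 0 ≤ c) (hw : 0 ≤ w) : 0 ≤ spread x c w := by
  intro v
  by_cases hv : v = x
  · subst hv
    simpa [spread] using mul_nonneg (hw v) (hc v)
  · rw [spread_apply_of_ne hv]
    exact add_nonneg (hw v) (mul_nonneg (hw x) (hc v))

/-- The faces of the stellar subdivision at a point `x` in the interior of `e`. -/
def starFaces (F : Set (Finset V)) (e : Finset V) (x : V) : Set (Finset V) :=
  {s | s ∈ F ∧ ¬ e ⊆ s} ∪ {s | ∃ t, s = insert x t ∧ ¬ e ⊆ t ∧ t ∪ e ∈ F}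

lemma vertex_mem {K : Cpx V} {s : Finset V} (hs : s ∈ K.faces) {v : V} (hv : v ∈ s) :
    {v} ∈ K.faces :=
  K.down_closed hs (Finset.singleton_subset_iff.2 hv) (Finset.singleton_nonempty _)

/-- The point `cmb c` lies in the interior of the simplex `e`, which is not a vertex. -/
structure IsInner (K : Cpx V) (e : Finset V) (c : V →₀ ℝ) : Prop where
  mem : e ∈ K.faces
  nonneg : 0 ≤ c
  support : c.support = e
  total : tot c = 1
  two_le : 2 ≤ e.card

variable {K : Cpx V} {e : Finset V} {c : V →₀ ℝ}

lemma cmb_notMem_of_card (hS : IsInner K e c) {s : Finset V} (hs : s ∈ K.faces) : cmb c ∉ s := by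
  have ⟨he, hc0, hce, hc1, hcard⟩ := hS
  intro hx
  have hxK : {cmb c} ∈ K.faces := vertex_mem hs hx
  have := support_subset_of_mem_convexHull hc0 (hce ▸ he) hc1 hxK (by simp)
  have := Finset.card_le_card this
  rw [hce, Finset.card_singleton] at this
  omega

lemma starFaces_cases {w : V →₀ ℝ} (hS : IsInner K e c) (hw : IsWeight (starFaces K.faces e (cmb c)) w) :
    IsWeight K.faces (spread (cmb c) c w) ∧ (∀ v, v ≠ cmb c → w v ≤ spread (cmb c) c w v) ∧ ¬ e ⊆
    w.support := by
  have ⟨he, hc0, hce, hc1, hcard⟩ := hS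
  set x := cmb c with hx
  have hxe : x ∉ e := cmb_notMem_of_card hS he
  have hene : e.Nonempty := K.nonempty_of_mem_faces he
  have hmono : ∀ v, v ≠ x → w v ≤ spread x c w v := by
    intro v hv
    rw [spread_apply_of_ne hv]
    exact le_add_of_nonneg_right (mul_nonneg (hw.1 x) (hc0 v))
  refine ⟨?_, hmono, ?_⟩
  · rcases hw.2 with rfl | ⟨hs, hes⟩ | ⟨t, ht, het, htK⟩
    · simp [spread, IsWeight]
    · have hxw : w x = 0 := by
        by_contra h
        exact cmb_notMem_of_card hS hs (mem_support_iff.2 h)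
      have : spread x c w = w := by simp [spread, hxw]
      rw [this]
      exact ⟨hw.1, Or.inr hs⟩
    · refine IsWeight.of_subset (spread_nonneg hc0 hw.1) htK ?_
      intro v hv
      rw [Finset.mem_union]
      by_contra hcon
      push Not at hcon
      rw [mem_support_iff] at hv
      apply hv
      have hcv : c v = 0 := by
        by_contra h; exact hcon.2 (hce ▸ mem_support_iff.2 h)
      by_cases hvx : v = x
      · subst hvx
        simp [spread, hcv]
      · have : w v = 0 := by
          by_contra h
          have := mem_support_iff.2 h
          rw [ht, Finset.mem_insert] at this
          rcases this with h | h
          · exact hvx h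
          · exact hcon.1 h
        simp [spread, hcv, this, Finsupp.single_eq_of_ne hvx]
  · rcases hw.2 with rfl | ⟨hs, hes⟩ | ⟨t, ht, het, htK⟩
    · simpa [Finset.subset_empty] using hene.ne_empty
    · exact hes
    · rw [ht]
      intro h
      apply het
      intro v hv
      rcases Finset.mem_insert.1 (h hv) with h | h
      · exact absurd (h ▸ hv) hxe
      · exact h

/-- Stellar subdivision at the point `cmb c` in the interior of the simplex `e`. -/
def star (hS : IsInner K e c) : Cpx V := complexOfWeights (starFaces K.faces e (cmb c))
    (by
      rintro s (⟨hs, -⟩ | ⟨t, rfl, -, -⟩)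
      · exact K.nonempty_of_mem_faces hs
      · exact Finset.insert_nonempty _ _)
    (by
      rintro s (⟨hs, hes⟩ | ⟨t, rfl, het, htK⟩) r hrs hr
      · exact Or.inl ⟨K.down_closed hs hrs hr, fun h => hes (h.trans hrs)⟩
      · by_cases hxr : cmb c ∈ r
        · refine Or.inr ⟨r.erase (cmb c), (Finset.insert_erase hxr).symm, ?_, ?_⟩
          · intro h
            exact het (h.trans (Finset.subset_insert_iff.1 hrs))
          · refine K.down_closed htK (Finset.union_subset_union_left
              (Finset.subset_insert_iff.1 hrs)) ?_
            exact (K.nonempty_of_mem_faces hS.mem).mono Finset.subset_union_right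
        · have hrt : r ⊆ t := (Finset.subset_insert_iff_of_notMem hxr).1 hrs
          exact Or.inl ⟨K.down_closed htK (hrt.trans Finset.subset_union_left) hr,
            fun h => het (h.trans hrt)⟩)
    (by
      have key : ∀ w w' : V →₀ ℝ, IsWeight (starFaces K.faces e (cmb c)) w →
          IsWeight (starFaces K.faces e (cmb c)) w' →
          spread (cmb c) c w = spread (cmb c) c w' → ¬ w (cmb c) < w' (cmb c) := by
        intro w w' hw hw' h hlt
        apply (starFaces_cases hS hw).2.2
        intro v hv
        have hvx : v ≠ cmb c := fun h =>
          cmb_notMem_of_card hS hS.mem (h ▸ hv)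
        have h2 := DFunLike.congr_fun h v
        rw [spread_apply_of_ne hvx, spread_apply_of_ne hvx] at h2
        have hcv : 0 < c v := lt_of_le_of_ne (hS.nonneg v) (Ne.symm (by
          rw [← hS.support] at hv; exact mem_support_iff.1 hv))
        have h3 : 0 ≤ w' v := hw'.1 v
        rw [mem_support_iff]
        have := mul_lt_mul_of_pos_right hlt hcv
        intro h0
        linarith
      intro w w' hw hw' ht hcm
      have h := IsWeight.unique (starFaces_cases hS hw).1
        (starFaces_cases hS hw').1
        (by rw [spread_tot hS.total, spread_tot hS.total, ht])
        (by rw [spread_cmb rfl, spread_cmb rfl, hcm])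
      have hr : w (cmb c) = w' (cmb c) :=
        le_antisymm (not_lt.1 (key _ _ hw' hw h.symm)) (not_lt.1 (key _ _ hw hw' h))
      unfold spread at h
      rw [hr] at h
      simpa using h)

variable (hS : IsInner K e c)

lemma mem_star_faces {s : Finset V} : s ∈ (star hS).faces ↔
    (s ∈ K.faces ∧ ¬ e ⊆ s) ∨ ∃ t, s = insert (cmb c) t ∧ ¬ e ⊆ t ∧ t ∪ e ∈ K.faces := Iff.rfl

lemma cmb_mem_convexHull {e : Finset V} {c : V →₀ ℝ} (hc0 : 0 ≤ c) (hce : c.support = e)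
    (hc1 : tot c = 1) : cmb c ∈ Δ e :=
  mem_convexHull_iff_weights.2 ⟨c, hc0, hce.subset, hc1, rfl⟩

lemma star_convexHull_subset {s : Finset V} (hs : s ∈ (star hS).faces) :
    ∃ t ∈ K.faces, Δ s ⊆ Δ t := by
  rcases (mem_star_faces hS).1 hs with ⟨hs, -⟩ | ⟨t, rfl, -, ht⟩
  · exact ⟨s, hs, subset_rfl⟩
  · refine ⟨_, ht, convexHull_min ?_ (convex_convexHull ℝ _)⟩
    rw [Finset.coe_insert, Set.insert_subset_iff]
    refine ⟨convexHull_mono (by simp) (cmb_mem_convexHull hS.nonneg hS.support hS.total), ?_⟩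
    exact (Finset.coe_subset.2 Finset.subset_union_left).trans (subset_convexHull ℝ _)

lemma star_space : (star hS).space = K.space := by
  have ⟨he, hc0, hce, hc1, hcard⟩ := hS
  apply subset_antisymm
  · intro y hy
    obtain ⟨s, hs, hys⟩ := mem_space_iff.1 hy
    obtain ⟨t, ht, hst⟩ := star_convexHull_subset hS hs
    exact mem_space_iff.2 ⟨t, ht, hst hys⟩
  · intro y hy
    obtain ⟨u, hu0, hu, hu1, huy⟩ := exists_weights hy
    by_cases heu : e ⊆ u.support
    · have hene : e.Nonempty := K.nonempty_of_mem_faces he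
      obtain ⟨a, ha, hmin⟩ := Finset.exists_min_image e (fun v => u v / c v) hene
      have hcpos : ∀ v ∈ e, 0 < c v := fun v hv => lt_of_le_of_ne (hc0 v) (Ne.symm (by
          rw [← hce] at hv; exact mem_support_iff.1 hv))
      set r := u a / c a with hr
      have hr0 : 0 ≤ r := div_nonneg (hu0 a) (hc0 a)
      set w' := u - r • c with hw'
      have hw'0 : 0 ≤ w' := by
        intro v
        by_cases hv : v ∈ e
        · have := (le_div_iff₀ (hcpos v hv)).1 (hmin v hv)
          simpa [hw'] using this
        · have hcv : c v = 0 := by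
            by_contra h; exact hv (hce ▸ mem_support_iff.2 h)
          have := hu0 v
          simpa [hw', hcv] using this
      have hw'a : w' a = 0 := by
        simp [hw', hr, div_mul_cancel₀ _ (hcpos a ha).ne']
      have hw's : w'.support ⊆ u.support.erase a := by
        intro v hv
        have hva : v ≠ a := by
          rintro rfl; exact mem_support_iff.1 hv hw'a
        rw [Finset.mem_erase]
        refine ⟨hva, ?_⟩
        by_contra hvu
        have hve : v ∉ e := fun h => hvu (heu h)
        have hcv : c v = 0 := by
          by_contra h; exact hve (hce ▸ mem_support_iff.2 h)
        have huv : u v = 0 := by simpa using hvu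
        exact mem_support_iff.1 hv (by simp [hw', hcv, huv])
      set w := w' + Finsupp.single (cmb c) r with hw
      have hws : w.support ⊆ insert (cmb c) (u.support.erase a) := by
        refine Finsupp.support_add.trans ?_
        refine Finset.union_subset (hw's.trans (Finset.subset_insert _ _)) ?_
        exact Finsupp.support_single_subset.trans (by simp)
      refine mem_space_iff.2
        ⟨insert (cmb c) (u.support.erase a), Or.inr ⟨_, rfl, ?_, ?_⟩, ?_⟩
      · intro h
        exact Finset.notMem_erase a _ (h ha)
      · refine K.down_closed hu (Finset.union_subset (Finset.erase_subset _ _) heu) ?_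
        exact hene.mono Finset.subset_union_right
      · refine mem_convexHull_iff_weights.2 ⟨w, ?_, hws, ?_, ?_⟩
        · exact add_nonneg hw'0 (Finsupp.single_nonneg.2 hr0)
        · simp [hw, hw', hc1, hu1]
        · simp [hw, hw', huy]
    · exact mem_space_iff.2 ⟨_, Or.inl ⟨hu, heu⟩,
        mem_convexHull_iff_weights.2 ⟨u, hu0, Finset.Subset.refl _, hu1, huy⟩⟩

lemma star_finite (hK : K.faces.Finite) : (star hS).faces.Finite := by
  have h2 : {t : Finset V | ∃ s ∈ K.faces, t ⊆ s}.Finite := by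
    have : {t : Finset V | ∃ s ∈ K.faces, t ⊆ s} = ⋃ s ∈ K.faces, (s.powerset : Set (Finset V)) := by
      ext t; simp
    rw [this]
    exact hK.biUnion fun s _ => Finset.finite_toSet _
  refine (hK.union (h2.image (insert (cmb c)))).subset ?_
  rintro s (⟨hs, -⟩ | ⟨t, rfl, -, ht⟩)
  · exact Or.inl hs
  · exact Or.inr ⟨t, ⟨_, ht, Finset.subset_union_left⟩, rfl⟩

/-- Weights on an edge. -/
lemma exists_edge_weights {a b : V} (hab : a ≠ b) {r : ℝ} (hr0 : 0 < r) (hr1 : r < 1) :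
    ∃ c : V →₀ ℝ, 0 ≤ c ∧ c.support = {a, b} ∧ tot c = 1 ∧ cmb c = (1 - r) • a + r • b := by
  refine ⟨Finsupp.single a (1 - r) + Finsupp.single b r, ?_, ?_, ?_, ?_⟩
  · exact add_nonneg (Finsupp.single_nonneg.2 (by linarith)) (Finsupp.single_nonneg.2 hr0.le)
  · rw [Finsupp.support_add_eq, Finsupp.support_single _ (by linarith),
      Finsupp.support_single _ hr0.ne']
    · rfl
    · rw [Finsupp.support_single _ (by linarith), Finsupp.support_single _ hr0.ne']
      simpa using hab
  · simp
  · rw [map_add, cmb_single, cmb_single]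

end Star

section Cut

open scoped Classical

variable {V : Type*} [AddCommGroup V] [Module ℝ V]

/-- `K'` is a finite subdivision of `K` in which the faces with vertices in `A` are unchanged, and
each face lies in one with the same vertices in `A`. -/
structure RelSub (A : Set V) (K' K : Cpx V) : Prop where
  finite : K'.faces.Finite
  space_eq : K'.space = K.space
  exists_face : ∀ s' ∈ K'.faces, ∃ s ∈ K.faces, Δ s' ⊆ Δ s ∧ ∀ v ∈ A, v ∈ s' ↔ v ∈ s
  faces_iff : ∀ s : Finset V, (s : Set V) ⊆ A → (s ∈ K'.faces ↔ s ∈ K.faces)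

lemma RelSub.refl {A : Set V} {K : Cpx V} (hK : K.faces.Finite) : RelSub A K K :=
  ⟨hK, rfl, fun s hs => ⟨s, hs, subset_rfl, fun _ _ => Iff.rfl⟩, fun _ _ => Iff.rfl⟩

lemma RelSub.trans {A : Set V} {K₁ K₂ K₃ : Cpx V} (h : RelSub A K₁ K₂)
    (h' : RelSub A K₂ K₃) : RelSub A K₁ K₃ := by
  refine ⟨h.finite, h.space_eq.trans h'.space_eq, fun s hs => ?_, fun s hs =>
    (h.faces_iff s hs).trans (h'.faces_iff s hs)⟩
  obtain ⟨t, ht, hst, hA⟩ := h.exists_face s hs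
  obtain ⟨u, hu, htu, hA'⟩ := h'.exists_face t ht
  exact ⟨u, hu, hst.trans htu, fun v hv => (hA v hv).trans (hA' v hv)⟩

/-- The affine function `f` does not change sign on `s`. -/
def OneSigned (f : V →ᵃ[ℝ] ℝ) (s : Finset V) : Prop := (∀ v ∈ s, 0 ≤ f v) ∨ ∀ v ∈ s, f v ≤ 0

lemma affine_nonneg_of_mem_convexHull {f : V →ᵃ[ℝ] ℝ} {s : Set V} (h : ∀ v ∈ s, 0 ≤ f v) {x : V}
    (hx : x ∈ convexHull ℝ s) : 0 ≤ f x := by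
  have : convexHull ℝ s ⊆ f ⁻¹' Ici 0 := convexHull_min h ((convex_Ici 0).affine_preimage f)
  exact this hx

lemma affine_nonpos_of_mem_convexHull {f : V →ᵃ[ℝ] ℝ} {s : Set V} (h : ∀ v ∈ s, f v ≤ 0) {x : V}
    (hx : x ∈ convexHull ℝ s) : f x ≤ 0 := by
  have : convexHull ℝ s ⊆ f ⁻¹' Iic 0 := convexHull_min h ((convex_Iic 0).affine_preimage f)
  exact this hx

lemma OneSigned.mono {f : V →ᵃ[ℝ] ℝ} {s s' : Finset V} (h : OneSigned f s)
    (hs : Δ s' ⊆ Δ s) : OneSigned f s' := by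
  rcases h with h | h
  · exact Or.inl fun v hv => affine_nonneg_of_mem_convexHull (s := (s : Set V)) h
      (hs (subset_convexHull ℝ _ hv))
  · exact Or.inr fun v hv => affine_nonpos_of_mem_convexHull (s := (s : Set V)) h
      (hs (subset_convexHull ℝ _ hv))

lemma star_relSub {A : Set V} {K : Cpx V} (hK : K.faces.Finite) {e : Finset V} {c : V →₀ ℝ}
    (hS : IsInner K e c) (hA : ∀ x ∈ A, x ∈ K.space → {x} ∈ K.faces)
    (heA : ∀ v ∈ e, v ∉ A) : RelSub A (star hS) K := by
  have hxA : cmb c ∉ A := fun hx => cmb_notMem_of_card hS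
    (hA _ hx (mem_space_iff.2
      ⟨e, hS.mem, cmb_mem_convexHull hS.nonneg hS.support hS.total⟩)) (Finset.mem_singleton_self _)
  refine ⟨star_finite hS hK, star_space hS, ?_, ?_⟩
  · intro s hs
    rcases (mem_star_faces hS).1 hs with ⟨hs, -⟩ | ⟨t, rfl, -, ht⟩
    · exact ⟨s, hs, subset_rfl, fun _ _ => Iff.rfl⟩
    · refine ⟨_, ht, convexHull_min ?_ (convex_convexHull ℝ _), ?_⟩
      · rw [Finset.coe_insert, Set.insert_subset_iff]
        refine ⟨convexHull_mono (by simp) (cmb_mem_convexHull hS.nonneg hS.support hS.total), ?_⟩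
        exact (Finset.coe_subset.2 Finset.subset_union_left).trans (subset_convexHull ℝ _)
      · intro v hv
        rw [Finset.mem_insert, Finset.mem_union]
        constructor
        · rintro (rfl | h)
          · exact absurd hv hxA
          · exact Or.inl h
        · rintro (h | h)
          · exact Or.inr h
          · exact absurd hv (heA v h)
  · intro s hs
    rw [mem_star_faces]
    constructor
    · rintro (⟨h, -⟩ | ⟨t, rfl, -, -⟩)
      · exact h
      · exact absurd (hs (by simp)) hxA
    · intro h
      refine Or.inl ⟨h, fun hes => ?_⟩
      obtain ⟨v, hv⟩ := K.nonempty_of_mem_faces hS.mem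
      exact heA v hv (hs (hes hv))

lemma RelSub.vertices {A : Set V} {K' K : Cpx V} (h : RelSub A K' K)
    (hA : ∀ x ∈ A, x ∈ K.space → {x} ∈ K.faces) : ∀ x ∈ A, x ∈ K'.space → {x} ∈ K'.faces := by
  intro x hx hxK
  exact (h.faces_iff _ (by simpa using hx)).2 (hA x hx (h.space_eq ▸ hxK))

/-- Subdivide along the zero set of an affine function, away from the vertices in `A`. -/
lemma exists_cut (A : Set V) (f : V →ᵃ[ℝ] ℝ) (n : ℕ) : ∀ K : Cpx V, K.faces.Finite →
    (∀ x ∈ A, x ∈ K.space → {x} ∈ K.faces) →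
    {e : Finset V | e ∈ K.faces ∧ ∃ a b, e = {a, b} ∧ a ∉ A ∧ b ∉ A ∧ f a < 0 ∧ 0 < f b}.ncard = n →
    ∃ K', RelSub A K' K ∧ ∀ s ∈ K'.faces, (∀ v ∈ s, v ∉ A) → OneSigned f s := by
  induction n using Nat.strong_induction_on with
  | _ n ih =>
  intro K hK hA hn
  set bad := {e : Finset V | e ∈ K.faces ∧ ∃ a b, e = {a, b} ∧ a ∉ A ∧ b ∉ A ∧ f a < 0 ∧ 0 < f b}
    with hbad
  have hbadfin : bad.Finite := hK.subset fun e he => he.1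
  by_cases hne : bad.Nonempty
  · obtain ⟨e, heb⟩ := hne
    obtain ⟨he, a, b, hab, haA, hbA, hfa, hfb⟩ := id heb
    have hne : a ≠ b := by rintro rfl; linarith
    have hd : 0 < f b - f a := by linarith
    obtain ⟨c, hc0, hce, hc1, hcx⟩ := exists_edge_weights hne (r := -f a / (f b - f a))
      (div_pos (by linarith) hd) ((div_lt_one hd).2 (by linarith))
    have hfx : f (cmb c) = 0 := by
      rw [hcx, ← AffineMap.lineMap_apply_module, AffineMap.apply_lineMap,
        AffineMap.lineMap_apply_module]
      simp only [smul_eq_mul]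
      field_simp
      simp
    rw [← hab] at hce
    have hS : IsInner K e c := ⟨he, hc0, hce, hc1, by rw [hab, Finset.card_pair hne]⟩
    have hrel := star_relSub hK hS hA (by
      rw [hab]; intro v hv; simp only [Finset.mem_insert, Finset.mem_singleton] at hv
      rcases hv with rfl | rfl <;> assumption)
    have hih := fun hlt => ih _ hlt (star hS) hrel.finite
      (hrel.vertices hA) rfl
    obtain ⟨K', hK', hs'⟩ := hih (by
      rw [← hn]
      refine Set.ncard_lt_ncard ⟨?_, ?_⟩ hbadfin
      · rintro s ⟨hs, a', b', hs', ha', hb', hfa', hfb'⟩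
        rcases (mem_star_faces hS).1 hs with ⟨hs, -⟩ | ⟨t, ht, -, -⟩
        · exact ⟨hs, a', b', hs', ha', hb', hfa', hfb'⟩
        · exfalso
          have : cmb c ∈ s := ht ▸ Finset.mem_insert_self _ _
          rw [hs'] at this
          simp only [Finset.mem_insert, Finset.mem_singleton] at this
          rcases this with h | h
          · rw [← h, hfx] at hfa'; exact lt_irrefl _ hfa'
          · rw [← h, hfx] at hfb'; exact lt_irrefl _ hfb'
      · intro hcon
        have := hcon heb
        rcases (mem_star_faces hS).1 this.1 with ⟨-, hs⟩ | ⟨t, ht, -, -⟩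
        · exact hs (Finset.Subset.refl _)
        · exact cmb_notMem_of_card hS he (ht ▸ Finset.mem_insert_self _ _))
    exact ⟨K', hK'.trans hrel, hs'⟩
  · refine ⟨K, RelSub.refl hK, fun s hs hsA => ?_⟩
    by_contra hcon
    simp only [OneSigned, not_or] at hcon
    push Not at hcon
    obtain ⟨⟨a, ha, hfa⟩, b, hb, hfb⟩ := hcon
    refine hne ⟨{a, b}, K.down_closed hs ?_ (Finset.insert_nonempty _ _), a, b, rfl, hsA a ha,
      hsA b hb, hfa, hfb⟩
    rw [Finset.insert_subset_iff, Finset.singleton_subset_iff]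
    exact ⟨ha, hb⟩

lemma exists_cut_finset (A : Set V) (K : Cpx V) (hK : K.faces.Finite)
    (hA : ∀ x ∈ A, x ∈ K.space → {x} ∈ K.faces) (Φ : Set (V →ᵃ[ℝ] ℝ)) (hΦ : Φ.Finite) :
    ∃ K', RelSub A K' K ∧ ∀ f ∈ Φ, ∀ s ∈ K'.faces, (∀ v ∈ s, v ∉ A) → OneSigned f s := by
  induction Φ, hΦ using Set.Finite.induction_on with
  | empty => exact ⟨K, RelSub.refl hK, by simp⟩
  | insert _ _ ih =>
    rename_i f Φ _ _
    obtain ⟨K₁, h₁, h₁'⟩ := ih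
    obtain ⟨K₂, h₂, h₂'⟩ := exists_cut A f _ K₁ h₁.finite (h₁.vertices hA) rfl
    refine ⟨K₂, h₂.trans h₁, ?_⟩
    rintro g (rfl | hg) s hs hsA
    · exact h₂' s hs hsA
    · obtain ⟨t, ht, hst, htA⟩ := h₂.exists_face s hs
      exact (h₁' g hg t ht fun v hv hvA => hsA v ((htA v hvA).2 hv) hvA).mono hst

/-- The affine function `y ↦ φ (y, 1)`. -/
def affineOfLinear (φ : V × ℝ →ₗ[ℝ] ℝ) : V →ᵃ[ℝ] ℝ :=
  (φ ∘ₗ LinearMap.inl ℝ V ℝ).toAffineMap + AffineMap.const ℝ V (φ (0, 1))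

lemma affineOfLinear_apply (φ : V × ℝ →ₗ[ℝ] ℝ) (y : V) : affineOfLinear φ y = φ (y, 1) := by
  simp [affineOfLinear, ← map_add]

/-- A simplex is cut out by finitely many affine inequalities among the points that are combinations
of finitely many given ones. -/
lemma exists_inequalities {s : Finset V} (hs : AffineIndependent ℝ ((↑) : s → V)) (T : Finset V) :
    ∃ Φ : Set (V →ᵃ[ℝ] ℝ), Φ.Finite ∧ ∀ y ∈ Δ T, (y ∈ Δ s ↔ ∀ f ∈ Φ, 0 ≤ f y) := by
  set S : Set (V × ℝ) := (fun v : V => (v, (1 : ℝ))) '' (s : Set V) with hS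
  have hli : LinearIndepOn ℝ id S := by
    apply LinearIndepOn.id_image
    rw [LinearIndepOn, Fintype.linearIndependent_iff]
    intro g hg i
    have h1 := congrArg Prod.fst hg
    have h2 := congrArg Prod.snd hg
    simp only [Prod.fst_sum, Prod.snd_sum, Prod.smul_fst, Prod.smul_snd, smul_eq_mul, mul_one,
      Prod.fst_zero, Prod.snd_zero] at h1 h2
    exact affineIndependent_iff.1 hs Finset.univ g h2 h1 i (Finset.mem_univ _)
  set b := Module.Basis.extend hli with hb
  set T' := T.biUnion fun v => (b.repr (v, 1)).support with hT'
  refine ⟨(fun i => affineOfLinear (b.coord i)) '' T' ∪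
    (fun i => affineOfLinear (-(b.coord i))) '' {i | i ∈ T' ∧ (i : V × ℝ) ∉ S},
    (T'.finite_toSet.image _).union ((T'.finite_toSet.subset fun i hi => hi.1).image _), ?_⟩
  intro y hy
  have hself : ∀ v ∈ s, ∀ i, (b.repr (v, 1)) i = if (i : V × ℝ) = (v, 1) then 1 else 0 := by
    intro v hv i
    have hvS : (v, (1 : ℝ)) ∈ S := ⟨v, hv, rfl⟩
    have hbv : b ⟨_, Module.Basis.subset_extend hli hvS⟩ = (v, (1 : ℝ)) :=
      Module.Basis.extend_apply_self hli _
    rw [← hbv, Module.Basis.repr_self_apply, hbv]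
    congr 1
    rw [Subtype.ext_iff]
    exact propext ⟨fun h => h.symm, fun h => h.symm⟩
  constructor
  · rintro hys f (⟨i, hi, rfl⟩ | ⟨i, ⟨hi, hiS⟩, rfl⟩)
    · refine affine_nonneg_of_mem_convexHull (s := (s : Set V)) (fun v hv => ?_) hys
      rw [affineOfLinear_apply, Module.Basis.coord_apply, hself v hv]
      split_ifs <;> norm_num
    · refine affine_nonneg_of_mem_convexHull (s := (s : Set V)) (fun v hv => ?_) hys
      rw [affineOfLinear_apply, LinearMap.neg_apply, Module.Basis.coord_apply, hself v hv, if_neg]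
      · simp
      · intro h; exact hiS (h ▸ ⟨v, hv, rfl⟩)
  · intro h
    have hpos : ∀ i ∈ T', 0 ≤ b.repr (y, 1) i := by
      intro i hi
      have := h _ (Or.inl ⟨i, hi, rfl⟩)
      rwa [affineOfLinear_apply, Module.Basis.coord_apply] at this
    have hsupp : ∀ i ∈ (b.repr (y, 1)).support, i ∈ T' := by
      intro i hi
      by_contra hiT
      have h0 : ∀ v ∈ (T : Set V), affineOfLinear (b.coord i) v = 0 := by
        intro v hv
        rw [affineOfLinear_apply, Module.Basis.coord_apply]
        by_contra hne
        exact hiT (Finset.mem_biUnion.2 ⟨v, hv, mem_support_iff.2 hne⟩)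
      have h1 := affine_nonneg_of_mem_convexHull (fun v hv => (h0 v hv).ge) hy
      have h2 := affine_nonpos_of_mem_convexHull (fun v hv => (h0 v hv).le) hy
      rw [affineOfLinear_apply, Module.Basis.coord_apply] at h1 h2
      exact mem_support_iff.1 hi (le_antisymm h2 h1)
    have hS' : ∀ i ∈ (b.repr (y, 1)).support, (i : V × ℝ) ∈ S := by
      intro i hi
      by_contra hiS
      have := h _ (Or.inr ⟨i, ⟨hsupp i hi, hiS⟩, rfl⟩)
      rw [affineOfLinear_apply, LinearMap.neg_apply, Module.Basis.coord_apply] at this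
      exact mem_support_iff.1 hi (le_antisymm (by linarith) (hpos i (hsupp i hi)))
    have hsum : ∑ i ∈ (b.repr (y, 1)).support, b.repr (y, 1) i • (i : V × ℝ) = (y, 1) := by
      have := b.linearCombination_repr (y, (1 : ℝ))
      rw [Finsupp.linearCombination_apply, Finsupp.sum] at this
      conv_rhs => rw [← this]
      exact sum_congr rfl fun i _ => by rw [hb, Module.Basis.extend_apply_self]
    have h1 := congrArg Prod.fst hsum
    have h2 := congrArg Prod.snd hsum
    simp only [Prod.fst_sum, Prod.snd_sum, Prod.smul_fst, Prod.smul_snd, smul_eq_mul] at h1 h2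
    rw [← h1]
    refine (convex_convexHull ℝ _).sum_mem (fun i hi => hpos i (hsupp i hi)) ?_ ?_
    · refine Eq.trans ?_ h2
      refine sum_congr rfl fun i hi => ?_
      obtain ⟨v, -, hv⟩ := hS' i hi
      rw [← hv, mul_one]
    · intro i hi
      obtain ⟨v, hvs, hv⟩ := hS' i hi
      rw [← hv]
      exact subset_convexHull ℝ _ hvs

/-- A finite set that contains all vertices of a finite complex. -/
lemma exists_vertices_finset {K : Cpx V} (hK : K.faces.Finite) :
    ∃ T : Finset V, ∀ s ∈ K.faces, s ⊆ T :=
  ⟨hK.toFinset.biUnion id, fun s hs =>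
    Finset.subset_biUnion_of_mem id (hK.mem_toFinset.2 hs)⟩

lemma space_subset_convexHull {K : Cpx V} {T : Finset V}
    (hT : ∀ s ∈ K.faces, s ⊆ T) : K.space ⊆ Δ T := by
  intro x hx
  obtain ⟨s, hs, hxs⟩ := mem_space_iff.1 hx
  exact convexHull_mono (Finset.coe_subset.2 (hT s hs)) hxs

/-- If no function of a family that cuts out the simplex `t` changes sign on `s`, and an interior
point of `s` lies in `t`, then `s` lies in `t`. -/
lemma convexHull_subset_of_oneSigned {Φ : Set (V →ᵃ[ℝ] ℝ)} {s t : Finset V} {Y : Set V}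
    (ht : ∀ y ∈ Y, y ∈ Δ t ↔ ∀ f ∈ Φ, 0 ≤ f y) (hsY : Δ s ⊆ Y) (hs : ∀ f ∈ Φ, OneSigned f s)
    {w : V →₀ ℝ} (h0 : 0 ≤ w) (hw : w.support = s) (h1 : tot w = 1) (hx : cmb w ∈ Δ t) : Δ s ⊆ Δ t
    := by
  have hxs : cmb w ∈ Δ s := mem_convexHull_iff_weights.2 ⟨w, h0, hw.subset, h1, rfl⟩
  intro y hy
  rw [ht y (hsY hy)]
  intro f hf
  have hfx := (ht _ (hsY hxs)).1 hx f hf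
  rcases hs f hf with h | h
  · exact affine_nonneg_of_mem_convexHull h hy
  · have hf0 : f (cmb w) = 0 := le_antisymm (affine_nonpos_of_mem_convexHull h hxs) hfx
    have hlin : f (cmb w) = ∑ v ∈ s, w v * f v := by
      have h1' : ∑ v ∈ s, w v = 1 := by rw [← h1, tot_eq_sum hw.subset]
      have e : cmb w = s.affineCombination ℝ id w := by
        rw [Finset.affineCombination_eq_linear_combination _ _ _ h1', cmb_eq_sum hw.subset]
        rfl
      rw [e, Finset.map_affineCombination _ _ _ h1',
        Finset.affineCombination_eq_linear_combination _ _ _ h1']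
      simp
    rw [hlin] at hf0
    have h2 : ∀ v ∈ s, 0 ≤ w v * (- f v) := fun v hv => mul_nonneg (h0 v) (by linarith [h v hv])
    have h3 : ∑ v ∈ s, w v * (- f v) = 0 := by
      simp only [mul_neg, Finset.sum_neg_distrib, hf0, neg_zero]
    rw [Finset.sum_eq_zero_iff_of_nonneg h2] at h3
    refine affine_nonneg_of_mem_convexHull (s := (s : Set V)) (fun v hv => ?_) hy
    have h4 := h3 v hv
    have hwv : w v ≠ 0 := mem_support_iff.1 (by rw [hw]; exact hv)
    have := (mul_eq_zero.1 h4).resolve_left hwv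
    linarith

lemma exists_common_subdivision {K L : Cpx V} (hK : K.faces.Finite) (hL : L.faces.Finite)
    (hKL : K.space = L.space) : ∃ K' : Cpx V, K'.faces.Finite ∧ K'.space = K.space ∧
    (∀ s' ∈ K'.faces, ∃ s ∈ K.faces, Δ s' ⊆ Δ s) ∧ ∀ s' ∈ K'.faces, ∃ s ∈ L.faces, Δ s' ⊆ Δ s := by
  obtain ⟨T, hT⟩ := exists_vertices_finset hK
  have hΦ : ∀ t : Finset V, ∃ Φ : Set (V →ᵃ[ℝ] ℝ), Φ.Finite ∧ (t ∈ L.faces →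
      ∀ y ∈ Δ T, (y ∈ Δ t ↔ ∀ f ∈ Φ, 0 ≤ f y)) := by
    intro t
    by_cases ht : t ∈ L.faces
    · obtain ⟨Φ, h1, h2⟩ := exists_inequalities (L.indep ht) T
      exact ⟨Φ, h1, fun _ => h2⟩
    · exact ⟨∅, Set.finite_empty, fun h => absurd h ht⟩
  choose Φ hΦf hΦ using hΦ
  obtain ⟨K', hK', hone⟩ := exists_cut_finset ∅ K hK (by simp) (⋃ t ∈ L.faces, Φ t)
    (hL.biUnion fun t _ => hΦf t)
  refine ⟨K', hK'.finite, hK'.space_eq, fun s hs => ?_, fun s hs => ?_⟩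
  · obtain ⟨t, ht, hst, -⟩ := hK'.exists_face s hs
    exact ⟨t, ht, hst⟩
  · obtain ⟨w, h0, hw, h1, hx⟩ := exists_relint s (K'.nonempty_of_mem_faces hs)
    have hsK : Δ s ⊆ K.space := hK'.space_eq ▸ convexHull_subset_space hs
    obtain ⟨t, ht, hxt⟩ := mem_space_iff.1 (hKL ▸ hsK hx)
    refine ⟨t, ht, convexHull_subset_of_oneSigned (hΦ t ht)
      (hsK.trans (space_subset_convexHull hT)) (fun f hf => ?_) h0 hw h1 hxt⟩
    exact hone f (Set.mem_iUnion₂.2 ⟨t, ht, hf⟩) s hs (by simp)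

end Cut

section Fine

variable {V : Type*} [NormedAddCommGroup V] [NormedSpace ℝ V]

lemma exists_fine_subdivision (A : Set V) (K : Cpx V)
    (hK : K.faces.Finite) (hA : ∀ x ∈ A, x ∈ K.space → {x} ∈ K.faces) {ε : ℝ} (hε : 0 < ε) :
    ∃ K', RelSub A K' K ∧ ∀ s ∈ K'.faces, (∀ v ∈ s, v ∉ A) → ∀ x ∈ s, ∀ y ∈ s, dist x y ≤ ε := by
  classical
  obtain ⟨T, hT⟩ := exists_vertices_finset hK
  let b := Module.Basis.ofVectorSpace ℝ V
  set J := T.biUnion fun v => (b.repr v).support with hJ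
  have hJ0 : ∀ i ∉ J, ∀ y ∈ Δ T, b.repr y i = 0 := by
    intro i hi y hy
    have h0 : ∀ v ∈ (T : Set V), (b.coord i).toAffineMap v = 0 := by
      intro v hv
      by_contra hne
      exact hi (Finset.mem_biUnion.2 ⟨v, hv, mem_support_iff.2 hne⟩)
    exact le_antisymm (affine_nonpos_of_mem_convexHull (fun v hv => (h0 v hv).le) hy)
      (affine_nonneg_of_mem_convexHull (fun v hv => (h0 v hv).ge) hy)
  obtain ⟨R, hR⟩ : ∃ R : ℝ, ∀ i ∈ J, ∀ y ∈ Δ T, |b.repr y i| ≤ R := by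
    refine ⟨∑ i ∈ J, ∑ v ∈ T, |b.repr v i|, fun i hi y hy => ?_⟩
    have h1 : ∀ v ∈ (T : Set V), |b.repr v i| ≤ ∑ i ∈ J, ∑ v ∈ T, |b.repr v i| := by
      intro v hv
      calc |b.repr v i| ≤ ∑ v ∈ T, |b.repr v i| :=
            single_le_sum (f := fun v => |b.repr v i|) (fun _ _ => abs_nonneg _) hv
        _ ≤ _ := single_le_sum (f := fun i => ∑ v ∈ T, |b.repr v i|)
            (fun _ _ => sum_nonneg fun _ _ => abs_nonneg _) hi
    set R := ∑ i ∈ J, ∑ v ∈ T, |b.repr v i|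
    have := convexHull_min (s := (T : Set V)) (t := (b.coord i) ⁻¹' Icc (-R) R)
      (fun v hv => abs_le.1 (h1 v hv)) ((convex_Icc _ _).linear_preimage (b.coord i)) hy
    exact abs_le.2 this
  set C := 1 + ∑ i ∈ J, ‖b i‖ with hC
  have hCpos : 0 < C := by
    have : 0 ≤ ∑ i ∈ J, ‖b i‖ := sum_nonneg fun _ _ => norm_nonneg _
    linarith
  set δ := ε / C with hδ
  have hδpos : 0 < δ := div_pos hε hCpos
  obtain ⟨N, hN⟩ := exists_nat_gt (R / δ)
  have hRN : R < N * δ := (div_lt_iff₀ hδpos).1 hN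
  set fn : _ → ℤ → (V →ᵃ[ℝ] ℝ) := fun i j =>
    (b.coord i).toAffineMap - AffineMap.const ℝ V ((j : ℝ) * δ) with hfn
  obtain ⟨K', hK', hone⟩ := exists_cut_finset A K hK hA
    (⋃ i ∈ J, (fn i) '' (Finset.Icc (-(N : ℤ)) N))
    (J.finite_toSet.biUnion fun i _ => (Finset.finite_toSet _).image _)
  refine ⟨K', hK', fun s hs hsA x hx y hy => ?_⟩
  have hsT : Δ s ⊆ Δ T := (convexHull_subset_space hs).trans
      (hK'.space_eq ▸ space_subset_convexHull hT)
  have hsT' : ∀ v ∈ s, v ∈ Δ T := fun v hv =>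
    hsT (subset_convexHull ℝ _ hv)
  have key : ∀ i ∈ J, ∀ x ∈ s, ∀ y ∈ s, b.repr x i - b.repr y i ≤ δ := by
    intro i hi x hx y hy
    by_contra! hcon
    set j : ℤ := ⌊b.repr y i / δ⌋ + 1 with hj
    have hj1 : b.repr y i < j * δ := by
      rw [← div_lt_iff₀ hδpos, hj]; push_cast; exact Int.lt_floor_add_one _
    have hj2 : (j : ℝ) * δ ≤ b.repr y i + δ := by
      have := Int.floor_le (b.repr y i / δ)
      rw [le_div_iff₀ hδpos] at this
      rw [hj]; push_cast; linarith
    have hx' := abs_le.1 (hR i hi x (hsT' x hx))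
    have hy' := abs_le.1 (hR i hi y (hsT' y hy))
    have hjN : j ∈ Finset.Icc (-(N : ℤ)) N := by
      rw [Finset.mem_Icc]
      constructor
      · have : (-(N : ℝ)) * δ < j * δ := by nlinarith
        have := lt_of_mul_lt_mul_right this hδpos.le
        exact_mod_cast this.le
      · have : (j : ℝ) * δ < N * δ := by linarith
        have := lt_of_mul_lt_mul_right this hδpos.le
        exact_mod_cast this.le
    have := hone (fn i j) (Set.mem_iUnion₂.2 ⟨i, hi, j, hjN, rfl⟩) s hs hsA
    rcases this with h | h
    · have := h y hy
      simp [hfn] at this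
      linarith
    · have := h x hx
      simp [hfn] at this
      linarith
  have hexp : x - y = ∑ i ∈ J, (b.repr (x - y) i) • b i := by
    conv_lhs => rw [← b.linearCombination_repr (x - y), Finsupp.linearCombination_apply]
    refine Finsupp.sum_of_support_subset _ ?_ _ (by simp)
    intro i hi
    by_contra hiJ
    apply mem_support_iff.1 hi
    rw [map_sub, Finsupp.sub_apply, hJ0 i hiJ x (hsT' x hx), hJ0 i hiJ y (hsT' y hy), sub_zero]
  rw [dist_eq_norm, hexp]
  calc ‖∑ i ∈ J, (b.repr (x - y) i) • b i‖ ≤ ∑ i ∈ J, ‖(b.repr (x - y) i) • b i‖ := norm_sum_le _ _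
    _ ≤ ∑ i ∈ J, δ * ‖b i‖ := by
        refine Finset.sum_le_sum fun i hi => ?_
        rw [norm_smul]
        refine mul_le_mul_of_nonneg_right ?_ (norm_nonneg _)
        rw [Real.norm_eq_abs, abs_le, map_sub, Finsupp.sub_apply]
        exact ⟨by linarith [key i hi y hy x hx], key i hi x hx y hy⟩
    _ = δ * ∑ i ∈ J, ‖b i‖ := by rw [mul_sum]
    _ ≤ δ * C := by
        refine mul_le_mul_of_nonneg_left ?_ hδpos.le
        rw [hC]; linarith
    _ = ε := div_mul_cancel₀ _ hCpos.ne'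

end Fine

section Relative

open scoped Classical

variable {V : Type*} [AddCommGroup V] [Module ℝ V]

/-- Every simplex of `K'` lies in a simplex of `K`. -/
def Inside (K' K : Cpx V) : Prop := ∀ s' ∈ K'.faces, ∃ s ∈ K.faces, Δ s' ⊆ Δ s

lemma Inside.refl (K : Cpx V) : Inside K K := fun s hs => ⟨s, hs, subset_rfl⟩

lemma Inside.trans {K₁ K₂ K₃ : Cpx V} (h : Inside K₁ K₂) (h' : Inside K₂ K₃) : Inside K₁ K₃ := by
  intro s hs
  obtain ⟨t, ht, hst⟩ := h s hs
  obtain ⟨u, hu, htu⟩ := h' t ht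
  exact ⟨u, hu, hst.trans htu⟩

lemma RelSub.inside {A : Set V} {K' K : Cpx V} (h : RelSub A K' K) : Inside K' K := fun s hs =>
  let ⟨t, ht, hst, _⟩ := h.exists_face s hs
  ⟨t, ht, hst⟩

lemma Inside.convexHull_subset {K' K : Cpx V} (h : Inside K' K) {s t : Finset V} (hs : s ∈ K'.faces)
    (ht : t ∈ K.faces) {w : V →₀ ℝ} (h0 : 0 ≤ w) (hw : w.support = s) (h1 : tot w = 1)
    (hx : cmb w ∈ Δ t) : Δ s ⊆ Δ t := by
  obtain ⟨u, hu, hsu⟩ := h s hs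
  have hxs : cmb w ∈ Δ s := mem_convexHull_iff_weights.2 ⟨w, h0, hw.subset, h1, rfl⟩
  have hx' : cmb w ∈ convexHull ℝ ((u ∩ t : Finset V) : Set V) := by
    rw [Finset.coe_inter]
    exact K.inter_subset_convexHull hu ht ⟨hsu hxs, hx⟩
  exact (convexHull_subset_of_relint (K.indep hu) Finset.inter_subset_left
    ((subset_convexHull ℝ _).trans hsu) h0 hw h1 hx').trans
    (convexHull_mono (Finset.coe_subset.2 Finset.inter_subset_right))

lemma vertex_mem_of_mem_convexHull {K : Cpx V} {v : V} {t : Finset V}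
    (hv : {v} ∈ K.faces) (ht : t ∈ K.faces) (h : v ∈ Δ t) : v ∈ t := by
  have hs : (Finsupp.single v (1 : ℝ)).support = {v} := Finsupp.support_single _ one_ne_zero
  have := support_subset_of_mem_convexHull (K := K) (w := Finsupp.single v 1) (s := t)
    (Finsupp.single_nonneg.2 zero_le_one) (by rw [hs]; exact hv) (by simp) ht (by simpa using h)
  rw [hs] at this
  exact this (Finset.mem_singleton_self v)

/-- The subcomplex `L` becomes full after subdividing simplices that are not in `L`. -/
lemma exists_full (L : Cpx V) (n : ℕ) : ∀ K : Cpx V, K.faces.Finite → L.faces ⊆ K.faces →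
    {s : Finset V | s ∈ K.faces ∧ (∀ v ∈ s, {v} ∈ L.faces) ∧ s ∉ L.faces}.ncard = n → ∃ K' : Cpx V,
    K'.faces.Finite ∧ K'.space = K.space ∧ Inside K' K ∧ L.faces ⊆ K'.faces ∧ ∀ s ∈ K'.faces,
    (∀ v ∈ s, {v} ∈ L.faces) → s ∈ L.faces := by
  induction n using Nat.strong_induction_on with
  | _ n ih =>
  intro K hK hLK hn
  set bad := {s : Finset V | s ∈ K.faces ∧ (∀ v ∈ s, {v} ∈ L.faces) ∧ s ∉ L.faces} with hbad
  have hbadfin : bad.Finite := hK.subset fun e he => he.1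
  by_cases hne : bad.Nonempty
  · obtain ⟨e, heb⟩ := hne
    obtain ⟨he, heA, heL⟩ := id heb
    obtain ⟨c, hc0, hce, hc1, -⟩ := exists_relint e (K.nonempty_of_mem_faces he)
    have hcard : 2 ≤ e.card := by
      by_contra hcon
      have h1 : e.card = 1 := by
        have := (K.nonempty_of_mem_faces he).card_pos; omega
      obtain ⟨v, rfl⟩ := Finset.card_eq_one.1 h1
      exact heL (heA v (Finset.mem_singleton_self v))
    have hS : IsInner K e c := ⟨he, hc0, hce, hc1, hcard⟩
    have hxL : {cmb c} ∉ L.faces := fun h =>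
      cmb_notMem_of_card hS (hLK h) (Finset.mem_singleton_self _)
    have hih := fun hlt => ih _ hlt (star hS)
      (star_finite hS hK) (fun s hs => Or.inl ⟨hLK hs, fun hes =>
        heL (L.down_closed hs hes (K.nonempty_of_mem_faces he))⟩) rfl
    obtain ⟨K', h1, h2, h3, h4, h5⟩ := hih (by
      rw [← hn]
      have key : ∀ s ∈ (star hS).faces, (∀ v ∈ s, {v} ∈ L.faces) → s ∈ K.faces ∧ ¬ e ⊆ s := by
        intro s hs hsA
        rcases (mem_star_faces hS).1 hs with hs | ⟨t, ht, -, -⟩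
        · exact hs
        · exact absurd (hsA _ (ht ▸ Finset.mem_insert_self _ _)) hxL
      refine Set.ncard_lt_ncard ⟨?_, ?_⟩ hbadfin
      · rintro s ⟨hs, hsA, hsL⟩
        exact ⟨(key s hs hsA).1, hsA, hsL⟩
      · intro hcon
        exact (key e (hcon heb).1 heA).2 (Finset.Subset.refl _))
    exact ⟨K', h1, h2.trans (star_space hS),
        h3.trans fun s hs => star_convexHull_subset hS hs, h4, h5⟩
  · refine ⟨K, hK, rfl, Inside.refl K, hLK, fun s hs hsA => ?_⟩
    by_contra hcon
    exact hne ⟨s, hs, hsA, hcon⟩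

/-- The faces of the complex obtained from `K` by replacing the full subcomplex `L` by its
subdivision `L'`. -/
def replaceFaces (K L L' : Cpx V) : Set (Finset V) :=
  {r | r.Nonempty ∧ ∃ σ' τ, r = σ' ∪ τ ∧ (∀ v ∈ τ, {v} ∉ L.faces) ∧
    ((σ' = ∅ ∧ τ ∈ K.faces) ∨ (σ' ∈ L'.faces ∧ ∃ σ ∈ L.faces, Δ σ' ⊆ Δ σ ∧ σ ∪ τ ∈ K.faces))}

/-- Weights on `σ'` can be pushed to `σ` if `σ'` lies in `σ`. -/
lemma exists_push {σ' σ : Finset V} (h : Δ σ' ⊆ Δ σ) {w : V →₀ ℝ} (h0 : 0 ≤ w) (hw : w.support ⊆ σ')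
    : ∃ u : V →₀ ℝ, 0 ≤ u ∧ u.support ⊆ σ ∧ tot u = tot w ∧ cmb u = cmb w := by
  have hb : ∀ v : V, ∃ b : V →₀ ℝ, v ∈ σ' → (0 ≤ b ∧ b.support ⊆ σ ∧ tot b = 1 ∧ cmb b = v) := by
    intro v
    by_cases hv : v ∈ σ'
    · obtain ⟨b, hb⟩ := mem_convexHull_iff_weights.1 (h (subset_convexHull ℝ _ hv))
      exact ⟨b, fun _ => hb⟩
    · exact ⟨0, fun h => absurd h hv⟩
  choose b hb using hb
  refine ⟨∑ v ∈ σ', w v • b v, ?_, ?_, ?_, ?_⟩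
  · exact sum_nonneg fun v hv => smul_nonneg (h0 v) (hb v hv).1
  · intro y hy
    by_contra hys
    rw [mem_support_iff, Finsupp.finsetSum_apply] at hy
    refine hy (sum_eq_zero fun v hv => ?_)
    have : b v y = 0 := by
      by_contra h; exact hys ((hb v hv).2.1 (mem_support_iff.2 h))
    simp [this]
  · rw [map_sum, tot_eq_sum hw]
    exact sum_congr rfl fun v hv => by rw [map_smul, (hb v hv).2.2.1]; simp
  · rw [map_sum, cmb_eq_sum hw]
    exact sum_congr rfl fun v hv => by rw [map_smul, (hb v hv).2.2.2]

variable {K L L' : Cpx V}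

lemma replace_weights (hLK : L.faces ⊆ K.faces) (hsp : L'.space = L.space) {w : V →₀ ℝ}
    (hw : IsWeight (replaceFaces K L L') w) : ∃ w₁ w₂ u₁ : V →₀ ℝ, w = w₁ + w₂ ∧ IsWeight L'.faces
    w₁ ∧ tot u₁ = tot w₁ ∧ cmb u₁ = cmb w₁ ∧ IsWeight K.faces (u₁ + w₂) ∧
    (∀ v, u₁ v ≠ 0 → {v} ∈ L.faces) ∧ ∀ v, w₂ v ≠ 0 → {v} ∉ L.faces := by
  rcases hw.2 with rfl | ⟨hne, σ', τ, hr, hτ, h⟩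
  · exact ⟨0, 0, 0, by simp, ⟨le_rfl, Or.inl rfl⟩, rfl, rfl, ⟨by simp, Or.inl (by simp)⟩,
      by simp, by simp⟩
  · rcases h with ⟨rfl, hτK⟩ | ⟨hσ', σ, hσ, hσσ, hστ⟩
    · rw [Finset.empty_union] at hr
      refine ⟨0, w, 0, by simp, ⟨le_rfl, Or.inl rfl⟩, rfl, rfl,
        by rw [zero_add]; exact ⟨hw.1, Or.inr (hr ▸ hτK)⟩, by simp, fun v hv => hτ v ?_⟩
      rw [← hr]; exact mem_support_iff.2 hv
    · have hdisj : ∀ v ∈ τ, v ∉ σ' := by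
        intro v hv hvσ'
        have hvL : v ∈ L.space := hsp ▸ SimplicialComplex.subset_space hσ' hvσ'
        obtain ⟨t, ht, hvt⟩ := mem_space_iff.1 hvL
        have hvK : {v} ∈ K.faces := vertex_mem hστ (Finset.mem_union_right _ hv)
        exact hτ v hv (vertex_mem ht (vertex_mem_of_mem_convexHull hvK (hLK ht) hvt))
      set w₁ := w.filter (· ∈ σ') with hw₁
      set w₂ := w.filter (fun v => ¬ v ∈ σ') with hw₂
      have hw10 : 0 ≤ w₁ := by
        intro v; rw [hw₁, Finsupp.filter_apply]; split_ifs
        · exact hw.1 v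
        · exact le_rfl
      have hw20 : 0 ≤ w₂ := by
        intro v; rw [hw₂, Finsupp.filter_apply]; split_ifs
        · exact le_rfl
        · exact hw.1 v
      have hs1 : w₁.support ⊆ σ' := by
        intro v hv
        rw [hw₁, Finsupp.support_filter, Finset.mem_filter] at hv
        exact hv.2
      have hs2 : w₂.support ⊆ τ := by
        intro v hv
        rw [hw₂, Finsupp.support_filter, Finset.mem_filter, hr, Finset.mem_union] at hv
        exact hv.1.resolve_left hv.2
      obtain ⟨u₁, hu0, hus, hu1, huc⟩ := exists_push hσσ hw10 hs1
      refine ⟨w₁, w₂, u₁, (Finsupp.filter_add_filter_not _ _).symm,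
        IsWeight.of_subset hw10 hσ' hs1, hu1, huc, ?_, ?_, ?_⟩
      · exact IsWeight.of_subset (add_nonneg hu0 hw20) hστ
          (Finsupp.support_add.trans (Finset.union_subset_union hus hs2))
      · intro v hv
        exact vertex_mem hσ (hus (mem_support_iff.2 hv))
      · intro v hv
        exact hτ v (hs2 (mem_support_iff.2 hv))

/-- Replace the full subcomplex `L` of `K` by its subdivision `L'`. -/
def replace (hLK : L.faces ⊆ K.faces) (hsp : L'.space = L.space) : Cpx V :=
  complexOfWeights (replaceFaces K L L') (fun _ hs => hs.1)
    (by
      rintro s ⟨-, σ', τ, rfl, hτ, h⟩ t hts ht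
      refine ⟨ht, t ∩ σ', t ∩ τ, ?_, fun v hv => hτ v (Finset.mem_inter.1 hv).2, ?_⟩
      · rw [← Finset.inter_union_distrib_left, Finset.inter_eq_left.2 hts]
      · rcases h with ⟨rfl, hτK⟩ | ⟨hσ', σ, hσ, hσσ, hστ⟩
        · rw [Finset.empty_union] at hts
          refine Or.inl ⟨Finset.inter_empty _, ?_⟩
          rw [Finset.inter_eq_left.2 hts]
          exact K.down_closed hτK hts ht
        · by_cases hne : (t ∩ σ').Nonempty
          · refine Or.inr ⟨L'.down_closed hσ' Finset.inter_subset_right hne, σ, hσ,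
              (convexHull_mono (Finset.coe_subset.2 Finset.inter_subset_right)).trans hσσ, ?_⟩
            exact K.down_closed hστ (Finset.union_subset_union_right Finset.inter_subset_right)
              ((L.nonempty_of_mem_faces hσ).mono Finset.subset_union_left)
          · rw [Finset.not_nonempty_iff_eq_empty] at hne
            refine Or.inl ⟨hne, K.down_closed hστ
              (Finset.inter_subset_right.trans Finset.subset_union_right) ?_⟩
            have : t = t ∩ τ := by
              conv_lhs => rw [← Finset.inter_eq_left.2 hts, Finset.inter_union_distrib_left, hne,
                Finset.empty_union]
            rwa [← this])
    (by
      intro w w' hw hw' ht hc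
      obtain ⟨w₁, w₂, u₁, rfl, h1, h2, h3, h4, h5, h6⟩ := replace_weights hLK hsp hw
      obtain ⟨w₁', w₂', u₁', rfl, h1', h2', h3', h4', h5', h6'⟩ := replace_weights hLK hsp hw'
      rw [map_add, map_add] at ht hc
      have h := IsWeight.unique h4 h4' (by rw [map_add, map_add, h2, h2', ht])
        (by rw [map_add, map_add, h3, h3', hc])
      have e : ∀ v, u₁ v = u₁' v ∧ w₂ v = w₂' v := by
        intro v
        have hv := DFunLike.congr_fun h v
        simp only [Finsupp.coe_add, Pi.add_apply] at hv
        by_cases hvL : {v} ∈ L.faces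
        · have e1 : w₂ v = 0 := by by_contra h; exact h6 v h hvL
          have e2 : w₂' v = 0 := by by_contra h; exact h6' v h hvL
          rw [e1, e2] at hv ⊢
          exact ⟨by simpa using hv, rfl⟩
        · have e1 : u₁ v = 0 := by by_contra h; exact hvL (h5 v h)
          have e2 : u₁' v = 0 := by by_contra h; exact hvL (h5' v h)
          rw [e1, e2] at hv ⊢
          exact ⟨rfl, by simpa using hv⟩
      have eu : u₁ = u₁' := Finsupp.ext fun v => (e v).1
      have ew : w₂ = w₂' := Finsupp.ext fun v => (e v).2
      rw [ew, IsWeight.unique h1 h1' (by rw [← h2, ← h2', eu]) (by rw [← h3, ← h3', eu])])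

lemma replace_inside (hLK : L.faces ⊆ K.faces) (hsp : L'.space = L.space) :
    Inside (replace hLK hsp) K := by
  rintro r ⟨-, σ', τ, rfl, -, ⟨rfl, hτ⟩ | ⟨hσ', σ, hσ, hσσ, hστ⟩⟩
  · exact ⟨τ, hτ, by rw [Finset.empty_union]⟩
  · refine ⟨_, hστ, convexHull_min ?_ (convex_convexHull ℝ _)⟩
    rw [Finset.coe_union, Set.union_subset_iff]
    constructor
    · exact ((subset_convexHull ℝ _).trans hσσ).trans
        (convexHull_mono (Finset.coe_subset.2 Finset.subset_union_left))
    · exact (Finset.coe_subset.2 Finset.subset_union_right).trans (subset_convexHull ℝ _)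

lemma space_subset_of_inside {K' K : Cpx V} (h : Inside K' K) : K'.space ⊆ K.space := by
  intro y hy
  obtain ⟨s, hs, hys⟩ := mem_space_iff.1 hy
  obtain ⟨t, ht, hst⟩ := h s hs
  exact mem_space_iff.2 ⟨t, ht, hst hys⟩

lemma replace_space (hLK : L.faces ⊆ K.faces) (hsp : L'.space = L.space) (hin : Inside L' L)
    (hfull : ∀ s ∈ K.faces, (∀ v ∈ s, {v} ∈ L.faces) → s ∈ L.faces) :
    (replace hLK hsp).space = K.space := by
  apply subset_antisymm (space_subset_of_inside (replace_inside hLK hsp))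
  intro y hy
  obtain ⟨u, hu0, hu, hu1, huy⟩ := exists_weights hy
  set u₁ := u.filter (fun v => {v} ∈ L.faces) with hu₁
  set u₂ := u.filter (fun v => ¬ {v} ∈ L.faces) with hu₂
  have hu10 : 0 ≤ u₁ := by
    intro v; rw [hu₁, Finsupp.filter_apply]; split_ifs
    · exact hu0 v
    · exact le_rfl
  have hu20 : 0 ≤ u₂ := by
    intro v; rw [hu₂, Finsupp.filter_apply]; split_ifs
    · exact le_rfl
    · exact hu0 v
  have hs1 : ∀ v ∈ u₁.support, {v} ∈ L.faces := fun v hv => by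
    rw [hu₁, Finsupp.support_filter, Finset.mem_filter] at hv; exact hv.2
  have hs2 : ∀ v ∈ u₂.support, {v} ∉ L.faces := fun v hv => by
    rw [hu₂, Finsupp.support_filter, Finset.mem_filter] at hv; exact hv.2
  have hsu1 : u₁.support ⊆ u.support := by
    rw [hu₁, Finsupp.support_filter]; exact Finset.filter_subset _ _
  have hsu2 : u₂.support ⊆ u.support := by
    rw [hu₂, Finsupp.support_filter]; exact Finset.filter_subset _ _
  have hsplit : u₁ + u₂ = u := Finsupp.filter_add_filter_not _ _
  by_cases h0 : u₁ = 0
  · rw [h0, zero_add] at hsplit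
    refine mem_space_iff.2 ⟨u.support,
      ⟨K.nonempty_of_mem_faces hu, ∅, u.support, by simp, hsplit ▸ hs2, Or.inl ⟨rfl, hu⟩⟩, ?_⟩
    exact mem_convexHull_iff_weights.2 ⟨u, hu0, Finset.Subset.refl _, hu1, huy⟩
  · have hσK : u₁.support ∈ K.faces := K.down_closed hu hsu1 (Finsupp.support_nonempty_iff.2 h0)
    have hσ := hfull _ hσK hs1
    set m := tot u₁ with hm
    have hm0 : m ≠ 0 := fun h => h0 (eq_zero_of_tot_eq_zero hu10 h)
    have hmpos : 0 < m := lt_of_le_of_ne (tot_nonneg hu10) (Ne.symm hm0)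
    have hz : m⁻¹ • cmb u₁ ∈ convexHull ℝ (u₁.support : Set V) := by
      refine mem_convexHull_iff_weights.2 ⟨m⁻¹ • u₁, smul_nonneg (inv_nonneg.2 hmpos.le) hu10,
        Finsupp.support_smul, ?_, by rw [map_smul]⟩
      rw [map_smul, ← hm, smul_eq_mul, inv_mul_cancel₀ hm0]
    have hzL' : m⁻¹ • cmb u₁ ∈ L'.space := hsp ▸ convexHull_subset_space hσ hz
    obtain ⟨w, hw0, hw, hw1, hwz⟩ := exists_weights hzL'
    have hsub := hin.convexHull_subset hw hσ hw0 rfl hw1 (hwz ▸ hz)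
    refine mem_space_iff.2 ⟨w.support ∪ u₂.support,
      ⟨(L'.nonempty_of_mem_faces hw).mono Finset.subset_union_left, _, _, rfl, hs2,
        Or.inr ⟨hw, _, hσ, hsub, ?_⟩⟩, ?_⟩
    · exact K.down_closed hu (Finset.union_subset hsu1 hsu2)
        ((Finsupp.support_nonempty_iff.2 h0).mono Finset.subset_union_left)
    · refine mem_convexHull_iff_weights.2 ⟨m • w + u₂,
        add_nonneg (smul_nonneg hmpos.le hw0) hu20, ?_, ?_, ?_⟩
      · exact Finsupp.support_add.trans
          (Finset.union_subset_union Finsupp.support_smul (Finset.Subset.refl _))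
      · rw [map_add, map_smul, hw1, smul_eq_mul, mul_one, hm, ← map_add, hsplit, hu1]
      · rw [map_add, map_smul, hwz, smul_smul, mul_inv_cancel₀ hm0, one_smul, ← map_add, hsplit,
          huy]

lemma replace_finite (hLK : L.faces ⊆ K.faces) (hsp : L'.space = L.space) (hK : K.faces.Finite)
    (hL' : L'.faces.Finite) : (replace hLK hsp).faces.Finite := by
  obtain ⟨T, hT⟩ := exists_vertices_finset hK
  obtain ⟨T', hT'⟩ := exists_vertices_finset hL'
  refine ((T' ∪ T).powerset.finite_toSet).subset ?_
  rintro r ⟨-, σ', τ, rfl, -, ⟨rfl, hτ⟩ | ⟨hσ', σ, hσ, hσσ, hστ⟩⟩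
  · rw [Finset.mem_coe, Finset.mem_powerset]
    exact Finset.union_subset_union (Finset.empty_subset _) (hT _ hτ)
  · rw [Finset.mem_coe, Finset.mem_powerset]
    exact Finset.union_subset_union (hT' _ hσ') (Finset.subset_union_right.trans (hT _ hστ))

end Relative

variable {V : Type*} [NormedAddCommGroup V] [NormedSpace ℝ V] {E : Type*} [NormedAddCommGroup E]
  [NormedSpace ℝ E] {X : Type*} [TopologicalSpace X] [ChartedSpace E X]
  {K K' L L' : Cpx V} {T : Finset V}

section Collar

open scoped Classical

open scoped Pointwise in
/-- The points near the convex hull of `t`. -/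
lemma convexHull_subset_thickening {s t : Finset V} {ε : ℝ} (h : ∀ v ∈ s, ∃ y ∈ Δ t, dist v y ≤ ε) :
    ∀ x ∈ Δ s, ∃ y ∈ Δ t, dist x y ≤ ε := by
  have hconv : Convex ℝ (Δ t + Metric.closedBall (0 : V) ε) :=
    (convex_convexHull ℝ _).add (convex_closedBall 0 ε)
  intro x hx
  obtain ⟨y, hy, z, hz, rfl⟩ := convexHull_min (s := (s : Set V)) (fun v hv => by
    obtain ⟨y, hy, hvy⟩ := h v hv
    exact ⟨y, hy, v - y, by simpa [dist_eq_norm] using hvy, by simp⟩) hconv hx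
  exact ⟨y, hy, by simpa [dist_eq_norm] using hz⟩

/-- The state of a subdivision process that makes the collar of the full subcomplex `L` of `K₀`
thin by subdividing edges in the ratio `r : 1 - r`. -/
structure CollarState (L K₀ : Cpx V) (r : ℝ) (K : Cpx V) : Prop where
  finite : K.faces.Finite
  space_eq : K.space = K₀.space
  inside : Inside K K₀
  sub : L.faces ⊆ K.faces
  full : ∀ s ∈ K.faces, (∀ v ∈ s, {v} ∈ L.faces) → s ∈ L.faces
  vertex : ∀ s ∈ K.faces, ∀ v ∈ s, {v} ∈ K₀.faces ∨ ∃ a b, {a, b} ∈ K₀.faces ∧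
    {a} ∈ L.faces ∧ {b} ∉ L.faces ∧ v = (1 - r) • a + r • b

lemma exists_collar (L K₀ : Cpx V) {r : ℝ} (hr0 : 0 < r) (hr1 : r < 1) (hLK₀ : L.faces ⊆ K₀.faces)
    (n : ℕ) : ∀ K : Cpx V, CollarState L K₀ r K → {e : Finset V | e ∈ K.faces ∧ ∃ a b, e = {a, b} ∧
    {a} ∈ L.faces ∧ {b} ∉ L.faces ∧ {b} ∈ K₀.faces}.ncard = n → ∃ K' : Cpx V, CollarState L K₀ r K'
    ∧ ∀ a b, {a, b} ∈ K'.faces → {a} ∈ L.faces → {b} ∉ L.faces → {b} ∉ K₀.faces := by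
  induction n using Nat.strong_induction_on with
  | _ n ih =>
  intro K hK hn
  set bad := {e : Finset V | e ∈ K.faces ∧ ∃ a b, e = {a, b} ∧ {a} ∈ L.faces ∧ {b} ∉ L.faces ∧
      {b} ∈ K₀.faces} with hbad
  have hbadfin : bad.Finite := hK.finite.subset fun e he => he.1
  by_cases hne : bad.Nonempty
  · obtain ⟨e, heb⟩ := hne
    obtain ⟨he, a, b, hab, ha, hb, hb0⟩ := id heb
    have hne : a ≠ b := by rintro rfl; exact hb ha
    obtain ⟨c, hc0, hce, hc1, hcx⟩ := exists_edge_weights hne hr0 hr1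
    have heK₀ : {a, b} ∈ K₀.faces := by
      obtain ⟨t, ht, het⟩ := hK.inside e he
      refine K₀.down_closed ht ?_ (Finset.insert_nonempty _ _)
      rw [Finset.insert_subset_iff, Finset.singleton_subset_iff]
      exact ⟨vertex_mem_of_mem_convexHull (hLK₀ ha) ht (het (subset_convexHull ℝ _ (by simp [hab]))),
        vertex_mem_of_mem_convexHull hb0 ht (het (subset_convexHull ℝ _ (by simp [hab])))⟩
    have hx0 : {cmb c} ∉ K₀.faces := by
      intro h
      exact cmb_notMem_of_card ⟨heK₀, hc0, hce, hc1, (Finset.card_pair hne).ge⟩ h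
        (Finset.mem_singleton_self _)
    rw [← hab] at hce
    have hS : IsInner K e c := ⟨he, hc0, hce, hc1, by rw [hab, Finset.card_pair hne]⟩
    have hxL : {cmb c} ∉ L.faces := fun h => hx0 (hLK₀ h)
    have hst : CollarState L K₀ r (star hS) := by
      refine ⟨star_finite hS hK.finite, (star_space hS).trans hK.space_eq,
        Inside.trans (fun s hs => star_convexHull_subset hS hs) hK.inside,
        fun s hs => Or.inl ⟨hK.sub hs, fun hes => hb ?_⟩, fun s hs hsL => ?_, fun s hs v hv => ?_⟩
      · exact vertex_mem hs (hes (by simp [hab]))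
      · rcases (mem_star_faces hS).1 hs with ⟨hs, -⟩ | ⟨t, rfl, -, ht⟩
        · exact hK.full s hs hsL
        · exact absurd (hsL _ (Finset.mem_insert_self _ _)) hxL
      · rcases (mem_star_faces hS).1 hs with ⟨hs, -⟩ | ⟨t, rfl, -, ht⟩
        · exact hK.vertex s hs v hv
        · rcases Finset.mem_insert.1 hv with rfl | hv
          · exact Or.inr ⟨a, b, heK₀, ha, hb, hcx⟩
          · exact hK.vertex _ ht v (Finset.mem_union_left _ hv)
    have hih := fun hlt => ih _ hlt (star hS) hst rfl
    refine hih ?_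
    rw [← hn]
    refine Set.ncard_lt_ncard ⟨?_, ?_⟩ hbadfin
    · rintro s ⟨hs, a', b', hs', ha', hb', hb0'⟩
      rcases (mem_star_faces hS).1 hs with ⟨hs, -⟩ | ⟨t, ht, -, -⟩
      · exact ⟨hs, a', b', hs', ha', hb', hb0'⟩
      · exfalso
        have : cmb c ∈ s := ht ▸ Finset.mem_insert_self _ _
        rw [hs'] at this
        simp only [Finset.mem_insert, Finset.mem_singleton] at this
        rcases this with h | h
        · exact hxL (h ▸ ha')
        · exact hx0 (h ▸ hb0')
    · intro hcon
      have := hcon heb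
      rcases (mem_star_faces hS).1 this.1 with ⟨-, hs⟩ | ⟨t, ht, -, -⟩
      · exact hs (Finset.Subset.refl _)
      · exact cmb_notMem_of_card hS he (ht ▸ Finset.mem_insert_self _ _)
  · refine ⟨K, hK, fun a b hab ha hb hb0 => hne ⟨_, hab, a, b, rfl, ha, hb, hb0⟩⟩

/-- A subdivision `L'` of a subcomplex `L` of `K` extends to a subdivision of `K` whose simplices
are small or close to a simplex of `L'`. -/
theorem exists_relative_subdivision {K L L' : Cpx V} (hK : K.faces.Finite) (hLK : L.faces ⊆ K.faces)
    (hL' : L'.faces.Finite) (hsp : L'.space = L.space) (hin : Inside L' L) {ε : ℝ} (hε : 0 < ε) : ∃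
    K' : Cpx V, K'.faces.Finite ∧ K'.space = K.space ∧ Inside K' K ∧ L'.faces ⊆ K'.faces ∧
    (∀ s ∈ K'.faces, Δ s ⊆ L.space → s ∈ L'.faces) ∧ ∀ s ∈ K'.faces,
    (∀ x ∈ s, ∀ y ∈ s, dist x y ≤ ε) ∨ ∃ t ∈ L'.faces, ∀ x ∈ Δ s, ∃ y ∈ Δ t, dist x y ≤ ε := by
  obtain ⟨K₁, hK₁, hsp₁, hin₁, hLK₁, hfull₁⟩ := exists_full L _ K hK hLK rfl
  set K₂ := replace hLK₁ hsp with hK₂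
  have hfin₂ : K₂.faces.Finite := replace_finite hLK₁ hsp hK₁ hL'
  have hsp₂ : K₂.space = K.space := (replace_space hLK₁ hsp hin hfull₁).trans hsp₁
  have hin₂ : Inside K₂ K := (replace_inside hLK₁ hsp).trans hin₁
  have hL'K₂ : L'.faces ⊆ K₂.faces := by
    intro s hs
    obtain ⟨t, ht, hst⟩ := hin s hs
    exact ⟨L'.nonempty_of_mem_faces hs, s, ∅, by simp, by simp,
      Or.inr ⟨hs, t, ht, hst, by simpa using hLK₁ ht⟩⟩
  have hfull₂ : ∀ s ∈ K₂.faces, (∀ v ∈ s, {v} ∈ L'.faces) → s ∈ L'.faces := by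
    rintro s ⟨hne, σ', τ, rfl, hτ, h⟩ hsv
    have hτ0 : τ = ∅ := by
      rw [Finset.eq_empty_iff_forall_notMem]
      intro v hv
      have hvL : v ∈ L.space := hsp ▸ SimplicialComplex.subset_space
        (hsv v (Finset.mem_union_right _ hv)) (by simp)
      obtain ⟨t, ht, hvt⟩ := mem_space_iff.1 hvL
      have hvK : {v} ∈ K₁.faces := by
        rcases h with ⟨-, h⟩ | ⟨-, σ, -, -, h⟩
        · exact vertex_mem h hv
        · exact vertex_mem h (Finset.mem_union_right _ hv)
      exact hτ v hv (vertex_mem ht (vertex_mem_of_mem_convexHull hvK (hLK₁ ht) hvt))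
    subst hτ0
    rcases h with ⟨rfl, h⟩ | ⟨h, -⟩
    · simp at hne
    · simpa using h
  obtain ⟨T, hT⟩ := exists_vertices_finset hfin₂
  obtain ⟨D, hD⟩ : ∃ D : ℝ, 0 < D ∧ ∀ a ∈ T, ∀ b ∈ T, ‖b - a‖ ≤ D := by
    refine ⟨1 + ∑ a ∈ T, ∑ b ∈ T, ‖b - a‖, ?_, fun a ha b hb => ?_⟩
    · have : 0 ≤ ∑ a ∈ T, ∑ b ∈ T, ‖b - a‖ :=
        sum_nonneg fun _ _ => sum_nonneg fun _ _ => norm_nonneg _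
      linarith
    · have h1 : ‖b - a‖ ≤ ∑ b ∈ T, ‖b - a‖ :=
        single_le_sum (f := fun b => ‖b - a‖) (fun _ _ => norm_nonneg _) hb
      have h2 : ∑ b ∈ T, ‖b - a‖ ≤ ∑ a ∈ T, ∑ b ∈ T, ‖b - a‖ :=
        single_le_sum (f := fun a => ∑ b ∈ T, ‖b - a‖)
          (fun _ _ => sum_nonneg fun _ _ => norm_nonneg _) ha
      linarith
  set r : ℝ := min (1 / 2) (ε / D) with hr
  have hr0 : 0 < r := lt_min (by norm_num) (div_pos hε hD.1)
  have hr1 : r < 1 := (min_le_left _ _).trans_lt (by norm_num)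
  have hrD : r * D ≤ ε := by
    calc r * D ≤ ε / D * D := mul_le_mul_of_nonneg_right (min_le_right _ _) hD.1.le
      _ = ε := div_mul_cancel₀ _ hD.1.ne'
  obtain ⟨K₃, hK₃, hK₃'⟩ := exists_collar L' K₂ hr0 hr1 hL'K₂ _ K₂
    ⟨hfin₂, rfl, Inside.refl _, hL'K₂, hfull₂, fun s hs v hv => Or.inl (vertex_mem hs hv)⟩ rfl
  have hnear : ∀ s ∈ K₃.faces, ∀ v ∈ s, {v} ∈ L'.faces → ∃ t ∈ L'.faces,
      ∀ x ∈ Δ s, ∃ y ∈ Δ t, dist x y ≤ ε := by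
    intro s hs v hv hvL
    obtain ⟨t₂, ht₂, hst₂⟩ := hK₃.inside s hs
    have hvt₂ : v ∈ t₂ := vertex_mem_of_mem_convexHull (hL'K₂ hvL) ht₂
      (hst₂ (subset_convexHull ℝ _ hv))
    set t := t₂.filter (fun v => {v} ∈ L'.faces) with ht
    have hvt : v ∈ t := Finset.mem_filter.2 ⟨hvt₂, hvL⟩
    refine ⟨t, hfull₂ t (K₂.down_closed ht₂ (Finset.filter_subset _ _) ⟨v, hvt⟩)
      fun x hx => (Finset.mem_filter.1 hx).2, convexHull_subset_thickening fun x hx => ?_⟩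
    have hxt₂ := hst₂ (subset_convexHull ℝ _ hx)
    rcases hK₃.vertex s hs x hx with hx0 | ⟨a, b, hab, ha, hb, hxab⟩
    · have hxL : {x} ∈ L'.faces := by
        by_contra hxL
        refine hK₃' v x (K₃.down_closed hs ?_ (Finset.insert_nonempty _ _)) hvL hxL hx0
        rw [Finset.insert_subset_iff, Finset.singleton_subset_iff]
        exact ⟨hv, hx⟩
      refine ⟨x, subset_convexHull ℝ _ (Finset.mem_filter.2
        ⟨vertex_mem_of_mem_convexHull hx0 ht₂ hxt₂, hxL⟩), by simpa using hε.le⟩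
    · have hne : a ≠ b := by rintro rfl; exact hb ha
      obtain ⟨c, hc0, hce, hc1, hcx⟩ := exists_edge_weights hne hr0 hr1
      have hsub := support_subset_of_mem_convexHull hc0 (hce ▸ hab) hc1 ht₂
        (by rw [hcx, ← hxab]; exact hxt₂)
      rw [hce] at hsub
      have hat : a ∈ t := Finset.mem_filter.2 ⟨hsub (by simp), ha⟩
      refine ⟨a, subset_convexHull ℝ _ hat, ?_⟩
      have : x - a = r • (b - a) := by rw [hxab]; module
      rw [dist_eq_norm, this, norm_smul, Real.norm_eq_abs, abs_of_pos hr0]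
      refine le_trans ?_ hrD
      exact mul_le_mul_of_nonneg_left (hD.2 a (hT _ hab (by simp)) b (hT _ hab (by simp))) hr0.le
  obtain ⟨K₄, hK₄, hfine⟩ := exists_fine_subdivision {x : V | ({x} : Finset V) ∈ L'.faces} K₃ hK₃.finite
    (fun x hx _ => hK₃.sub hx) hε
  refine ⟨K₄, hK₄.finite, (hK₄.space_eq.trans hK₃.space_eq).trans hsp₂,
    (hK₄.inside.trans hK₃.inside).trans hin₂, ?_, ?_, ?_⟩
  · intro s hs
    exact (hK₄.faces_iff s fun v hv => vertex_mem hs hv).2 (hK₃.sub hs)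
  · intro s hs hsL
    have hsA : ∀ v ∈ s, {v} ∈ L'.faces := by
      intro v hv
      have hvL : v ∈ L'.space := hsp ▸ hsL (subset_convexHull ℝ _ hv)
      obtain ⟨t, ht, hvt⟩ := mem_space_iff.1 hvL
      have ht₄ : t ∈ K₄.faces := (hK₄.faces_iff t fun v hv => vertex_mem ht hv).2 (hK₃.sub ht)
      exact vertex_mem ht (vertex_mem_of_mem_convexHull (vertex_mem hs hv) ht₄ hvt)
    exact hK₃.full s ((hK₄.faces_iff s hsA).1 hs) hsA
  · intro s hs
    by_cases h : ∀ v ∈ s, v ∉ {x : V | ({x} : Finset V) ∈ L'.faces}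
    · exact Or.inl (hfine s hs h)
    · push Not at h
      obtain ⟨v, hv, hvL⟩ := h
      obtain ⟨u, hu, hsu, hA⟩ := hK₄.exists_face s hs
      obtain ⟨t, ht, hnt⟩ := hnear u hu v ((hA v hvL).1 hv) hvL
      exact Or.inr ⟨t, ht, fun x hx => hnt x (hsu hx)⟩

end Collar

section Carrier

lemma exists_isCarrier {K : Cpx V} {s' t : Finset V} (hs' : s'.Nonempty) (ht : t ∈ K.faces)
    (h : Δ s' ⊆ Δ t) : ∃ s, IsCarrier K s' s := by
  classical
  obtain ⟨w, h0, hw, h1, hx⟩ := exists_relint s' hs'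
  obtain ⟨u, hu0, hu, hu1, hux⟩ := exists_weights (convexHull_subset_space ht (h hx))
  have key : ∀ r ∈ K.faces, Δ s' ⊆ Δ r → u.support ⊆ r := fun r hr hsr =>
    support_subset_of_mem_convexHull hu0 hu hu1 hr (hux ▸ hsr hx)
  refine ⟨u.support, hu, ?_, key⟩
  refine convexHull_subset_of_relint (K.indep ht) (key t ht h) ((subset_convexHull ℝ _).trans h)
    h0 hw h1 ?_
  exact mem_convexHull_iff_weights.2 ⟨u, hu0, Finset.Subset.refl _, hu1, hux⟩

lemma IsCarrier.unique {K : Cpx V} {s' s t : Finset V}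
    (hs : IsCarrier K s' s) (ht : IsCarrier K s' t) : s = t :=
  Finset.Subset.antisymm (hs.2.2 t ht.1 ht.2.1) (ht.2.2 s hs.1 hs.2.1)

lemma IsCarrier.trans {K₁ K₂ : Cpx V} (hin : Inside K₂ K₁) {s'' s' s : Finset V}
    (h : IsCarrier K₂ s'' s') (h' : IsCarrier K₁ s' s) (hne : s''.Nonempty) : IsCarrier K₁ s'' s :=
    by
  classical
  refine ⟨h'.1, h.2.1.trans h'.2.1, fun u hu hsu => h'.2.2 u hu ?_⟩
  obtain ⟨w, h0, hw, h1, hx⟩ := exists_relint s'' hne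
  obtain ⟨c, hc0, hc, hc1, hcx⟩ := exists_weights (convexHull_subset_space h.1 (h.2.1 hx))
  have hcs : s' = c.support := by
    refine Finset.Subset.antisymm ?_ ?_
    · refine h.2.2 _ hc ?_
      refine convexHull_subset_of_relint (K₂.indep h.1)
        (support_subset_of_mem_convexHull hc0 hc hc1 h.1 (hcx ▸ h.2.1 hx))
        ((subset_convexHull ℝ _).trans h.2.1) h0 hw h1 ?_
      exact mem_convexHull_iff_weights.2 ⟨c, hc0, Finset.Subset.refl _, hc1, hcx⟩
    · exact support_subset_of_mem_convexHull hc0 hc hc1 h.1 (hcx ▸ h.2.1 hx)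
  exact hin.convexHull_subset h.1 hu hc0 hcs.symm hc1 (hcx ▸ hsu hx)

end Carrier

section Param

/-- The linear part of `ρ v`. -/
def paramLin {p : ℕ} (v : Fin (p + 1) → V) : (Fin p → ℝ) →L[ℝ] V :=
  ∑ i, (pr p i).smulRight (v i.succ - v 0)

lemma paramLin_apply {p : ℕ} (v : Fin (p + 1) → V) (t : Fin p → ℝ) :
    paramLin v t = ∑ i, t i • (v i.succ - v 0) := by
  simp [paramLin]

lemma paramLin_single {p : ℕ} (v : Fin (p + 1) → V) (i : Fin p) :
    paramLin v (single i 1) = v i.succ - v 0 := by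
  rw [paramLin_apply, sum_eq_single i]
  · simp
  · intro j _ hj; simp [Pi.single_eq_of_ne hj]
  · simp

lemma simplexParam_eq {p : ℕ} (v : Fin (p + 1) → V) (t : Fin p → ℝ) :
    ρ v t = v 0 + paramLin v t := by
  rw [paramLin_apply]; rfl

lemma hasFDerivAt_simplexParam {p : ℕ} (v : Fin (p + 1) → V) (t : Fin p → ℝ) :
    HasFDerivAt (ρ v) (paramLin v) t := by
  have : ρ v = fun t => v 0 + paramLin v t := funext (simplexParam_eq v)
  rw [this]
  exact (paramLin v).hasFDerivAt.const_add _

lemma contDiff_simplexParam {p : ℕ} (v : Fin (p + 1) → V) {n : WithTop ℕ∞} :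
    ContDiff ℝ n (ρ v) := by
  have : ρ v = fun t => v 0 + paramLin v t := funext (simplexParam_eq v)
  rw [this]
  exact contDiff_const.add (paramLin v).contDiff

lemma continuous_simplexParam {p : ℕ} (v : Fin (p + 1) → V) : Continuous (ρ v) :=
  (contDiff_simplexParam v (n := 0)).continuous

/-- The barycentric coordinates of a point with respect to the standard simplex. -/
def baryCoord {p : ℕ} (t : Fin p → ℝ) : Fin (p + 1) → ℝ := cons (1 - ∑ i, t i) t

lemma sum_baryCoord {p : ℕ} (t : Fin p → ℝ) : ∑ i, baryCoord t i = 1 := by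
  rw [sum_univ_succ]; simp [baryCoord]

lemma baryCoord_nonneg {p : ℕ} {t : Fin p → ℝ} (ht : t ∈ stdSimp p) (i : Fin (p + 1)) :
    0 ≤ baryCoord t i := by
  refine Fin.cases ?_ (fun j => ?_) i
  · simpa [baryCoord] using ht.2
  · simpa [baryCoord] using ht.1 j

lemma simplexParam_eq_sum {p : ℕ} (v : Fin (p + 1) → V) (t : Fin p → ℝ) :
    ρ v t = ∑ i, baryCoord t i • v i := by
  rw [sum_univ_succ]
  simp only [baryCoord, Fin.cons_zero, Fin.cons_succ, simplexParam, smul_sub, sub_smul, one_smul,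
    sum_sub_distrib, sum_smul]
  abel

lemma simplexParam_sum {p : ℕ} (v : Fin (p + 1) → V) (c : Fin (p + 1) → ℝ) (hc : ∑ i, c i = 1) :
    ρ v (fun i => c i.succ) = ∑ i, c i • v i := by
  rw [simplexParam_eq_sum]
  refine sum_congr rfl fun i _ => ?_
  congr 1
  refine Fin.cases ?_ (fun j => ?_) i
  · rw [sum_univ_succ] at hc
    simp [baryCoord]; linarith
  · simp [baryCoord]

/-- The vertices of the standard simplex. -/
def stdVert (p : ℕ) : Fin (p + 1) → (Fin p → ℝ) := cons 0 fun i => single i 1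

@[simp] lemma stdVert_zero (p : ℕ) : stdVert p 0 = 0 := rfl

@[simp] lemma stdVert_succ (p : ℕ) (i : Fin p) : stdVert p i.succ = single i 1 := rfl

lemma simplexParam_stdVert {p : ℕ} (v : Fin (p + 1) → V) (i : Fin (p + 1)) :
    ρ v (stdVert p i) = v i := by
  refine Fin.cases ?_ (fun j => ?_) i
  · simp [simplexParam_eq]
  · rw [simplexParam_eq, stdVert_succ, paramLin_single]; simp

lemma simplexParam_stdVert_self {p : ℕ} (t : Fin p → ℝ) : ρ (stdVert p) t = t := by
  rw [simplexParam_eq, paramLin_apply]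
  ext j
  simp [Pi.single_apply]

lemma simplexParam_comp {p q : ℕ} (v : Fin (p + 1) → V) (w : Fin (q + 1) → (Fin p → ℝ))
    (t : Fin q → ℝ) : ρ v (ρ w t) = ρ (fun i => ρ v (w i)) t := by
  simp only [simplexParam_eq, map_add, paramLin_apply, map_sum, map_smul, map_sub]
  simp [add_assoc]

/-- Reorder the vertices. -/
lemma simplexParam_reindex {p q : ℕ} (v : Fin (p + 1) → V) (f : Fin (q + 1) → Fin (p + 1))
    (t : Fin q → ℝ) : ρ (v ∘ f) t = ρ v (ρ (stdVert p ∘ f) t) := by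
  rw [simplexParam_comp]
  congr 1
  ext i
  simp [simplexParam_stdVert]

lemma range_vertexSet {m : ℕ} (v : Fin m → V) : ((vertexSet v : Finset V) : Set V) = range v := by
  simp [vertexSet]

lemma simplexParam_image {p : ℕ} (v : Fin (p + 1) → V) :
    ρ v '' stdSimp p = convexHull ℝ (range v) := by
  apply subset_antisymm
  · rintro _ ⟨t, ht, rfl⟩
    rw [simplexParam_eq_sum]
    exact (convex_convexHull ℝ _).sum_mem (fun i _ => baryCoord_nonneg ht i) (sum_baryCoord t)
      fun i _ => subset_convexHull ℝ _ (mem_range_self i)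
  · rw [← Set.image_univ, ← Finset.coe_univ]
    intro x hx
    have hx' : ∃ c : Fin (p + 1) → ℝ, (∀ i, 0 ≤ c i) ∧ ∑ i, c i = 1 ∧ ∑ i, c i • v i = x := by
      have hconv : Convex ℝ {x | ∃ c : Fin (p + 1) → ℝ, (∀ i, 0 ≤ c i) ∧ ∑ i, c i = 1 ∧
          ∑ i, c i • v i = x} := by
        rintro x ⟨c, hc0, hc1, rfl⟩ y ⟨d, hd0, hd1, rfl⟩ a b ha hb hab
        refine ⟨fun i => a * c i + b * d i, fun i => by
          have := hc0 i; have := hd0 i; positivity, ?_, ?_⟩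
        · rw [sum_add_distrib, ← mul_sum, ← mul_sum, hc1, hd1]; simpa using hab
        · simp only [add_smul, sum_add_distrib, smul_sum, smul_smul]
      refine convexHull_min ?_ hconv hx
      rintro _ ⟨i, -, rfl⟩
      refine ⟨single i 1, fun j => ?_, by simp, ?_⟩
      · by_cases h : j = i
        · subst h; simp
        · simp [Pi.single_eq_of_ne h]
      · rw [sum_eq_single i]
        · simp
        · intro j _ hj; simp [Pi.single_eq_of_ne hj]
        · simp
    obtain ⟨c, hc0, hc1, rfl⟩ := hx'
    refine ⟨fun i => c i.succ, ⟨fun i => hc0 _, ?_⟩, simplexParam_sum v c hc1⟩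
    rw [sum_univ_succ] at hc1
    have := hc0 0
    linarith

lemma stdSimp_eq_convexHull (p : ℕ) : stdSimp p = convexHull ℝ (range (stdVert p)) := by
  rw [← simplexParam_image]
  conv_lhs => rw [← image_id (stdSimp p)]
  exact image_congr fun t _ => (simplexParam_stdVert_self t).symm

lemma convex_stdSimp (p : ℕ) : Convex ℝ (stdSimp p) := by
  rw [stdSimp_eq_convexHull]; exact convex_convexHull ℝ _

lemma isCompact_stdSimp (p : ℕ) : IsCompact (stdSimp p) := by
  rw [stdSimp_eq_convexHull]
  exact (Set.finite_range _).isCompact_convexHull ℝ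

lemma measurableSet_stdSimp (p : ℕ) : MeasurableSet (stdSimp p) :=
  (isCompact_stdSimp p).isClosed.measurableSet

/-- The interior of the standard simplex. -/
def openSimp (p : ℕ) : Set (Fin p → ℝ) := {t | (∀ i, 0 < t i) ∧ ∑ i, t i < 1}

lemma isOpen_openSimp (p : ℕ) : IsOpen (openSimp p) := by
  have : openSimp p = (⋂ i, {t | 0 < t i}) ∩ {t | ∑ i, t i < 1} := by
    ext t; simp [openSimp]
  rw [this]
  refine IsOpen.inter (isOpen_iInter_of_finite fun i => ?_) ?_
  · exact isOpen_lt continuous_const (continuous_apply i)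
  · exact isOpen_lt (continuous_finsetSum _ fun i _ => continuous_apply i) continuous_const

lemma openSimp_subset (p : ℕ) : openSimp p ⊆ stdSimp p :=
  fun _ ht => ⟨fun i => (ht.1 i).le, ht.2.le⟩

lemma stdBary_mem (p : ℕ) : stdBary p ∈ openSimp p := by
  refine ⟨fun i => by simp only [stdBary]; positivity, ?_⟩
  simp only [stdBary, sum_const, Finset.card_univ, Fintype.card_fin, nsmul_eq_mul]
  rw [mul_one_div, div_lt_one (by positivity)]
  linarith

lemma openSimp_subset_interior (p : ℕ) : openSimp p ⊆ interior (stdSimp p) :=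
  interior_maximal (openSimp_subset p) (isOpen_openSimp p)

lemma interior_stdSimp_nonempty (p : ℕ) : (interior (stdSimp p)).Nonempty :=
  ⟨_, openSimp_subset_interior p (stdBary_mem p)⟩

lemma uniqueDiffOn_stdSimp (p : ℕ) : UniqueDiffOn ℝ (stdSimp p) :=
  uniqueDiffOn_convex (convex_stdSimp p) (interior_stdSimp_nonempty p)

lemma mem_closure_interior_stdSimp {p : ℕ} {t : Fin p → ℝ} (ht : t ∈ stdSimp p) :
    t ∈ closure (interior (stdSimp p)) := by
  rw [(convex_stdSimp p).closure_interior_eq_closure_of_nonempty_interior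
    (interior_stdSimp_nonempty p)]
  exact subset_closure ht

lemma mem_closure_openSimp {p : ℕ} {t : Fin p → ℝ} (ht : t ∈ stdSimp p) :
    t ∈ closure (openSimp p) := by
  have h : Filter.Tendsto (fun r : ℝ => (1 - r) • t + r • stdBary p) (𝓝[>] 0) (𝓝 t) := by
    have : Continuous fun r : ℝ => (1 - r) • t + r • stdBary p := by fun_prop
    have h2 := (this.tendsto 0).mono_left (nhdsWithin_le_nhds (s := Ioi 0))
    simpa using h2
  refine mem_closure_of_tendsto h ?_
  have : Ioo (0 : ℝ) 1 ∈ 𝓝[>] (0 : ℝ) := Ioo_mem_nhdsGT one_pos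
  filter_upwards [this] with r hr
  have hb := stdBary_mem p
  refine ⟨fun i => ?_, ?_⟩
  · have h1 := ht.1 i
    have h2 := hb.1 i
    simp only [Pi.add_apply, Pi.smul_apply, smul_eq_mul]
    have := mul_pos hr.1 h2
    have := mul_nonneg (sub_nonneg.2 hr.2.le) h1
    linarith
  · simp only [Pi.add_apply, Pi.smul_apply, smul_eq_mul, sum_add_distrib, ← mul_sum]
    have h1 := mul_le_mul_of_nonneg_left ht.2 (sub_nonneg.2 hr.2.le)
    have h2 := mul_lt_mul_of_pos_left hb.2 hr.1
    linarith

lemma volume_stdSimp_ne_zero (p : ℕ) : volume (stdSimp p) ≠ 0 := by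
  intro h
  have := measure_mono_null (openSimp_subset p) h
  rw [(isOpen_openSimp p).measure_eq_zero_iff volume] at this
  exact (this ▸ stdBary_mem p : stdBary p ∈ (∅ : Set _))

/-- Affine bijections of the standard simplex preserve its volume. -/
lemma abs_det_paramLin_perm {p : ℕ} (π : Perm (Fin (p + 1))) :
    |(paramLin (stdVert p ∘ π)).det| = 1 := by
  have himg : ρ (stdVert p ∘ π) '' stdSimp p = stdSimp p := by
    rw [simplexParam_image, stdSimp_eq_convexHull, EquivLike.range_comp]
  have h2 : ρ (stdVert p ∘ π) '' stdSimp p =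
      (fun x => stdVert p (π 0) + x) '' ((paramLin (stdVert p ∘ π)) '' stdSimp p) := by
    rw [image_image]
    exact image_congr fun t _ => simplexParam_eq _ _
  have hvol : volume (stdSimp p) =
      ENNReal.ofReal |(paramLin (stdVert p ∘ π)).det| * volume (stdSimp p) := by
    conv_lhs => rw [← himg, h2, image_add_left, measure_preimage_add]
    exact Measure.addHaar_image_continuousLinearMap _ _ _
  have hfin : volume (stdSimp p) ≠ ⊤ := (isCompact_stdSimp p).measure_lt_top.ne
  have h1 : ENNReal.ofReal |(paramLin (stdVert p ∘ π)).det| = 1 := by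
    have := (ENNReal.mul_left_inj (volume_stdSimp_ne_zero p) hfin).1 ((one_mul _).trans hvol)
    exact this.symm
  simpa using h1

lemma simplexParam_perm_injective {p : ℕ} (π : Perm (Fin (p + 1))) :
    Injective (ρ (stdVert p ∘ π)) := by
  intro s t h
  have key : ∀ t, ρ (stdVert p ∘ π.symm) (ρ (stdVert p ∘ π) t) = t := by
    intro t
    rw [← simplexParam_reindex]
    have : (stdVert p ∘ π.symm) ∘ π = stdVert p := by ext; simp
    rw [this, simplexParam_stdVert_self]
  rw [← key s, ← key t, h]

lemma integral_perm {p : ℕ} (π : Perm (Fin (p + 1))) (f : (Fin p → ℝ) → ℝ) :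
    ∫ t in stdSimp p, f (ρ (stdVert p ∘ π) t) = ∫ t in stdSimp p, f t := by
  have himg : ρ (stdVert p ∘ π) '' stdSimp p = stdSimp p := by
    rw [simplexParam_image, stdSimp_eq_convexHull, EquivLike.range_comp]
  conv_rhs => rw [← himg]
  rw [integral_image_eq_integral_abs_det_fderiv_smul _ (measurableSet_stdSimp p)
    (fun t _ => (hasFDerivAt_simplexParam _ t).hasFDerivWithinAt)
    (simplexParam_perm_injective π).injOn]
  simp [abs_det_paramLin_perm]

end Param

section BaseStokes

/-- An alternating map is unchanged if multiples of the entry `0` are subtracted from the others. -/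
lemma AlternatingMap.map_sub_entry {W : Type*} [AddCommGroup W] [Module ℝ W] {n : ℕ}
    (G : W [⋀^Fin (n + 1)]→ₗ[ℝ] ℝ) (x : Fin (n + 1) → W) (S : Finset (Fin (n + 1))) (hS : 0 ∉ S) :
    G (fun i => if i ∈ S then x i - x 0 else x i) = G x := by
  classical
  induction S using Finset.induction_on with
  | empty => simp
  | insert a S ha ih =>
    have ha0 : a ≠ 0 := fun h => hS (h ▸ Finset.mem_insert_self _ _)
    have hS0 : 0 ∉ S := fun h => hS (Finset.mem_insert_of_mem h)
    set y : Fin (n + 1) → W := fun i => if i ∈ S then x i - x 0 else x i with hy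
    have e : (fun i => if i ∈ insert a S then x i - x 0 else x i) =
        Function.update y a (y a - y 0) := by
      ext i
      by_cases h : i = a
      · subst h; simp [hy, ha, hS0]
      · simp [hy, h, Finset.mem_insert]
    rw [e, AlternatingMap.map_update_sub, Function.update_eq_self,
      AlternatingMap.map_update_self _ _ ha0, sub_zero, ih hS0]

lemma alternating_sub_eq_sum {W : Type*} [NormedAddCommGroup W] [NormedSpace ℝ W] {q : ℕ}
    (η : W [⋀^Fin q]→L[ℝ] ℝ) (x : Fin (q + 1) → W) :
    η (fun i => x i.succ - x 0) = ∑ j : Fin (q + 1), (-1 : ℝ) ^ (j : ℕ) * η (x ∘ j.succAbove) := by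
  set L : W × ℝ →ₗ[ℝ] (W × ℝ) [⋀^Fin q]→ₗ[ℝ] ℝ :=
    (LinearMap.snd ℝ W ℝ).smulRight (η.toAlternatingMap.compLinearMap (LinearMap.fst ℝ W ℝ)) with hL
  set G := AlternatingMap.alternatizeUncurryFin L with hG
  have h1 := AlternatingMap.map_sub_entry G (fun i => (x i, (1 : ℝ)))
    (Finset.univ.erase 0) (by simp)
  rw [hG, AlternatingMap.alternatizeUncurryFin_apply, AlternatingMap.alternatizeUncurryFin_apply,
    sum_eq_single 0] at h1
  · have h2 : (fun i : Fin q => x i.succ - x 0) = Prod.fst ∘ Fin.removeNth 0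
      (fun i : Fin (q + 1) => if i ∈ Finset.univ.erase 0 then ((x i, (1 : ℝ)) - (x 0, (1 : ℝ)))
        else (x i, (1 : ℝ))) := by
      ext i
      simp [tail]
    rw [h2]
    refine Eq.trans ?_ (h1.trans ?_)
    · simp [hL, Function.comp_def]
    · refine sum_congr rfl fun j _ => ?_
      simp [hL, Function.comp_def, Fin.removeNth]
  · intro j _ hj
    simp [hL, hj]
  · simp

lemma insertNth_mem_stdSimp {q : ℕ} (j : Fin (q + 1)) (x : ℝ) (s : Fin q → ℝ) :
    j.insertNth x s ∈ stdSimp (q + 1) ↔ s ∈ stdSimp q ∧ x ∈ Icc 0 (1 - ∑ i, s i) := by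
  simp only [stdSimp, mem_ofPred_eq, mem_Icc]
  rw [Fin.sum_univ_succAbove _ j, Fin.forall_iff_succAbove j]
  simp only [Fin.insertNth_apply_same, Fin.insertNth_apply_succAbove]
  constructor
  · rintro ⟨⟨h1, h2⟩, h3⟩
    exact ⟨⟨h2, by linarith⟩, h1, by linarith⟩
  · rintro ⟨⟨h2, h4⟩, h1, h3⟩
    exact ⟨⟨h1, h2⟩, by linarith⟩

/-- The fundamental theorem of calculus on the standard simplex. -/
lemma integral_partial_stdSimp {q : ℕ} (j : Fin (q + 1)) {a : (Fin (q + 1) → ℝ) → ℝ}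
    (ha : ContDiffOn ℝ 1 a (stdSimp (q + 1))) :
    ∫ t in stdSimp (q + 1), fderivWithin ℝ a (stdSimp (q + 1)) t (single j 1) =
      ∫ s in stdSimp q, (a (j.insertNth (1 - ∑ i, s i) s) - a (j.insertNth 0 s)) := by
  classical
  set S := stdSimp (q + 1) with hS
  set f : (Fin (q + 1) → ℝ) → ℝ := fun t => fderivWithin ℝ a S t (single j 1) with hf
  have hfc : ContinuousOn f S :=
    (ha.continuousOn_fderivWithin (uniqueDiffOn_stdSimp _) le_rfl).clm_apply continuousOn_const
  have hfi : IntegrableOn f S := hfc.integrableOn_compact (isCompact_stdSimp _)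
  have hSm : MeasurableSet S := measurableSet_stdSimp _
  rw [← integral_indicator hSm]
  have hmp := (volume_preserving_piFinSuccAbove (fun _ : Fin (q + 1) => ℝ) j).symm
  rw [← hmp.integral_comp' (g := S.indicator f), Measure.volume_eq_prod, integral_prod_symm]
  · rw [← integral_indicator (measurableSet_stdSimp q)]
    congr 1
    ext s
    have hind : ∀ x : ℝ, S.indicator f ((MeasurableEquiv.piFinSuccAbove (fun _ => ℝ) j).symm (x, s))
        = if s ∈ stdSimp q ∧ x ∈ Icc 0 (1 - ∑ i, s i) then f (j.insertNth x s) else 0 := by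
      intro x
      have e : (MeasurableEquiv.piFinSuccAbove (fun _ => ℝ) j).symm (x, s) = j.insertNth x s := rfl
      rw [e, Set.indicator_apply]
      simp only [hS, insertNth_mem_stdSimp]
    simp only [hind]
    by_cases hs : s ∈ stdSimp q
    · rw [Set.indicator_of_mem hs]
      have h01 : (0 : ℝ) ≤ 1 - ∑ i, s i := by linarith [hs.2]
      have e2 : (fun x : ℝ => if s ∈ stdSimp q ∧ x ∈ Icc 0 (1 - ∑ i, s i) then
          f (j.insertNth x s) else 0) =
          (Icc 0 (1 - ∑ i, s i)).indicator fun x => f (j.insertNth x s) := by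
        ext x; simp [Set.indicator_apply, hs]
      rw [e2, integral_indicator measurableSet_Icc, integral_Icc_eq_integral_Ioc,
        ← intervalIntegral.integral_of_le h01]
      have hmaps : MapsTo (fun x : ℝ => (j.insertNth x s : Fin (q + 1) → ℝ))
          (Icc 0 (1 - ∑ i, s i)) S := fun x hx => (insertNth_mem_stdSimp j x s).2 ⟨hs, hx⟩
      have hcurve : ∀ x : ℝ, HasDerivAt (fun x : ℝ => (j.insertNth x s : Fin (q + 1) → ℝ))
          (single j 1) x := by
        intro x
        rw [hasDerivAt_pi]
        intro i
        refine Fin.succAboveCases j ?_ (fun k => ?_) i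
        · simpa using hasDerivAt_id' x
        · simpa using hasDerivAt_const x (s k)
      have hcc : Continuous (fun x : ℝ => (j.insertNth x s : Fin (q + 1) → ℝ)) :=
        continuous_iff_continuousAt.2 fun x => (hcurve x).continuousAt
      refine intervalIntegral.integral_eq_sub_of_hasDerivAt_of_le
        (f := fun x => a (j.insertNth x s)) h01
        (ha.continuousOn.comp hcc.continuousOn hmaps) (fun x hx => ?_) ?_
      · have h1 := ((ha.differentiableOn one_ne_zero) _
          (hmaps (Ioo_subset_Icc_self hx))).hasFDerivWithinAt
        exact (h1.comp_hasDerivWithinAt x (hcurve x).hasDerivWithinAt hmaps).hasDerivAt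
          (Icc_mem_nhds hx.1 hx.2)
      · refine ContinuousOn.intervalIntegrable ?_
        rw [uIcc_of_le h01]
        exact hfc.comp hcc.continuousOn hmaps
    · rw [Set.indicator_of_notMem hs]
      simp [hs]
  · exact (hmp.integrable_comp_emb (MeasurableEquiv.measurableEmbedding _)).2
      ((integrable_indicator_iff hSm).2 hfi)

/-- Stokes' theorem on the standard simplex. -/
theorem stokes_stdSimp {q : ℕ} (η : (Fin (q + 1) → ℝ) → (Fin (q + 1) → ℝ) [⋀^Fin q]→L[ℝ] ℝ)
    (hη : DifferentiableOn ℝ η (stdSimp (q + 1)))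
    (hη' : ∀ x, ContDiffOn ℝ 1 (fun t => η t x) (stdSimp (q + 1))) : ∫ t in stdSimp (q + 1),
    extDerivWithin η (stdSimp (q + 1)) t (fun i => single i 1) = ∑ k : Fin (q + 2), (-1 : ℝ) ^
    (k : ℕ) * ∫ s in stdSimp q, η (ρ (stdVert (q + 1) ∘ k.succAbove) s)
    (fun i => paramLin (stdVert (q + 1) ∘ k.succAbove) (single i 1)) := by
  set S := stdSimp (q + 1) with hS
  set e : Fin (q + 1) → (Fin (q + 1) → ℝ) := fun i => single i 1 with he
  set a : Fin (q + 1) → (Fin (q + 1) → ℝ) → ℝ := fun j t => η t (e ∘ j.succAbove) with ha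
  have hac : ∀ j, ContDiffOn ℝ 1 (a j) S := fun j => hη' _
  have hfc : ∀ j, ContinuousOn (fun t => fderivWithin ℝ (a j) S t (single j 1)) S := fun j =>
    ((hac j).continuousOn_fderivWithin (uniqueDiffOn_stdSimp _) le_rfl).clm_apply
      continuousOn_const
  have hmapsface : ∀ k : Fin (q + 2), MapsTo (ρ (stdVert (q + 1) ∘ k.succAbove))
      (stdSimp q) S := by
    intro k
    rw [mapsTo_iff_image_subset, simplexParam_image, hS, stdSimp_eq_convexHull (q + 1)]
    exact convexHull_mono (range_comp_subset_range _ _)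
  have hci : ∀ j (k : Fin (q + 2)), IntegrableOn
      (fun s => a j (ρ (stdVert (q + 1) ∘ k.succAbove) s)) (stdSimp q)
      volume := fun j k =>
    ((hac j).continuousOn.comp (continuous_simplexParam _).continuousOn
      (hmapsface k)).integrableOn_compact (isCompact_stdSimp _)
  have h1 : ∫ t in S, extDerivWithin η S t e = ∑ j : Fin (q + 1), (-1 : ℝ) ^ (j : ℕ) *
        ∫ t in S, fderivWithin ℝ (a j) S t (single j 1) := by
    rw [setIntegral_congr_fun (g := fun t => ∑ j : Fin (q + 1),
      (-1 : ℝ) ^ (j : ℕ) * fderivWithin ℝ (a j) S t (single j 1)) (measurableSet_stdSimp _)]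
    · rw [integral_finsetSum]
      · exact sum_congr rfl fun j _ => integral_const_mul _ _
      · exact fun j _ => ((hfc j).integrableOn_compact (isCompact_stdSimp _)).const_mul _
    · intro t ht
      simp only
      rw [extDerivWithin_apply (hη t ht) (uniqueDiffOn_stdSimp _ t ht)]
      exact sum_congr rfl fun j _ => by
        simp [ha, he, Function.comp_def]
        rfl
  have hfaceS : ∀ (j : Fin (q + 1)) (s : Fin q → ℝ),
      ρ (stdVert (q + 1) ∘ j.succ.succAbove) s = j.insertNth 0 s := by
    intro j s
    rw [simplexParam_eq, paramLin_apply]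
    simp only [comp_apply, Fin.succ_succAbove_zero, stdVert_zero, Fin.succ_succAbove_succ,
      stdVert_succ, sub_zero, zero_add]
    ext i
    rw [Finset.sum_apply]
    refine Fin.succAboveCases j ?_ (fun k => ?_) i
    · simp [(Fin.succAbove_ne j _).symm]
    · simp [Pi.single_apply]
  have hface0 : ∀ (j : Fin (q + 1)) (s : Fin q → ℝ),
      ρ (stdVert (q + 1) ∘ (0 : Fin (q + 2)).succAbove)
        (ρ (stdVert q ∘ j.cycleRange.symm) s) = j.insertNth (1 - ∑ i, s i) s := by
    intro j s
    rw [← simplexParam_reindex, simplexParam_eq_sum]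
    ext i
    rw [Finset.sum_apply, sum_univ_succ]
    simp only [comp_apply, Fin.cycleRange_symm_zero, Fin.cycleRange_symm_succ,
      Fin.succAbove_zero, stdVert_succ, baryCoord, Fin.cons_zero, Fin.cons_succ, Pi.smul_apply,
      smul_eq_mul]
    refine Fin.succAboveCases j ?_ (fun k => ?_) i
    · simp [(Fin.succAbove_ne j _).symm]
    · simp [Pi.single_apply, Fin.succAbove_ne j]
  have h2 : ∀ j : Fin (q + 1), ∫ t in S, fderivWithin ℝ (a j) S t (single j 1) =
      (∫ s in stdSimp q, a j (ρ (stdVert (q + 1) ∘ (0 : Fin (q + 2)).succAbove) s)) -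
      ∫ s in stdSimp q, a j (ρ (stdVert (q + 1) ∘ j.succ.succAbove) s) := by
    intro j
    rw [integral_partial_stdSimp j (hac j)]
    rw [← integral_perm j.cycleRange.symm
      (fun s => a j (ρ (stdVert (q + 1) ∘ (0 : Fin (q + 2)).succAbove) s)),
      ← integral_sub]
    · simp only [hface0, hfaceS]
    · have hm : MapsTo (ρ (stdVert q ∘ j.cycleRange.symm)) (stdSimp q) (stdSimp q) := by
        rw [mapsTo_iff_image_subset, simplexParam_image, stdSimp_eq_convexHull q,
          EquivLike.range_comp]
      exact ((hac j).continuousOn.comp ((continuous_simplexParam _).comp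
        (continuous_simplexParam _)).continuousOn
        ((hmapsface 0).comp hm)).integrableOn_compact (isCompact_stdSimp _)
    · exact hci j _
  rw [h1]
  simp only [h2, mul_sub, sum_sub_distrib]
  rw [sum_univ_succ (n := q + 1), sub_eq_add_neg, ← Finset.sum_neg_distrib]
  congr 1
  · simp only [Fin.val_zero, pow_zero, one_mul, paramLin_single, comp_apply,
      Fin.succAbove_zero, stdVert_succ]
    have : ∀ s, η (ρ (stdVert (q + 1) ∘ Fin.succ) s)
        (fun i : Fin q => (single i.succ 1 : Fin (q + 1) → ℝ) - single 0 1) =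
        ∑ j : Fin (q + 1), (-1 : ℝ) ^ (j : ℕ) * a j (ρ (stdVert (q + 1) ∘ Fin.succ) s) :=
      fun s => alternating_sub_eq_sum _ e
    simp only [this]
    rw [integral_finsetSum]
    · exact sum_congr rfl fun j _ => (integral_const_mul _ _).symm
    · exact fun j _ => (by simpa using hci j 0 : IntegrableOn _ _ _).const_mul _
  · refine sum_congr rfl fun j _ => ?_
    simp only [Fin.val_succ, pow_succ, mul_neg, mul_one, neg_mul, paramLin_single,
      comp_apply, Fin.succ_succAbove_zero, stdVert_zero, Fin.succ_succAbove_succ,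
      stdVert_succ, sub_zero]
    rfl

end BaseStokes

section Pullback

lemma contDiffWithinAt_comp_apply {F G : Type*} [NormedAddCommGroup F] [NormedSpace ℝ F]
    [NormedAddCommGroup G] [NormedSpace ℝ G] {q : ℕ} {η : G → F [⋀^Fin q]→L[ℝ] ℝ}
    {A : G → G →L[ℝ] F} {s : Set G} {t : G} {n : WithTop ℕ∞} (hη : ContDiffWithinAt ℝ n η s t)
    (hA : ContDiffWithinAt ℝ n A s t) (x : Fin q → G) :
    ContDiffWithinAt ℝ n (fun t => (η t).compContinuousLinearMap (A t) x) s t := by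
  let T : (F [⋀^Fin q]→L[ℝ] ℝ) →L[ℝ] ContinuousMultilinearMap ℝ (fun _ : Fin q => F) ℝ :=
    ContinuousAlternatingMap.toContinuousMultilinearMapCLM ℝ
  have h0 : ContDiffWithinAt ℝ n (fun t => T (η t)) s t := T.contDiff.comp_contDiffWithinAt hη
  have h1 : ContDiffWithinAt ℝ n (fun t => ((fun _ : Fin q => A t), T (η t))) s t :=
    (contDiffWithinAt_pi.2 fun _ => hA).prodMk h0
  have h2 := (ContinuousMultilinearMap.analyticAt_uncurry_compContinuousLinearMap (𝕜 := ℝ)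
    (Fm := fun _ : Fin q => G) (Em := fun _ : Fin q => F) (G := ℝ)
    (q := ((fun _ : Fin q => A t), T (η t)))).contDiffAt (n := n)
  have h3 := h2.comp_contDiffWithinAt t h1
  exact (ContinuousMultilinearMap.apply ℝ (fun _ : Fin q => G) ℝ x).contDiff.comp_contDiffWithinAt h3

/-- The pullback of a form along a map that is differentiable within `s`. -/
def Form.pull {m q : ℕ} (η : Form E X q) (φ : (Fin m → ℝ) → X) (s : Set (Fin m → ℝ))
    (t : Fin m → ℝ) : (Fin m → ℝ) [⋀^Fin q]→L[ℝ] ℝ :=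
  (η (φ t)).compContinuousLinearMap (mfderivWithin 𝓜 m 𝓘(ℝ, E) φ s t)

variable [IsManifold 𝓘(ℝ, E) ∞ X]

lemma Form.pull_eq_inChart {m q : ℕ} (η : Form E X q) {φ : (Fin m → ℝ) → X} {s : Set (Fin m → ℝ)}
    (hs : UniqueDiffOn ℝ s) (hφ : ContMDiffOn 𝓜 m 𝓘(ℝ, E) ∞ φ s) (x₀ : X) {t : Fin m → ℝ}
    (ht : t ∈ s) (htx : φ t ∈ (chartAt E x₀).source) : η.pull φ s t =
    (η.inChart x₀ (extChartAt 𝓘(ℝ, E) x₀ (φ t))).compContinuousLinearMap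
    (fderivWithin ℝ (extChartAt 𝓘(ℝ, E) x₀ ∘ φ) s t) := by
  have : IsManifold 𝓘(ℝ, E) 1 X := IsManifold.of_le (n := ∞) (by simp)
  have hsrc : φ t ∈ (extChartAt 𝓘(ℝ, E) x₀).source := by rwa [extChartAt_source]
  have hleft : (extChartAt 𝓘(ℝ, E) x₀).symm (extChartAt 𝓘(ℝ, E) x₀ (φ t)) = φ t :=
    (extChartAt 𝓘(ℝ, E) x₀).left_inv hsrc
  have hφd : MDifferentiableWithinAt 𝓜 m 𝓘(ℝ, E) φ s t :=
    (hφ t ht).mdifferentiableWithinAt (by simp)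
  have hχd := mdifferentiableAt_extChartAt (I := 𝓘(ℝ, E)) htx
  have hcomp : MDifferentiableWithinAt 𝓜 m 𝓘(ℝ, E)
      (extChartAt 𝓘(ℝ, E) x₀ ∘ φ) s t := hχd.comp_mdifferentiableWithinAt t hφd
  have htgt : extChartAt 𝓘(ℝ, E) x₀ (φ t) ∈ (extChartAt 𝓘(ℝ, E) x₀).target :=
    (extChartAt 𝓘(ℝ, E) x₀).map_source hsrc
  have hsymm : MDifferentiableAt 𝓘(ℝ, E) 𝓘(ℝ, E) (extChartAt 𝓘(ℝ, E) x₀).symm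
      (extChartAt 𝓘(ℝ, E) x₀ (φ t)) :=
    (((contMDiffOn_extChartAt_symm (n := ∞) x₀) _ htgt).contMDiffAt
      (extChartAt_target_mem_nhds' htgt)).mdifferentiableAt (by simp)
  have hus : UniqueMDiffWithinAt 𝓜 m s t := (hs t ht).uniqueMDiffWithinAt
  have hev : φ =ᶠ[𝓝[s] t]
      ((extChartAt 𝓘(ℝ, E) x₀).symm ∘ (extChartAt 𝓘(ℝ, E) x₀ ∘ φ)) := by
    filter_upwards [hφ.continuousOn.continuousWithinAt ht
      ((isOpen_extChartAt_source (I := 𝓘(ℝ, E)) x₀).mem_nhds hsrc)] with y hy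
    exact ((extChartAt 𝓘(ℝ, E) x₀).left_inv hy).symm
  have hD : mfderivWithin 𝓜 m 𝓘(ℝ, E) φ s t =
      (mfderiv 𝓘(ℝ, E) 𝓘(ℝ, E) (extChartAt 𝓘(ℝ, E) x₀).symm (extChartAt 𝓘(ℝ, E) x₀ (φ t))).comp
        (fderivWithin ℝ (extChartAt 𝓘(ℝ, E) x₀ ∘ φ) s t) := by
    refine (hev.mfderivWithin_eq hleft.symm).trans
      ((mfderiv_comp_mfderivWithin t hsymm hcomp hus).trans ?_)
    rw [mfderivWithin_eq_fderivWithin]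
    rfl
  have key : ∀ (η' : X → E [⋀^Fin q]→L[ℝ] ℝ) (z : X) (L : E →L[ℝ] E)
      (D D' : (Fin m → ℝ) →L[ℝ] E), z = φ t → D = L.comp D' →
      (η' (φ t)).compContinuousLinearMap D =
        ((η' z).compContinuousLinearMap L).compContinuousLinearMap D' := by
    rintro η' z L D D' rfl rfl; rfl
  exact key η _ _ _ _ hleft hD

omit [IsManifold 𝓘(ℝ, E) ∞ X] in
lemma Form.pull_comp {m m' q : ℕ} (η : Form E X q) {φ : (Fin m → ℝ) → X} {s : Set (Fin m → ℝ)}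
    {g : (Fin m' → ℝ) → (Fin m → ℝ)} {s' : Set (Fin m' → ℝ)} {t : Fin m' → ℝ}
    {L : (Fin m' → ℝ) →L[ℝ] (Fin m → ℝ)} (hs' : UniqueDiffWithinAt ℝ s' t) (hg : HasFDerivAt g L t)
    (hφ : MDifferentiableWithinAt 𝓜 m 𝓘(ℝ, E) φ s (g t)) (hmaps : MapsTo g s' s) : η.pull (φ ∘ g) s'
    t = (η.pull φ s (g t)).compContinuousLinearMap L := by
  have h1 := (hφ.hasMFDerivWithinAt.comp t hg.hasMFDerivAt.hasMFDerivWithinAt hmaps).mfderivWithin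
    hs'.uniqueMDiffWithinAt
  unfold Form.pull
  rw [h1]
  rfl

lemma Form.pull_smooth {m q : ℕ} {η : Form E X q} {U : Set X} (hU : IsOpen U) (hη : η.SmoothOn U)
    {φ : (Fin m → ℝ) → X} {s : Set (Fin m → ℝ)} (hs : UniqueDiffOn ℝ s)
    (hφ : ContMDiffOn 𝓜 m 𝓘(ℝ, E) ∞ φ s) (hmaps : MapsTo φ s U) {t : Fin m → ℝ} (ht : t ∈ s) :
    DifferentiableWithinAt ℝ (η.pull φ s) s t ∧
    (∀ x, ContDiffWithinAt ℝ 1 (fun t => η.pull φ s t x) s t) ∧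
    (t ∈ closure (interior s) → extDerivWithin (η.pull φ s) s t = η.d.pull φ s t) := by
  set x₀ := φ t with hx₀
  set χ := extChartAt 𝓘(ℝ, E) x₀ with hχ
  set ψ := χ ∘ φ with hψ
  have hsrc : φ t ∈ (chartAt E x₀).source := mem_chart_source E x₀
  have hψs : ContDiffWithinAt ℝ ∞ ψ s t := by
    have := (contMDiffAt_extChartAt (I := 𝓘(ℝ, E)) (n := ∞) (x := x₀)).comp_contMDiffWithinAt t
      (hφ t ht)
    exact this.contDiffWithinAt
  have hev : η.pull φ s =ᶠ[𝓝[s] t] fun t => (η.inChart x₀ (ψ t)).compContinuousLinearMap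
      (fderivWithin ℝ ψ s t) := by
    filter_upwards [hφ.continuousOn.continuousWithinAt ht
      ((chartAt E x₀).open_source.mem_nhds hsrc), self_mem_nhdsWithin] with y hy hys
    exact η.pull_eq_inChart hs hφ x₀ hys hy
  have hO : IsOpen (χ.target ∩ χ.symm ⁻¹' U) :=
    (continuousOn_extChartAt_symm x₀).isOpen_inter_preimage (isOpen_extChartAt_target x₀) hU
  have hmem : ψ t ∈ χ.target ∩ χ.symm ⁻¹' U := by
    refine ⟨mem_extChartAt_target x₀, ?_⟩
    have : χ.symm (ψ t) = x₀ := extChartAt_to_inv x₀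
    rw [mem_preimage, this]
    exact hmaps ht
  have hηs : ContDiffAt ℝ ∞ (η.inChart x₀) (ψ t) := (hη x₀).contDiffAt (hO.mem_nhds hmem)
  have hηψ : ContDiffWithinAt ℝ ∞ (fun t => η.inChart x₀ (ψ t)) s t :=
    hηs.comp_contDiffWithinAt t hψs
  have hDψ : ContDiffWithinAt ℝ ∞ (fderivWithin ℝ ψ s) s t := hψs.fderivWithin_right hs (by simp) ht
  refine ⟨?_, fun x => ?_, fun hcl => ?_⟩
  · refine DifferentiableWithinAt.congr_of_eventuallyEq ?_ hev (hev.self_of_nhdsWithin ht)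
    exact ((hηψ.differentiableWithinAt (by simp)).hasFDerivWithinAt
      |>.continuousAlternatingMapCompContinuousLinearMap
      (hDψ.differentiableWithinAt (by simp)).hasFDerivWithinAt).differentiableWithinAt
  · have h1 := contDiffWithinAt_comp_apply (n := 1) (hηψ.of_le (by simp)) (hDψ.of_le (by simp)) x
    refine h1.congr_of_eventuallyEq ?_ ?_
    · filter_upwards [hev] with y hy
      rw [hy]
    · rw [hev.self_of_nhdsWithin ht]
  · rw [hev.extDerivWithin_eq_of_mem ht]
    rw [extDerivWithin_pullback (t := univ) (r := ∞)
      (hηs.differentiableAt (by simp)).differentiableWithinAt hψs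
      (by rw [minSmoothness_of_isRCLikeNormedField]; exact WithTop.coe_le_coe.2 le_top) hs hcl ht
      (mapsTo_univ _ _), extDerivWithin_univ]
    have hφd : MDifferentiableWithinAt 𝓜 m 𝓘(ℝ, E) φ s t :=
      (hφ t ht).mdifferentiableWithinAt (by simp)
    have hD : mfderivWithin 𝓜 m 𝓘(ℝ, E) φ s t = fderivWithin ℝ ψ s t := by
      rw [hφd.mfderivWithin]
      simp only [mfld_simps]
      rfl
    unfold Form.pull Form.d
    rw [hD]
    rfl

end Pullback

section SimplexIntegral

lemma simplexIntegral_eq {p : ℕ} (f : V → X) (v : Fin (p + 1) → V) (η : Form E X p) :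
    simplexIntegral f v η = ∫ t in stdSimp p,
      η.pull (f ∘ ρ v) (stdSimp p) t (fun i => single i 1) := rfl

/-- `f` is smooth on the closed simplex spanned by `v`. -/
def SmoothOnSimplex {p : ℕ} (f : V → X) (v : Fin (p + 1) → V) : Prop :=
  ContMDiffOn 𝓜 p 𝓘(ℝ, E) ∞ (f ∘ ρ v) (stdSimp p)

lemma mapsTo_simplexParam_comp {m p : ℕ} (w : Fin (m + 1) → Fin p → ℝ)
    (hw : ∀ i, w i ∈ stdSimp p) : MapsTo (ρ w) (stdSimp m) (stdSimp p) := by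
  rw [mapsTo_iff_image_subset, simplexParam_image]
  exact convexHull_min (range_subset_iff.2 hw) (convex_stdSimp p)

lemma SmoothOnSimplex.comp {m p : ℕ} {f : V → X} {v : Fin (p + 1) → V}
    (h : SmoothOnSimplex (E := E) f v) (w : Fin (m + 1) → Fin p → ℝ)
    (hw : ∀ i, w i ∈ stdSimp p) : SmoothOnSimplex (E := E) f (ρ v ∘ w) := by
  unfold SmoothOnSimplex at *
  have e : f ∘ ρ (ρ v ∘ w) = (f ∘ ρ v) ∘ ρ w := by
    ext t; simp only [comp_apply, simplexParam_comp]; rfl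
  rw [e]
  exact ContMDiffOn.comp h (contDiff_simplexParam w).contMDiff.contMDiffOn
    (mapsTo_simplexParam_comp w hw)

lemma pull_simplexParam_comp {m p q : ℕ} {f : V → X} {v : Fin (p + 1) → V}
    (h : SmoothOnSimplex (E := E) f v) (w : Fin (m + 1) → Fin p → ℝ)
    (hw : ∀ i, w i ∈ stdSimp p) (η : Form E X q) {t : Fin m → ℝ} (ht : t ∈ stdSimp m) :
    η.pull (f ∘ ρ (ρ v ∘ w)) (stdSimp m) t =
      (η.pull (f ∘ ρ v) (stdSimp p) (ρ w t)).compContinuousLinearMap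
        (paramLin w) := by
  have e : f ∘ ρ (ρ v ∘ w) = (f ∘ ρ v) ∘ ρ w := by
    ext t; simp only [comp_apply, simplexParam_comp]; rfl
  rw [e]
  exact η.pull_comp (uniqueDiffOn_stdSimp _ t ht) (hasFDerivAt_simplexParam w t)
    ((h _ (mapsTo_simplexParam_comp w hw ht)).mdifferentiableWithinAt (by simp))
    (mapsTo_simplexParam_comp w hw)

lemma simplexParam_comp_stdVert {m p : ℕ} (v : Fin (p + 1) → V) (f : Fin m → Fin (p + 1)) :
    ρ v ∘ (stdVert p ∘ f) = v ∘ f := by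
  ext i; simp [simplexParam_stdVert]

lemma simplexIntegral_comp {m p : ℕ} {f : V → X} {v : Fin (p + 1) → V}
    (h : SmoothOnSimplex (E := E) f v) (w : Fin (m + 1) → Fin p → ℝ)
    (hw : ∀ i, w i ∈ stdSimp p) (η : Form E X m) :
    simplexIntegral f (ρ v ∘ w) η = ∫ t in stdSimp m, η.pull (f ∘ ρ v) (stdSimp p) (ρ w t)
        (fun i => paramLin w (single i 1)) := by
  rw [simplexIntegral_eq]
  refine setIntegral_congr_fun (measurableSet_stdSimp m) fun t ht => ?_
  rw [pull_simplexParam_comp h w hw η ht]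
  rfl

lemma simplexIntegral_congr {p : ℕ} {f g : V → X} {v : Fin (p + 1) → V} (η : Form E X p)
    (hfg : ∀ t ∈ stdSimp p, f (ρ v t) = g (ρ v t)) : simplexIntegral f v η = simplexIntegral g v η
    := by
  rw [simplexIntegral_eq, simplexIntegral_eq]
  refine setIntegral_congr_fun (measurableSet_stdSimp p) fun t ht => ?_
  have h1 : mfderivWithin 𝓜 p 𝓘(ℝ, E) (f ∘ ρ v) (stdSimp p) t =
      mfderivWithin 𝓜 p 𝓘(ℝ, E) (g ∘ ρ v) (stdSimp p) t :=
    mfderivWithin_congr (fun t ht => hfg t ht) (hfg t ht)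
  have key : ∀ (η' : X → E [⋀^Fin p]→L[ℝ] ℝ) (a b : X) (D D' : (Fin p → ℝ) →L[ℝ] E), a = b →
      D = D' → (η' a).compContinuousLinearMap D (fun i => single i 1) =
        (η' b).compContinuousLinearMap D' (fun i => single i 1) := by
    rintro η' a b D D' rfl rfl; rfl
  exact key η _ _ _ _ (hfg t ht) h1

lemma simplexIntegral_congr_form {p : ℕ} {f : V → X} {v : Fin (p + 1) → V} {η θ : Form E X p}
    (h : ∀ t ∈ stdSimp p, η (f (ρ v t)) = θ (f (ρ v t))) : simplexIntegral f v η = simplexIntegral f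
    v θ :=
  setIntegral_congr_fun (measurableSet_stdSimp p) fun t ht => by
    simp only [h t ht]

lemma simplexIntegral_eq_zero {p : ℕ} {f : V → X} {v : Fin (p + 1) → V} {η : Form E X p}
    (h : ∀ t ∈ stdSimp p, η (f (ρ v t)) = 0) : simplexIntegral f v η = 0 := by
  rw [simplexIntegral, setIntegral_congr_fun (g := fun _ => (0 : ℝ)) (measurableSet_stdSimp p)]
  · simp
  · intro t ht
    simp only [h t ht]
    rfl

lemma simplexIntegral_neg {p : ℕ} (f : V → X) (v : Fin (p + 1) → V) (η : Form E X p) :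
    simplexIntegral f v (fun x => -η x) = -simplexIntegral f v η := by
  unfold simplexIntegral
  rw [← integral_neg]
  rfl

section

variable [IsManifold 𝓘(ℝ, E) ∞ X]

lemma continuousOn_pull {p : ℕ} {f : V → X} {v : Fin (p + 1) → V}
    (h : SmoothOnSimplex (E := E) f v) {U : Set X} (hU : IsOpen U)
    (hmaps : MapsTo (f ∘ ρ v) (stdSimp p) U) {q : ℕ} {η : Form E X q}
    (hη : η.SmoothOn U) (x : Fin q → Fin p → ℝ) :
    ContinuousOn (fun t => η.pull (f ∘ ρ v) (stdSimp p) t x) (stdSimp p) := fun _ ht =>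
  ((Form.pull_smooth hU hη (uniqueDiffOn_stdSimp p) h hmaps ht).2.1 x).continuousWithinAt

lemma simplexIntegral_sub {p : ℕ} {f : V → X} {v : Fin (p + 1) → V}
    (h : SmoothOnSimplex (E := E) f v) {U : Set X} (hU : IsOpen U)
    (hmaps : MapsTo (f ∘ ρ v) (stdSimp p) U) {η θ : Form E X p}
    (hη : η.SmoothOn U) (hθ : θ.SmoothOn U) :
    simplexIntegral f v (fun x => η x - θ x) = simplexIntegral f v η - simplexIntegral f v θ := by
  simp only [simplexIntegral_eq]
  rw [← integral_sub]
  · rfl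
  · exact (continuousOn_pull h hU hmaps hη _).integrableOn_compact (isCompact_stdSimp p)
  · exact (continuousOn_pull h hU hmaps hθ _).integrableOn_compact (isCompact_stdSimp p)

/-- Stokes' theorem for a smooth singular simplex. -/
theorem simplexIntegral_d {q : ℕ} {f : V → X} {v : Fin (q + 2) → V}
    (h : SmoothOnSimplex (E := E) f v) {U : Set X} (hU : IsOpen U)
    (hmaps : MapsTo (f ∘ ρ v) (stdSimp (q + 1)) U) {η : Form E X q}
    (hη : η.SmoothOn U) :
    simplexIntegral f v η.d =
      ∑ k : Fin (q + 2), (-1 : ℝ) ^ (k : ℕ) * simplexIntegral f (v ∘ k.succAbove) η := by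
  have hp := fun t ht => Form.pull_smooth hU hη (uniqueDiffOn_stdSimp (q + 1)) h hmaps (t := t) ht
  have h1 := stokes_stdSimp (η.pull (f ∘ ρ v) (stdSimp (q + 1)))
    (fun t ht => (hp t ht).1) (fun x t ht => (hp t ht).2.1 x)
  have h2 : simplexIntegral f v η.d = ∫ t in stdSimp (q + 1),
      extDerivWithin (η.pull (f ∘ ρ v) (stdSimp (q + 1))) (stdSimp (q + 1)) t
        (fun i => single i 1) := by
    rw [simplexIntegral_eq]
    refine setIntegral_congr_fun (measurableSet_stdSimp _) fun t ht => ?_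
    rw [(hp t ht).2.2 (mem_closure_interior_stdSimp ht)]
  rw [h2, h1]
  refine sum_congr rfl fun k _ => ?_
  congr 1
  rw [← simplexParam_comp_stdVert v k.succAbove, simplexIntegral_comp h _ fun i => ?_]
  rw [stdSimp_eq_convexHull]
  exact subset_convexHull ℝ _ ⟨_, rfl⟩

end

end SimplexIntegral

section BaryDet

/-- The determinant of the barycentric coordinates of `p + 1` points of `ℝᵖ`. -/
def baryDet {p : ℕ} (b : Fin (p + 1) → Fin p → ℝ) : ℝ := (Matrix.of fun i => baryCoord (b i)).det

lemma baryDet_perm {p : ℕ} (b : Fin (p + 1) → Fin p → ℝ) (π : Perm (Fin (p + 1))) :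
    baryDet (b ∘ π) = ((Perm.sign π : ℤ) : ℝ) * baryDet b :=
  Matrix.det_permute π (Matrix.of fun i => baryCoord (b i))

lemma det_paramLin {p : ℕ} (b : Fin (p + 1) → Fin p → ℝ) : (paramLin b).det = baryDet b := by
  classical
  set N : Matrix (Fin (p + 1)) (Fin (p + 1)) ℝ :=
    Matrix.of fun i => if i = 0 then baryCoord (b 0) else baryCoord (b i) - baryCoord (b 0) with hN
  set C : Matrix (Fin (p + 1)) (Fin (p + 1)) ℝ :=
    Matrix.of fun i j => if j = 0 then 1 else if i = j then 1 else 0 with hC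
  have hNdet : baryDet b = N.det := by
    refine Matrix.det_eq_of_forall_row_eq_smul_add_const (fun i => if i = 0 then 0 else 1) 0
      (by simp) fun i j => ?_
    by_cases hi : i = 0
    · subst hi; simp [hN]
    · simp [hN, hi]
  have hCdet : C.det = 1 := by
    rw [Matrix.det_of_isLowerTriangular]
    · exact Finset.prod_eq_one fun i _ => by simp [hC]
    · intro i j hij
      have h1 : i < j := hij
      have h2 : j ≠ 0 := fun h => by subst h; exact absurd h1 (Fin.not_lt_zero _)
      simp [hC, h2, h1.ne]
  have h0 : ∀ i, (N * C) i 0 = if i = 0 then 1 else 0 := by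
    intro i
    have : (N * C) i 0 = ∑ j, N i j := by simp [Matrix.mul_apply, hC]
    rw [this]
    by_cases hi : i = 0
    · subst hi; simp [hN, sum_baryCoord]
    · simp [hN, hi, sum_baryCoord]
  have hs : ∀ i k : Fin p, (N * C) i.succ k.succ = (b i.succ - b 0) k := by
    intro i k
    rw [Matrix.mul_apply, sum_eq_single k.succ]
    · simp [hN, hC, baryCoord]
    · intro j _ hj
      simp [hC, hj]
    · simp
  have hdet : (N * C).det = ((N * C).submatrix Fin.succ Fin.succ).det := by
    rw [Matrix.det_succ_column_zero, sum_eq_single 0]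
    · simp [h0]
    · intro i _ hi
      simp [h0, hi]
    · simp
  rw [hNdet, ← mul_one N.det, ← hCdet, ← Matrix.det_mul, hdet, ← Matrix.det_transpose]
  change LinearMap.det (paramLin b : (Fin p → ℝ) →ₗ[ℝ] (Fin p → ℝ)) = _
  rw [← LinearMap.det_toMatrix']
  congr 1
  ext k i
  rw [LinearMap.toMatrix'_apply, Matrix.transpose_apply, Matrix.submatrix_apply, hs]
  exact congrFun (paramLin_single b i) k

lemma baryDet_stdVert (p : ℕ) : baryDet (stdVert p) = 1 := by
  rw [← det_paramLin]
  have : paramLin (stdVert p) = ContinuousLinearMap.id ℝ _ := by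
    ext t j
    simp [paramLin_apply, Pi.single_apply]
  rw [this]
  exact LinearMap.det_id

lemma alternating_comp_eq_det {p : ℕ} (α : (Fin p → ℝ) [⋀^Fin p]→L[ℝ] ℝ)
    (L : (Fin p → ℝ) →L[ℝ] (Fin p → ℝ)) : α (fun i => L (single i 1)) = L.det * α
    (fun i => single i 1) := by
  have h1 := AlternatingMap.eq_smul_basis_det (Pi.basisFun ℝ (Fin p)) α.toAlternatingMap
  have h2 := congrArg (fun f : (Fin p → ℝ) [⋀^Fin p]→ₗ[ℝ] ℝ => f (fun i => L (single i 1))) h1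
  have h3 := Module.Basis.det_comp (Pi.basisFun ℝ (Fin p)) (L : (Fin p → ℝ) →ₗ[ℝ] (Fin p → ℝ))
    (Pi.basisFun ℝ (Fin p))
  rw [Module.Basis.det_self, mul_one] at h3
  have h4 : (fun i => L (single i 1)) =
      (L : (Fin p → ℝ) →ₗ[ℝ] (Fin p → ℝ)) ∘ (Pi.basisFun ℝ (Fin p)) := by
    ext i j; simp
  simp only [AlternatingMap.smul_apply, smul_eq_mul] at h2
  rw [h4] at h2 ⊢
  rw [h3] at h2
  have h5 : (⇑(Pi.basisFun ℝ (Fin p)) : Fin p → Fin p → ℝ) = fun i => single i 1 := by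
    ext i j; simp
  rw [h5] at h2 ⊢
  rw [mul_comm]
  exact h2

end BaryDet

section Reparam

lemma injective_simplexParam_of_det {p : ℕ} {b : Fin (p + 1) → Fin p → ℝ}
    (hb : (paramLin b).det ≠ 0) : Injective (ρ b) := by
  intro s t h
  rw [simplexParam_eq, simplexParam_eq, add_right_inj] at h
  have hu : IsUnit (LinearMap.det (paramLin b : (Fin p → ℝ) →ₗ[ℝ] (Fin p → ℝ))) :=
    isUnit_iff_ne_zero.2 hb
  exact (LinearEquiv.ofIsUnitDet (v := Pi.basisFun ℝ (Fin p)) (v' := Pi.basisFun ℝ (Fin p))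
    (f := (paramLin b : (Fin p → ℝ) →ₗ[ℝ] (Fin p → ℝ)))
    (by rwa [LinearMap.det_toMatrix])).injective h

/-- The integral over a simplex inside of the simplex `v`, in the coordinates of `v`. -/
lemma simplexIntegral_comp_eq {p : ℕ} {f : V → X} {v : Fin (p + 1) → V}
    (h : SmoothOnSimplex (E := E) f v) (b : Fin (p + 1) → Fin p → ℝ)
    (hb : ∀ i, b i ∈ stdSimp p) (η : Form E X p) :
    simplexIntegral f (ρ v ∘ b) η = (sign (baryDet b) : ℝ) * ∫ t in convexHull ℝ (range b),
        η.pull (f ∘ ρ v) (stdSimp p) t (fun i => single i 1) := by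
  rw [simplexIntegral_comp h b hb]
  simp only [alternating_comp_eq_det]
  rw [integral_const_mul, ← det_paramLin]
  by_cases h0 : (paramLin b).det = 0
  · simp [h0]
  rw [← simplexParam_image, integral_image_eq_integral_abs_det_fderiv_smul _
    (measurableSet_stdSimp p) (fun t _ => (hasFDerivAt_simplexParam b t).hasFDerivWithinAt)
    (injective_simplexParam_of_det h0).injOn]
  simp only [smul_eq_mul]
  rw [integral_const_mul, ← mul_assoc]
  congr 1
  rcases lt_or_gt_of_ne h0 with h | h
  · simp [sign_neg h, abs_of_neg h]
  · simp [sign_pos h, abs_of_pos h]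

lemma simplexIntegral_perm {p : ℕ} {f : V → X} {v : Fin (p + 1) → V}
    (h : SmoothOnSimplex (E := E) f v) (π : Perm (Fin (p + 1))) (η : Form E X p) :
    simplexIntegral f (v ∘ π) η = ((Perm.sign π : ℤ) : ℝ) * simplexIntegral f v η := by
  rw [← simplexParam_comp_stdVert v π, simplexIntegral_comp_eq h _ fun i => ?_, baryDet_perm,
    baryDet_stdVert, EquivLike.range_comp, ← stdSimp_eq_convexHull, simplexIntegral_eq]
  · congr 1
    rcases Int.units_eq_one_or (Perm.sign π) with h | h <;> simp [h]
  · rw [stdSimp_eq_convexHull]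
    exact subset_convexHull ℝ _ ⟨_, rfl⟩

end Reparam

section Edge

lemma mem_stdSimp_one {s : ℝ} : (fun _ : Fin 1 => s) ∈ stdSimp 1 ↔ s ∈ Icc (0 : ℝ) 1 := by
  simp [stdSimp, mem_Icc]

lemma integral_stdSimp_one (a : (Fin 1 → ℝ) → ℝ) :
    ∫ t in stdSimp 1, a t = ∫ s in (0 : ℝ)..1, a fun _ => s := by
  rw [intervalIntegral.integral_of_le zero_le_one, ← integral_Icc_eq_integral_Ioc]
  have h0 := (volume_preserving_funUnique (Fin 1) ℝ).symm.setIntegral_preimage_emb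
      (MeasurableEquiv.measurableEmbedding _) a (stdSimp 1)
  have h1 : (MeasurableEquiv.funUnique (Fin 1) ℝ).symm ⁻¹' stdSimp 1 = Icc 0 1 := by
    ext s; exact mem_stdSimp_one
  rw [h1] at h0
  exact h0.symm

/-- A function with logarithmic derivative `√-1 θ` changes along a path by the exponential of
`√-1` times the integral of `θ`. -/
lemma eq_mul_exp_simplexIntegral {f : V → X} {w : Fin 2 → V}
    (h : SmoothOnSimplex (E := E) f w) {U : Set X} (hmaps : MapsTo (f ∘ ρ w) (stdSimp 1) U)
    {g : X → ℂ} (hg : ∀ x ∈ U, MDifferentiableAt 𝓘(ℝ, E) 𝓘(ℝ, ℂ) g x) {θ : Form E X 1}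
    (hθ : ContinuousOn (fun t => θ.pull (f ∘ ρ w) (stdSimp 1) t (fun i => single i 1)) (stdSimp 1))
    (hgθ : ∀ x ∈ U, ∀ v : TangentSpace 𝓘(ℝ, E) x,
      (mfderiv 𝓘(ℝ, E) 𝓘(ℝ, ℂ) g x v : ℂ) = Complex.I * g x * ((θ x (fun _ => v) : ℝ) : ℂ)) :
    g (f (w 1)) = g (f (w 0)) * Complex.exp (Complex.I * (simplexIntegral f w θ : ℝ)) := by
  set φ := f ∘ ρ w with hφ
  set a : ℝ → ℝ := fun s => θ.pull φ (stdSimp 1) (fun _ => s) (fun i => single i 1) with ha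
  have hline : Continuous fun s : ℝ => (fun _ : Fin 1 => s) := by fun_prop
  have hac : ContinuousOn a (Icc 0 1) := hθ.comp hline.continuousOn fun s hs => mem_stdSimp_one.2 hs
  set A : ℝ → ℝ := fun s => ∫ x in (0 : ℝ)..s, a x with hA
  have hint : simplexIntegral f w θ = A 1 := by
    rw [simplexIntegral_eq, integral_stdSimp_one]
  have hAd : ∀ s ∈ Icc (0 : ℝ) 1, HasDerivWithinAt A (a s) (Icc 0 1) s := by
    intro s hs
    have hint : IntervalIntegrable a volume 0 s := by
      refine ContinuousOn.intervalIntegrable ?_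
      rw [uIcc_of_le hs.1]
      exact hac.mono (Icc_subset_Icc_right hs.2)
    have : Fact (s ∈ Icc (0 : ℝ) 1) := ⟨hs⟩
    exact intervalIntegral.integral_hasDerivWithinAt_right hint
      (hac.stronglyMeasurableAtFilter_nhdsWithin measurableSet_Icc s) (hac s hs)
  have hGd : ∀ s ∈ Icc (0 : ℝ) 1, HasDerivWithinAt (fun s => g (φ fun _ => s))
      (Complex.I * g (φ fun _ => s) * (a s : ℂ)) (Icc 0 1) s := by
    intro s hs
    have hs' := mem_stdSimp_one.2 hs
    have h1 : HasMFDerivWithinAt 𝓜 1 𝓘(ℝ, ℂ) (g ∘ φ) (stdSimp 1) (fun _ => s) _ :=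
      (hg _ (hmaps hs')).hasMFDerivAt.comp_hasMFDerivWithinAt _
        ((h _ hs').mdifferentiableWithinAt (by simp)).hasMFDerivWithinAt
    have h2 := (hasMFDerivWithinAt_iff_hasFDerivWithinAt.1 h1)
    have h3 : HasDerivAt (fun s : ℝ => (fun _ : Fin 1 => s)) (fun _ => 1) s :=
      hasDerivAt_pi.2 fun _ => hasDerivAt_id' s
    have h4 := h2.comp_hasDerivWithinAt s h3.hasDerivWithinAt
      (fun s hs => mem_stdSimp_one.2 hs : MapsTo _ (Icc (0 : ℝ) 1) (stdSimp 1))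
    have h5 := hgθ _ (hmaps hs') (mfderivWithin 𝓜 1 𝓘(ℝ, E) φ (stdSimp 1)
      (fun _ => s) (fun _ : Fin 1 => (1 : ℝ)))
    have h6 : a s = θ (φ fun _ => s) (fun _ => mfderivWithin 𝓜 1 𝓘(ℝ, E) φ (stdSimp 1)
      (fun _ => s) (fun _ : Fin 1 => (1 : ℝ))) := by
      have : (fun i : Fin 1 => (single i 1 : Fin 1 → ℝ)) = fun _ => fun _ => 1 := by
        ext i j; simp [Subsingleton.elim j i]
      simp only [ha, this]
      rfl
    rw [h6]
    exact h4.congr_deriv h5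
  have hconst : ∀ s ∈ Icc (0 : ℝ) 1, HasDerivWithinAt
      (fun s => g (φ fun _ => s) * Complex.exp (-(Complex.I * (A s : ℝ)))) 0 (Icc 0 1) s := by
    intro s hs
    have h1 : HasDerivWithinAt (fun s => Complex.exp (-(Complex.I * (A s : ℝ))))
        (Complex.exp (-(Complex.I * (A s : ℝ))) * (-(Complex.I * (a s : ℝ)))) (Icc 0 1) s :=
      (((hAd s hs).ofReal_comp).const_mul Complex.I).neg.cexp
    refine ((hGd s hs).mul h1).congr_deriv ?_
    ring
  have hfin := (convex_Icc (0 : ℝ) 1).norm_image_sub_le_of_norm_hasDerivWithin_le (C := 0)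
    hconst (by simp) (left_mem_Icc.2 zero_le_one) (right_mem_Icc.2 zero_le_one)
  rw [zero_mul, norm_le_zero_iff, sub_eq_zero] at hfin
  have hv0 : φ (fun _ => 0) = f (w 0) := by
    have : (fun _ : Fin 1 => (0 : ℝ)) = stdVert 1 0 := rfl
    rw [hφ, comp_apply, this, simplexParam_stdVert]
  have hv1 : φ (fun _ => 1) = f (w 1) := by
    have : (fun _ : Fin 1 => (1 : ℝ)) = stdVert 1 1 := by
      ext i; fin_cases i; rfl
    rw [hφ, comp_apply, this, simplexParam_stdVert]
  simp only [hv0, hv1] at hfin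
  have hA0 : A 0 = 0 := intervalIntegral.integral_same
  rw [hA0] at hfin
  simp only [Complex.ofReal_zero, mul_zero, neg_zero, Complex.exp_zero, mul_one] at hfin
  rw [hint, ← hfin, mul_assoc, ← Complex.exp_add]
  simp

end Edge

section Tuples

open scoped Classical in
/-- The `m`-tuples of elements of `T`. -/
abbrev tup {V : Type*} (T : Finset V) (m : ℕ) : Finset (Fin m → V) := Fintype.piFinset fun _ => T

variable {A : Type*} [AddCommMonoid A]

lemma mem_tup {T : Finset V} {m : ℕ} {v : Fin m → V} : v ∈ tup T m ↔ ∀ i, v i ∈ T := by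
  classical
  exact Fintype.mem_piFinset

lemma sum_tup_succ (T : Finset V) {m : ℕ} (F : (Fin (m + 1) → V) → A) :
    ∑ v ∈ tup T (m + 1), F v = ∑ w ∈ tup T m, ∑ x ∈ T, F (cons x w) := by
  classical
  rw [sum_comm, ← Finset.sum_product']
  refine Finset.sum_bij' (fun v _ => (v 0, tail v)) (fun p _ => cons p.1 p.2)
    ?_ ?_ ?_ ?_ ?_
  · intro v hv
    rw [mem_tup] at hv
    exact Finset.mem_product.2 ⟨hv 0, mem_tup.2 fun i => hv i.succ⟩
  · intro p hp
    obtain ⟨h1, h2⟩ := Finset.mem_product.1 hp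
    rw [mem_tup] at h2 ⊢
    exact fun i => Fin.cases h1 h2 i
  · intro v _; exact Fin.cons_self_tail v
  · intro p _; simp
  · intro v _; simp

lemma sum_tup_perm (T : Finset V) {m : ℕ} (π : Perm (Fin m)) (F : (Fin m → V) → A) :
    ∑ v ∈ tup T m, F (v ∘ π) = ∑ v ∈ tup T m, F v := by
  refine Finset.sum_bij' (fun v _ => v ∘ π) (fun v _ => v ∘ π.symm) ?_ ?_ ?_ ?_ ?_
  · intro v hv; rw [mem_tup] at hv ⊢; exact fun i => hv _
  · intro v hv; rw [mem_tup] at hv ⊢; exact fun i => hv _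
  · intro v _; ext i; simp
  · intro v _; ext i; simp
  · intro v _; rfl

end Tuples

section Ordered

/-- The simplex spanned by a tuple. -/
abbrev hull {m : ℕ} (v : Fin m → V) : Set V := convexHull ℝ (range v)

lemma convexHull_vertexSet {m : ℕ} (v : Fin m → V) :
    convexHull ℝ ((vertexSet v : Finset V) : Set V) = hull v := by rw [range_vertexSet]

lemma mem_vertexSet {m : ℕ} {v : Fin m → V} {x : V} : x ∈ vertexSet v ↔ ∃ i, v i = x := by
  rw [← Finset.mem_coe, range_vertexSet]; rfl

lemma vertexSet_comp_subset {m k : ℕ} (v : Fin m → V) (f : Fin k → Fin m) :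
    vertexSet (v ∘ f) ⊆ vertexSet v := by
  intro x hx
  rw [mem_vertexSet] at hx ⊢
  obtain ⟨i, rfl⟩ := hx
  exact ⟨f i, rfl⟩

lemma vertexSet_comp_perm {m : ℕ} (v : Fin m → V) (π : Perm (Fin m)) :
    vertexSet (v ∘ π) = vertexSet v := by
  apply Finset.coe_injective
  rw [range_vertexSet, range_vertexSet, EquivLike.range_comp]

lemma card_vertexSet {m : ℕ} {v : Fin m → V} (hv : Injective v) : (vertexSet v).card = m := by
  classical
  have : vertexSet v = Finset.univ.image v := by
    ext x; simp [mem_vertexSet]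
  rw [this, Finset.card_image_of_injective _ hv, Finset.card_univ, Fintype.card_fin]

lemma vertexSet_cons {m : ℕ} (x : V) (w : Fin m → V) [DecidableEq V] :
    vertexSet (cons x w : Fin (m + 1) → V) = insert x (vertexSet w) := by
  ext y
  rw [mem_vertexSet, Finset.mem_insert, mem_vertexSet, Fin.exists_fin_succ]
  simp [eq_comm]

lemma exists_ordering {s : Finset V} {m : ℕ} (h : s.card = m) :
    ∃ v : Fin m → V, Injective v ∧ vertexSet v = s := by
  subst h
  refine ⟨fun i => (s.equivFin.symm i : V), fun i j hij => ?_, ?_⟩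
  · exact s.equivFin.symm.injective (Subtype.ext hij)
  · ext x
    rw [mem_vertexSet]
    constructor
    · rintro ⟨i, rfl⟩; exact (s.equivFin.symm i).2
    · intro hx; exact ⟨s.equivFin ⟨x, hx⟩, by simp⟩

lemma exists_ordering_of_mem {s : Finset V} (hs : s ∈ K.faces) :
    ∃ p, s.card = p + 1 ∧ ∃ v : Fin (p + 1) → V, Injective v ∧ vertexSet v = s :=
  have h : s.card = s.card - 1 + 1 := by have := (K.nonempty_of_mem_faces hs).card_pos; omega
  ⟨_, h, exists_ordering h⟩

lemma exists_perm_of_vertexSet_eq {m : ℕ} {v w : Fin m → V} (hv : Injective v) (hw : Injective w)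
    (h : vertexSet v = vertexSet w) : ∃ π : Perm (Fin m), v = w ∘ π := by
  have hr : range v = range w := by rw [← range_vertexSet, h, range_vertexSet]
  refine ⟨(Equiv.ofInjective v hv).trans ((Equiv.setCongr hr).trans (Equiv.ofInjective w hw).symm),
    ?_⟩
  ext i
  have := Equiv.apply_ofInjective_symm hw (Equiv.setCongr hr (Equiv.ofInjective v hv i))
  simp only [comp_apply, Equiv.trans_apply, this]
  rfl

open scoped Classical in
lemma card_orderings {T s : Finset V} {m : ℕ} (hs : s ⊆ T) (h : s.card = m) :
    {v ∈ tup T m | Injective v ∧ vertexSet v = s}.card = m.factorial := by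
  obtain ⟨v₀, hv₀, rfl⟩ := exists_ordering h
  rw [show m.factorial = (Finset.univ : Finset (Perm (Fin m))).card by
    rw [Finset.card_univ, Fintype.card_perm, Fintype.card_fin]]
  symm
  refine Finset.card_bij (fun π _ => v₀ ∘ π) ?_ ?_ ?_
  · intro π _
    rw [Finset.mem_filter, mem_tup]
    exact ⟨fun i => hs (mem_vertexSet.2 ⟨_, rfl⟩), hv₀.comp π.injective, vertexSet_comp_perm _ _⟩
  · intro π _ π' _ hh
    ext i
    have := congrFun hh i
    exact congrArg Fin.val (hv₀ this)
  · intro v hv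
    obtain ⟨-, hv1, hv2⟩ := Finset.mem_filter.1 hv
    obtain ⟨π, rfl⟩ := exists_perm_of_vertexSet_eq hv1 hv₀ hv2
    exact ⟨π, Finset.mem_univ _, rfl⟩

lemma orderedSimplices_comp_perm {p : ℕ} {v : Fin (p + 1) → V} (π : Perm (Fin (p + 1)))
    (hv : v ∈ ordS K p) : v ∘ π ∈ ordS K p :=
  ⟨hv.1.comp π.injective, by rw [vertexSet_comp_perm]; exact hv.2⟩

lemma orderedSimplices_comp {p q : ℕ} {v : Fin (p + 1) → V} {f : Fin (q + 1) → Fin (p + 1)}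
    (hf : Injective f) (hv : v ∈ ordS K p) : v ∘ f ∈ ordS K q :=
  ⟨hv.1.comp hf, K.down_closed hv.2 (vertexSet_comp_subset v f) ⟨v (f 0), mem_vertexSet.2 ⟨0, rfl⟩⟩⟩

lemma affineIndependent_of_mem {p : ℕ} {v : Fin (p + 1) → V} (hv : v ∈ ordS K p) :
    AffineIndependent ℝ v := by
  have h1 := K.indep hv.2
  let e : Fin (p + 1) → (vertexSet v : Finset V) := fun i => ⟨v i, mem_vertexSet.2 ⟨i, rfl⟩⟩
  have he : Injective e := fun i j h => hv.1 (congrArg Subtype.val h)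
  exact h1.comp_embedding ⟨e, he⟩

end Ordered

section Coordinates

lemma baryCoord_injective {p : ℕ} : Injective (baryCoord (p := p)) := by
  intro s t h
  ext i
  have := congrFun h i.succ
  simpa [baryCoord] using this

lemma injective_simplexParam {p : ℕ} {v : Fin (p + 1) → V} (hv : AffineIndependent ℝ v) :
    Injective (ρ v) := by
  intro s t h
  rw [simplexParam_eq_sum, simplexParam_eq_sum] at h
  apply baryCoord_injective
  have h1 := (affineIndependent_iff_eq_of_fintype_affineCombination_eq ℝ v).1 hv (baryCoord s)
    (baryCoord t) (sum_baryCoord s) (sum_baryCoord t)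
  apply h1
  rw [Finset.affineCombination_eq_linear_combination _ _ _ (sum_baryCoord s),
    Finset.affineCombination_eq_linear_combination _ _ _ (sum_baryCoord t)]
  exact h

/-- The coordinates of the points `v'` with respect to the simplex `v`. -/
def relCoord {p m : ℕ} (v : Fin (p + 1) → V) (v' : Fin m → V) : Fin m → Fin p → ℝ := fun i =>
  Function.invFunOn (ρ v) (stdSimp p) (v' i)

lemma relCoord_mem {p m : ℕ} {v : Fin (p + 1) → V} {v' : Fin m → V} (h : range v' ⊆ hull v)
    (i : Fin m) : relCoord v v' i ∈ stdSimp p := by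
  have : v' i ∈ ρ v '' stdSimp p := by
    rw [simplexParam_image]; exact h ⟨i, rfl⟩
  exact Function.invFunOn_mem this

lemma simplexParam_relCoord {p m : ℕ} {v : Fin (p + 1) → V} {v' : Fin m → V}
    (h : range v' ⊆ hull v) : ρ v ∘ relCoord v v' = v' := by
  ext i
  have : v' i ∈ ρ v '' stdSimp p := by
    rw [simplexParam_image]; exact h ⟨i, rfl⟩
  exact Function.invFunOn_eq this

lemma range_subset_hull_of_hull {p m : ℕ} {v : Fin p → V} {v' : Fin m → V}
    (h : hull v' ⊆ hull v) : range v' ⊆ hull v := (subset_convexHull ℝ _).trans h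

lemma linearIndependent_of_affineIndependent {p : ℕ} {v : Fin (p + 1) → V}
    (hv : AffineIndependent ℝ v) : Injective (paramLin v) := by
  intro s t h
  apply injective_simplexParam hv
  rw [simplexParam_eq, simplexParam_eq, h]

lemma paramLin_comp {p m : ℕ} (v : Fin (p + 1) → V) (b : Fin (m + 1) → Fin p → ℝ) :
    paramLin (ρ v ∘ b) = (paramLin v).comp (paramLin b) := by
  ext1 t
  have h1 : ρ (ρ v ∘ b) t = ρ v (ρ b t) := (simplexParam_comp v b t).symm
  rw [simplexParam_eq, simplexParam_eq, simplexParam_eq, map_add, comp_apply,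
    simplexParam_eq, add_assoc, add_right_inj, add_right_inj] at h1
  exact h1

lemma baryDet_relCoord_ne_zero {p : ℕ} {v v' : Fin (p + 1) → V} (hv' : AffineIndependent ℝ v')
    (h : range v' ⊆ hull v) : baryDet (relCoord v v') ≠ 0 := by
  have h1 := linearIndependent_of_affineIndependent hv'
  rw [← simplexParam_relCoord h, paramLin_comp] at h1
  have h2 : Injective (paramLin (relCoord v v')) := by
    rw [ContinuousLinearMap.coe_comp] at h1
    exact Function.Injective.of_comp h1
  rw [← det_paramLin]
  exact (LinearMap.bot_lt_ker_of_det_eq_zero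
    (f := (paramLin (relCoord v v') : (Fin p → ℝ) →ₗ[ℝ] (Fin p → ℝ)))).mt
    (by rw [LinearMap.ker_eq_bot.2 h2]; exact lt_irrefl _)

lemma card_le_of_subset_convexHull {s' s : Finset V} (hs' : AffineIndependent ℝ ((↑) : s' → V))
    (h : (s' : Set V) ⊆ Δ s) : s'.card ≤ s.card :=
  hs'.card_le_card_of_subset_affineSpan (h.trans (convexHull_subset_affineSpan _))

end Coordinates

section Cover

lemma hull_eq_image {p : ℕ} (v : Fin (p + 1) → V) : hull v = ρ v '' stdSimp p :=
  (simplexParam_image v).symm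

lemma simplexParam_mem_hull {p : ℕ} (v : Fin (p + 1) → V) {t : Fin p → ℝ} (ht : t ∈ stdSimp p) :
    ρ v t ∈ hull v :=
  hull_eq_image v ▸ mem_image_of_mem _ ht

lemma support_eq_of_mem_hull {s t : Finset V} {w : V →₀ ℝ} (h0 : 0 ≤ w) (h1 : tot w = 1)
    (hs : s ∈ K.faces) (hw : w.support = s) (ht : t ∈ K.faces) (hcard : t.card ≤ s.card) :
    cmb w ∈ Δ t ↔ t = s := by
  constructor
  · intro hx
    have := support_subset_of_mem_convexHull h0 (hw ▸ hs) h1 ht hx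
    rw [hw] at this
    exact (eq_of_subset_of_card_le this hcard).symm
  · rintro rfl
    exact mem_convexHull_iff_weights.2 ⟨w, h0, hw.subset, h1, rfl⟩

open scoped Classical in
/-- Integration over the images of all ordered simplices of maximal dimension counts every point
as often as there are orderings of the vertices of a simplex. -/
theorem sum_integral_cover {n : ℕ} {T : Finset V} (hK : K.faces.Finite) (hT : ∀ s ∈ K.faces, s ⊆ T)
    (hcard : ∀ s ∈ K.faces, s.card ≤ n + 1) {F : V → Fin n → ℝ} {Q : Set V}
    (hinj : InjOn F (K.space ∩ Q)) (hmeas : ∀ s ∈ K.faces, MeasurableSet (F '' (Δ s ∩ Q)))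
    (hnull : ∀ s ∈ K.faces, s.card ≤ n → volume (F '' (Δ s ∩ Q)) = 0) {θ : (Fin n → ℝ) → ℝ}
    (hθ : IntegrableOn θ (F '' (K.space ∩ Q))) : ∑ v ∈ tup T (n + 1),
    (if v ∈ ordS K n then ∫ y in F '' (hull v ∩ Q), θ y else 0) = ((n + 1).factorial : ℝ) * ∫ y in F
    '' (K.space ∩ Q), θ y := by
  set D := F '' (K.space ∩ Q) with hD
  have hDeq : D = ⋃ s ∈ K.faces, F '' (Δ s ∩ Q) := by
    rw [hD]
    have : K.space ∩ Q = ⋃ s ∈ K.faces, Δ s ∩ Q := by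
      ext x
      simp only [mem_inter_iff, mem_space_iff, mem_iUnion]
      tauto
    rw [this, image_iUnion₂]
  have hDm : MeasurableSet D := by
    rw [hDeq]; exact hK.measurableSet_biUnion hmeas
  have hsub : ∀ v, v ∈ ordS K n → F '' (hull v ∩ Q) ⊆ D := by
    intro v hv
    refine image_mono (inter_subset_inter_left _ ?_)
    rw [← convexHull_vertexSet]
    exact convexHull_subset_space hv.2
  have hvm : ∀ v, v ∈ ordS K n → MeasurableSet (F '' (hull v ∩ Q)) := by
    intro v hv
    rw [← convexHull_vertexSet]
    exact hmeas _ hv.2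
  have h1 : ∀ v ∈ tup T (n + 1), (if v ∈ ordS K n then ∫ y in F '' (hull v ∩ Q), θ y else 0) =
      ∫ y in D, if v ∈ ordS K n ∧ y ∈ F '' (hull v ∩ Q) then θ y else 0 := by
    intro v _
    by_cases hv : v ∈ ordS K n
    · simp only [hv, if_true, true_and]
      have : (fun y => if y ∈ F '' (hull v ∩ Q) then θ y else 0) =
          (F '' (hull v ∩ Q)).indicator θ := rfl
      rw [this, setIntegral_indicator (hvm v hv), inter_eq_self_of_subset_right (hsub v hv)]
    · simp [hv]
  rw [sum_congr rfl h1, ← integral_finsetSum, ← integral_const_mul]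
  · set Z := ⋃ s ∈ {s ∈ K.faces | s.card ≤ n}, F '' (Δ s ∩ Q) with hZ
    have hZ0 : volume Z = 0 := by
      rw [hZ, measure_biUnion_null_iff (hK.subset (fun _ h => h.1)).countable]
      exact fun s hs => hnull s hs.1 hs.2
    refine setIntegral_congr_ae hDm ?_
    have hae : ∀ᵐ y, y ∉ Z := measure_eq_zero_iff_ae_notMem.1 hZ0
    filter_upwards [hae] with y hyZ hyD
    obtain ⟨x, ⟨hxK, hxQ⟩, rfl⟩ := hyD
    obtain ⟨w, h0, hws, h1, rfl⟩ := exists_weights hxK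
    set s := w.support with hs
    have hxs : cmb w ∈ Δ s := mem_convexHull_iff_weights.2 ⟨w, h0, subset_rfl, h1, rfl⟩
    have hcs : s.card = n + 1 := by
      refine le_antisymm (hcard s hws) ?_
      by_contra hlt
      exact hyZ (mem_biUnion (show s ∈ {s ∈ K.faces | s.card ≤ n} from ⟨hws, by omega⟩)
        ⟨_, ⟨hxs, hxQ⟩, rfl⟩)
    have hiff : ∀ v, (v ∈ ordS K n ∧ F (cmb w) ∈ F '' (hull v ∩ Q)) ↔
        (Injective v ∧ vertexSet v = s) := by
      intro v
      constructor
      · rintro ⟨hv, x', ⟨hx', hx'Q⟩, hxx⟩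
        have : x' = cmb w := by
          refine hinj ⟨?_, hx'Q⟩ ⟨hxK, hxQ⟩ hxx
          rw [← convexHull_vertexSet] at hx'
          exact convexHull_subset_space hv.2 hx'
        subst this
        refine ⟨hv.1, (support_eq_of_mem_hull h0 h1 hws rfl hv.2 ?_).1 ?_⟩
        · rw [card_vertexSet hv.1, hcs]
        · rwa [convexHull_vertexSet]
      · rintro ⟨hv, hvs⟩
        refine ⟨⟨hv, by rw [hvs]; exact hws⟩, _, ⟨?_, hxQ⟩, rfl⟩
        rw [← convexHull_vertexSet, hvs]
        exact hxs
    simp only [hiff]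
    rw [← Finset.sum_filter, sum_const, card_orderings (hT s hws) hcs, nsmul_eq_mul]
  · intro v _
    by_cases hv : v ∈ ordS K n
    · simp only [hv, true_and]
      exact (hθ.integrable.indicator (hvm v hv))
    · simp [hv]

end Cover

section Subdivide

open scoped Classical in
/-- The sign of the orientation of the simplex `v'` inside of the simplex `v`. -/
def relSign {p : ℕ} (v v' : Fin (p + 1) → V) : ℤ :=
  if hull v' ⊆ hull v then (sign (baryDet (relCoord v v')) : ℤ) else 0

/-- The simplices of `K'` inside of a convex set. -/
def complexIn (K' : Cpx V) (C : Set V) : Cpx V where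
  faces := {s ∈ K'.faces | Δ s ⊆ C}
  isRelLowerSet_faces := by
    rintro s ⟨hs, hsb⟩
    exact ⟨K'.nonempty_of_mem_faces hs, fun t hts ht =>
      ⟨K'.down_closed hs hts ht, (convexHull_mono (Finset.coe_subset.2 hts)).trans hsb⟩⟩
  indep hs := K'.indep hs.1
  inter_subset_convexHull hs ht := K'.inter_subset_convexHull hs.1 ht.1

lemma complexIn_space (hin : Inside K' K) (hsp : K'.space = K.space) {s : Finset V}
    (hs : s ∈ K.faces) : (complexIn K' (Δ s)).space = Δ s := by
  apply subset_antisymm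
  · intro x hx
    obtain ⟨t, ht, hxt⟩ := mem_space_iff.1 hx
    exact ht.2 hxt
  · intro x hx
    have hxK : x ∈ K'.space := by
      rw [hsp]; exact convexHull_subset_space hs hx
    obtain ⟨w, h0, hw, h1, rfl⟩ := exists_weights hxK
    exact mem_space_iff.2
      ⟨w.support, ⟨hw, hin.convexHull_subset hw hs h0 rfl h1 hx⟩,
        mem_convexHull_iff_weights.2 ⟨w, h0, subset_rfl, h1, rfl⟩⟩

lemma volume_convexHull_range_eq_zero {m n : ℕ} (b : Fin m → Fin n → ℝ) (h : m ≤ n) :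
    volume (convexHull ℝ (range b)) = 0 := by
  refine measure_mono_null (convexHull_subset_affineSpan _) ?_
  refine Measure.addHaar_affineSubspace _ _ fun htop => ?_
  rcases m with _ | m
  · rw [range_eq_empty, AffineSubspace.span_empty] at htop
    exact AffineSubspace.bot_ne_top ℝ _ _ htop
  · have h1 := finrank_vectorSpan_range_le ℝ b (Fintype.card_fin (m + 1))
    rw [← direction_affineSpan, htop, AffineSubspace.direction_top, finrank_top,
      Module.finrank_fin_fun] at h1
    omega

variable [IsManifold 𝓘(ℝ, E) ∞ X]

open scoped Classical in
/-- The integral over a simplex is the sum of the integrals over the simplices of a subdivision. -/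
theorem sum_relSign_mul_simplexIntegral {p : ℕ} {T : Finset V} (hK' : K'.faces.Finite)
    (hT : ∀ s ∈ K'.faces, s ⊆ T) (hin : Inside K' K) (hsp : K'.space = K.space)
    {v : Fin (p + 1) → V} (hv : v ∈ ordS K p) {f : V → X}
    (h : SmoothOnSimplex (E := E) f v) {U : Set X} (hU : IsOpen U)
    (hmaps : MapsTo (f ∘ ρ v) (stdSimp p) U) {η : Form E X p} (hη : η.SmoothOn U) :
    ∑ v' ∈ tup T (p + 1), (if v' ∈ ordS K' p then
      (relSign v v' : ℝ) * simplexIntegral f v' η else 0) =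
      ((p + 1).factorial : ℝ) * simplexIntegral f v η := by
  set L := complexIn K' (convexHull ℝ (vertexSet v : Set V)) with hL
  have hLsp : L.space = hull v := by
    rw [hL, complexIn_space hin hsp hv.2, convexHull_vertexSet]
  have hvi := affineIndependent_of_mem hv
  set F : V → Fin p → ℝ := Function.invFunOn (ρ v) (stdSimp p) with hF
  set θ : (Fin p → ℝ) → ℝ := fun t => η.pull (f ∘ ρ v) (stdSimp p) t
    (fun i => single i 1) with hθ
  have hFpar : ∀ t ∈ stdSimp p, F (ρ v t) = t := by
    intro t ht
    apply injective_simplexParam hvi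
    exact Function.invFunOn_eq (⟨t, ht, rfl⟩ : ∃ a ∈ stdSimp p, ρ v a = ρ v t)
  have hhull : ∀ x ∈ hull v, ∃ t ∈ stdSimp p, ρ v t = x := by
    intro x hx
    rwa [hull_eq_image] at hx
  have hFimg : ∀ {m : ℕ} (v' : Fin m → V), hull v' ⊆ hull v → F '' hull v' =
      convexHull ℝ (range (relCoord v v')) := by
    intro m v' hv'
    rcases m with _ | m
    · simp [range_eq_empty]
    · rw [hull_eq_image, ← simplexParam_image, image_image]
      refine image_congr fun t ht => ?_
      have h1 := simplexParam_relCoord (range_subset_hull_of_hull hv')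
      have h2 : ρ v' t = ρ v (ρ (relCoord v v') t) := by
        rw [simplexParam_comp]
        exact congrArg (fun u => ρ u t) h1.symm
      rw [h2, hFpar]
      exact mapsTo_simplexParam_comp _ (relCoord_mem (range_subset_hull_of_hull hv')) ht
  have hFspace : F '' (L.space ∩ univ) = stdSimp p := by
    rw [inter_univ, hLsp, hull_eq_image, image_image]
    conv_rhs => rw [← image_id (stdSimp p)]
    exact image_congr fun t ht => hFpar t ht
  have hfaces : ∀ s ∈ L.faces, ∃ (v' : Fin s.card → V), Injective v' ∧ vertexSet v' = s ∧
      hull v' ⊆ hull v := by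
    intro s hs
    obtain ⟨v', h1, h2⟩ := exists_ordering (s := s) rfl
    refine ⟨v', h1, h2, ?_⟩
    rw [← convexHull_vertexSet, h2, ← convexHull_vertexSet v]
    exact hs.2
  have hcover := sum_integral_cover (K := L) (T := T) (n := p) (F := F) (Q := univ) (θ := θ)
    (hK'.subset fun s hs => hs.1) (fun s hs => hT s hs.1) ?_ ?_ ?_ ?_ ?_
  · rw [hFspace] at hcover
    rw [simplexIntegral_eq, ← hcover]
    refine sum_congr rfl fun v' _ => ?_
    have hmem : v' ∈ ordS L p ↔ v' ∈ ordS K' p ∧ hull v' ⊆ hull v := by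
      unfold orderedSimplices
      simp only [mem_ofPred_eq, hL, complexIn, convexHull_vertexSet, and_assoc]
    by_cases h1 : v' ∈ ordS K' p
    · by_cases h2 : hull v' ⊆ hull v
      · have hsub := range_subset_hull_of_hull h2
        rw [if_pos h1, if_pos (hmem.2 ⟨h1, h2⟩), inter_univ, hFimg v' h2, relSign, if_pos h2]
        conv_lhs => rw [← simplexParam_relCoord hsub]
        rw [simplexIntegral_comp_eq h _ (relCoord_mem hsub), simplexParam_relCoord hsub]
        have h0 := baryDet_relCoord_ne_zero (affineIndependent_of_mem h1) hsub
        rcases lt_or_gt_of_ne h0 with hlt | hlt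
        · simp [sign_neg hlt, hθ]
        · simp [sign_pos hlt, hθ]
      · rw [if_pos h1, if_neg (fun h => h2 (hmem.1 h).2), relSign, if_neg h2]
        simp
    · rw [if_neg h1, if_neg (fun h => h1 (hmem.1 h).1)]
  · intro s hs
    rw [← card_vertexSet hv.1]
    exact card_le_of_subset_convexHull (K'.indep hs.1) ((subset_convexHull ℝ _).trans hs.2)
  · intro x hx y hy hxy
    rw [hLsp] at hx hy
    obtain ⟨t, ht, rfl⟩ := hhull x hx.1
    obtain ⟨u, hu, rfl⟩ := hhull y hy.1
    rw [hFpar t ht, hFpar u hu] at hxy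
    rw [hxy]
  · intro s hs
    obtain ⟨v', -, h2, h3⟩ := hfaces s hs
    rw [← h2, convexHull_vertexSet, inter_univ, hFimg v' h3]
    exact ((finite_range _).isCompact_convexHull ℝ).measurableSet
  · intro s hs hsc
    obtain ⟨v', -, h2, h3⟩ := hfaces s hs
    rw [← h2, convexHull_vertexSet, inter_univ, hFimg v' h3]
    exact volume_convexHull_range_eq_zero _ hsc
  · rw [hFspace]
    exact (continuousOn_pull h hU hmaps hη _).integrableOn_compact (isCompact_stdSimp p)

end Subdivide

section BoundarySubdivision

lemma bary_unique {p : ℕ} {v : Fin (p + 1) → V} (hv : AffineIndependent ℝ v) {c d : Fin (p + 1) → ℝ}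
    (hc : ∑ i, c i = 1) (hd : ∑ i, d i = 1) (h : ∑ i, c i • v i = ∑ i, d i • v i) : c = d := by
  apply (affineIndependent_iff_eq_of_fintype_affineCombination_eq ℝ v).1 hv c d hc hd
  rw [Finset.affineCombination_eq_linear_combination _ _ _ hc,
    Finset.affineCombination_eq_linear_combination _ _ _ hd]
  exact h

lemma sum_baryCoord_relCoord {p m : ℕ} {v : Fin (p + 1) → V} {v' : Fin m → V}
    (h : range v' ⊆ hull v) (i : Fin m) : ∑ j, baryCoord (relCoord v v' i) j • v j = v' i := by
  rw [← simplexParam_eq_sum]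
  exact congrFun (simplexParam_relCoord h) i

lemma baryCoord_relCoord {p m : ℕ} {v : Fin (p + 1) → V} (hv : AffineIndependent ℝ v)
    {v' : Fin m → V} (h : range v' ⊆ hull v) {i : Fin m} {c : Fin (p + 1) → ℝ}
    (hc : ∑ j, c j = 1) (hcv : ∑ j, c j • v j = v' i) : baryCoord (relCoord v v' i) = c :=
  bary_unique hv (sum_baryCoord _) hc ((sum_baryCoord_relCoord h i).trans hcv.symm)

lemma hull_tail_subset {p : ℕ} (v : Fin (p + 1) → V) : hull (tail v) ⊆ hull v :=
  convexHull_mono (range_comp_subset_range Fin.succ v)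

lemma baryDet_cons {p : ℕ} {v : Fin (p + 2) → V} (hv : AffineIndependent ℝ v) {x : V}
    {w' : Fin (p + 1) → V} (h : range (cons x w' : Fin (p + 2) → V) ⊆ hull v)
    (hw' : range w' ⊆ hull (tail v)) : baryDet (relCoord v (cons x w' : Fin (p + 2) → V)) =
    baryCoord (relCoord v (cons x w' : Fin (p + 2) → V) 0) 0 * baryDet (relCoord (tail v) w') := by
  have hrow : ∀ i : Fin (p + 1), baryCoord (relCoord v (cons x w' : Fin (p + 2) → V) i.succ) =
      cons 0 (baryCoord (relCoord (tail v) w' i)) := by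
    intro i
    refine baryCoord_relCoord hv h ?_ ?_
    · rw [sum_univ_succ]; simp [sum_baryCoord]
    · rw [sum_univ_succ, Fin.cons_succ, ← sum_baryCoord_relCoord hw' i]
      simp [tail]
  rw [baryDet, Matrix.det_succ_column_zero, sum_univ_succ, sum_eq_zero]
  · simp only [Fin.val_zero, pow_zero, one_mul, Matrix.of_apply, add_zero, Fin.succAbove_zero]
    congr 2
    ext i j
    rw [Matrix.submatrix_apply, Matrix.of_apply, hrow, Fin.cons_succ]
    rfl
  · intro i _
    rw [Matrix.of_apply, hrow, Fin.cons_zero]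
    ring

lemma baryCoord_relCoord_zero_pos {p : ℕ} {v : Fin (p + 2) → V} (hv : AffineIndependent ℝ v) {x : V}
    {w' : Fin (p + 1) → V} (h : range (cons x w' : Fin (p + 2) → V) ⊆ hull v)
    (hi : AffineIndependent ℝ (cons x w' : Fin (p + 2) → V)) (hw' : range w' ⊆ hull (tail v)) : 0 <
    baryCoord (relCoord v (cons x w' : Fin (p + 2) → V) 0) 0 := by
  refine lt_of_le_of_ne (baryCoord_nonneg (relCoord_mem h _) _) fun h0 => ?_
  have := baryDet_relCoord_ne_zero hi h
  rw [baryDet_cons hv h hw', ← h0, zero_mul] at this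
  exact this rfl

lemma relSign_cons {p : ℕ} {v : Fin (p + 2) → V} (hv : AffineIndependent ℝ v) {x : V}
    {w' : Fin (p + 1) → V} (h : hull (cons x w' : Fin (p + 2) → V) ⊆ hull v)
    (hi : AffineIndependent ℝ (cons x w' : Fin (p + 2) → V)) (hw' : hull w' ⊆ hull (tail v)) :
    relSign v (cons x w' : Fin (p + 2) → V) = relSign (tail v) w' := by
  rw [relSign, relSign, if_pos h, if_pos hw', baryDet_cons hv (range_subset_hull_of_hull h)
    (range_subset_hull_of_hull hw'), sign_mul, sign_pos (baryCoord_relCoord_zero_pos hv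
    (range_subset_hull_of_hull h) hi (range_subset_hull_of_hull hw')), one_mul]

/-- The finitely supported function with values `c i` at the points `w i`. -/
def finsuppOf {m : ℕ} (w : Fin m → V) (c : Fin m → ℝ) : V →₀ ℝ := ∑ i, Finsupp.single (w i) (c i)

lemma cmb_finsuppOf {m : ℕ} (w : Fin m → V) (c : Fin m → ℝ) :
    cmb (finsuppOf w c) = ∑ i, c i • w i := by
  simp [finsuppOf, map_sum]

lemma tot_finsuppOf {m : ℕ} (w : Fin m → V) (c : Fin m → ℝ) : tot (finsuppOf w c) = ∑ i, c i := by
  simp [finsuppOf, map_sum]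

lemma finsuppOf_nonneg {m : ℕ} (w : Fin m → V) {c : Fin m → ℝ} (hc : ∀ i, 0 ≤ c i) :
    0 ≤ finsuppOf w c :=
  sum_nonneg fun i _ => Finsupp.single_nonneg.2 (hc i)

lemma finsuppOf_apply_of_notMem {m : ℕ} {w : Fin m → V} (c : Fin m → ℝ) {x : V}
    (hx : ∀ i, w i ≠ x) : finsuppOf w c x = 0 := by
  rw [finsuppOf, Finsupp.finsetSum_apply]
  exact sum_eq_zero fun i _ => Finsupp.single_eq_of_ne (hx i).symm

lemma finsuppOf_apply {m : ℕ} {w : Fin m → V} (hw : Injective w) (c : Fin m → ℝ)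
    (i : Fin m) : finsuppOf w c (w i) = c i := by
  rw [finsuppOf, Finsupp.finsetSum_apply, sum_eq_single i]
  · simp
  · intro j _ hj
    exact Finsupp.single_eq_of_ne fun h => hj (hw h).symm
  · simp

lemma support_finsuppOf_subset {m : ℕ} (w : Fin m → V) (c : Fin m → ℝ) :
    (finsuppOf w c).support ⊆ vertexSet w := by
  intro x hx
  rw [mem_vertexSet]
  by_contra! h
  exact mem_support_iff.1 hx (finsuppOf_apply_of_notMem c h)

lemma cons_unique {p : ℕ} {v : Fin (p + 2) → V} (hv : AffineIndependent ℝ v) {x₁ x₂ : V}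
    {w' : Fin (p + 1) → V} (hw' : hull w' ⊆ hull (tail v)) (hwi : AffineIndependent ℝ w')
    (h₁ : (cons x₁ w' : Fin (p + 2) → V) ∈ ordS K' (p + 1))
    (h₂ : (cons x₂ w' : Fin (p + 2) → V) ∈ ordS K' (p + 1))
    (hs₁ : hull (cons x₁ w' : Fin (p + 2) → V) ⊆ hull v)
    (hs₂ : hull (cons x₂ w' : Fin (p + 2) → V) ⊆ hull v) : x₁ = x₂ := by
  classical
  have hr := range_subset_hull_of_hull hw'
  have hr₁ := range_subset_hull_of_hull hs₁
  have hr₂ := range_subset_hull_of_hull hs₂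
  set d₁ := baryCoord (relCoord v (cons x₁ w' : Fin (p + 2) → V) 0) with hd₁
  set d₂ := baryCoord (relCoord v (cons x₂ w' : Fin (p + 2) → V) 0) with hd₂
  have hp₁ : 0 < d₁ 0 := baryCoord_relCoord_zero_pos hv hr₁ (affineIndependent_of_mem h₁) hr
  have hp₂ : 0 < d₂ 0 := baryCoord_relCoord_zero_pos hv hr₂ (affineIndependent_of_mem h₂) hr
  have hx₁ : ∑ j, d₁ j • v j = x₁ := sum_baryCoord_relCoord hr₁ 0
  have hx₂ : ∑ j, d₂ j • v j = x₂ := sum_baryCoord_relCoord hr₂ 0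
  have ht₁ : ∑ j, d₁ j = 1 := sum_baryCoord _
  have ht₂ : ∑ j, d₂ j = 1 := sum_baryCoord _
  set B : Matrix (Fin (p + 1)) (Fin (p + 1)) ℝ :=
    Matrix.of fun i => baryCoord (relCoord (tail v) w' i) with hB
  have hBu : IsUnit B.det := isUnit_iff_ne_zero.2 (baryDet_relCoord_ne_zero hwi hr)
  set κ := d₁ 0 / d₂ 0 with hκ
  have hκ0 : 0 < κ := div_pos hp₁ hp₂
  have hκd : κ * d₂ 0 = d₁ 0 := div_mul_cancel₀ _ hp₂.ne'
  set r : Fin (p + 1) → ℝ := fun j => d₁ j.succ - κ * d₂ j.succ with hrdef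
  set c := Matrix.vecMul r B⁻¹ with hc
  have hcB : ∀ j, ∑ i, c i * B i j = r j := by
    intro j
    have : Matrix.vecMul c B = r := by
      rw [hc, Matrix.vecMul_vecMul, Matrix.nonsing_inv_mul _ hBu, Matrix.vecMul_one]
    exact congrFun this j
  have hcsum : ∑ i, c i = 1 - κ := by
    have e1 : ∑ i, c i = ∑ j, r j := by
      rw [sum_congr rfl fun j _ => (hcB j).symm, sum_comm]
      refine sum_congr rfl fun i _ => ?_
      rw [← mul_sum]
      simp [hB, sum_baryCoord]
    rw [sum_univ_succ] at ht₁ ht₂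
    rw [e1, hrdef, sum_sub_distrib, ← mul_sum]
    have a1 : ∑ j : Fin (p + 1), d₁ j.succ = 1 - d₁ 0 := by linarith
    have a2 : ∑ j : Fin (p + 1), d₂ j.succ = 1 - d₂ 0 := by linarith
    rw [a1, a2, mul_sub, hκd]
    ring
  have hrel : x₁ = κ • x₂ + ∑ i, c i • w' i := by
    have e1 : ∑ i, c i • w' i = ∑ j : Fin (p + 1), r j • v j.succ := by
      simp only [← hcB, sum_smul]
      rw [sum_comm]
      refine sum_congr rfl fun i _ => ?_
      rw [← sum_baryCoord_relCoord hr i, smul_sum]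
      exact sum_congr rfl fun j _ => by rw [smul_smul]; rfl
    rw [e1, ← hx₁, ← hx₂, sum_univ_succ (n := p + 1), sum_univ_succ (n := p + 1), smul_add, smul_smul, hκd,
      add_assoc (d₁ 0 • v 0), smul_sum, ← sum_add_distrib]
    congr 1
    refine sum_congr rfl fun j _ => ?_
    rw [hrdef, smul_smul, ← add_smul]
    congr 1; ring
  obtain ⟨M, hM0, hM⟩ : ∃ M : ℝ, 0 ≤ M ∧ ∀ i, 0 ≤ M + c i := by
    refine ⟨∑ i, |c i|, sum_nonneg fun i _ => abs_nonneg _, fun i => ?_⟩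
    have := single_le_sum (f := fun i => |c i|) (fun i _ => abs_nonneg _) (Finset.mem_univ i)
    have h2 := neg_abs_le (c i)
    linarith
  set W₁ := finsuppOf (cons x₁ w' : Fin (p + 2) → V) (cons 1 fun _ => M) with hW₁
  set W₂ := finsuppOf (cons x₂ w' : Fin (p + 2) → V) (cons κ fun i => M + c i) with hW₂
  have heq : W₁ = W₂ := by
    refine IsWeight.unique (K := K') (.of_subset (finsuppOf_nonneg _ ?_) h₁.2
      (support_finsuppOf_subset _ _)) (.of_subset (finsuppOf_nonneg _ ?_) h₂.2
      (support_finsuppOf_subset _ _)) ?_ ?_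
    · exact fun i => Fin.cases (by simp) (fun _ => by simpa using hM0) i
    · exact fun i => Fin.cases (by simpa using hκ0.le) (fun i => by simpa using hM i) i
    · rw [tot_finsuppOf, tot_finsuppOf, sum_univ_succ (n := p + 1), sum_univ_succ (n := p + 1)]
      simp only [Fin.cons_zero, Fin.cons_succ, sum_add_distrib, hcsum]
      ring
    · rw [cmb_finsuppOf, cmb_finsuppOf, sum_univ_succ (n := p + 1), sum_univ_succ (n := p + 1)]
      simp only [Fin.cons_zero, Fin.cons_succ, sum_add_distrib, add_smul, one_smul]
      rw [hrel]
      abel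
  by_contra hne
  have e1 : W₁ x₁ = 1 := finsuppOf_apply h₁.1 _ 0
  have e2 : W₂ x₁ = 0 := by
    refine finsuppOf_apply_of_notMem _ fun i => Fin.cases ?_ (fun j => ?_) i
    · simpa using Ne.symm hne
    · intro h
      have : (cons x₁ w' : Fin (p + 2) → V) j.succ = (cons x₁ w' : Fin (p + 2) → V) 0 := by
        simpa using h
      exact (Fin.succ_ne_zero j) (h₁.1 this)
  rw [heq, e2] at e1
  exact zero_ne_one e1

lemma cons_exists {p : ℕ} (hK' : K'.faces.Finite) (hin : Inside K' K) (hsp : K'.space = K.space)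
    {v : Fin (p + 2) → V} (hv : v ∈ ordS K (p + 1)) {w' : Fin (p + 1) → V} (hw : w' ∈ ordS K' p)
    (hw' : hull w' ⊆ hull (tail v)) : ∃ x, (cons x w' : Fin (p + 2) → V) ∈ ordS K' (p + 1) ∧ hull
    (cons x w' : Fin (p + 2) → V) ⊆ hull v := by
  classical
  have hvi := affineIndependent_of_mem hv
  set L := complexIn K' (convexHull ℝ (vertexSet v : Set V)) with hL
  have hLsp : L.space = hull v := by
    rw [hL, complexIn_space hin hsp hv.2, convexHull_vertexSet]
  obtain ⟨Y, hY0, hYs, hY1, hYc⟩ := exists_relint (vertexSet w') ⟨_, mem_vertexSet.2 ⟨0, rfl⟩⟩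
  rw [convexHull_vertexSet] at hYc
  set y := cmb Y with hy
  have hyt : y ∈ hull (tail v) := hw' hYc
  have htail : ∀ z ∈ hull (tail v), ∃ b : Fin (p + 1) → ℝ, ∑ i, b i = 1 ∧
      ∑ i, b i • v i.succ = z := by
    intro z hz
    rw [hull_eq_image] at hz
    obtain ⟨t, -, rfl⟩ := hz
    exact ⟨baryCoord t, sum_baryCoord t, (simplexParam_eq_sum _ _).symm⟩
  set z : ℝ → V := fun ε => y + ε • (v 0 - y) with hz
  have hzc : Continuous z := by fun_prop
  have hz0 : z 0 = y := by simp [hz]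
  have hzmem : ∀ ε ∈ Ioc (0 : ℝ) 1, z ε ∈ hull v := by
    intro ε hε
    have := (convex_convexHull ℝ (range v)).add_smul_sub_mem (hull_tail_subset v hyt)
      (subset_convexHull ℝ _ ⟨0, rfl⟩ : v 0 ∈ hull v) ⟨hε.1.le, hε.2⟩
    exact this
  have hznot : ∀ ε, 0 < ε → z ε ∉ hull (tail v) := by
    intro ε hε hmem
    obtain ⟨b, hb1, hb⟩ := htail y hyt
    obtain ⟨b', hb1', hb'⟩ := htail _ hmem
    have := bary_unique hvi (c := cons ε fun i => (1 - ε) * b i) (d := cons 0 b')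
      (by rw [sum_univ_succ]; simp [← mul_sum, hb1])
      (by rw [sum_univ_succ]; simp [hb1'])
      (by
        rw [sum_univ_succ (n := p + 1), sum_univ_succ (n := p + 1)]
        simp only [Fin.cons_zero, Fin.cons_succ, zero_smul, zero_add, hb', mul_smul,
          ← smul_sum, hb, hz]
        rw [smul_sub, sub_smul, one_smul]
        abel)
    have h0 := congrFun this 0
    simp only [Fin.cons_zero] at h0
    exact hε.ne' h0
  obtain ⟨s, hs, hsf⟩ : ∃ s ∈ L.faces, ∃ᶠ ε in 𝓝[>] (0 : ℝ), z ε ∈ Δ s := by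
    by_contra! hcon
    have h1 : ∀ᶠ ε in 𝓝[>] (0 : ℝ), ∀ s ∈ L.faces, z ε ∉ Δ s :=
      (Filter.eventually_all_finite (hK'.subset fun s hs => hs.1)).2 fun s hs =>
        hcon s hs
    have h2 : ∀ᶠ ε in 𝓝[>] (0 : ℝ), ε ∈ Ioc (0 : ℝ) 1 := Ioc_mem_nhdsGT one_pos
    obtain ⟨ε, hε1, hε2⟩ := (h1.and h2).exists
    have := hzmem ε hε2
    rw [← hLsp] at this
    obtain ⟨s, hs, hx⟩ := mem_space_iff.1 this
    exact hε1 s hs hx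
  have hys : y ∈ Δ s := by
    have hcl : IsClosed (Δ s) := s.finite_toSet.isClosed_convexHull ℝ
    have htd : Filter.Tendsto z (𝓝[>] (0 : ℝ)) (𝓝 y) := by
      rw [← hz0]; exact hzc.continuousAt.tendsto.mono_left nhdsWithin_le_nhds
    exact hcl.mem_of_frequently_of_tendsto hsf htd
  have hsub : vertexSet w' ⊆ s := by
    rw [← hYs]
    exact support_subset_of_mem_convexHull hY0 (hYs ▸ hw.2) hY1 hs.1 hys
  have hne : s ≠ vertexSet w' := by
    rintro rfl
    obtain ⟨ε, hε1, hε2⟩ := (hsf.and_eventually self_mem_nhdsWithin).exists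
    rw [convexHull_vertexSet] at hε1
    exact hznot ε hε2 (hw' hε1)
  have hcard : s.card ≤ p + 2 := by
    rw [← card_vertexSet hv.1]
    exact card_le_of_subset_convexHull (K'.indep hs.1) ((subset_convexHull ℝ _).trans hs.2)
  obtain ⟨x, hxs, hxw⟩ := Finset.exists_of_ssubset (hsub.ssubset_of_ne hne.symm)
  have hins : insert x (vertexSet w') = s := by
    refine eq_of_subset_of_card_le (Finset.insert_subset hxs hsub) ?_
    rw [Finset.card_insert_of_notMem hxw, card_vertexSet hw.1]
    exact hcard
  have hvs : vertexSet (cons x w' : Fin (p + 2) → V) = s := by rw [vertexSet_cons, hins]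
  refine ⟨x, ⟨?_, by rw [hvs]; exact hs.1⟩, ?_⟩
  · rw [Fin.cons_injective_iff]
    exact ⟨fun ⟨i, hi⟩ => hxw (mem_vertexSet.2 ⟨i, hi⟩), hw.1⟩
  · rw [← convexHull_vertexSet, hvs, ← convexHull_vertexSet]
    exact hs.2

open scoped Classical in
/-- Compatibility of subdivision with the passage to the boundary. -/
theorem sum_relSign_cons {p : ℕ} {T : Finset V} (hK' : K'.faces.Finite) (hT : ∀ s ∈ K'.faces, s ⊆ T)
    (hin : Inside K' K) (hsp : K'.space = K.space) {v : Fin (p + 2) → V} (hv : v ∈ ordS K (p + 1))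
    {w' : Fin (p + 1) → V} (hw : w' ∈ ordS K' p) (hw' : hull w' ⊆ hull (tail v)) : ∑ x ∈ T, (if
    (cons x w' : Fin (p + 2) → V) ∈ ordS K' (p + 1) then relSign v (cons x w' : Fin (p + 2) → V)
    else 0) = relSign (tail v) w' := by
  obtain ⟨x, hx, hxv⟩ := cons_exists hK' hin hsp hv hw hw'
  have hxT : x ∈ T := hT _ hx.2 (mem_vertexSet.2 ⟨0, rfl⟩)
  rw [Finset.sum_eq_single_of_mem x hxT, if_pos hx, relSign_cons (affineIndependent_of_mem hv) hxv
    (affineIndependent_of_mem hx) hw']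
  intro x' _ hne
  split_ifs with h
  · by_cases hs : hull (cons x' w' : Fin (p + 2) → V) ⊆ hull v
    · exact absurd (cons_unique (affineIndependent_of_mem hv) hw' (affineIndependent_of_mem hw)
        h hx hs hxv) hne
    · rw [relSign, if_neg hs]
  · rfl

end BoundarySubdivision

section CoordForm

/-- The determinant of `ℝⁿ` as a continuous alternating form. -/
def detForm (n : ℕ) : (Fin n → ℝ) [⋀^Fin n]→L[ℝ] ℝ := { (Pi.basisFun ℝ (Fin n)).det with
    cont := by
      have : (fun v : Fin n → Fin n → ℝ => (Pi.basisFun ℝ (Fin n)).det v) =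
          fun v => (Matrix.of fun i j => v j i).det := by
        ext v
        rw [Module.Basis.det_apply]
        congr 1
      change Continuous fun v : Fin n → Fin n → ℝ => (Pi.basisFun ℝ (Fin n)).det v
      rw [this]
      refine Continuous.matrix_det (continuous_matrix fun i j => ?_)
      simp only [Matrix.of_apply]
      fun_prop }

lemma detForm_apply {n : ℕ} (v : Fin n → Fin n → ℝ) :
    detForm n v = (Matrix.of fun i j => v j i).det := by
  change (Pi.basisFun ℝ (Fin n)).det v = _
  rw [Module.Basis.det_apply]
  congr 1

lemma detForm_self (n : ℕ) : detForm n (fun i => single i 1) = 1 := by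
  rw [detForm_apply]
  convert Matrix.det_one (n := Fin n) (R := ℝ) using 2
  ext i j
  simp [Matrix.one_apply, Pi.single_apply]

lemma detForm_comp {n : ℕ} (L : (Fin n → ℝ) →L[ℝ] (Fin n → ℝ)) :
    detForm n (fun i => L (single i 1)) = L.det := by
  rw [alternating_comp_eq_det, detForm_self, mul_one]

/-- The contraction of the determinant with the `j`-th basis vector. -/
def contrForm {m : ℕ} (j : Fin (m + 1)) : (Fin (m + 1) → ℝ) [⋀^Fin m]→L[ℝ] ℝ :=
  { (detForm (m + 1)).toAlternatingMap.curryLeft (single j 1) with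
    cont := by
      change Continuous fun v : Fin m → Fin (m + 1) → ℝ =>
        detForm (m + 1) (Matrix.vecCons (single j 1) v)
      exact (detForm (m + 1)).cont.comp (by fun_prop) }

lemma contrForm_apply {m : ℕ} (j : Fin (m + 1)) (v : Fin m → Fin (m + 1) → ℝ) :
    contrForm j v = detForm (m + 1) (Matrix.vecCons (single j 1) v) := rfl

/-- The form `y_j · ι(e_j) det` on `ℝⁿ`. -/
def coordForm {m : ℕ} (j : Fin (m + 1)) : Form (Fin (m + 1) → ℝ) (Fin (m + 1) → ℝ) m :=
  fun y => y j • contrForm j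

lemma coordForm_inChart {m : ℕ} (j : Fin (m + 1)) (x₀ : Fin (m + 1) → ℝ) :
    (coordForm j).inChart x₀ = fun y => y j • contrForm j := by
  funext y
  have h1 : mfderiv 𝓜 (m + 1) 𝓜 (m + 1)
      (extChartAt 𝓜 (m + 1) x₀).symm y =
      ContinuousLinearMap.id ℝ (Fin (m + 1) → ℝ) := mfderiv_id
  have h2 : ∀ L : (Fin (m + 1) → ℝ) →L[ℝ] (Fin (m + 1) → ℝ), L = ContinuousLinearMap.id ℝ _ →
      (y j • contrForm j).compContinuousLinearMap L = y j • contrForm j := by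
    rintro _ rfl
    ext v
    rfl
  exact h2 _ h1

lemma coordForm_smoothOn {m : ℕ} (j : Fin (m + 1)) : (coordForm j).SmoothOn univ := by
  intro x₀
  rw [coordForm_inChart]
  exact ((contDiff_apply ℝ ℝ j).smul contDiff_const).contDiffOn

/-- The (constant) exterior derivative of `y_j · ι(e_j) det`. -/
def coordVol {m : ℕ} (j : Fin (m + 1)) : (Fin (m + 1) → ℝ) [⋀^Fin (m + 1)]→L[ℝ] ℝ :=
  .alternatizeUncurryFin ((pr (m + 1) j).smulRight (contrForm j))

lemma coordForm_d {m : ℕ} (j : Fin (m + 1)) (x : Fin (m + 1) → ℝ) :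
    (coordForm j).d x = coordVol j := by
  have : (coordForm j).d x = extDeriv (fun y : Fin (m + 1) → ℝ => y j • contrForm j)
      (extChartAt 𝓜 (m + 1) x x) := by
    unfold Form.d
    rw [coordForm_inChart]
  rw [this]
  have hd : ∀ y : Fin (m + 1) → ℝ, HasFDerivAt (fun y : Fin (m + 1) → ℝ => y j • contrForm j)
      ((pr (m + 1) j).smulRight (contrForm j)) y :=
    fun y => ((pr (m + 1) j).hasFDerivAt).smul_const (contrForm j)
  rw [extDeriv, (hd _).fderiv, coordVol]

/-- The value of `d (y_j · ι(e_j) det)` on the standard frame. -/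
def coordConst {m : ℕ} (j : Fin (m + 1)) : ℝ := coordVol j (fun i => single i 1)

lemma coordConst_zero {m : ℕ} : coordConst (0 : Fin (m + 1)) = 1 := by
  rw [coordConst, coordVol, ContinuousAlternatingMap.alternatizeUncurryFin_apply, sum_eq_single 0]
  · have h1 : (Matrix.vecCons (single (0 : Fin (m + 1)) (1 : ℝ))
        (Fin.removeNth 0 fun i : Fin (m + 1) => single i (1 : ℝ)) : Fin (m + 1) → _) =
        fun i => single i 1 := by
      ext i : 1
      refine Fin.cases rfl (fun i => ?_) i
      simp; rfl
    simp only [Fin.val_zero, pow_zero, one_smul, ContinuousLinearMap.smulRight_apply,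
      ContinuousLinearMap.proj_apply, Pi.single_eq_same, contrForm_apply, h1, detForm_self]
  · intro k _ hk
    simp [hk.symm]
  · simp

lemma det_of_row_eq_zero {n : ℕ} (j : Fin n) (L : (Fin n → ℝ) →L[ℝ] (Fin n → ℝ))
    (h : ∀ x, L x j = 0) : L.det = 0 := by
  rw [← detForm_comp, detForm_apply]
  exact Matrix.det_eq_zero_of_row_eq_zero j fun i => by simp [h]

lemma det_update_proj {n : ℕ} (j : Fin n) (L : (Fin n → ℝ) →L[ℝ] (Fin n → ℝ))
    (l : (Fin n → ℝ) →L[ℝ] ℝ) (h : ∀ x, L x = Function.update x j (l x)) : L.det = l (single j 1) :=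
    by
  rw [← detForm_comp, detForm_apply]
  have : (Matrix.of fun i k : Fin n => L (single k 1) i) =
      (1 : Matrix (Fin n) (Fin n) ℝ).updateRow j (fun k => l (single k 1)) := by
    ext i k
    rw [Matrix.of_apply, h, Matrix.updateRow_apply, Function.update_apply]
    split_ifs with hij
    · rfl
    · simp [Matrix.one_apply, Pi.single_apply]
  rw [this, ← Matrix.det_transpose, ← Matrix.updateCol_transpose, Matrix.transpose_one,
    ← Matrix.cramer_apply, Matrix.cramer_one]
  rfl

end CoordForm

section Reindex

/-- Summing an alternating chain against the alternating sum over the faces amounts to summing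
its boundary. -/
lemma sum_mul_alternating_faces {T : Finset V} {m : ℕ} (c : (Fin (m + 1) → V) → ℝ)
    (hc : ∀ (π : Perm (Fin (m + 1))) v, c (v ∘ π) = ((Perm.sign π : ℤ) : ℝ) * c v)
    (J : (Fin m → V) → ℝ) : ∑ v ∈ tup T (m + 1), c v * ∑ k : Fin (m + 1), (-1 : ℝ) ^ (k : ℕ) * J
    (v ∘ k.succAbove) = ((m : ℝ) + 1) * ∑ w ∈ tup T m, (∑ x ∈ T, c (cons x w)) * J w := by
  have h1 : ∀ k : Fin (m + 1), ∑ v ∈ tup T (m + 1), c v * ((-1 : ℝ) ^ (k : ℕ) *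
      J (v ∘ k.succAbove)) = ∑ v ∈ tup T (m + 1), c v * J (tail v) := by
    intro k
    rw [← sum_tup_perm T k.cycleRange.symm (fun v => c v * J (tail v))]
    refine sum_congr rfl fun v _ => ?_
    rw [hc, Perm.sign_symm, Fin.sign_cycleRange]
    have : tail (v ∘ k.cycleRange.symm) = v ∘ k.succAbove := by
      ext i
      simp [tail]
    rw [this]
    push_cast
    ring
  simp only [mul_sum]
  rw [sum_comm]
  rw [sum_congr rfl fun k _ => h1 k, sum_const, Finset.card_univ, Fintype.card_fin, sum_tup_succ]
  simp only [tail_cons, Finset.sum_mul, nsmul_eq_mul, mul_sum]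
  push_cast
  rfl

end Reindex

section TopDegree

lemma volume_image_eq_zero_of_lt {p n : ℕ} (hpn : p < n) {f : (Fin p → ℝ) → Fin n → ℝ}
    {s : Set (Fin p → ℝ)} (hs : Convex ℝ s) (hf : ContDiffOn ℝ 1 f s) {R : Set (Fin p → ℝ)}
    (hR : R ⊆ s) : volume (f '' R) = 0 := by
  refine measure_zero_of_dimH_lt (d := (n : NNReal)) ?_ ?_
  · have := hausdorffMeasure_pi_real (ι := Fin n)
    simp only [Fintype.card_fin] at this
    rw [← this]
    exact Measure.AbsolutelyContinuous.rfl
  · calc dimH (f '' R) ≤ dimH R := hf.dimH_image_le hs hR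
      _ ≤ dimH (univ : Set (Fin p → ℝ)) := dimH_mono (subset_univ _)
      _ = p := Real.dimH_univ_pi_fin p
      _ < n := by exact_mod_cast hpn

open scoped Classical in
/-- Integration of a top degree form over a compact piece of a chart, simplex by simplex. -/
theorem sum_orient_integral {n : ℕ} {T : Finset V} (hK : K.faces.Finite) (hT : ∀ s ∈ K.faces, s ⊆ T)
    (hcard : ∀ s ∈ K.faces, s.card ≤ n + 1) {F : V → Fin n → ℝ} {Q : Set V} (hinj : InjOn F (K.space
    ∩ Q)) (hF : ∀ p, ∀ v ∈ ordS K p, ContDiffOn ℝ ∞ (F ∘ ρ v) (stdSimp p)) (hQ : ∀ p, ∀ v ∈ ordS K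
    p, IsCompact (stdSimp p ∩ ρ v ⁻¹' Q)) {c : (Fin (n + 1) → V) → ℝ} {σ : ℝ} (hc : ∀ v ∈ ordS K n,
    ∀ t ∈ stdSimp n, ρ v t ∈ Q → c v * (fderivWithin ℝ (F ∘ ρ v) (stdSimp n) t).det = σ *
    |(fderivWithin ℝ (F ∘ ρ v) (stdSimp n) t).det|) {θ : (Fin n → ℝ) → ℝ} (hθ : IntegrableOn θ (F ''
    (K.space ∩ Q))) : ∑ v ∈ tup T (n + 1), (if v ∈ ordS K n then c v * ∫ t in stdSimp n ∩ ρ v ⁻¹' Q,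
    (fderivWithin ℝ (F ∘ ρ v) (stdSimp n) t).det * θ (F (ρ v t)) else 0) = σ * (((n + 1).factorial :
    ℝ) * ∫ y in F '' (K.space ∩ Q), θ y) := by
  have himg : ∀ p (v : Fin (p + 1) → V), F '' (hull v ∩ Q) =
      (F ∘ ρ v) '' (stdSimp p ∩ ρ v ⁻¹' Q) := by
    intro p v
    rw [hull_eq_image, image_comp, image_inter_preimage]
  have hord : ∀ s ∈ K.faces, ∃ p, ∃ v ∈ ordS K p, s.card = p + 1 ∧ Δ s = hull v := by
    intro s hs
    obtain ⟨p, hp, v, hv, rfl⟩ := exists_ordering_of_mem hs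
    exact ⟨p, v, ⟨hv, hs⟩, hp, convexHull_vertexSet v⟩
  rw [← sum_integral_cover hK hT hcard hinj ?_ ?_ hθ, mul_sum]
  · refine sum_congr rfl fun v _ => ?_
    split_ifs with hv
    · rw [himg, integral_image_eq_integral_abs_det_fderiv_smul volume (hQ n v hv).measurableSet
        (fun t ht => (((hF n v hv).differentiableOn (by simp) t ht.1).hasFDerivWithinAt).mono
          inter_subset_left), ← integral_const_mul, ← integral_const_mul]
      · refine setIntegral_congr_fun (hQ n v hv).measurableSet fun t ht => ?_
        simp only [smul_eq_mul, comp_apply]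
        rw [← mul_assoc, hc v hv t ht.1 ht.2, mul_assoc]
      · intro t ht t' ht' htt
        refine injective_simplexParam (affineIndependent_of_mem hv) (hinj ?_ ?_ htt)
        · refine ⟨convexHull_subset_space hv.2 ?_, ht.2⟩
          rw [convexHull_vertexSet]; exact simplexParam_mem_hull _ ht.1
        · refine ⟨convexHull_subset_space hv.2 ?_, ht'.2⟩
          rw [convexHull_vertexSet]; exact simplexParam_mem_hull _ ht'.1
    · simp
  · intro s hs
    obtain ⟨p, v, hv, -, hsv⟩ := hord s hs
    rw [hsv, himg]
    exact ((hQ p v hv).image_of_continuousOn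
      ((hF p v hv).continuousOn.mono inter_subset_left)).measurableSet
  · intro s hs hsc
    obtain ⟨p, v, hv, hp, hsv⟩ := hord s hs
    rw [hsv, himg]
    exact volume_image_eq_zero_of_lt (by omega) (convex_stdSimp p) ((hF p v hv).of_le (by simp))
      inter_subset_left

end TopDegree
variable {n : ℕ} {H : Type*} [TopologicalSpace H]
  {I : ModelWithCorners ℝ 𝔼 n H} {N : Type*} [TopologicalSpace N]
  [ChartedSpace H N] {P : Set V} {h : V → N}

section OrientSign

variable (I) in
/-- The preferred chart around `x₀`, as a map to `ℝⁿ`. -/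
def coord (x₀ : N) (y : N) : Fin n → ℝ := 𝓔 n (extChartAt I x₀ y)

lemma coord_injOn (x₀ : N) : InjOn (coord I x₀) (chartAt H x₀).source := by
  rw [← extChartAt_source I]
  exact (𝓔 n).injective.comp_injOn (extChartAt I x₀).injOn

variable [IsManifold I ∞ N] (o : ManifoldOrientation I N)

lemma frameDet_eq (x : N) (D : (Fin n → ℝ) →L[ℝ] 𝔼 n) : o.frameDet x (fun i => D (single i 1)) =
    ((o.sgn x : ℤ) : ℝ) * (((𝓔 n : _ →L[ℝ] (Fin n → ℝ))).comp D).det := by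
  rw [← detForm_comp, detForm_apply]
  rfl

lemma contDiffWithinAt_coord {p : ℕ} {φ : (Fin p → ℝ) → N} {s : Set (Fin p → ℝ)} {t : Fin p → ℝ}
    (hφ : ContMDiffWithinAt 𝓜 p I ∞ φ s t) {x₀ : N}
    (hx : φ t ∈ (chartAt H x₀).source) : ContDiffWithinAt ℝ ∞ (coord I x₀ ∘ φ) s t := by
  have h1 := ((contMDiffOn_extChartAt (I := I) (n := ∞) (x := x₀)).contMDiffAt
    ((chartAt H x₀).open_source.mem_nhds hx)).comp_contMDiffWithinAt t hφ
  exact ((𝓔 n).contDiff.contDiffAt).comp_contDiffWithinAt t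
    h1.contDiffWithinAt

lemma fderivWithin_coord {p : ℕ} {φ : (Fin p → ℝ) → N} {s : Set (Fin p → ℝ)} {t : Fin p → ℝ}
    (hs : UniqueDiffWithinAt ℝ s t) (hφ : MDifferentiableWithinAt 𝓜 p I φ s t) {x₀ : N}
    (hx : φ t ∈ (chartAt H x₀).source) : fderivWithin ℝ (coord I x₀ ∘ φ) s t =
    (((𝓔 n : _ →L[ℝ] (Fin n → ℝ))).comp (tangentCoordChange I (φ t) x₀ (φ t))).comp
    (mfderivWithin 𝓜 p I φ s t) := by
  have h1 : HasFDerivWithinAt (extChartAt I (φ t) ∘ φ)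
      (mfderivWithin 𝓜 p I φ s t : (Fin p → ℝ) →L[ℝ] 𝔼 n) s t := by
    exact (hφ.hasMFDerivWithinAt.2).mono fun y hy => ⟨hy, mem_range_self y⟩
  have h2 := hasFDerivWithinAt_tangentCoordChange (I := I) (x := φ t) (y := x₀) (z := φ t)
    ⟨mem_extChartAt_source _, by rwa [extChartAt_source]⟩
  have h3 := h2.comp t h1 (fun y _ => by
    simp only [comp_apply, extChartAt_coe]; exact mem_range_self _)
  have h4 := ((𝓔 n).hasFDerivAt).comp_hasFDerivWithinAt t h3
  refine HasFDerivWithinAt.fderivWithin ?_ hs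
  refine HasFDerivWithinAt.congr_of_eventuallyEq h4 ?_ ?_
  · filter_upwards [hφ.continuousWithinAt ((chartAt H (φ t)).open_source.mem_nhds
      (mem_chart_source H (φ t)))] with y hy
    simp only [comp_apply, coord]
    rw [(extChartAt I (φ t)).left_inv (by rwa [extChartAt_source])]
  · simp only [comp_apply, coord]
    rw [(extChartAt I (φ t)).left_inv (mem_extChartAt_source _)]

/-- The sign of a frame given by a parametrization, computed in another chart. -/
lemma frameDet_coord {φ : (Fin n → ℝ) → N} {s : Set (Fin n → ℝ)} {t : Fin n → ℝ}
    (hs : UniqueDiffWithinAt ℝ s t) (hφ : MDifferentiableWithinAt 𝓜 n I φ s t) {x₀ : N}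
    (hx : φ t ∈ (chartAt H x₀).source) (ho : 0 < (((o.sgn x₀ * o.sgn (φ t) : ℤˣ) : ℤ) : ℝ) *
    (tangentCoordChange I (φ t) x₀ (φ t)).det) : sign
    (o.frameDet (φ t) fun i => mfderivWithin 𝓜 n I φ s t (single i 1)) = sign
    (((o.sgn x₀ : ℤ) : ℝ) * (fderivWithin ℝ (coord I x₀ ∘ φ) s t).det) := by
  set D : (Fin n → ℝ) →L[ℝ] 𝔼 n := mfderivWithin 𝓜 n I φ s t
    with hD
  have h1 := frameDet_eq o (φ t) D
  have h2 := fderivWithin_coord hs hφ hx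
  rw [h2]
  set e := 𝓔 n
  set T := tangentCoordChange I (φ t) x₀ (φ t) with hT
  have h3 : (((e : _ →L[ℝ] (Fin n → ℝ)).comp T).comp D) =
      (((e : _ →L[ℝ] (Fin n → ℝ)).comp T).comp (e.symm : (Fin n → ℝ) →L[ℝ] _)).comp
        ((e : _ →L[ℝ] (Fin n → ℝ)).comp D) := by
    ext x i; simp
  have h4 : (((e : _ →L[ℝ] (Fin n → ℝ)).comp T).comp (e.symm : (Fin n → ℝ) →L[ℝ] _)).det = T.det :=
    LinearMap.det_conj (T : 𝔼 n →ₗ[ℝ] 𝔼 n)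
      e.toLinearEquiv
  have h5 : ((((e : _ →L[ℝ] (Fin n → ℝ)).comp T).comp D)).det =
      T.det * ((e : _ →L[ℝ] (Fin n → ℝ)).comp D).det := by
    rw [h3, ← h4]
    exact LinearMap.det_comp _ _
  refine (congrArg sign h1).trans (Eq.trans ?_ (congrArg (fun z =>
    sign (((o.sgn x₀ : ℤ) : ℝ) * z)) h5.symm))
  simp only [sign_mul]
  have h6 := sign_pos ho
  rw [sign_mul] at h6
  push_cast at h6
  rw [sign_mul] at h6
  have h7 : ∀ u : ℤˣ, sign (((u : ℤ) : ℝ)) * sign (((u : ℤ) : ℝ)) = 1 := by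
    intro u
    rcases Int.units_eq_one_or u with rfl | rfl <;> simp
  rw [← mul_assoc]
  congr 1
  calc _ = sign (((o.sgn (φ t) : ℤ) : ℝ)) * 1 := by rw [mul_one]
    _ = _ := by
      rw [← h6, mul_comm (sign (((o.sgn x₀ : ℤ) : ℝ))), mul_assoc, ← mul_assoc,
        ← mul_assoc, h7, one_mul]

/-- The sign of the frame of a parametrized simplex does not depend on the point. -/
lemma sign_frameDet_eq (hK : IsSmoothTriangulation I P h K) {v : Fin (n + 1) → V}
    (hv : v ∈ ordS K n) {t : Fin n → ℝ} (ht : t ∈ stdSimp n) : ((sign (o.frameDet (h (ρ v t)) fun i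
    => mfderivWithin 𝓜 n I (h ∘ ρ v) (stdSimp n) t (single i 1)) : ℤ)) = orientSign o h v ∧
    orientSign o h v ≠ 0 :=
    by
  set φ := h ∘ ρ v with hφ
  have hsm := hK.smooth n v hv
  set s : (Fin n → ℝ) → SignType := fun t => sign (o.frameDet (φ t) fun i =>
    mfderivWithin 𝓜 n I φ (stdSimp n) t (single i 1)) with hs
  have hne : ∀ t ∈ stdSimp n, s t ≠ 0 := by
    intro t ht
    set D : (Fin n → ℝ) →L[ℝ] 𝔼 n := mfderivWithin 𝓜 n I φ (stdSimp n) t with hD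
    have hinj : Injective D := hK.immersive n v hv t ht
    have h1 := frameDet_eq o (φ t) D
    rw [hs]
    simp only
    rw [sign_ne_zero]
    refine fun h0 => ?_
    have h2 := h1.symm.trans h0
    rcases mul_eq_zero.1 h2 with h3 | h3
    · rcases Int.units_eq_one_or (o.sgn (φ t)) with h4 | h4 <;> simp [h4] at h3
    · have h5 : Injective ((((𝓔 n : _ →L[ℝ] (Fin n → ℝ))).comp D :
          (Fin n → ℝ) →L[ℝ] (Fin n → ℝ)) : (Fin n → ℝ) →ₗ[ℝ] (Fin n → ℝ)) :=
        (𝓔 n).injective.comp hinj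
      exact (((LinearMap.isUnit_iff_ker_eq_bot _).2 (LinearMap.ker_eq_bot.2 h5)).map
        LinearMap.det).ne_zero h3
  have hc : ContinuousOn s (stdSimp n) := by
    intro t ht
    set x₀ := φ t with hx₀
    have hsrc : x₀ ∈ (chartAt H x₀).source := mem_chart_source H x₀
    have hcd := contDiffWithinAt_coord (hsm t ht) hsrc
    have hcont : ContinuousWithinAt (fun t' => sign (((o.sgn x₀ : ℤ) : ℝ) *
        (fderivWithin ℝ (coord I x₀ ∘ φ) (stdSimp n) t').det)) (stdSimp n) t := by
      have h1 : ContinuousWithinAt (fun t' => ((o.sgn x₀ : ℤ) : ℝ) *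
          (fderivWithin ℝ (coord I x₀ ∘ φ) (stdSimp n) t').det) (stdSimp n) t := by
        refine continuousWithinAt_const.mul ?_
        exact ContinuousLinearMap.continuous_det.continuousAt.comp_continuousWithinAt
          (hcd.fderivWithin_right (m := ∞) (uniqueDiffOn_stdSimp n) (by simp) ht).continuousWithinAt
      refine (continuousAt_sign_of_ne_zero ?_).comp_continuousWithinAt h1
      have h2 := hne t ht
      rw [hs] at h2
      simp only at h2
      rw [frameDet_coord o (uniqueDiffOn_stdSimp n t ht)
        ((hsm t ht).mdifferentiableWithinAt (by simp)) hsrc (o.locally_constant x₀).self_of_nhds,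
        sign_ne_zero] at h2
      exact h2
    refine hcont.congr_of_eventuallyEq ?_ ?_
    · filter_upwards [(hsm t ht).continuousWithinAt (o.locally_constant x₀),
        (hsm t ht).continuousWithinAt ((chartAt H x₀).open_source.mem_nhds hsrc),
        self_mem_nhdsWithin] with t' h1 h2 h3
      exact frameDet_coord o (uniqueDiffOn_stdSimp n t' h3)
        ((hsm t' h3).mdifferentiableWithinAt (by simp)) h2 h1
    · exact frameDet_coord o (uniqueDiffOn_stdSimp n t ht)
        ((hsm t ht).mdifferentiableWithinAt (by simp)) hsrc (o.locally_constant x₀).self_of_nhds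
  have hconst : s t = s (stdBary n) :=
    (convex_stdSimp n).isPreconnected.constant hc ht (openSimp_subset n (stdBary_mem n))
  refine ⟨congrArg _ hconst, fun h0 => hne (stdBary n) (openSimp_subset n (stdBary_mem n)) ?_⟩
  have h1 : ((s (stdBary n) : SignType) : ℤ) = 0 := h0
  generalize s (stdBary n) = z at h1
  revert h1
  cases z <;> simp

/-- The orientation sign of a simplex, computed in any chart. -/
lemma orientSign_eq_coord (hK : IsSmoothTriangulation I P h K) {v : Fin (n + 1) → V}
    (hv : v ∈ ordS K n) {t : Fin n → ℝ} (ht : t ∈ stdSimp n) {x₀ : N}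
    (hx : h (ρ v t) ∈ (chartAt H x₀).source) (ho : 0 < (((o.sgn x₀ * o.sgn (h (ρ v t)) : ℤˣ) : ℤ) :
    ℝ) * (tangentCoordChange I (h (ρ v t)) x₀ (h (ρ v t))).det) : orientSign o h v = (sign (((o.sgn
    x₀ : ℤ) : ℝ) * (fderivWithin ℝ (coord I x₀ ∘ h ∘ ρ v) (stdSimp n) t).det) : ℤ) := by
  rw [← (sign_frameDet_eq o hK hv ht).1]
  exact congrArg _ (frameDet_coord o (φ := h ∘ ρ v) (uniqueDiffOn_stdSimp n t ht)
    ((hK.smooth n v hv t ht).mdifferentiableWithinAt (by simp)) hx ho)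

/-- The orientation sign of a subsimplex of the same dimension. -/
lemma orientSign_comp (hK : IsSmoothTriangulation I P h K) {v : Fin (n + 1) → V}
    (hv : v ∈ ordS K n) {b : Fin (n + 1) → Fin n → ℝ} (hb : ∀ i, b i ∈ stdSimp n) :
    orientSign o h (ρ v ∘ b) = (sign (baryDet b) : ℤ) * orientSign o h v := by
  set t := ρ b (stdBary n) with ht
  have hmaps := mapsTo_simplexParam_comp b hb
  have hbary := openSimp_subset n (stdBary_mem n)
  have hts : t ∈ stdSimp n := hmaps hbary
  have hpt : ρ (ρ v ∘ b) (stdBary n) = ρ v t := (simplexParam_comp v b (stdBary n)).symm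
  have hfun : h ∘ ρ (ρ v ∘ b) = (h ∘ ρ v) ∘ ρ b := by
    funext s
    exact congrArg h (simplexParam_comp v b s).symm
  have hD : mfderivWithin 𝓜 n I ((h ∘ ρ v) ∘ ρ b) (stdSimp n)
      (stdBary n) = (mfderivWithin 𝓜 n I (h ∘ ρ v) (stdSimp n) t).comp
        (paramLin b) :=
    ((((hK.smooth n v hv t hts).mdifferentiableWithinAt (by simp)).hasMFDerivWithinAt.comp
      (stdBary n) (hasFDerivAt_simplexParam b _).hasMFDerivAt.hasMFDerivWithinAt
        hmaps).mfderivWithin (uniqueDiffOn_stdSimp n _ hbary).uniqueMDiffWithinAt)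
  rw [← (sign_frameDet_eq o hK hv hts).1]
  unfold orientSign
  set D : (Fin n → ℝ) →L[ℝ] 𝔼 n := mfderivWithin 𝓜 n I (h ∘ ρ v) (stdSimp n) t with hDdef
  have h1 : o.frameDet (h (ρ (ρ v ∘ b) (stdBary n))) (fun i =>
      mfderivWithin 𝓜 n I (h ∘ ρ (ρ v ∘ b)) (stdSimp n)
        (stdBary n) (single i 1)) =
      o.frameDet (h (ρ v t)) (fun i => (D.comp (paramLin b)) (single i 1)) := by
    have key : ∀ (y : N) (g : (Fin n → ℝ) → N) (L : (Fin n → ℝ) →L[ℝ] 𝔼 n),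
        y = h (ρ v t) → g = (h ∘ ρ v) ∘ ρ b →
        o.frameDet y (fun i => (mfderivWithin 𝓜 n I g (stdSimp n)
          (stdBary n) : (Fin n → ℝ) →L[ℝ] 𝔼 n) (single i 1)) =
        o.frameDet (h (ρ v t)) (fun i => (mfderivWithin 𝓜 n I ((h ∘ ρ v) ∘ ρ b) (stdSimp n)
          (stdBary n) : (Fin n → ℝ) →L[ℝ] 𝔼 n) (single i 1)) := by
      rintro y g L rfl rfl; rfl
    refine (key _ _ D (congrArg h hpt) hfun).trans ?_
    rw [hD]
    rfl
  refine (congrArg (fun z => (sign z : ℤ)) h1).trans ?_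
  have h2 := frameDet_eq o (h (ρ v t)) D
  have h3 := frameDet_eq o (h (ρ v t)) (D.comp (paramLin b))
  have h4 : (((𝓔 n : _ →L[ℝ] (Fin n → ℝ))).comp (D.comp (paramLin b))).det = (((𝓔 n :
        _ →L[ℝ] (Fin n → ℝ))).comp D).det * (paramLin b).det :=
    LinearMap.det_comp ((((𝓔 n : _ →L[ℝ] (Fin n → ℝ))).comp D :
      (Fin n → ℝ) →L[ℝ] (Fin n → ℝ)) : (Fin n → ℝ) →ₗ[ℝ] (Fin n → ℝ)) (paramLin b)
  refine (congrArg (fun z => (sign z : ℤ)) h3).trans ?_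
  refine Eq.trans ?_ (congrArg (fun z => (sign (baryDet b) : ℤ) * (sign z : ℤ)) h2.symm)
  rw [h4, det_paramLin]
  simp only [sign_mul, SignType.coe_mul]
  ring

lemma orientSign_perm (hK : IsSmoothTriangulation I P h K) {v : Fin (n + 1) → V} (hv : v ∈ ordS K n)
    (π : Perm (Fin (n + 1))) : orientSign o h (v ∘ π) = (Perm.sign π : ℤ) * orientSign o h v := by
  have h1 := orientSign_comp o hK hv (b := stdVert n ∘ π) (fun i => by
    rw [stdSimp_eq_convexHull]; exact subset_convexHull ℝ _ (mem_range_self _))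
  rw [simplexParam_comp_stdVert, baryDet_perm, baryDet_stdVert, mul_one] at h1
  rw [h1]
  rcases Int.units_eq_one_or (Perm.sign π) with h2 | h2 <;> simp [h2]

open scoped Classical in
/-- The orientation signs as a chain on all tuples. -/
def orientChain (K : Cpx V) (h : V → N) (v : Fin (n + 1) → V) : ℤ :=
  if v ∈ ordS K n then orientSign o h v else 0

lemma orientChain_of_mem {v : Fin (n + 1) → V} (hv : v ∈ ordS K n) :
    orientChain o K h v = orientSign o h v := if_pos hv

lemma orientChain_perm (hK : IsSmoothTriangulation I P h K) (π : Perm (Fin (n + 1)))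
    (v : Fin (n + 1) → V) : orientChain o K h (v ∘ π) = (Perm.sign π : ℤ) * orientChain o K h v :=
    by
  unfold orientChain
  by_cases hv : v ∈ ordS K n
  · rw [if_pos hv, if_pos (orderedSimplices_comp_perm π hv), orientSign_perm o hK hv]
  · rw [if_neg hv, if_neg (fun h' => hv ?_), mul_zero]
    have := orderedSimplices_comp_perm π.symm h'
    rwa [Function.comp_assoc, Equiv.self_comp_symm, Function.comp_id] at this

omit [IsManifold I ∞ N] in
lemma IsSmoothTriangulation.card_le (hK : IsSmoothTriangulation I P h K) {s : Finset V}
    (hs : s ∈ K.faces) : s.card ≤ n + 1 := by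
  obtain ⟨p, hp, v, hv, rfl⟩ := exists_ordering_of_mem hs
  set D : (Fin p → ℝ) →L[ℝ] 𝔼 n := mfderivWithin 𝓜 p I (h ∘ ρ v) (stdSimp p) (stdBary p)
  have hinj : Injective (D : (Fin p → ℝ) →ₗ[ℝ] 𝔼 n) :=
    hK.immersive p v ⟨hv, hs⟩ (stdBary p) (openSimp_subset p (stdBary_mem p))
  have := LinearMap.finrank_le_finrank_of_injective hinj
  simp at this
  omega

end OrientSign

section ChartBump

variable (I) in
/-- Two nested bump functions in the preferred chart around `x₀`. -/
structure ChartBump (x₀ : N) (W : Set N) where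
  /-- the outer bump function -/
  out : SmoothBumpFunction I x₀
  /-- the inner bump function -/
  inn : SmoothBumpFunction I x₀
  lt : inn.rOut < out.rIn
  sub : (extChartAt I x₀).symm '' (Metric.closedBall (extChartAt I x₀ x₀) inn.rOut ∩ range I) ⊆ W

lemma exists_chartBump {x₀ : N} {W : Set N} (hW : W ∈ 𝓝 x₀) {R : ℝ} (hR : 0 < R) :
    ∃ B : ChartBump I x₀ W, B.inn.rOut < R := by
  have h1 : (extChartAt I x₀).symm ⁻¹' W ∈ 𝓝[range I] (extChartAt I x₀ x₀) := by
    refine mem_nhdsWithin_of_mem_nhds (continuousAt_extChartAt_symm x₀ ?_)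
    rwa [extChartAt_to_inv]
  obtain ⟨f, -, hf⟩ := (SmoothBumpFunction.nhdsWithin_range_basis (I := I) (c := x₀)).mem_iff.1 h1
  set r := min (f.rIn / 2) (R / 2) with hr
  have hr0 : 0 < r := lt_min (by linarith [f.rIn_pos]) (by linarith)
  have hr1 : r < f.rIn := (min_le_left _ _).trans_lt (by linarith [f.rIn_pos])
  have hr2 : r < R := (min_le_right _ _).trans_lt (by linarith)
  have hsub : Metric.closedBall (extChartAt I x₀ x₀) r ∩ range I ⊆
      Metric.closedBall (extChartAt I x₀ x₀) f.rOut ∩ range I :=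
    inter_subset_inter_left _ (Metric.closedBall_subset_closedBall (by linarith [f.rIn_lt_rOut]))
  exact ⟨⟨f, ⟨⟨r / 2, r, by linarith, by linarith⟩, hsub.trans f.closedBall_subset⟩, hr1,
    image_subset_iff.2 (hsub.trans hf)⟩, hr2⟩

namespace ChartBump

variable {x₀ : N} {W : Set N} (B : ChartBump I x₀ W)

/-- The compact set that carries the inner bump function. -/
def carrier : Set N :=
  (extChartAt I x₀).symm '' (Metric.closedBall (extChartAt I x₀ x₀) B.inn.rOut ∩ range I)

/-- The chart, cut off outside the carrier. -/
def map (y : N) : Fin n → ℝ := 𝓔 n (B.out y • extChartAt I x₀ y)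

/-- The inner bump function in the chart. -/
def fn (y : Fin n → ℝ) : ℝ := B.inn.toContDiffBump ((𝓔 n).symm y)

/-- The image of the carrier in the chart. -/
def img : Set (Fin n → ℝ) := 𝓔 n ''
  (Metric.closedBall (extChartAt I x₀ x₀) B.inn.rOut ∩ range I)

lemma mem_carrier {y : N} : y ∈ B.carrier ↔ y ∈ (chartAt H x₀).source ∧
    dist (extChartAt I x₀ y) (extChartAt I x₀ x₀) ≤ B.inn.rOut := by
  constructor
  · rintro ⟨z, hz, rfl⟩
    have := B.inn.closedBall_subset hz
    refine ⟨by rw [← extChartAt_source I]; exact (extChartAt I x₀).map_target this, ?_⟩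
    rw [(extChartAt I x₀).right_inv this]
    exact hz.1
  · rintro ⟨h1, h2⟩
    refine ⟨extChartAt I x₀ y, ⟨h2, ?_⟩, (extChartAt I x₀).left_inv (by rwa [extChartAt_source])⟩
    rw [extChartAt_coe]
    exact mem_range_self _

lemma coord_image : coord I x₀ '' B.carrier = B.img := by
  unfold carrier img
  rw [image_image]
  refine image_congr fun z hz => ?_
  rw [coord, (extChartAt I x₀).right_inv (B.inn.closedBall_subset hz)]

lemma isCompact_img : IsCompact B.img :=
  ((isCompact_closedBall _ _).inter_right I.isClosed_range).image
    (𝓔 n).continuous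

lemma map_eventuallyEq {y : N} (hy : y ∈ B.carrier) : B.map =ᶠ[𝓝 y] coord I x₀ := by
  have := B.mem_carrier.1 hy
  filter_upwards [B.out.eventuallyEq_one_of_dist_lt this.1 (this.2.trans_lt B.lt)] with z hz
  simp [map, coord, hz]

lemma map_image : B.map '' B.carrier = B.img := by
  rw [← coord_image]
  exact image_congr fun y hy => (B.map_eventuallyEq hy).self_of_nhds

lemma map_injOn : InjOn B.map B.carrier := by
  intro y hy z hz h
  rw [(B.map_eventuallyEq hy).self_of_nhds, (B.map_eventuallyEq hz).self_of_nhds] at h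
  exact coord_injOn x₀ (B.mem_carrier.1 hy).1 (B.mem_carrier.1 hz).1 h

lemma inn_eq_of_mem_source {y : N} (hy : y ∈ (chartAt H x₀).source) :
    B.inn y = B.fn (coord I x₀ y) := by
  rw [B.inn.eqOn_source hy]
  simp [fn, coord]

lemma inn_eventuallyEq {y : N} (hy : y ∈ B.carrier) : B.inn =ᶠ[𝓝 y] B.fn ∘ B.map := by
  filter_upwards [B.map_eventuallyEq hy,
    (chartAt H x₀).open_source.mem_nhds (B.mem_carrier.1 hy).1] with z hz hz'
  rw [B.inn_eq_of_mem_source hz', comp_apply, hz]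

lemma contDiff_fn : ContDiff ℝ ∞ B.fn := B.inn.toContDiffBump.contDiff.comp (𝓔 n).symm.contDiff

lemma fn_nonneg (y : Fin n → ℝ) : 0 ≤ B.fn y := B.inn.toContDiffBump.nonneg

lemma fn_eq_zero {y : Fin n → ℝ} (hy : y ∉ 𝓔 n '' Metric.closedBall (extChartAt I x₀ x₀) B.inn.rOut)
    : B.fn y = 0 := by
  refine B.inn.toContDiffBump.zero_of_le_dist (le_of_not_ge fun h => hy ?_)
  exact ⟨_, h, (𝓔 n).apply_symm_apply y⟩

lemma isCompact_image_closedBall : IsCompact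
    (𝓔 n '' Metric.closedBall (extChartAt I x₀ x₀) B.inn.rOut) :=
  (isCompact_closedBall _ _).image (𝓔 n).continuous

lemma hasCompactSupport_fn : HasCompactSupport B.fn :=
  .intro B.isCompact_image_closedBall fun _ hy => B.fn_eq_zero hy

lemma fderiv_fn_eq_zero {y : Fin n → ℝ}
    (hy : y ∉ 𝓔 n '' Metric.closedBall (extChartAt I x₀ x₀) B.inn.rOut) : fderiv ℝ B.fn y = 0 := by
  have h1 : B.fn =ᶠ[𝓝 y] fun _ => 0 := by
    filter_upwards [B.isCompact_image_closedBall.isClosed.isOpen_compl.mem_nhds hy] with z hz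
    exact B.fn_eq_zero hz
  rw [h1.fderiv_eq]
  simp

lemma integral_img (s : Set (Fin n → ℝ)) (hs : s = 𝓔 n '' range I) (x : Fin n → ℝ) : ∫ y in B.img,
    fderiv ℝ B.fn y x = ∫ y in s, fderiv ℝ B.fn y x := by
  symm
  have h1 : B.img ⊆ s := by
    rw [hs]; exact image_mono inter_subset_right
  refine setIntegral_eq_of_subset_of_forall_sdiff_eq_zero (hs ▸ ?_) h1 ?_
  · exact ((𝓔 n).toHomeomorph.isClosedMap _ I.isClosed_range).measurableSet
  · rintro y ⟨hy1, hy2⟩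
    rw [B.fderiv_fn_eq_zero]
    · rfl
    · rintro ⟨z, hz, rfl⟩
      rw [hs] at hy1
      obtain ⟨z', hz', h2⟩ := hy1
      rw [(𝓔 n).injective h2] at hz'
      exact hy2 ⟨z, ⟨hz, hz'⟩, rfl⟩

section T2

variable [T2Space N]

lemma inn_eq_zero {y : N} (hy : y ∉ B.carrier) : B.inn y = 0 := by
  by_contra h
  exact hy (B.inn.tsupport_subset_symm_image_closedBall (subset_tsupport _ h))

lemma isClosed_carrier : IsClosed B.carrier := B.inn.isClosed_symm_image_closedBall

lemma inn_eventuallyEq_zero {y : N} (hy : y ∉ B.carrier) : B.inn =ᶠ[𝓝 y] 0 := by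
  filter_upwards [B.isClosed_carrier.isOpen_compl.mem_nhds hy] with z hz
  exact B.inn_eq_zero hz

variable [IsManifold I ∞ N]

lemma contMDiff_map : ContMDiff I 𝓜 n ∞ B.map := by
  have h1 : ContMDiff I 𝓘(ℝ, 𝔼 n) ∞ fun y => B.out y • extChartAt I x₀ y :=
    B.out.contMDiff_smul contMDiffOn_extChartAt
  exact (𝓔 n).contDiff.contMDiff.comp h1

end T2

end ChartBump

end ChartBump

section ChartStokes

variable {m : ℕ} {I : ModelWithCorners ℝ 𝔼 (m + 1) H} [IsManifold I ∞ N]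
  [T2Space N] (o : ManifoldOrientation I N) {x₀ : N} {W : Set N} (B : ChartBump I x₀ W)

lemma contrForm_eq_det (j : Fin (m + 1)) (v : Fin m → Fin (m + 1) → ℝ) :
    contrForm j v = (-1) ^ (j : ℕ) * (Matrix.of fun k l => v l (j.succAbove k)).det := by
  rw [contrForm_apply, detForm_apply, Matrix.det_succ_column_zero, sum_eq_single j]
  · simp only [Matrix.of_apply, Matrix.cons_val_zero, Pi.single_eq_same, mul_one]
    rfl
  · intro i _ hi
    simp [hi]
  · simp

/-- The chart of a pair of bump functions with the `j`-th coordinate replaced by the inner bump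
function. -/
def ChartBump.mod (j : Fin (m + 1)) (h : V → N) (x : V) : Fin (m + 1) → ℝ :=
  Function.update (B.map (h x)) j (B.inn (h x))

lemma ChartBump.smooth_mod (j : Fin (m + 1)) {p : ℕ} {v : Fin (p + 1) → V}
    (hv : ContMDiffOn 𝓜 p I ∞ (h ∘ ρ v) (stdSimp p)) : SmoothOnSimplex (E := Fin (m + 1) → ℝ)
    (B.mod j h) v := by
  have h1 : ContMDiff I 𝓜 (m + 1) ∞
      (fun y => Function.update (B.map y) j (B.inn y)) := by
    rw [contMDiff_pi_space]
    intro i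
    by_cases hi : i = j
    · subst hi
      simpa using B.inn.contMDiff
    · simpa [hi] using contMDiff_pi_space.1 B.contMDiff_map i
  exact h1.comp_contMDiffOn hv

lemma ChartBump.contDiffOn_map {p : ℕ} {v : Fin (p + 1) → V}
    (hv : ContMDiffOn 𝓜 p I ∞ (h ∘ ρ v) (stdSimp p)) : ContDiffOn ℝ ∞ ((B.map ∘ h) ∘ ρ v)
    (stdSimp p) :=
  contMDiffOn_iff_contDiffOn.1 (B.contMDiff_map.comp_contMDiffOn hv)

/-- The integral of the test form over a simplex of codimension one. -/
lemma ChartBump.simplexIntegral_mod (j : Fin (m + 1)) {w : Fin (m + 1) → V}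
    (hw : ContMDiffOn 𝓜 m I ∞ (h ∘ ρ w) (stdSimp m)) : simplexIntegral (B.mod j h) w (coordForm j) =
    (-1) ^ (j : ℕ) * ∫ t in stdSimp m, B.inn (h (ρ w t)) *
    (fderivWithin ℝ (fun t k => B.map (h (ρ w t)) (j.succAbove k)) (stdSimp m) t).det := by
  rw [simplexIntegral, ← integral_const_mul]
  refine setIntegral_congr_fun (measurableSet_stdSimp m) fun t ht => ?_
  have hsm : DifferentiableWithinAt ℝ (B.mod j h ∘ ρ w) (stdSimp m) t :=
    (contMDiffOn_iff_contDiffOn.1 (B.smooth_mod j hw)).differentiableOn (by simp) t ht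
  set D := fderivWithin ℝ (B.mod j h ∘ ρ w) (stdSimp m) t with hD
  have h1 : (coordForm j (B.mod j h (ρ w t)) fun i =>
      mfderivWithin 𝓜 m 𝓜 (m + 1) (B.mod j h ∘ ρ w)
        (stdSimp m) t (single i 1)) =
      B.mod j h (ρ w t) j * contrForm j (fun i => D (single i 1)) := by
    rw [mfderivWithin_eq_fderivWithin]
    rfl
  refine h1.trans ?_
  have h2 : (fun t k => B.map (h (ρ w t)) (j.succAbove k)) =
      fun t k => (B.mod j h ∘ ρ w) t (j.succAbove k) := by
    funext t k
    simp [ChartBump.mod, Fin.succAbove_ne]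
  have h3 : fderivWithin ℝ (fun t k => B.map (h (ρ w t)) (j.succAbove k))
      (stdSimp m) t = ContinuousLinearMap.pi fun k =>
        (pr (m + 1) (j.succAbove k)).comp D := by
    rw [h2]
    refine HasFDerivWithinAt.fderivWithin ?_ (uniqueDiffOn_stdSimp m t ht)
    rw [hasFDerivWithinAt_pi]
    intro k
    exact (pr (m + 1) (j.succAbove k)).hasFDerivAt.comp_hasFDerivWithinAt t hsm.hasFDerivWithinAt
  rw [h3, contrForm_eq_det, ← detForm_comp, detForm_apply]
  have h4 : B.mod j h (ρ w t) j = B.inn (h (ρ w t)) := by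
    simp [ChartBump.mod]
  rw [h4]
  simp only [ContinuousLinearMap.pi_apply, ContinuousLinearMap.comp_apply,
    ContinuousLinearMap.proj_apply]
  ring

lemma ChartBump.det_mod (j : Fin (m + 1)) {v : Fin (m + 2) → V}
    (hv : ContMDiffOn 𝓜 (m + 1) I ∞ (h ∘ ρ v) (stdSimp (m + 1))) {t : Fin (m + 1) → ℝ}
    (ht : t ∈ stdSimp (m + 1)) : (fderivWithin ℝ (B.mod j h ∘ ρ v) (stdSimp (m + 1)) t).det =
    (ρ v ⁻¹' (h ⁻¹' B.carrier)).indicator (fun t => (fderivWithin ℝ ((B.map ∘ h) ∘ ρ v) (stdSimp (m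
    + 1)) t).det * fderiv ℝ B.fn ((B.map ∘ h) (ρ v t)) (single j 1)) t := by
  have hsm : DifferentiableWithinAt ℝ (B.mod j h ∘ ρ v) (stdSimp (m + 1)) t :=
    (contMDiffOn_iff_contDiffOn.1 (B.smooth_mod j hv)).differentiableOn (by simp) t ht
  have hcont := hv.continuousOn.continuousWithinAt ht
  have hu := uniqueDiffOn_stdSimp (m + 1) t ht
  by_cases hC : h (ρ v t) ∈ B.carrier
  · rw [indicator_of_mem (show t ∈ ρ v ⁻¹' (h ⁻¹' B.carrier) from hC)]
    set F := (B.map ∘ h) ∘ ρ v with hFdef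
    set y := F t with hy
    set l := fderiv ℝ B.fn y with hl
    have hF : HasFDerivWithinAt F (fderivWithin ℝ F (stdSimp (m + 1)) t) (stdSimp (m + 1)) t :=
      ((B.contDiffOn_map hv).differentiableOn (by simp) t ht).hasFDerivWithinAt
    set L : (Fin (m + 1) → ℝ) →L[ℝ] (Fin (m + 1) → ℝ) := ContinuousLinearMap.pi
      (Function.update (fun i => pr (m + 1) i) j l) with hL
    have hLu : ∀ x, L x = Function.update x j (l x) := by
      intro x
      funext i
      by_cases hi : i = j
      · subst hi; simp [hL]
      · simp [hL, hi]
    have hΦ : HasFDerivAt (fun z : Fin (m + 1) → ℝ => Function.update z j (B.fn z)) L y := by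
      rw [hasFDerivAt_pi']
      intro i
      by_cases hi : i = j
      · subst hi
        simpa [hL] using ((B.contDiff_fn.differentiable (by simp)) y).hasFDerivAt
      · have : (pr (m + 1) i).comp L =
            pr (m + 1) i := by
          ext x; simp [hL, hi]
        rw [this]
        simp only [Function.update_of_ne hi]
        exact (pr (m + 1) i).hasFDerivAt
    have h1 : fderivWithin ℝ (B.mod j h ∘ ρ v) (stdSimp (m + 1)) t =
        L.comp (fderivWithin ℝ F (stdSimp (m + 1)) t) := by
      refine HasFDerivWithinAt.fderivWithin ?_ hu
      refine (hΦ.comp_hasFDerivWithinAt t hF).congr_of_eventuallyEq ?_ ?_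
      · filter_upwards [hcont (B.inn_eventuallyEq hC)] with t' ht'
        have : B.inn (h (ρ v t')) = B.fn (B.map (h (ρ v t'))) := ht'
        simp only [comp_apply, ChartBump.mod, this, hFdef]
      · have : B.inn (h (ρ v t)) = B.fn (B.map (h (ρ v t))) := (B.inn_eventuallyEq hC).self_of_nhds
        simp only [comp_apply, ChartBump.mod, this, hFdef]
    rw [h1]
    calc (L.comp (fderivWithin ℝ F (stdSimp (m + 1)) t)).det =
        L.det * (fderivWithin ℝ F (stdSimp (m + 1)) t).det := LinearMap.det_comp _ _
      _ = _ := by rw [det_update_proj j L l hLu, mul_comm]; rfl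
  · rw [indicator_of_notMem (show t ∉ ρ v ⁻¹' (h ⁻¹' B.carrier) from hC)]
    refine det_of_row_eq_zero j _ fun x => ?_
    have h1 : HasFDerivWithinAt (fun t => (B.mod j h ∘ ρ v) t j)
        ((pr (m + 1) j).comp
          (fderivWithin ℝ (B.mod j h ∘ ρ v) (stdSimp (m + 1)) t)) (stdSimp (m + 1)) t :=
      (pr (m + 1) j).hasFDerivAt.comp_hasFDerivWithinAt t hsm.hasFDerivWithinAt
    have h2 : HasFDerivWithinAt (fun t => (B.mod j h ∘ ρ v) t j)
        (0 : (Fin (m + 1) → ℝ) →L[ℝ] ℝ) (stdSimp (m + 1)) t := by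
      refine (hasFDerivWithinAt_const (0 : ℝ) t _).congr_of_eventuallyEq ?_ ?_
      · filter_upwards [hcont (B.inn_eventuallyEq_zero hC)] with t' ht'
        have : B.inn (h (ρ v t')) = 0 := ht'
        simp [ChartBump.mod, this]
      · have : B.inn (h (ρ v t)) = 0 := B.inn_eq_zero hC
        simp [ChartBump.mod, this]
    exact congrArg (fun l : (Fin (m + 1) → ℝ) →L[ℝ] ℝ => l x) (hu.eq h1 h2)

/-- Stokes' theorem for a form supported in a chart of a triangulated manifold, with the boundary
terms collected by simplices. -/
theorem chart_stokes (hK : IsSmoothTriangulation I P h K) {T : Finset V} (hT : ∀ s ∈ K.faces, s ⊆ T)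
    (hW : ∀ y ∈ W, 0 < (((o.sgn x₀ * o.sgn y : ℤˣ) : ℤ) : ℝ) * (tangentCoordChange I y x₀ y).det)
    (j : Fin (m + 1)) : ∑ w ∈ tup T (m + 1), ((∑ x ∈ T, orientChain o K h (cons x w) : ℤ) : ℝ) *
    simplexIntegral (B.mod j h) w (coordForm j) = coordConst j * ((o.sgn x₀ : ℤ) : ℝ) *
    ((m + 1).factorial : ℝ) * ∫ y in B.img, fderiv ℝ B.fn y (single j 1) := by
  classical
  have hbij := hK.bijOn
  have hsp := hK.space_eq
  have hFQ : (B.map ∘ h) '' (K.space ∩ h ⁻¹' B.carrier) = B.img := by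
    rw [image_comp, image_inter_preimage, hsp, hbij.image_eq, univ_inter, B.map_image]
  have h1 := sum_mul_alternating_faces (T := T) (fun v => ((orientChain o K h v : ℤ) : ℝ))
    (fun π v => by rw [orientChain_perm o hK]; push_cast; ring)
    (fun w => simplexIntegral (B.mod j h) w (coordForm j))
  have h2 : ∀ v ∈ tup T (m + 2), ((orientChain o K h v : ℤ) : ℝ) *
      ∑ k : Fin (m + 2), (-1 : ℝ) ^ (k : ℕ) *
        simplexIntegral (B.mod j h) (v ∘ k.succAbove) (coordForm j) =
      coordConst j * (if v ∈ ordS K (m + 1) then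
        ((orientChain o K h v : ℤ) : ℝ) * ∫ t in stdSimp (m + 1) ∩ ρ v ⁻¹' (h ⁻¹' B.carrier),
        (fderivWithin ℝ ((B.map ∘ h) ∘ ρ v) (stdSimp (m + 1)) t).det *
          fderiv ℝ B.fn ((B.map ∘ h) (ρ v t)) (single j 1) else 0) := by
    intro v _
    split_ifs with hv
    · have hsm := hK.smooth (m + 1) v hv
      rw [← simplexIntegral_d (B.smooth_mod j hsm) isOpen_univ (mapsTo_univ _ _)
        (coordForm_smoothOn j), mul_left_comm]
      congr 1
      have hmeas : MeasurableSet (stdSimp (m + 1) ∩ ρ v ⁻¹' (h ⁻¹' B.carrier)) :=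
        (hsm.continuousOn.preimage_isClosed_of_isClosed (isCompact_stdSimp _).isClosed
          B.isClosed_carrier).measurableSet
      have h3 : ∫ t in stdSimp (m + 1) ∩ ρ v ⁻¹' (h ⁻¹' B.carrier),
          (fderivWithin ℝ ((B.map ∘ h) ∘ ρ v) (stdSimp (m + 1)) t).det *
          fderiv ℝ B.fn ((B.map ∘ h) (ρ v t)) (single j 1) =
          ∫ t in stdSimp (m + 1), (fderivWithin ℝ (B.mod j h ∘ ρ v) (stdSimp (m + 1)) t).det := by
        rw [← integral_indicator hmeas, ← integral_indicator (measurableSet_stdSimp _)]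
        congr 1
        funext t
        by_cases ht : t ∈ stdSimp (m + 1)
        · rw [indicator_of_mem ht, B.det_mod j hsm ht]
          by_cases hC : t ∈ ρ v ⁻¹' (h ⁻¹' B.carrier)
          · rw [indicator_of_mem hC, indicator_of_mem (show t ∈ stdSimp (m + 1) ∩
              ρ v ⁻¹' (h ⁻¹' B.carrier) from ⟨ht, hC⟩)]
          · rw [indicator_of_notMem hC, indicator_of_notMem (fun h' => hC h'.2)]
        · rw [indicator_of_notMem ht, indicator_of_notMem (fun h' => ht h'.1)]
      rw [h3, ← integral_const_mul, simplexIntegral]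
      refine setIntegral_congr_fun (measurableSet_stdSimp _) fun t _ => ?_
      rw [mfderivWithin_eq_fderivWithin, mul_comm]
      have h4 := coordForm_d j (B.mod j h (ρ v t))
      refine (congrArg (fun α : (Fin (m + 1) → ℝ) [⋀^Fin (m + 1)]→L[ℝ] ℝ => α fun i =>
        fderivWithin ℝ (B.mod j h ∘ ρ v) (stdSimp (m + 1)) t (single i 1)) h4).trans ?_
      exact alternating_comp_eq_det (coordVol j) _
    · rw [orientChain, if_neg hv]; simp
  rw [sum_congr rfl h2, ← mul_sum,
    sum_orient_integral (σ := ((o.sgn x₀ : ℤ) : ℝ)) hK.finite hT (fun s hs => hK.card_le hs) ?_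
      (fun p v hv => B.contDiffOn_map (hK.smooth p v hv)) (fun p v hv => ?_) ?_
      (θ := fun y => fderiv ℝ B.fn y (single j 1)) ?_, hFQ] at h1
  · have h5 : ((m + 1 : ℕ) : ℝ) + 1 ≠ 0 := by positivity
    have h6 : ((m + 1 + 1).factorial : ℝ) = (((m + 1 : ℕ) : ℝ) + 1) * ((m + 1).factorial : ℝ) := by
      rw [Nat.factorial_succ]; push_cast; ring
    rw [h6] at h1
    have h7 : (((m + 1 : ℕ) : ℝ) + 1) * (coordConst j * ((o.sgn x₀ : ℤ) : ℝ) * ((m + 1).factorial : ℝ) *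
        ∫ y in B.img, fderiv ℝ B.fn y (single j 1)) = (((m + 1 : ℕ) : ℝ) + 1) *
        ∑ w ∈ tup T (m + 1), (∑ x ∈ T, ((orientChain o K h (cons x w) : ℤ) : ℝ)) *
          simplexIntegral (B.mod j h) w (coordForm j) := by
      rw [← h1]; ring
    push_cast
    exact (mul_left_cancel₀ h5 h7).symm
  · refine B.map_injOn.comp (hbij.injOn.mono ?_) (fun x hx => hx.2)
    rw [← hsp]
    exact inter_subset_left
  · intro v hv t ht hC
    have hC' : h (ρ v t) ∈ B.carrier := hC
    have h3 := orientSign_eq_coord o hK hv ht (x₀ := x₀) (B.mem_carrier.1 hC').1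
      (hW _ (B.sub hC'))
    have h4 : fderivWithin ℝ ((B.map ∘ h) ∘ ρ v) (stdSimp (m + 1)) t =
        fderivWithin ℝ (coord I x₀ ∘ h ∘ ρ v) (stdSimp (m + 1)) t := by
      refine Filter.EventuallyEq.fderivWithin_eq ?_ (B.map_eventuallyEq hC').self_of_nhds
      exact (hK.smooth _ v hv).continuousOn.continuousWithinAt ht (B.map_eventuallyEq hC')
    rw [orientChain_of_mem o hv, h3, h4]
    generalize (fderivWithin ℝ (coord I x₀ ∘ h ∘ ρ v) (stdSimp (m + 1)) t).det = d
    rcases Int.units_eq_one_or (o.sgn x₀) with h5 | h5 <;>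
      rcases lt_trichotomy d 0 with h6 | h6 | h6 <;>
      simp [h5, h6, abs_of_neg, abs_of_pos]
  · rw [hFQ]
    refine ContinuousOn.integrableOn_compact B.isCompact_img ?_
    exact ((B.contDiff_fn.continuous_fderiv (by simp)).clm_apply continuous_const).continuousOn
  · refine IsCompact.of_isClosed_subset (isCompact_stdSimp p) ?_ inter_subset_left
    exact (hK.smooth p v hv).continuousOn.preimage_isClosed_of_isClosed
      (isCompact_stdSimp _).isClosed B.isClosed_carrier

/-- The test form vanishes on simplices that avoid the carrier. -/
lemma ChartBump.simplexIntegral_mod_eq_zero (j : Fin (m + 1)) {w : Fin (m + 1) → V}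
    (hw : ∀ t ∈ stdSimp m, h (ρ w t) ∉ B.carrier) : simplexIntegral (B.mod j h) w (coordForm j) = 0
    := by
  refine simplexIntegral_eq_zero fun t ht => ?_
  have h1 : B.mod j h (ρ w t) j = 0 := by
    simp [ChartBump.mod, B.inn_eq_zero (hw t ht)]
  change (B.mod j h (ρ w t) j) • contrForm j = 0
  rw [h1, zero_smul]

end ChartStokes

section Flux

lemma hasDerivAt_insertNth {m : ℕ} (j : Fin (m + 1)) (s : Fin m → ℝ) (x : ℝ) :
    HasDerivAt (fun x : ℝ => (j.insertNth x s : Fin (m + 1) → ℝ)) (single j 1) x := by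
  rw [hasDerivAt_pi]
  intro i
  refine Fin.succAboveCases j ?_ (fun k => ?_) i
  · simpa using hasDerivAt_id' x
  · simpa using hasDerivAt_const x (s k)

lemma contDiff_insertNth {m : ℕ} (j : Fin (m + 1)) (s : Fin m → ℝ) :
    ContDiff ℝ ∞ (fun x : ℝ => (j.insertNth x s : Fin (m + 1) → ℝ)) := by
  rw [contDiff_pi]
  intro i
  refine Fin.succAboveCases j ?_ (fun k => ?_) i
  · simp only [Fin.insertNth_apply_same]
    exact contDiff_id
  · simpa using contDiff_const

lemma HasCompactSupport.insertNth {m : ℕ} (j : Fin (m + 1)) {u : (Fin (m + 1) → ℝ) → ℝ}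
    (hc : HasCompactSupport u) (s : Fin m → ℝ) : HasCompactSupport fun x : ℝ => u (j.insertNth x s)
    := by
  refine HasCompactSupport.of_support_subset_isCompact
    (K := (fun y : Fin (m + 1) → ℝ => y j) '' tsupport u)
    (hc.isCompact.image (continuous_apply j)) ?_
  intro x hx
  exact ⟨j.insertNth x s, subset_tsupport u hx, by simp⟩

lemma integral_fderiv_slab {m : ℕ} (j : Fin (m + 1)) {u : (Fin (m + 1) → ℝ) → ℝ}
    (hu : ContDiff ℝ ∞ u) (hc : HasCompactSupport u) {s : Set ℝ} (hs : MeasurableSet s) :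
    ∫ y in (fun y : Fin (m + 1) → ℝ => y j) ⁻¹' s, fderiv ℝ u y (single j 1) =
      ∫ y', ∫ x in s, deriv (fun x => u (j.insertNth x y')) x := by
  set f : (Fin (m + 1) → ℝ) → ℝ := fun y => fderiv ℝ u y (single j 1) with hf
  have hmeas : MeasurableSet ((fun y : Fin (m + 1) → ℝ => y j) ⁻¹' s) := measurable_pi_apply j hs
  have hfi : Integrable f := by
    refine Continuous.integrable_of_hasCompactSupport
      ((hu.continuous_fderiv (by simp)).clm_apply continuous_const) ?_
    exact (hc.fderiv (𝕜 := ℝ)).comp_left (g := fun L : (Fin (m + 1) → ℝ) →L[ℝ] ℝ =>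
      L (single j 1)) (by simp)
  rw [← integral_indicator hmeas]
  have hmp := (volume_preserving_piFinSuccAbove (fun _ : Fin (m + 1) => ℝ) j).symm
  rw [← hmp.integral_comp' (g := ((fun y : Fin (m + 1) → ℝ => y j) ⁻¹' s).indicator f),
    Measure.volume_eq_prod, integral_prod_symm]
  · congr 1
    ext y'
    rw [← integral_indicator hs]
    congr 1
    ext x
    have e : (MeasurableEquiv.piFinSuccAbove (fun _ => ℝ) j).symm (x, y') = j.insertNth x y' := rfl
    rw [e]
    by_cases hx : x ∈ s
    · rw [indicator_of_mem hx, indicator_of_mem (by simpa using hx)]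
      exact (((hu.differentiable (by simp) _).hasFDerivAt).comp_hasDerivAt x
        (hasDerivAt_insertNth j y' x)).deriv.symm
    · rw [indicator_of_notMem hx, indicator_of_notMem (by simpa using hx)]
  · exact (hmp.integrable_comp_emb (MeasurableEquiv.measurableEmbedding _)).2
      (hfi.indicator hmeas)

lemma integral_fderiv_eq_zero {m : ℕ} (j : Fin (m + 1)) {u : (Fin (m + 1) → ℝ) → ℝ}
    (hu : ContDiff ℝ ∞ u) (hc : HasCompactSupport u) : ∫ y, fderiv ℝ u y (single j 1) = 0 := by
  have h1 := integral_fderiv_slab j hu hc MeasurableSet.univ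
  rw [preimage_univ, setIntegral_univ] at h1
  rw [h1]
  refine integral_eq_zero_of_ae (.of_forall fun y' => ?_)
  have h2 : ContDiff ℝ 1 fun x : ℝ => u (j.insertNth x y') :=
    (hu.comp (contDiff_insertNth j y')).of_le (by simp)
  have h3 := HasCompactSupport.insertNth j hc y'
  have h4 := (h2.continuous_deriv le_rfl).integrable_of_hasCompactSupport (μ := volume) h3.deriv
  simp only [Pi.zero_apply]
  rw [setIntegral_univ, ← intervalIntegral.integral_Iic_add_Ioi (b := 0) h4.integrableOn
    h4.integrableOn, h3.integral_Iic_deriv_eq h2, h3.integral_Ioi_deriv_eq h2, add_neg_cancel]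

lemma integral_fderiv_halfSpace {m : ℕ} (j : Fin (m + 1)) {u : (Fin (m + 1) → ℝ) → ℝ}
    (hu : ContDiff ℝ ∞ u) (hc : HasCompactSupport u) : ∫ y in {y : Fin (m + 1) → ℝ | 0 ≤ y j},
    fderiv ℝ u y (single j 1) = -∫ y', u (j.insertNth 0 y') := by
  have h1 := integral_fderiv_slab j hu hc (measurableSet_Ici (a := (0 : ℝ)))
  refine h1.trans ?_
  rw [← integral_neg]
  congr 1
  ext y'
  have h2 : ContDiff ℝ 1 fun x : ℝ => u (j.insertNth x y') :=
    (hu.comp (contDiff_insertNth j y')).of_le (by simp)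
  rw [integral_Ici_eq_integral_Ioi, (HasCompactSupport.insertNth j hc y').integral_Ioi_deriv_eq h2]

end Flux

section Orderings

open scoped Classical in
/-- Sums over the orderings of a fixed simplex. -/
lemma sum_orderings {T : Finset V} {m : ℕ} {w : Fin m → V} (hw : Injective w)
    (hT : vertexSet w ⊆ T) (F : (Fin m → V) → ℝ) (hF : ∀ π : Perm (Fin m), F (w ∘ π) = F w)
    (h0 : ∀ v ∈ tup T m, ¬(Injective v ∧ vertexSet v = vertexSet w) → F v = 0) :
    ∑ v ∈ tup T m, F v = (m.factorial : ℝ) * F w := by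
  rw [← Finset.sum_filter_add_sum_filter_not _ fun v => Injective v ∧
    vertexSet v = vertexSet w, sum_eq_zero (s := Finset.filter (fun v =>
      ¬(Injective v ∧ vertexSet v = vertexSet w)) (tup T m)) fun v hv =>
      h0 v (Finset.mem_filter.1 hv).1 (Finset.mem_filter.1 hv).2, add_zero,
    sum_congr rfl (g := fun _ => F w), sum_const,
    card_orderings hT (card_vertexSet hw), nsmul_eq_mul]
  intro v hv
  obtain ⟨-, h1, h2⟩ := Finset.mem_filter.1 hv
  obtain ⟨π, rfl⟩ := exists_perm_of_vertexSet_eq h1 hw h2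
  exact hF π

/-- The boundary of a chain. -/
def chainBoundary (T : Finset V) {m : ℕ} (c : (Fin (m + 1) → V) → ℤ) (w : Fin m → V) : ℤ :=
  ∑ x ∈ T, c (cons x w)

lemma cons_comp_perm {m : ℕ} (x : V) (π : Perm (Fin m)) (w : Fin m → V) :
    (cons x (w ∘ π) : Fin (m + 1) → V) = cons x w ∘
    (Perm.decomposeFin.symm (0, π) : Perm (Fin (m + 1))) := by
  funext i
  refine Fin.cases ?_ (fun i => ?_) i
  · simp
  · simp [Perm.decomposeFin_symm_apply_succ]

lemma alternating_cons {m : ℕ} {c : (Fin (m + 1) → V) → ℤ}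
    (hc : ∀ (π : Perm (Fin (m + 1))) v, c (v ∘ π) = (Perm.sign π : ℤ) * c v) (x : V)
    (π : Perm (Fin m)) (w : Fin m → V) : c (cons x (w ∘ π)) = (Perm.sign π : ℤ) * c (cons x w) := by
  rw [cons_comp_perm, hc, Perm.decomposeFin.symm_sign]
  simp

lemma chainBoundary_perm (T : Finset V) {m : ℕ} {c : (Fin (m + 1) → V) → ℤ}
    (hc : ∀ (π : Perm (Fin (m + 1))) v, c (v ∘ π) = (Perm.sign π : ℤ) * c v) (π : Perm (Fin m))
    (w : Fin m → V) : chainBoundary T c (w ∘ π) = (Perm.sign π : ℤ) * chainBoundary T c w := by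
  rw [chainBoundary, chainBoundary, mul_sum]
  exact sum_congr rfl fun x _ => alternating_cons hc x π w

end Orderings

section Relint

lemma baryCoord_pos {p : ℕ} {t : Fin p → ℝ} (ht : t ∈ openSimp p) (i : Fin (p + 1)) :
    0 < baryCoord t i := by
  refine Fin.cases ?_ (fun i => ?_) i
  · simpa [baryCoord] using ht.2
  · simpa [baryCoord] using ht.1 i

/-- A simplex that contains a relative interior point of another one contains its vertices. -/
lemma vertexSet_subset_of_simplexParam_mem {p : ℕ} {w : Fin (p + 1) → V}
    (hw : w ∈ ordS K p) {t : Fin p → ℝ} (ht : t ∈ openSimp p) {s : Finset V}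
    (hs : s ∈ K.faces) (hx : ρ w t ∈ Δ s) : vertexSet w ⊆ s := by
  have hsupp : (finsuppOf w (baryCoord t)).support = vertexSet w := by
    refine (support_finsuppOf_subset w _).antisymm fun x hx => ?_
    obtain ⟨i, rfl⟩ := mem_vertexSet.1 hx
    rw [mem_support_iff, finsuppOf_apply hw.1]
    exact (baryCoord_pos ht i).ne'
  rw [← hsupp]
  refine support_subset_of_mem_convexHull (finsuppOf_nonneg w fun i => (baryCoord_pos ht i).le)
    (hsupp ▸ hw.2) (by rw [tot_finsuppOf, sum_baryCoord]) hs ?_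
  rwa [cmb_finsuppOf, ← simplexParam_eq_sum]

end Relint

section Localize

variable [T2Space N]

omit [T2Space N] in
lemma exists_image_convexHull_eq (h : V → N) {s : Finset V} (hs : s ∈ K.faces) : ∃ p, ∃ v ∈ ordS K
    p, vertexSet v = s ∧ h '' Δ s = (h ∘ ρ v) '' stdSimp p := by
  obtain ⟨p, hp, v, hv, rfl⟩ := exists_ordering_of_mem hs
  exact ⟨p, v, ⟨hv, hs⟩, rfl, by rw [convexHull_vertexSet, hull_eq_image, image_comp]⟩

lemma IsSmoothTriangulation.isClosed_image (hK : IsSmoothTriangulation I P h K) {s : Finset V}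
    (hs : s ∈ K.faces) : IsClosed (h '' Δ s) := by
  obtain ⟨p, v, hv, -, h1⟩ := exists_image_convexHull_eq h hs
  rw [h1]
  exact ((isCompact_stdSimp p).image_of_continuousOn (hK.smooth p v hv).continuousOn).isClosed

lemma IsSmoothTriangulation.simplexParam_mem (hK : IsSmoothTriangulation I P h K) {p : ℕ}
    {v : Fin (p + 1) → V} (hv : v ∈ ordS K p) {t : Fin p → ℝ} (ht : t ∈ stdSimp p) : ρ v t ∈ P := by
  rw [← hK.space_eq]
  refine convexHull_subset_space hv.2 ?_
  rw [convexHull_vertexSet, hull_eq_image]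
  exact mem_image_of_mem _ ht

/-- Near a point of the relative interior of a simplex there are no points of other simplices of
at most the same dimension. -/
lemma IsSmoothTriangulation.exists_nhds (hK : IsSmoothTriangulation I P h K) {p : ℕ}
    {w : Fin (p + 1) → V} (hw : w ∈ ordS K p) {t : Fin p → ℝ} (ht : t ∈ openSimp p)
    {O : Set (Fin p → ℝ)} (hO : IsOpen O) (htO : t ∈ O) : ∃ W ∈ 𝓝 (h (ρ w t)),
    (∀ w' ∈ ordS K p, ∀ t' ∈ stdSimp p, h (ρ w' t') ∈ W → vertexSet w' = vertexSet w) ∧ ∀ t' ∈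
    stdSimp p, h (ρ w t') ∈ W → t' ∈ O := by
  set C₁ : Set N := ⋃ s ∈ {s | s ∈ K.faces ∧ s.card ≤ p + 1 ∧ s ≠ vertexSet w}, h '' Δ s with hC₁
  set C₂ : Set N := (h ∘ ρ w) '' (stdSimp p \ O) with hC₂
  have hc1 : IsClosed C₁ :=
    (hK.finite.subset fun s hs => hs.1).isClosed_biUnion fun s hs => hK.isClosed_image hs.1
  have hc2 : IsClosed C₂ := (((isCompact_stdSimp p).diff hO).image_of_continuousOn
    ((hK.smooth p w hw).continuousOn.mono sdiff_subset)).isClosed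
  have hts := openSimp_subset p ht
  have hinj := hK.bijOn.injOn
  have hn1 : h (ρ w t) ∉ C₁ := by
    rw [hC₁]
    simp only [mem_iUnion, not_exists]
    rintro s ⟨hs, hcard, hne⟩ ⟨y, hy, hyx⟩
    have hyP : y ∈ P := by
      rw [← hK.space_eq]; exact convexHull_subset_space hs hy
    rw [hinj hyP (hK.simplexParam_mem hw hts) hyx] at hy
    have h1 := vertexSet_subset_of_simplexParam_mem hw ht hs hy
    exact hne (eq_of_subset_of_card_le h1 (by rw [card_vertexSet hw.1]; exact hcard)).symm
  have hn2 : h (ρ w t) ∉ C₂ := by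
    rintro ⟨t', ht', h1⟩
    have h2 := hinj (hK.simplexParam_mem hw ht'.1) (hK.simplexParam_mem hw hts) h1
    rw [injective_simplexParam (affineIndependent_of_mem hw) h2] at ht'
    exact ht'.2 htO
  refine ⟨C₁ᶜ ∩ C₂ᶜ, Filter.inter_mem (hc1.isOpen_compl.mem_nhds hn1)
    (hc2.isOpen_compl.mem_nhds hn2), ?_, ?_⟩
  · intro w' hw' t' ht' hW
    by_contra hne
    refine hW.1 ?_
    rw [hC₁]
    refine mem_biUnion (x := vertexSet w') ⟨hw'.2, (card_vertexSet hw'.1).le, hne⟩ ?_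
    rw [convexHull_vertexSet, hull_eq_image]
    exact mem_image_of_mem _ (mem_image_of_mem _ ht')
  · intro t' ht' hW
    by_contra hne
    exact hW.2 ⟨t', ⟨ht', hne⟩, rfl⟩

end Localize

section LocalDegree

variable {m : ℕ} {I : ModelWithCorners ℝ 𝔼 (m + 1) H} [IsManifold I ∞ N]
  [T2Space N] (o : ManifoldOrientation I N) {x₀ : N} {W : Set N} (B : ChartBump I x₀ W)

/-- Points near `x₀` where the orientation is constant in the preferred chart of `x₀`. -/
def orientNhds (x₀ : N) : Set N :=
  {y | 0 < (((o.sgn x₀ * o.sgn y : ℤˣ) : ℤ) : ℝ) * (tangentCoordChange I y x₀ y).det}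

lemma chart_stokes_single (hK : IsSmoothTriangulation I P h K) {T : Finset V}
    (hT : ∀ s ∈ K.faces, s ⊆ T) {w : Fin (m + 1) → V} (hw : w ∈ ordS K m) (hW : W ⊆ orientNhds o x₀)
    (hWw : ∀ w' ∈ ordS K m, ∀ t' ∈ stdSimp m, h (ρ w' t') ∈ W → vertexSet w' = vertexSet w)
    (j : Fin (m + 1)) : (chainBoundary T (orientChain o K h) w : ℝ) * simplexIntegral (B.mod j h) w
    (coordForm j) = coordConst j * ((o.sgn x₀ : ℤ) : ℝ) * ∫ y in B.img, fderiv ℝ B.fn y (single j 1)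
    := by
  have h1 := chart_stokes o B hK hT hW j
  change ∑ w ∈ tup T (m + 1), (chainBoundary T (orientChain o K h) w : ℝ) *
      simplexIntegral (B.mod j h) w (coordForm j) = _ at h1
  rw [sum_orderings hw.1 (hT _ hw.2)] at h1
  · have h2 : ((m + 1).factorial : ℝ) ≠ 0 := by positivity
    refine mul_left_cancel₀ h2 (h1.trans ?_)
    ring
  · intro π
    rw [chainBoundary_perm T (orientChain_perm o hK),
      simplexIntegral_perm (B.smooth_mod j (hK.smooth m w hw))]
    rcases Int.units_eq_one_or (Perm.sign π) with h3 | h3 <;> simp [h3]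
  · intro w' _ hne
    by_cases hw' : w' ∈ ordS K m
    · rw [B.simplexIntegral_mod_eq_zero j, mul_zero]
      intro t ht hmem
      exact hne ⟨hw'.1, hWw w' hw' t ht (B.sub hmem)⟩
    · have : chainBoundary T (orientChain o K h) w' = 0 := by
        refine sum_eq_zero fun x _ => if_neg fun hx => hw' ?_
        have := orderedSimplices_comp (f := Fin.succ) (Fin.succ_injective _) hx
        exact this
      rw [this]; simp

/-- The minors of the Jacobian of a simplex of codimension one in a chart. -/
def chartMinor (I : ModelWithCorners ℝ 𝔼 (m + 1) H) (x₀ : N)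
    (j : Fin (m + 1)) (h : V → N) (w : Fin (m + 1) → V) (t : Fin m → ℝ) : ℝ :=
  (fderivWithin ℝ (fun t k => coord I x₀ (h (ρ w t)) (j.succAbove k)) (stdSimp m) t).det

lemma contDiffWithinAt_minorMap (hK : IsSmoothTriangulation I P h K) {w : Fin (m + 1) → V}
    (hw : w ∈ ordS K m) {t : Fin m → ℝ} (ht : t ∈ stdSimp m)
    (hx : h (ρ w t) ∈ (chartAt H x₀).source) (j : Fin (m + 1)) : ContDiffWithinAt ℝ ∞
    (fun t k => coord I x₀ (h (ρ w t)) (j.succAbove k)) (stdSimp m) t := by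
  have h1 := contDiffWithinAt_coord (hK.smooth m w hw t ht) hx
  rw [contDiffWithinAt_pi] at h1 ⊢
  exact fun k => h1 _

lemma fderivWithin_minorMap (hK : IsSmoothTriangulation I P h K) {w : Fin (m + 1) → V}
    (hw : w ∈ ordS K m) {t : Fin m → ℝ} (ht : t ∈ stdSimp m)
    (hx : h (ρ w t) ∈ (chartAt H x₀).source) (j : Fin (m + 1)) (x : Fin m → ℝ) (k : Fin m) :
    fderivWithin ℝ (fun t k => coord I x₀ (h (ρ w t)) (j.succAbove k)) (stdSimp m) t x k =
    fderivWithin ℝ (coord I x₀ ∘ h ∘ ρ w) (stdSimp m) t x (j.succAbove k) := by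
  have h1 := ((contDiffWithinAt_coord (hK.smooth m w hw t ht) hx).differentiableWithinAt
    (by simp)).hasFDerivWithinAt
  have h2 : HasFDerivWithinAt (fun t k => coord I x₀ (h (ρ w t)) (j.succAbove k))
      (ContinuousLinearMap.pi fun k => (pr (m + 1) (j.succAbove k)).comp
        (fderivWithin ℝ (coord I x₀ ∘ h ∘ ρ w) (stdSimp m) t)) (stdSimp m) t := by
    rw [hasFDerivWithinAt_pi]
    intro k
    exact (pr (m + 1) (j.succAbove k)).hasFDerivAt.comp_hasFDerivWithinAt t h1
  rw [h2.fderivWithin (uniqueDiffOn_stdSimp m t ht)]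
  rfl

lemma exists_open_minor (hK : IsSmoothTriangulation I P h K) {w : Fin (m + 1) → V}
    (hw : w ∈ ordS K m) {t₀ : Fin m → ℝ} (ht₀ : t₀ ∈ openSimp m)
    (hx : h (ρ w t₀) ∈ (chartAt H x₀).source) {j : Fin (m + 1)} (hj : chartMinor I x₀ j h w t₀ ≠ 0)
    : ∃ O : Set (Fin m → ℝ), IsOpen O ∧ t₀ ∈ O ∧ O ⊆ openSimp m ∧ ∀ t ∈ O, 0 < chartMinor I x₀ j h w
    t₀ * chartMinor I x₀ j h w t := by
  have hts := openSimp_subset m ht₀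
  have h1 : ContinuousWithinAt (fun t => chartMinor I x₀ j h w t₀ * chartMinor I x₀ j h w t)
      (stdSimp m) t₀ :=
    continuousWithinAt_const.mul (ContinuousLinearMap.continuous_det.continuousAt.comp_continuousWithinAt
      ((contDiffWithinAt_minorMap hK hw hts hx j).fderivWithin_right (m := ∞)
        (uniqueDiffOn_stdSimp m) (by simp) hts).continuousWithinAt)
  have h2 : stdSimp m ∈ 𝓝 t₀ := mem_interior_iff_mem_nhds.1 (openSimp_subset_interior m ht₀)
  have h3 : ∀ᶠ t in 𝓝 t₀, 0 < chartMinor I x₀ j h w t₀ * chartMinor I x₀ j h w t :=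
    (h1.continuousAt h2).eventually (lt_mem_nhds (mul_self_pos.2 hj))
  obtain ⟨O, hO1, hO2, hO3⟩ := mem_nhds_iff.1 h3
  exact ⟨O ∩ openSimp m, hO2.inter (isOpen_openSimp m), ⟨hO3, ht₀⟩, inter_subset_right,
    fun t ht => hO1 ht.1⟩

lemma ChartBump.simplexIntegral_mod_eq_minor (hK : IsSmoothTriangulation I P h K)
    {w : Fin (m + 1) → V} (hw : w ∈ ordS K m) (j : Fin (m + 1)) : simplexIntegral (B.mod j h) w
    (coordForm j) = (-1) ^ (j : ℕ) * ∫ t in stdSimp m, B.inn (h (ρ w t)) * chartMinor I x₀ j h w t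
    := by
  rw [B.simplexIntegral_mod j (hK.smooth m w hw)]
  congr 1
  refine setIntegral_congr_fun (measurableSet_stdSimp m) fun t ht => ?_
  by_cases hC : h (ρ w t) ∈ B.carrier
  · have h1 : (fun t k => B.map (h (ρ w t)) (j.succAbove k)) =ᶠ[𝓝[stdSimp m] t]
        fun t k => coord I x₀ (h (ρ w t)) (j.succAbove k) := by
      filter_upwards [(hK.smooth _ w hw).continuousOn.continuousWithinAt ht
        (B.map_eventuallyEq hC)] with t' ht'
      have : B.map (h (ρ w t')) = coord I x₀ (h (ρ w t')) := ht'
      simp only [this]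
    simp only [chartMinor]
    rw [h1.fderivWithin_eq (h1.self_of_nhdsWithin ht)]
  · simp [B.inn_eq_zero hC]

lemma continuousOn_inn_mul_minor (hK : IsSmoothTriangulation I P h K)
    {w : Fin (m + 1) → V} (hw : w ∈ ordS K m) (j : Fin (m + 1)) :
    ContinuousOn (fun t => B.inn (h (ρ w t)) * chartMinor I x₀ j h w t) (stdSimp m) := by
  intro t ht
  have hc := (hK.smooth _ w hw).continuousOn.continuousWithinAt ht
  by_cases hC : h (ρ w t) ∈ B.carrier
  · refine ContinuousWithinAt.mul (B.inn.continuous.continuousAt.comp_continuousWithinAt hc) ?_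
    exact ContinuousLinearMap.continuous_det.continuousAt.comp_continuousWithinAt
      ((contDiffWithinAt_minorMap hK hw ht (B.mem_carrier.1 hC).1 j).fderivWithin_right (m := ∞)
        (uniqueDiffOn_stdSimp m) (by simp) ht).continuousWithinAt
  · refine (continuousWithinAt_const (b := (0 : ℝ))).congr_of_eventuallyEq ?_ ?_
    · filter_upwards [hc (B.inn_eventuallyEq_zero hC)] with t' ht'
      have : B.inn (h (ρ w t')) = 0 := ht'
      rw [this, zero_mul]
    · rw [B.inn_eq_zero hC, zero_mul]

lemma ChartBump.simplexIntegral_mod_ne_zero (hK : IsSmoothTriangulation I P h K)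
    {w : Fin (m + 1) → V} (hw : w ∈ ordS K m) (j : Fin (m + 1)) {t₀ : Fin m → ℝ}
    (hx₀ : h (ρ w t₀) = x₀) {O : Set (Fin m → ℝ)} (hO : IsOpen O) (ht₀ : t₀ ∈ O)
    (hOs : O ⊆ openSimp m) (hpos : ∀ t ∈ O, 0 < chartMinor I x₀ j h w t₀ * chartMinor I x₀ j h w t)
    (hCO : ∀ t ∈ stdSimp m, h (ρ w t) ∈ B.carrier → t ∈ O) : simplexIntegral (B.mod j h) w
    (coordForm j) ≠ 0 := by
  rw [B.simplexIntegral_mod_eq_minor hK hw]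
  refine mul_ne_zero (by positivity) ?_
  have hc := continuousOn_inn_mul_minor B hK hw j
  set ε := chartMinor I x₀ j h w t₀ with hε
  suffices h0 : 0 < ∫ t in stdSimp m, ε * (B.inn (h (ρ w t)) * chartMinor I x₀ j h w t) by
    rw [integral_const_mul] at h0
    exact fun h1 => by rw [h1, mul_zero] at h0; exact lt_irrefl _ h0
  have hint : IntegrableOn (fun t => ε * (B.inn (h (ρ w t)) * chartMinor I x₀ j h w t))
      (stdSimp m) := (continuousOn_const.mul hc).integrableOn_compact (isCompact_stdSimp m)
  rw [setIntegral_pos_iff_support_of_nonneg_ae ?_ hint]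
  · have h1 : ContinuousAt (fun t => h (ρ w t)) t₀ :=
      ((hK.smooth m w hw).continuousOn.continuousWithinAt (openSimp_subset m (hOs ht₀))).continuousAt
        (mem_interior_iff_mem_nhds.1 (openSimp_subset_interior m (hOs ht₀)))
    have h2 : ∀ᶠ t in 𝓝 t₀, B.inn (h (ρ w t)) = 1 := by
      have h3 : ∀ᶠ y in 𝓝 x₀, B.inn y = 1 := B.inn.eventuallyEq_one
      rw [ContinuousAt, hx₀] at h1
      exact h1.eventually h3
    obtain ⟨O', hO1, hO2, hO3⟩ := mem_nhds_iff.1 h2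
    refine lt_of_lt_of_le ((hO2.inter hO).measure_pos volume ⟨t₀, hO3, ht₀⟩)
      (measure_mono fun t ht => ⟨?_, openSimp_subset m (hOs ht.2)⟩)
    have h3 : B.inn (h (ρ w t)) = 1 := hO1 ht.1
    rw [Function.mem_support, h3, one_mul]
    exact (hpos t ht.2).ne'
  · refine (ae_restrict_iff' (measurableSet_stdSimp m)).2 (.of_forall fun t ht => ?_)
    simp only [Pi.zero_apply]
    by_cases hC : h (ρ w t) ∈ B.carrier
    · rw [mul_left_comm]
      exact mul_nonneg B.inn.nonneg (hpos t (hCO t ht hC)).le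
    · rw [B.inn_eq_zero hC]; simp

lemma exists_contrForm_ne_zero {D : (Fin m → ℝ) →L[ℝ] (Fin (m + 1) → ℝ)}
    (hD : Injective D) : ∃ j : Fin (m + 1), contrForm j (fun i => D (single i 1)) ≠ 0 := by
  by_contra! h0
  have hli : LinearIndependent ℝ fun i : Fin m => D (single i 1) := by
    have := (Pi.basisFun ℝ (Fin m)).linearIndependent.map'
      (D : (Fin m → ℝ) →ₗ[ℝ] (Fin (m + 1) → ℝ)) (LinearMap.ker_eq_bot.2
        (show Injective (D : (Fin m → ℝ) →ₗ[ℝ] (Fin (m + 1) → ℝ)) from hD))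
    have e : (⇑(D : (Fin m → ℝ) →ₗ[ℝ] (Fin (m + 1) → ℝ)) ∘ ⇑(Pi.basisFun ℝ (Fin m))) =
        fun i => D (single i 1) := by
      funext i
      simp
    rw [e] at this
    exact this
  obtain ⟨x, hx⟩ : ∃ x, x ∉ Submodule.span ℝ (range fun i : Fin m => D (single i 1)) := by
    by_contra! hall
    have h1 := finrank_range_le_card (R := ℝ) (b := fun i : Fin m => D (single i 1))
    rw [Set.finrank, Submodule.eq_top_iff'.2 hall, finrank_top] at h1
    simp at h1
  have h2 : LinearIndependent ℝ (cons x fun i : Fin m => D (single i 1) :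
      Fin (m + 1) → Fin (m + 1) → ℝ) := linearIndependent_finCons.2 ⟨hli, hx⟩
  have h3 : detForm (m + 1) (Matrix.vecCons x fun i => D (single i 1)) = 0 := by
    rw [detForm_apply, Matrix.det_succ_column_zero]
    refine sum_eq_zero fun j _ => ?_
    have h4 := h0 j
    rw [contrForm_eq_det] at h4
    rw [mul_right_comm]
    refine mul_eq_zero_of_left ?_ _
    rw [← h4]
    rfl
  have h6 := (Module.Basis.isUnit_det (Pi.basisFun ℝ (Fin (m + 1)))
    (basisOfLinearIndependentOfCardEqFinrank h2 (by simp)))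
  rw [coe_basisOfLinearIndependentOfCardEqFinrank] at h6
  exact h6.ne_zero h3

lemma injective_fderivWithin_coord (hK : IsSmoothTriangulation I P h K) {p : ℕ}
    {w : Fin (p + 1) → V} (hw : w ∈ ordS K p) {t : Fin p → ℝ} (ht : t ∈ stdSimp p)
    (hx : h (ρ w t) = x₀) : Injective (fderivWithin ℝ (coord I x₀ ∘ h ∘ ρ w) (stdSimp p) t) := by
  subst hx
  have h0 : fderivWithin ℝ (coord I (h (ρ w t)) ∘ h ∘ ρ w) (stdSimp p) t = _ :=
    fderivWithin_coord (φ := h ∘ ρ w) (uniqueDiffOn_stdSimp p t ht)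
    ((hK.smooth p w hw t ht).mdifferentiableWithinAt (by simp)) (mem_chart_source H _)
  rw [h0]
  intro a b hab
  refine hK.immersive p w hw t ht ?_
  have h2 : ∀ x : 𝔼 (m + 1), tangentCoordChange I (h (ρ w t))
      (h (ρ w t)) (h (ρ w t)) x = x :=
    fun x => tangentCoordChange_self (mem_extChartAt_source _)
  have h1 : tangentCoordChange I (h (ρ w t)) (h (ρ w t))
      (h (ρ w t)) _ = tangentCoordChange I (h (ρ w t))
      (h (ρ w t)) (h (ρ w t)) _ :=
    (𝓔 (m + 1)).injective hab
  exact (h2 _).symm.trans (h1.trans (h2 _))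

/-- The boundary of the orientation chain vanishes on simplices with a relative interior point in
the interior of the manifold. -/
theorem chainBoundary_eq_zero_of_interior (hK : IsSmoothTriangulation I P h K) {T : Finset V}
    (hT : ∀ s ∈ K.faces, s ⊆ T) {w : Fin (m + 1) → V} (hw : w ∈ ordS K m) {t₀ : Fin m → ℝ}
    (ht₀ : t₀ ∈ openSimp m) (hint : I.IsInteriorPoint (h (ρ w t₀))) : chainBoundary T
    (orientChain o K h) w = 0 := by
  set x₀ := h (ρ w t₀) with hx₀
  have hts := openSimp_subset m ht₀
  have hsrc : h (ρ w t₀) ∈ (chartAt H x₀).source := mem_chart_source H x₀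
  obtain ⟨j, hj⟩ := exists_contrForm_ne_zero (injective_fderivWithin_coord hK hw hts hx₀.symm)
  have hj' : chartMinor I x₀ j h w t₀ ≠ 0 := by
    intro h0
    apply hj
    rw [contrForm_eq_det]
    rw [chartMinor, ← detForm_comp, detForm_apply] at h0
    simp only [fderivWithin_minorMap hK hw hts hsrc] at h0
    rw [h0, mul_zero]
  obtain ⟨O, hO, htO, hOs, hpos⟩ := exists_open_minor hK hw ht₀ hsrc hj'
  obtain ⟨W, hWn, hW1, hW2⟩ := hK.exists_nhds hw ht₀ hO htO
  obtain ⟨R, hR, hRI⟩ := Metric.mem_nhds_iff.1 (range_mem_nhds_isInteriorPoint hint)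
  obtain ⟨B, hBR⟩ := exists_chartBump (I := I) (Filter.inter_mem hWn (o.locally_constant x₀)) hR
  have h1 := chart_stokes_single o B hK hT hw inter_subset_right
    (fun w' hw' t' ht' hmem => hW1 w' hw' t' ht' hmem.1) j
  have h2 : ∫ y in B.img, fderiv ℝ B.fn y (single j 1) = 0 := by
    refine Eq.trans ?_ (integral_fderiv_eq_zero j B.contDiff_fn B.hasCompactSupport_fn)
    refine setIntegral_eq_integral_of_forall_compl_eq_zero fun y hy => ?_
    rw [B.fderiv_fn_eq_zero]
    · rfl
    · rintro ⟨z, hz, rfl⟩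
      exact hy ⟨z, ⟨hz, hRI (Metric.closedBall_subset_ball hBR hz)⟩, rfl⟩
  rw [h2, mul_zero] at h1
  rcases mul_eq_zero.1 h1 with h3 | h3
  · exact_mod_cast h3
  · exact absurd h3 (B.simplexIntegral_mod_ne_zero hK hw j hx₀.symm hO htO hOs hpos
      (fun t ht hC => hW2 t ht (B.sub hC).1))

end LocalDegree

section HalfSpace

variable {m : ℕ} [ChartedSpace (EuclideanHalfSpace (m + 1)) N]

lemma equiv_image_range_halfSpace : {y : Fin (m + 1) → ℝ | 0 ≤ y 0} = 𝓔 (m + 1) '' range 𝓗 m := by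
  rw [range_modelWithCornersEuclideanHalfSpace]
  ext y
  constructor
  · intro hy
    exact ⟨(𝓔 (m + 1)).symm y, hy, rfl⟩
  · rintro ⟨z, hz, rfl⟩
    exact hz

variable [IsManifold 𝓗 m ∞ N]

lemma mem_interior_iff_coord {x₀ y : N} (hy : y ∈ (chartAt (EuclideanHalfSpace (m + 1)) x₀).source) :
    (𝓗 m).IsInteriorPoint y ↔ 0 < coord 𝓗 m x₀ y 0 := by
  rw [ModelWithCorners.isInteriorPoint_iff_of_mem_atlas (n := 1) (one_ne_zero)
    (chart_mem_atlas _ x₀) hy]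
  have h1 : ((chartAt (EuclideanHalfSpace (m + 1)) x₀).extend 𝓗 m y ∈
      interior (range 𝓗 m)) ↔ 0 < coord 𝓗 m x₀ y 0 := by
    rw [interior_range_modelWithCornersEuclideanHalfSpace]
    rfl
  rw [← h1]
  constructor
  · exact fun h => OpenPartialHomeomorph.interior_extend_target_subset_interior_range _ h
  · exact fun h => OpenPartialHomeomorph.mem_interior_extend_target _
      ((chartAt (EuclideanHalfSpace (m + 1)) x₀).map_source hy) h

lemma coord_zero_nonneg (x₀ y : N) : 0 ≤ coord 𝓗 m x₀ y 0 := by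
  have h1 : coord 𝓗 m x₀ y ∈
      𝓔 (m + 1) '' range 𝓗 m :=
    mem_image_of_mem _ (by rw [extChartAt_coe]; exact mem_range_self _)
  rw [← equiv_image_range_halfSpace] at h1
  exact h1

lemma mem_boundary_iff_coord {x₀ y : N} (hy : y ∈ (chartAt (EuclideanHalfSpace (m + 1)) x₀).source) :
    y ∈ (𝓗 m).boundary N ↔ coord 𝓗 m x₀ y 0 = 0 := by
  change (𝓗 m).IsBoundaryPoint y ↔ _
  rw [ModelWithCorners.isBoundaryPoint_iff_not_isInteriorPoint, mem_interior_iff_coord hy, not_lt]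
  exact ⟨fun h => h.antisymm (coord_zero_nonneg x₀ y), fun h => h.le⟩

variable [T2Space N] (o : ManifoldOrientation 𝓗 m N) {x₀ : N} {W : Set N}
  (B : ChartBump 𝓗 m x₀ W)

lemma ChartBump.integral_img_halfSpace :
    ∫ y in B.img, fderiv ℝ B.fn y (single 0 1) = -∫ y' : Fin m → ℝ, B.fn (cons 0 y') := by
  rw [B.integral_img _ equiv_image_range_halfSpace,
    integral_fderiv_halfSpace 0 B.contDiff_fn B.hasCompactSupport_fn]
  simp only [Fin.insertNth_zero]
  rfl

lemma ChartBump.integral_boundary_pos (hx₀ : x₀ ∈ (𝓗 m).boundary N) :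
    0 < ∫ y' : Fin m → ℝ, B.fn (cons 0 y') := by
  have h1 : Continuous fun y' : Fin m → ℝ => (cons (0 : ℝ) y' : Fin (m + 1) → ℝ) :=
    continuous_const.finCons continuous_id
  refine Continuous.integral_pos_of_hasCompactSupport_nonneg_nonzero
    (x := tail (coord 𝓗 m x₀ x₀)) (B.contDiff_fn.continuous.comp h1) ?_
    (fun y => B.fn_nonneg _) ?_
  · refine HasCompactSupport.of_support_subset_isCompact
      (K := (fun y : Fin (m + 1) → ℝ => tail y) '' tsupport B.fn)
      (B.hasCompactSupport_fn.isCompact.image (continuous_pi fun i => continuous_apply _)) ?_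
    intro x hx
    exact ⟨cons 0 x, subset_tsupport B.fn hx, tail_cons _ _⟩
  · have h2 := (mem_boundary_iff_coord (mem_chart_source _ x₀)).1 hx₀
    have h3 : (cons 0 (tail (coord 𝓗 m x₀ x₀)) : Fin (m + 1) → ℝ) = coord 𝓗 m x₀ x₀ := by
      conv_rhs => rw [← Fin.cons_self_tail (coord 𝓗 m x₀ x₀), h2]
    change B.fn (cons 0 (tail (coord 𝓗 m x₀ x₀))) ≠ 0
    rw [h3, ← B.inn_eq_of_mem_source (mem_chart_source _ x₀), B.inn.eq_one]
    exact one_ne_zero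

lemma chainBoundary_eq_zero_of_notMem {T : Finset V} {w : Fin (m + 1) → V}
    (hw : w ∉ ordS K m) : chainBoundary T (orientChain o K h) w = 0 :=
  sum_eq_zero fun _ _ => if_neg fun hx =>
    hw (orderedSimplices_comp (f := Fin.succ) (Fin.succ_injective _) hx)

/-- Every boundary point lies in a simplex in the support of the boundary of the orientation
chain. -/
theorem exists_simplex_of_mem_boundary (hK : IsSmoothTriangulation 𝓗 m P h K)
    {T : Finset V} (hT : ∀ s ∈ K.faces, s ⊆ T) (hx₀ : x₀ ∈ (𝓗 m).boundary N) :
    ∃ w ∈ ordS K m, x₀ ∈ h '' hull w ∧ chainBoundary T (orientChain o K h) w ≠ 0 := by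
  by_contra! hcon
  set C : Set N := ⋃ s ∈ {s | s ∈ K.faces ∧ x₀ ∉ h '' Δ s}, h '' Δ s with hC
  have hc : IsClosed C :=
    (hK.finite.subset fun s hs => hs.1).isClosed_biUnion fun s hs => hK.isClosed_image hs.1
  have hxC : x₀ ∉ C := by
    rw [hC]
    simp only [mem_iUnion, not_exists]
    exact fun s hs => hs.2
  obtain ⟨B, -⟩ := exists_chartBump (I := 𝓗 m)
    (Filter.inter_mem (hc.isOpen_compl.mem_nhds hxC) (o.locally_constant x₀)) one_pos
  have h1 := chart_stokes o B hK hT (fun y hy => hy.2) 0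
  rw [B.integral_img_halfSpace, coordConst_zero] at h1
  have h2 := B.integral_boundary_pos hx₀
  rw [sum_eq_zero] at h1
  · have h3 : ((o.sgn x₀ : ℤ) : ℝ) ≠ 0 := by exact_mod_cast (o.sgn x₀).ne_zero
    have h4 : ((m + 1).factorial : ℝ) ≠ 0 := by positivity
    exact mul_ne_zero (mul_ne_zero (mul_ne_zero one_ne_zero h3) h4) (neg_ne_zero.2 h2.ne') h1.symm
  · intro w _
    change (chainBoundary T (orientChain o K h) w : ℝ) * _ = 0
    by_cases hw : w ∈ ordS K m
    · by_cases hx : x₀ ∈ h '' hull w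
      · rw [hcon w hw hx]; simp
      · rw [B.simplexIntegral_mod_eq_zero 0, mul_zero]
        intro t ht hmem
        refine (B.sub hmem).1 ?_
        rw [hC]
        refine mem_biUnion (x := vertexSet w) ⟨hw.2, by rwa [convexHull_vertexSet]⟩ ?_
        rw [convexHull_vertexSet, hull_eq_image]
        exact mem_image_of_mem _ (mem_image_of_mem _ ht)
    · rw [chainBoundary_eq_zero_of_notMem o hw]; simp

/-- The support of the boundary of the orientation chain lies in the boundary of the manifold. -/
theorem mapsTo_boundary_of_chainBoundary (hK : IsSmoothTriangulation 𝓗 m P h K) {T : Finset V}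
    (hT : ∀ s ∈ K.faces, s ⊆ T) {w : Fin (m + 1) → V} (hw : w ∈ ordS K m)
    (hne : chainBoundary T (orientChain o K h) w ≠ 0) : MapsTo h (hull w) ((𝓗 m).boundary N) := by
  have h1 : ∀ t ∈ openSimp m, h (ρ w t) ∈ (𝓗 m).boundary N := by
    intro t ht
    by_contra hb
    exact hne (chainBoundary_eq_zero_of_interior o hK hT hw ht
      (((𝓗 m).isInteriorPoint_iff_not_isBoundaryPoint _).2 hb))
  have h2 : IsClosed (stdSimp m ∩ (h ∘ ρ w) ⁻¹' (𝓗 m).boundary N) :=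
    (hK.smooth m w hw).continuousOn.preimage_isClosed_of_isClosed (isCompact_stdSimp m).isClosed
      (ModelWithCorners.isClosed_boundary (n := 1) one_ne_zero)
  rw [hull_eq_image]
  rintro _ ⟨t, ht, rfl⟩
  exact (h2.closure_subset_iff.2 (fun t ht => ⟨openSimp_subset m ht, h1 t ht⟩)
    (mem_closure_openSimp ht)).2

/-- The differential of a simplex in the boundary has no normal component. -/
lemma fderivWithin_coord_apply_zero (hK : IsSmoothTriangulation 𝓗 m P h K) {p : ℕ}
    {w : Fin (p + 1) → V} (hw : w ∈ ordS K p) (hb : MapsTo h (hull w) ((𝓗 m).boundary N))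
    {t₀ : Fin p → ℝ} (ht₀ : t₀ ∈ stdSimp p)
    (hsrc : h (ρ w t₀) ∈ (chartAt (EuclideanHalfSpace (m + 1)) x₀).source) (x : Fin p → ℝ) :
    fderivWithin ℝ (coord 𝓗 m x₀ ∘ h ∘ ρ w) (stdSimp p) t₀ x 0 = 0 := by
  have hbt : ∀ t ∈ stdSimp p, h (ρ w t) ∈ (𝓗 m).boundary N := by
    intro t ht
    exact hb (simplexParam_mem_hull w ht)
  have h1 := ((contDiffWithinAt_coord (hK.smooth p w hw t₀ ht₀) hsrc).differentiableWithinAt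
    (by simp)).hasFDerivWithinAt
  have h2 := (pr (m + 1) 0).hasFDerivAt.comp_hasFDerivWithinAt t₀ h1
  have h3 : HasFDerivWithinAt ((pr (m + 1) 0) ∘ (coord 𝓗 m x₀ ∘ h ∘ ρ w))
      (0 : (Fin p → ℝ) →L[ℝ] ℝ) (stdSimp p) t₀ := by
    refine (hasFDerivWithinAt_const (0 : ℝ) t₀ _).congr_of_eventuallyEq ?_ ?_
    · filter_upwards [(hK.smooth p w hw).continuousOn.continuousWithinAt ht₀
        ((chartAt _ x₀).open_source.mem_nhds hsrc), self_mem_nhdsWithin] with t h4 h5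
      exact (mem_boundary_iff_coord h4).1 (hbt t h5)
    · exact (mem_boundary_iff_coord hsrc).1 (hbt t₀ ht₀)
  exact congrArg (fun l : (Fin p → ℝ) →L[ℝ] ℝ => l x)
    ((uniqueDiffOn_stdSimp p t₀ ht₀).eq h2 h3)

/-- The boundary of the orientation chain on a simplex in the boundary of the manifold. -/
theorem chainBoundary_eq_of_mapsTo_boundary (hK : IsSmoothTriangulation 𝓗 m P h K)
    {T : Finset V} (hT : ∀ s ∈ K.faces, s ⊆ T) {w : Fin (m + 1) → V} (hw : w ∈ ordS K m)
    (hb : MapsTo h (hull w) ((𝓗 m).boundary N)) {t₀ : Fin m → ℝ} (ht₀ : t₀ ∈ openSimp m)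
    (hx₀ : h (ρ w t₀) = x₀) : chartMinor 𝓗 m x₀ 0 h w t₀ ≠ 0 ∧ chainBoundary T
    (orientChain o K h) w = -((o.sgn x₀ : ℤ) * (sign (chartMinor 𝓗 m x₀ 0 h w t₀) : ℤ)) :=
    by
  have hts := openSimp_subset m ht₀
  have hsrc : h (ρ w t₀) ∈ (chartAt (EuclideanHalfSpace (m + 1)) x₀).source :=
    hx₀ ▸ mem_chart_source _ _
  have hbt : ∀ t ∈ stdSimp m, h (ρ w t) ∈ (𝓗 m).boundary N := by
    intro t ht
    exact hb (simplexParam_mem_hull w ht)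
  set D := fderivWithin ℝ (coord 𝓗 m x₀ ∘ h ∘ ρ w) (stdSimp m) t₀ with hD
  have hrow : ∀ x, D x 0 = 0 := fderivWithin_coord_apply_zero hK hw hb hts hsrc
  have hmin : chartMinor 𝓗 m x₀ 0 h w t₀ ≠ 0 := by
    obtain ⟨j, hj⟩ := exists_contrForm_ne_zero (injective_fderivWithin_coord hK hw hts hx₀)
    rw [← hD, contrForm_eq_det] at hj
    have hj0 : j = 0 := by
      by_contra hne
      obtain ⟨k, hk⟩ := Fin.exists_succAbove_eq (Ne.symm hne)
      refine hj (mul_eq_zero_of_right _ (Matrix.det_eq_zero_of_row_eq_zero k fun l => ?_))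
      rw [Matrix.of_apply, hk, hrow]
    subst hj0
    intro h0
    rw [chartMinor, ← detForm_comp, detForm_apply] at h0
    simp only [fderivWithin_minorMap hK hw hts hsrc] at h0
    exact hj (by rw [h0, mul_zero])
  refine ⟨hmin, ?_⟩
  obtain ⟨O, hO, htO, hOs, hpos⟩ := exists_open_minor hK hw ht₀ hsrc hmin
  obtain ⟨W, hWn, hW1, hW2⟩ := hK.exists_nhds hw ht₀ hO htO
  rw [hx₀] at hWn
  obtain ⟨B, -⟩ := exists_chartBump (I := 𝓗 m)
    (Filter.inter_mem hWn (o.locally_constant x₀)) one_pos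
  have h1 := chart_stokes_single o B hK hT hw inter_subset_right
    (fun w' hw' t' ht' hmem => hW1 w' hw' t' ht' hmem.1) 0
  rw [B.integral_img_halfSpace, coordConst_zero, B.simplexIntegral_mod_eq_minor hK hw] at h1
  have hx₀b : x₀ ∈ (𝓗 m).boundary N := hx₀ ▸ hbt t₀ hts
  have hu := B.integral_boundary_pos hx₀b
  set ε := chartMinor 𝓗 m x₀ 0 h w t₀ with hε
  set R := stdSimp m ∩ (h ∘ ρ w) ⁻¹' B.carrier with hR
  set G : (Fin m → ℝ) → Fin m → ℝ := fun t k =>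
    coord 𝓗 m x₀ (h (ρ w t)) ((0 : Fin (m + 1)).succAbove k) with hG
  have hRm : MeasurableSet R := ((hK.smooth m w hw).continuousOn.preimage_isClosed_of_isClosed
    (isCompact_stdSimp m).isClosed B.isClosed_carrier).measurableSet
  have hcons : ∀ t ∈ R, (cons 0 (G t) : Fin (m + 1) → ℝ) = coord 𝓗 m x₀ (h (ρ w t)) := by
    intro t ht
    have h2 := (mem_boundary_iff_coord (B.mem_carrier.1 ht.2).1).1 (hbt t ht.1)
    conv_rhs => rw [← Fin.cons_self_tail (coord 𝓗 m x₀ (h (ρ w t)))]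
    have h3 : coord 𝓗 m x₀ (h (ρ w t)) 0 = 0 := h2
    rw [h3]
    congr 1
  have hinj : InjOn G R := by
    intro t ht t' ht' htt
    have h2 : coord 𝓗 m x₀ (h (ρ w t)) = coord 𝓗 m x₀ (h (ρ w t')) := by
      rw [← hcons t ht, ← hcons t' ht', htt]
    have h3 := coord_injOn x₀ (B.mem_carrier.1 ht.2).1 (B.mem_carrier.1 ht'.2).1 h2
    exact injective_simplexParam (affineIndependent_of_mem hw)
      (hK.bijOn.injOn (hK.simplexParam_mem hw ht.1) (hK.simplexParam_mem hw ht'.1) h3)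
  have hJ : ∫ t in stdSimp m, B.inn (h (ρ w t)) * chartMinor 𝓗 m x₀ 0 h w t =
      ((sign ε : ℤ) : ℝ) * ∫ y' : Fin m → ℝ, B.fn (cons 0 y') := by
    have h2 : ∫ y' : Fin m → ℝ, B.fn (cons 0 y') = ∫ y' in G '' R, B.fn (cons 0 y') := by
      symm
      refine setIntegral_eq_integral_of_forall_compl_eq_zero fun y' hy' => ?_
      by_contra hne
      refine hy' ?_
      have h3 : (cons 0 y' : Fin (m + 1) → ℝ) ∈ B.img := by
        by_contra h4
        refine hne (B.fn_eq_zero fun h5 => h4 ?_)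
        obtain ⟨z, hz, hzy⟩ := h5
        have h6 : (cons 0 y' : Fin (m + 1) → ℝ) ∈ {y : Fin (m + 1) → ℝ | 0 ≤ y 0} := by simp
        rw [equiv_image_range_halfSpace] at h6
        obtain ⟨z', hz', hzy'⟩ := h6
        rw [(𝓔 (m + 1)).injective (hzy'.trans hzy.symm)] at hz'
        exact ⟨z, ⟨hz, hz'⟩, hzy⟩
      rw [← B.coord_image] at h3
      obtain ⟨y, hyC, hy⟩ := h3
      have hyb : y ∈ (𝓗 m).boundary N := by
        rw [mem_boundary_iff_coord (B.mem_carrier.1 hyC).1, hy]; simp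
      obtain ⟨w', hw', hyw, -⟩ := exists_simplex_of_mem_boundary o hK hT hyb
      rw [hull_eq_image] at hyw
      obtain ⟨_, ⟨t', ht', rfl⟩, rfl⟩ := hyw
      have h4 := hW1 w' hw' t' ht' (B.sub hyC).1
      have h5 : ρ w' t' ∈ hull w := by
        rw [← convexHull_vertexSet, ← h4, convexHull_vertexSet, hull_eq_image]
        exact mem_image_of_mem _ ht'
      rw [hull_eq_image] at h5
      obtain ⟨t, ht, h6⟩ := h5
      refine ⟨t, ⟨ht, ?_⟩, ?_⟩
      · rw [mem_preimage, comp_apply, h6]; exact hyC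
      · rw [hG]
        funext k
        simp only [h6, hy]
        simp
    rw [h2, integral_image_eq_integral_abs_det_fderiv_smul volume hRm (f' := fun t =>
      fderivWithin ℝ G (stdSimp m) t) (fun t ht => ?_) hinj, ← integral_const_mul]
    · have h3 : ∫ t in stdSimp m, B.inn (h (ρ w t)) * chartMinor 𝓗 m x₀ 0 h w t =
          ∫ t in R, B.inn (h (ρ w t)) * chartMinor 𝓗 m x₀ 0 h w t := by
        refine setIntegral_eq_of_subset_of_forall_sdiff_eq_zero (measurableSet_stdSimp m)
          inter_subset_left fun t ht => ?_
        rw [B.inn_eq_zero (y := h (ρ w t)) fun h4 => ht.2 ⟨ht.1, h4⟩, zero_mul]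
      rw [h3]
      refine setIntegral_congr_fun hRm fun t ht => ?_
      simp only [smul_eq_mul]
      rw [hcons t ht, ← B.inn_eq_of_mem_source (y := h (ρ w t)) (B.mem_carrier.1 ht.2).1, mul_comm, ← mul_assoc]
      congr 1
      have h4 := hpos t (hW2 t ht.1 (B.sub ht.2).1)
      change chartMinor 𝓗 m x₀ 0 h w t =
        _ * |chartMinor 𝓗 m x₀ 0 h w t|
      rcases pos_and_pos_or_neg_and_neg_of_mul_pos h4 with ⟨h5, h6⟩ | ⟨h5, h6⟩
      · simp [h5, abs_of_pos h6]
      · simp [h5, abs_of_neg h6]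
    · exact ((contDiffWithinAt_minorMap hK hw ht.1 (B.mem_carrier.1 ht.2).1
        0).differentiableWithinAt (by simp)).hasFDerivWithinAt.mono inter_subset_left
  rw [hJ] at h1
  simp only [Fin.val_zero, pow_zero, one_mul, mul_neg, ← neg_mul] at h1
  rw [← mul_assoc] at h1
  have h2 := mul_right_cancel₀ hu.ne' h1
  have h3 : chainBoundary T (orientChain o K h) w * (sign ε : ℤ) = -(o.sgn x₀ : ℤ) := by
    exact_mod_cast h2
  rcases lt_or_gt_of_ne hmin with h4 | h4
  · simp [h4] at h3 ⊢
    linarith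
  · simp [h4] at h3 ⊢
    linarith

end HalfSpace

section Immersion

variable {E₀ E₁ E₂ H₀ H₁ H₂ : Type*} [NormedAddCommGroup E₀] [NormedSpace ℝ E₀]
  [NormedAddCommGroup E₁] [NormedSpace ℝ E₁] [NormedAddCommGroup E₂] [NormedSpace ℝ E₂]
  [TopologicalSpace H₀] [TopologicalSpace H₁] [TopologicalSpace H₂] {I₀ : ModelWithCorners ℝ E₀ H₀}
  {I₁ : ModelWithCorners ℝ E₁ H₁} {I₂ : ModelWithCorners ℝ E₂ H₂} {N₀ N₁ N₂ : Type*}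
  [TopologicalSpace N₀] [ChartedSpace H₀ N₀] [TopologicalSpace N₁] [ChartedSpace H₁ N₁]
  [TopologicalSpace N₂] [ChartedSpace H₂ N₂] {n : WithTop ℕ∞} {f : N₀ → N₁} {φ : N₁ → N₂}
  {s : Set N₀} {z : N₀}

lemma contMDiffWithinAt_of_comp_inclusion {F : Type*} [NormedAddCommGroup F] [NormedSpace ℝ F]
    {d : OpenPartialHomeomorph N₁ H₁} {c : OpenPartialHomeomorph N₂ H₂} {e : (E₁ × F) ≃L[ℝ] E₂}
    (hd : d ∈ IsManifold.maximalAtlas I₁ n N₁) (hc : c ∈ IsManifold.maximalAtlas I₂ n N₂)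
    (hfz : f z ∈ d.source) (hφz : φ (f z) ∈ c.source) (hw : EqOn (c.extend I₂ ∘ φ ∘ (d.extend
    I₁).symm) (e ∘ fun x => (x, 0)) (d.extend I₁).target) (hf : ContinuousWithinAt f s z)
    (h : ContMDiffWithinAt I₀ I₂ n (φ ∘ f) s z) : ContMDiffWithinAt I₀ I₁ n f s z := by
  set s' := s ∩ f ⁻¹' d.source with hs'
  have hnear : f ⁻¹' d.source ∈ 𝓝[s] z := hf (d.open_source.mem_nhds hfz)
  rw [← contMDiffWithinAt_inter' hnear, ← hs']
  have h1 : ContMDiffWithinAt I₀ 𝓘(ℝ, E₂) n (c.extend I₂ ∘ (φ ∘ f)) s' z :=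
    (c.contMDiffAt_extend hc hφz).comp_contMDiffWithinAt z (h.mono inter_subset_left)
  have h2 : ContMDiffWithinAt I₀ 𝓘(ℝ, E₁) n
      ((Prod.fst ∘ e.symm) ∘ (c.extend I₂ ∘ (φ ∘ f))) s' z := by
    have h3 : ContDiff ℝ n ((Prod.fst ∘ e.symm) : E₂ → E₁) := contDiff_fst.comp e.symm.contDiff
    exact h3.contMDiff.contMDiffAt.comp_contMDiffWithinAt z h1
  have key : ∀ y, f y ∈ d.source →
      ((Prod.fst ∘ e.symm) ∘ (c.extend I₂ ∘ (φ ∘ f))) y = d.extend I₁ (f y) := by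
    intro y hy
    have h4 : c.extend I₂ (φ ((d.extend I₁).symm (d.extend I₁ (f y)))) = e (d.extend I₁ (f y), 0) :=
      hw (by
        rw [OpenPartialHomeomorph.extend_target_eq_image_source]
        exact mem_image_of_mem _ hy)
    rw [OpenPartialHomeomorph.extend_left_inv _ hy] at h4
    simp only [comp_apply]
    rw [h4]; simp
  have h5 : ContMDiffWithinAt I₀ 𝓘(ℝ, E₁) n (fun y => d.extend I₁ (f y)) s' z :=
    h2.congr (fun y hy => (key y hy.2).symm) (key z hfz).symm
  have h6 := (contMDiffOn_extend_symm (I := I₁) hd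
    (d.extend I₁ (f z)) (mem_image_of_mem I₁ (d.map_source hfz))).comp
    z h5 (t := I₁ '' d.target) (fun y hy => mem_image_of_mem I₁ (d.map_source hy.2))
  exact h6.congr (fun y hy => (OpenPartialHomeomorph.extend_left_inv _ hy.2).symm)
    (OpenPartialHomeomorph.extend_left_inv _ hfz).symm

/-- A continuous map whose composition with an immersion is smooth is smooth. -/
lemma contMDiffWithinAt_of_comp_immersion
    (hφ : Manifold.IsImmersionAt I₁ I₂ n φ (f z)) (hf : ContinuousWithinAt f s z)
    (h : ContMDiffWithinAt I₀ I₂ n (φ ∘ f) s z) : ContMDiffWithinAt I₀ I₁ n f s z :=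
  contMDiffWithinAt_of_comp_inclusion hφ.domChart_mem_maximalAtlas hφ.codChart_mem_maximalAtlas
    hφ.mem_domChart_source hφ.mem_codChart_source hφ.writtenInCharts hf h

end Immersion

section Subdivision

variable [IsManifold I ∞ N]

lemma IsSubdivision.inside (hs : IsSubdivision K' K) : Inside K' K := hs.2

lemma injective_paramLin {p q : ℕ} {v : Fin (q + 1) → V} {v' : Fin (p + 1) → V}
    (hv' : AffineIndependent ℝ v') (h : range v' ⊆ hull v) : Injective (paramLin (relCoord v v')) :=
    by
  have h1 := linearIndependent_of_affineIndependent hv'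
  rw [← simplexParam_relCoord h, paramLin_comp, ContinuousLinearMap.coe_comp] at h1
  exact Function.Injective.of_comp h1

/-- A finite subdivision of a smooth triangulation is a smooth triangulation. -/
theorem IsSmoothTriangulation.subdivision (hK : IsSmoothTriangulation I P h K)
    (hs : IsSubdivision K' K) (hfin : K'.faces.Finite) : IsSmoothTriangulation I P h K' := by
  have key : ∀ p, ∀ v' ∈ ordS K' p, ∃ q, ∃ v ∈ ordS K q, range v' ⊆ hull v := by
    intro p v' hv'
    obtain ⟨s, hs, hss⟩ := hs.2 _ hv'.2
    obtain ⟨q, hq, v, hv, rfl⟩ := exists_ordering_of_mem hs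
    rw [convexHull_vertexSet, convexHull_vertexSet] at hss
    exact ⟨q, v, ⟨hv, hs⟩, range_subset_hull_of_hull hss⟩
  have hfun : ∀ {p q : ℕ} {v : Fin (q + 1) → V} {v' : Fin (p + 1) → V}, range v' ⊆ hull v →
      h ∘ ρ v' = (h ∘ ρ v) ∘ ρ (relCoord v v') := by
    intro p q v v' hr
    funext t
    conv_lhs => rw [← simplexParam_relCoord hr]
    exact congrArg h (simplexParam_comp v _ t).symm
  refine ⟨hfin, hs.1.trans hK.space_eq, hK.bijOn, ?_, ?_⟩
  · intro p v' hv'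
    obtain ⟨q, v, hv, hr⟩ := key p v' hv'
    rw [hfun hr]
    exact (hK.smooth q v hv).comp (contDiff_simplexParam _).contMDiff.contMDiffOn
      (mapsTo_simplexParam_comp _ (relCoord_mem hr))
  · intro p v' hv' t ht
    obtain ⟨q, v, hv, hr⟩ := key p v' hv'
    have hmaps := mapsTo_simplexParam_comp _ (relCoord_mem hr) (m := p)
    have hD : mfderivWithin 𝓜 p I ((h ∘ ρ v) ∘ ρ (relCoord v v')) (stdSimp p) t =
        (mfderivWithin 𝓜 q I (h ∘ ρ v) (stdSimp q)
          (ρ (relCoord v v') t)).comp (paramLin (relCoord v v')) :=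
      (HasMFDerivWithinAt.comp (u := stdSimp q) t
        (((hK.smooth q v hv _ (hmaps ht)).mdifferentiableWithinAt (by simp)).hasMFDerivWithinAt)
        (hasFDerivAt_simplexParam _ _).hasMFDerivAt.hasMFDerivWithinAt
        hmaps).mfderivWithin (uniqueDiffOn_stdSimp p _ ht).uniqueMDiffWithinAt
    rw [hfun hr, hD]
    exact (hK.immersive q v hv _ (hmaps ht)).comp
      (injective_paramLin (affineIndependent_of_mem hv') hr)

/-- The orientation signs of a triangulation and of a subdivision. -/
lemma orientSign_eq_relSign_mul (o : ManifoldOrientation I N) (hK : IsSmoothTriangulation I P h K)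
    {v v' : Fin (n + 1) → V} (hv : v ∈ ordS K n) (hvv : hull v' ⊆ hull v) :
    orientSign o h v' = relSign v v' * orientSign o h v := by
  have hr := range_subset_hull_of_hull hvv
  rw [relSign, if_pos hvv, ← orientSign_comp o hK hv (relCoord_mem hr), simplexParam_relCoord hr]

/-- The boundary of the orientation chain vanishes on a manifold without boundary. -/
theorem chainBoundary_eq_zero {m : ℕ} {H : Type*} [TopologicalSpace H]
    {I : ModelWithCorners ℝ 𝔼 (m + 1) H} {N : Type*} [TopologicalSpace N] [ChartedSpace H N]
    [IsManifold I ∞ N] [T2Space N] [BoundarylessManifold I N] {h : V → N}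
    (o : ManifoldOrientation I N) (hK : IsSmoothTriangulation I P h K) {T : Finset V}
    (hT : ∀ s ∈ K.faces, s ⊆ T) (w : Fin (m + 1) → V) : chainBoundary T (orientChain o K h) w = 0 :=
    by
  by_cases hw : w ∈ ordS K m
  · exact chainBoundary_eq_zero_of_interior o hK hT hw (stdBary_mem m)
      BoundarylessManifold.isInteriorPoint
  · exact sum_eq_zero fun _ _ => if_neg fun hx =>
      hw (orderedSimplices_comp (f := Fin.succ) (Fin.succ_injective _) hx)

end Subdivision

section Boundary

variable {M : Type*} [TopologicalSpace M] [ChartedSpace (EuclideanHalfSpace 3) M]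
  [IsManifold (𝓡∂ 3) ∞ M] [T2Space M] (oM : ManifoldOrientation (𝓡∂ 3) M) {S : Type*}
  [TopologicalSpace S] [ChartedSpace 𝔼 2 S] [IsManifold (𝓡 2) ∞ S]
  [Nonempty S] (oS : ManifoldOrientation (𝓡 2) S) {j : S → M} {h : V → M}

lemma comp_boundaryMap (hjrange : range j = (𝓡∂ 3).boundary M) {x : V}
    (hx : h x ∈ (𝓡∂ 3).boundary M) : j (boundaryMap h j x) = h x := by
  rw [← hjrange] at hx
  exact Function.invFun_eq hx

lemma hull_maps_of_mem_boundaryComplex {p : ℕ} {w : Fin (p + 1) → V}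
    (hw : w ∈ ordS (boundaryComplex h K) p) : MapsTo h (hull w) ((𝓡∂ 3).boundary M) := by
  have := hw.2.2
  rwa [convexHull_vertexSet] at this

lemma param_maps_of_mem_boundaryComplex {p : ℕ} {w : Fin (p + 1) → V}
    (hw : w ∈ ordS (boundaryComplex h K) p) {t : Fin p → ℝ} (ht : t ∈ stdSimp p) :
    h (ρ w t) ∈ (𝓡∂ 3).boundary M := by
  refine hull_maps_of_mem_boundaryComplex hw ?_
  rw [hull_eq_image]
  exact mem_image_of_mem _ ht

lemma mfderivWithin_boundaryMap (hj : Manifold.IsSmoothEmbedding (𝓡 2) (𝓡∂ 3) ∞ j)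
    (hjrange : range j = (𝓡∂ 3).boundary M) (hK : IsSmoothTriangulation (𝓡∂ 3) P h K) {p : ℕ}
    {w : Fin (p + 1) → V} (hw : w ∈ ordS (boundaryComplex h K) p) : ContMDiffOn 𝓜 p (𝓡 2) ∞
    (boundaryMap h j ∘ ρ w) (stdSimp p) ∧ ∀ t ∈ stdSimp p, ∀ x, mfderivWithin 𝓜 p (𝓡∂ 3) (h ∘ ρ w)
    (stdSimp p) t x = mfderiv (𝓡 2) (𝓡∂ 3) j (boundaryMap h j (ρ w t))
    (mfderivWithin 𝓜 p (𝓡 2) (boundaryMap h j ∘ ρ w) (stdSimp p) t x) := by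
  have hwK : w ∈ ordS K p := ⟨hw.1, hw.2.1⟩
  have hEq : EqOn (j ∘ (boundaryMap h j ∘ ρ w)) (h ∘ ρ w) (stdSimp p) :=
    fun t ht => comp_boundaryMap hjrange (param_maps_of_mem_boundaryComplex hw ht)
  have hsm := (hK.smooth p w hwK).congr hEq
  have hc : ContinuousOn (boundaryMap h j ∘ ρ w) (stdSimp p) :=
    hj.isEmbedding.continuousOn_iff.2 hsm.continuousOn
  have hsmS : ContMDiffOn 𝓜 p (𝓡 2) ∞ (boundaryMap h j ∘ ρ w)
      (stdSimp p) := fun t ht =>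
    contMDiffWithinAt_of_comp_immersion (hj.isImmersion.isImmersionAt _) (hc t ht) (hsm t ht)
  refine ⟨hsmS, fun t ht x => ?_⟩
  have h1 : HasMFDerivWithinAt 𝓜 p (𝓡∂ 3) (j ∘ (boundaryMap h j ∘ ρ w))
      (stdSimp p) t _ :=
    ((hj.isImmersion.contMDiff.mdifferentiable (by simp)
      (boundaryMap h j (ρ w t))).hasMFDerivAt).comp_hasMFDerivWithinAt t
      ((hsmS t ht).mdifferentiableWithinAt (by simp)).hasMFDerivWithinAt
  have h2 := (h1.congr_of_eventuallyEq (f₁ := h ∘ ρ w)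
    (Filter.eventually_of_mem self_mem_nhdsWithin fun t ht => (hEq ht).symm)
    (hEq ht).symm).mfderivWithin (uniqueDiffOn_stdSimp p _ ht).uniqueMDiffWithinAt
  rw [h2]
  rfl

/-- The boundary of a smooth triangulation is a smooth triangulation of the boundary. -/
theorem isSmoothTriangulation_boundary (hj : Manifold.IsSmoothEmbedding (𝓡 2) (𝓡∂ 3) ∞ j)
    (hjrange : range j = (𝓡∂ 3).boundary M) (oM : ManifoldOrientation (𝓡∂ 3) M)
    (hK : IsSmoothTriangulation (𝓡∂ 3) P h K) :
    IsSmoothTriangulation (𝓡 2) (boundaryPoly P h) (boundaryMap h j) (boundaryComplex h K) := by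
  have hinj : Injective j := hj.isEmbedding.injective
  refine ⟨hK.finite.subset fun s hs => hs.1, ?_, ⟨fun _ _ => mem_univ _, ?_, ?_⟩, ?_, ?_⟩
  · refine Subset.antisymm ?_ ?_
    · intro x hx
      obtain ⟨s, hs, hxs⟩ := mem_space_iff.1 hx
      exact ⟨hK.space_eq ▸ mem_space_iff.2 ⟨s, hs.1, hxs⟩, hs.2 hxs⟩
    · rintro x ⟨hxP, hxb⟩
      obtain ⟨T, hT⟩ := exists_vertices_finset hK.finite
      obtain ⟨w, hw, hxw, hne⟩ := exists_simplex_of_mem_boundary oM hK hT hxb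
      have hb := mapsTo_boundary_of_chainBoundary oM hK hT hw hne
      obtain ⟨y, hy, hyx⟩ := hxw
      have hyP : y ∈ P := by
        rw [← hK.space_eq]
        refine mem_space_iff.2 ⟨_, hw.2, ?_⟩
        rwa [convexHull_vertexSet]
      rw [← hK.bijOn.injOn hyP hxP hyx]
      refine mem_space_iff.2 ⟨vertexSet w, ⟨hw.2, ?_⟩, ?_⟩
      · rwa [convexHull_vertexSet]
      · rwa [convexHull_vertexSet]
  · intro x hx y hy hxy
    refine hK.bijOn.injOn hx.1 hy.1 ?_
    rw [← comp_boundaryMap hjrange hx.2, ← comp_boundaryMap hjrange hy.2, hxy]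
  · intro y _
    obtain ⟨x, hx, hxy⟩ := hK.bijOn.surjOn (mem_univ (j y))
    refine ⟨x, ⟨hx, ?_⟩, ?_⟩
    · rw [hxy, ← hjrange]; exact mem_range_self _
    · apply hinj
      rw [comp_boundaryMap hjrange (by rw [hxy, ← hjrange]; exact mem_range_self _), hxy]
  · intro p w hw
    exact (mfderivWithin_boundaryMap hj hjrange hK hw).1
  · intro p w hw t ht a b hab
    refine hK.immersive p w ⟨hw.1, hw.2.1⟩ t ht ?_
    rw [(mfderivWithin_boundaryMap hj hjrange hK hw).2 t ht, hab,
      (mfderivWithin_boundaryMap hj hjrange hK hw).2 t ht]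

/-- The boundary of the orientation chain of a 3-manifold is the orientation chain of its
boundary. -/
theorem chainBoundary_orientChain (hj : Manifold.IsSmoothEmbedding (𝓡 2) (𝓡∂ 3) ∞ j)
    (hjrange : range j = (𝓡∂ 3).boundary M) (hor : IsBoundaryOrientation oM oS j)
    (hK : IsSmoothTriangulation (𝓡∂ 3) P h K) {T : Finset V} (hT : ∀ s ∈ K.faces, s ⊆ T)
    (w : Fin 3 → V) : chainBoundary T (orientChain oM K h) w = orientChain oS (boundaryComplex h K)
    (boundaryMap h j) w := by
  by_cases hw : w ∈ ordS (boundaryComplex h K) 2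
  swap
  · rw [orientChain, if_neg hw]
    by_contra hne
    by_cases hwK : w ∈ ordS K 2
    · refine hw ⟨hwK.1, hwK.2, ?_⟩
      rw [convexHull_vertexSet]
      exact mapsTo_boundary_of_chainBoundary oM hK hT hwK hne
    · exact hne (chainBoundary_eq_zero_of_notMem oM hwK)
  rw [orientChain_of_mem oS hw]
  have hwK : w ∈ ordS K 2 := ⟨hw.1, hw.2.1⟩
  have hb := hull_maps_of_mem_boundaryComplex hw
  set t₀ := stdBary 2
  have ht₀ : t₀ ∈ openSimp 2 := stdBary_mem 2
  have hts := openSimp_subset 2 ht₀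
  set x₀ := h (ρ w t₀) with hx₀
  set x := boundaryMap h j (ρ w t₀) with hx
  have hjx : j x = x₀ := comp_boundaryMap hjrange (param_maps_of_mem_boundaryComplex hw hts)
  obtain ⟨hmin, hval⟩ := chainBoundary_eq_of_mapsTo_boundary oM hK hT hwK hb ht₀ hx₀.symm
  rw [hval]
  have hS := isSmoothTriangulation_boundary hj hjrange oM hK
  have hne := (sign_frameDet_eq oS hS hw hts).2
  set D := fderivWithin ℝ (coord (𝓡∂ 3) x₀ ∘ h ∘ ρ w) (stdSimp 2) t₀ with hD
  have hrow : ∀ x, D x 0 = 0 := fderivWithin_coord_apply_zero hK hwK hb hts (mem_chart_source _ _)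
  set ε := chartMinor (𝓡∂ 3) x₀ 0 h w t₀ with hε
  have hεD : ε = D (single 0 1) 1 * D (single 1 1) 2 - D (single 1 1) 1 * D (single 0 1) 2 := by
    have h1 := fderivWithin_minorMap hK hwK hts (mem_chart_source _ x₀) 0
    rw [hε, chartMinor, ← detForm_comp, detForm_apply, Matrix.det_fin_two]
    simp only [Matrix.of_apply]
    rw [h1, h1, h1, h1]
    rfl
  set u : Fin 2 → 𝔼 2 := fun i =>
    mfderivWithin 𝓜 2 (𝓡 2) (boundaryMap h j ∘ ρ w) (stdSimp 2) t₀
      (single i 1) with hu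
  set c : Fin 2 → 𝔼 3 := fun i => mfderiv (𝓡 2) (𝓡∂ 3) j x (u i) with hc
  have hju : ∀ i k, c i k = D (single i 1) k := by
    intro i k
    have h1 := (mfderivWithin_boundaryMap hj hjrange hK hw).2 t₀ hts (single i 1)
    have h2 : D = _ := fderivWithin_coord (φ := h ∘ ρ w)
      (uniqueDiffOn_stdSimp 2 t₀ hts)
      ((hK.smooth 2 w hwK t₀ hts).mdifferentiableWithinAt (by simp)) (mem_chart_source _ _)
    have h3 : ∀ y : 𝔼 3, tangentCoordChange (𝓡∂ 3) x₀ x₀ x₀ y = y :=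
      fun y => tangentCoordChange_self (mem_extChartAt_source _)
    rw [h2]
    exact congrArg (fun y : 𝔼 3 => y k) ((h3 (c i)).symm.trans
      (congrArg (fun y : 𝔼 3 => tangentCoordChange (𝓡∂ 3) x₀ x₀ x₀ y) h1.symm))
  have hdet : ∀ a b : Fin 2, oM.frameDet (j x) ![-EuclideanSpace.single 0 1, c a, c b] =
      -((oM.sgn x₀ : ℤ) : ℝ) * (D (single a 1) 1 * D (single b 1) 2 -
      D (single b 1) 1 * D (single a 1) 2) := by
    intro a b
    rw [ManifoldOrientation.frameDet, Matrix.det_fin_three, hjx]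
    simp only [Matrix.of_apply, Matrix.cons_val_zero, Matrix.cons_val_one, Matrix.cons_val,
      hju, hrow]
    simp
    ring
  have hneg : (-EuclideanSpace.single 0 1 : 𝔼 3) 0 < 0 := by simp
  have hswap : oS.frameDet x ![u 1, u 0] = -oS.frameDet x u := by
    simp only [ManifoldOrientation.frameDet, Matrix.det_fin_two, Matrix.of_apply]
    simp
    ring
  have hos : orientSign oS (boundaryMap h j) w = (sign (oS.frameDet x u) : ℤ) := rfl
  rw [hos] at hne ⊢
  have hsg : ((oM.sgn x₀ : ℤ) = 1) ∨ ((oM.sgn x₀ : ℤ) = -1) := by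
    rcases Int.units_eq_one_or (oM.sgn x₀) with h1 | h1 <;> simp [h1]
  rcases lt_trichotomy (oS.frameDet x u) 0 with h1 | h1 | h1
  · have h2 := hor x ![u 1, u 0] _ (by rw [hswap]; linarith) hneg
    simp only [Matrix.cons_val_zero, Matrix.cons_val_one] at h2
    rw [hdet 1 0] at h2
    rcases hsg with h3 | h3 <;> rw [h3] at h2 ⊢ <;> push_cast at h2
    · have : 0 < ε := by rw [hεD]; linarith
      simp [h1, this]
    · have : ε < 0 := by rw [hεD]; linarith
      simp [h1, this]
  · rw [h1] at hne; simp at hne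
  · have h2 := hor x u _ h1 hneg
    rw [hdet 0 1] at h2
    rcases hsg with h3 | h3 <;> rw [h3] at h2 ⊢ <;> push_cast at h2
    · have : ε < 0 := by rw [hεD]; linarith
      simp [h1, this]
    · have : 0 < ε := by rw [hεD]; linarith
      simp [h1, this]

end Boundary

section Chains

variable {A : Type*} [AddCommGroup A]

/-- A chain on the tuples of vertices is alternating. -/
def IsAlternating (c : (Fin n → V) → ℤ) : Prop :=
  ∀ (π : Perm (Fin n)) v, c (v ∘ π) = (Perm.sign π : ℤ) * c v

lemma IsAlternating.comp_swap {c : (Fin n → V) → ℤ} (hc : IsAlternating c) {i j : Fin n} (hij : i ≠ j)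
    (v : Fin n → V) : c (v ∘ swap i j) = -c v := by
  rw [hc, Perm.sign_swap hij]; simp

lemma IsAlternating.eq_zero {c : (Fin n → V) → ℤ} (hc : IsAlternating c) {i j : Fin n}
    (hij : i ≠ j) {v : Fin n → V} (h : v i = v j) : c v = 0 := by
  have h1 : v ∘ swap i j = v := by
    funext k
    rcases eq_or_ne k i with rfl | hki
    · simp [h]
    rcases eq_or_ne k j with rfl | hkj
    · simp [h]
    simp [Equiv.swap_apply_of_ne_of_ne hki hkj]
  have h2 := hc.comp_swap hij v
  rw [h1] at h2
  omega

/-- A sum of terms that are invariant under a transposition vanishes. -/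
lemma IsAlternating.sum_eq_zero {c : (Fin n → V) → ℤ} (hc : IsAlternating c) {i j : Fin n}
    (hij : i ≠ j) {F : (Fin n → V) → A} (hF : ∀ v, F (v ∘ swap i j) = F v) :
    ∑ v ∈ tup T n, c v • F v = 0 := by
  refine Finset.sum_involution (fun v _ => v ∘ swap i j) ?_ ?_ ?_ ?_
  · intro v _
    rw [hF, hc.comp_swap hij, neg_smul, add_neg_cancel]
  · intro v _ hv h
    apply hv
    rw [hc.eq_zero hij (v := v), zero_smul]
    have := congrFun h i
    simpa using this.symm
  · intro v hv
    rw [mem_tup] at hv ⊢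
    exact fun k => hv _
  · intro v _
    funext k
    simp

/-- Splitting of a sum according to the order of two entries. -/
lemma sum_eq_sum_pairs {i j : Fin n} {F : (Fin n → V) → A} (r : V → V → Prop) [DecidableRel r]
    (htri : ∀ x y, r x y ∨ x = y ∨ r y x) (hasymm : ∀ x y, r x y → ¬r y x)
    (hF : ∀ v, v i = v j → F v = 0) : ∑ v ∈ tup T n, F v = ∑ v ∈ tup T n, if r (v i) (v j) then F v
    + F (v ∘ swap i j) else 0 := by
  have h1 : ∀ v : Fin n → V, F v = (if r (v i) (v j) then F v else 0) +
      (if r (v j) (v i) then F v else 0) := by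
    intro v
    rcases htri (v i) (v j) with h | h | h
    · rw [if_pos h, if_neg (hasymm _ _ h), add_zero]
    · rw [hF v h]; simp
    · rw [if_pos h, if_neg (hasymm _ _ h), zero_add]
  rw [sum_congr rfl fun v _ => h1 v, sum_add_distrib,
    ← sum_tup_perm T (swap i j) (fun v => if r (v j) (v i) then F v else 0),
    ← sum_add_distrib]
  refine sum_congr rfl fun v _ => ?_
  simp only [comp_apply, Equiv.swap_apply_left, Equiv.swap_apply_right]
  split_ifs <;> simp

/-- Half of a sum of terms that are invariant under a transposition, under a homomorphism that
splits the terms. -/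
lemma IsAlternating.map_half_sum {c : (Fin n → V) → ℤ} (hc : IsAlternating c) {i j : Fin n}
    (hij : i ≠ j) (e : ℝ →+ A) {x : (Fin n → V) → ℝ} {g : (Fin n → V) → A}
    (hx : ∀ v, c v ≠ 0 → x (v ∘ swap i j) = -x v)
    (hg : ∀ v, c v ≠ 0 → e (x v) = g v - g (v ∘ swap i j)) : e (∑ v ∈ tup T n, c v • (1 / 2 * x v))
    = ∑ v ∈ tup T n, c v • g v := by
  classical
  have htri : ∀ x y : V, WellOrderingRel x y ∨ x = y ∨ WellOrderingRel y x := fun x y =>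
    trichotomous_of WellOrderingRel x y
  have hasymm : ∀ x y : V, WellOrderingRel x y → ¬WellOrderingRel y x := fun x y h h' =>
    asymm_of WellOrderingRel h h'
  rw [sum_eq_sum_pairs (i := i) (j := j) WellOrderingRel htri hasymm
      (fun v hv => by rw [hc.eq_zero hij hv, zero_smul]), map_sum,
    sum_eq_sum_pairs (F := fun v => c v • g v) (i := i) (j := j) WellOrderingRel htri hasymm
      (fun v hv => by rw [hc.eq_zero hij hv, zero_smul])]
  refine sum_congr rfl fun v _ => ?_
  split_ifs with h
  · rw [hc.comp_swap hij]
    by_cases h0 : c v = 0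
    · simp [h0]
    · rw [hx v h0, show c v • (1 / 2 * x v) + -c v • (1 / 2 * -x v) = c v • x v by
        simp only [zsmul_eq_mul]; push_cast; ring, map_zsmul, hg v h0, smul_sub, neg_smul,
        sub_eq_add_neg]
  · exact map_zero e

/-- In a sum over an alternating chain, the faces of a simplex contribute equally. -/
lemma IsAlternating.sum_faces {c : (Fin (n + 1) → V) → ℤ} (hc : IsAlternating c)
    {F : (Fin n → V) → (Fin (n + 1) → V) → ℝ}
    (hF : ∀ (π : Perm (Fin (n + 1))) w v, F w (v ∘ π) = F w v) : ∑ v ∈ tup T (n + 1), c v • ∑ k :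
    Fin (n + 1), (-1) ^ (k : ℕ) * F (v ∘ k.succAbove) v = (n + 1) * ∑ v ∈ tup T (n + 1), c v • F
    (tail v) v := by
  have h1 : ∀ k : Fin (n + 1), ∑ v ∈ tup T (n + 1), c v • ((-1 : ℝ) ^ (k : ℕ) *
      F (v ∘ k.succAbove) v) = ∑ v ∈ tup T (n + 1), c v • F (tail v) v := by
    intro k
    rw [← sum_tup_perm T k.cycleRange.symm (fun v => c v • F (tail v) v)]
    refine sum_congr rfl fun v _ => ?_
    have h2 : tail (v ∘ k.cycleRange.symm) = v ∘ k.succAbove := by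
      funext i
      simp [tail]
    rw [h2, hF, hc, Perm.sign_symm, Fin.sign_cycleRange]
    simp only [zsmul_eq_mul]
    push_cast
    ring
  simp_rw [smul_sum]
  rw [sum_comm, sum_congr rfl fun k _ => h1 k]
  simp

/-- The same for the faces of the first facet. -/
lemma IsAlternating.sum_tail_faces {c : (Fin (n + 2) → V) → ℤ} (hc : IsAlternating c)
    {F : (Fin n → V) → (Fin (n + 2) → V) → ℝ}
    (hF : ∀ (π : Perm (Fin (n + 1))) w x u, F w (cons x (u ∘ π)) = F w (cons x u)) : ∑ v ∈ tup T
    (n + 2), c v • ∑ k : Fin (n + 1), (-1) ^ (k : ℕ) * F (tail v ∘ k.succAbove) v = (n + 1) * ∑ v ∈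
    tup T (n + 2), c v • F (tail (tail v)) v := by
  have hcomm : ∀ G : (Fin (n + 2) → V) → ℝ, ∑ v ∈ tup T (n + 2), G v =
      ∑ x ∈ T, ∑ w ∈ tup T (n + 1), G (cons x w) := fun G => by
    rw [sum_tup_succ, sum_comm]
  rw [hcomm, hcomm, mul_sum]
  refine sum_congr rfl fun x _ => ?_
  simp only [tail_cons]
  exact IsAlternating.sum_faces (c := fun u => c (cons x u))
    (F := fun w u => F w (cons x u)) (fun π u => alternating_cons hc x π u)
    (fun π w u => hF π w x u)

lemma IsAlternating.sum_faces₂ {c : (Fin 3 → V) → ℤ} (hc : IsAlternating c)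
    {F : (Fin 2 → V) → (Fin 3 → V) → ℝ} (hF : ∀ (π : Perm (Fin 3)) w v, F w (v ∘ π) = F w v) : ∑ v ∈
    tup T 3, c v • ∑ k : Fin 3, (-1) ^ (k : ℕ) * F (v ∘ k.succAbove) v = 3 * ∑ v ∈ tup T 3, c v • F
    (tail v) v := by
  have h := hc.sum_faces (T := T) hF
  rwa [show ((2 : ℕ) : ℝ) + 1 = 3 by norm_num] at h

lemma IsAlternating.sum_faces₃ {c : (Fin 4 → V) → ℤ} (hc : IsAlternating c)
    {F : (Fin 3 → V) → (Fin 4 → V) → ℝ} (hF : ∀ (π : Perm (Fin 4)) w v, F w (v ∘ π) = F w v) : ∑ v ∈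
    tup T 4, c v • ∑ k : Fin 4, (-1) ^ (k : ℕ) * F (v ∘ k.succAbove) v = 4 * ∑ v ∈ tup T 4, c v • F
    (tail v) v := by
  have h := hc.sum_faces (T := T) hF
  rwa [show ((3 : ℕ) : ℝ) + 1 = 4 by norm_num] at h

lemma IsAlternating.sum_tail_faces₃ {c : (Fin 4 → V) → ℤ} (hc : IsAlternating c)
    {F : (Fin 2 → V) → (Fin 4 → V) → ℝ}
    (hF : ∀ (π : Perm (Fin 3)) w x u, F w (cons x (u ∘ π)) = F w (cons x u)) : ∑ v ∈ tup T 4, c v •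
    ∑ k : Fin 3, (-1) ^ (k : ℕ) * F (tail v ∘ k.succAbove) v = 3 * ∑ v ∈ tup T 4, c v • F
    (tail (tail v)) v := by
  have h := hc.sum_tail_faces (T := T) hF
  rwa [show ((2 : ℕ) : ℝ) + 1 = 3 by norm_num] at h

lemma sum_smul_tail (c : (Fin (n + 1) → V) → ℤ) (F : (Fin n → V) → A) :
    ∑ v ∈ tup T (n + 1), c v • F (tail v) = ∑ w ∈ tup T n, chainBoundary T c w • F w := by
  rw [sum_tup_succ]
  refine sum_congr rfl fun w _ => ?_
  simp only [tail_cons, chainBoundary, sum_smul]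

end Chains

section Cochains

variable {ι : Type*}

/-- The values of a Deligne cocycle on the simplices of a complex: the integrals of its forms and
the values of its functions. The set `D a` is the part of the polyhedron on which the objects with
index `a` are defined. -/
structure Cochains (K : Cpx V) (D : ι → Set V) (A : Type*) [AddCommGroup A] where
  /-- the exponential map -/
  e : ℝ →+ A
  /-- the integrals of the 3-forms -/
  J₃ : ι → (Fin 4 → V) → ℝ
  /-- the integrals of the 2-forms -/
  J₂ : ι → ι → (Fin 3 → V) → ℝ
  /-- the integrals of the 1-forms -/
  J₁ : ι → ι → ι → (Fin 2 → V) → ℝ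
  /-- the values of the functions -/
  G : ι → ι → ι → ι → V → A
  stokes₃ : ∀ a b, ∀ v ∈ ordS K 3, hull v ⊆ D a → hull v ⊆ D b →
    J₃ b v - J₃ a v = ∑ k : Fin 4, (-1) ^ (k : ℕ) * J₂ a b (v ∘ k.succAbove)
  stokes₂ : ∀ a b c, ∀ w ∈ ordS K 2, hull w ⊆ D a → hull w ⊆ D b → hull w ⊆ D c →
    J₂ b c w - J₂ a c w + J₂ a b w = -∑ k : Fin 3, (-1) ^ (k : ℕ) * J₁ a b c (w ∘ k.succAbove)
  stokes₁ : ∀ a b c d, ∀ w ∈ ordS K 1, hull w ⊆ D a → hull w ⊆ D b → hull w ⊆ D c →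
    hull w ⊆ D d → e (J₁ b c d w - J₁ a c d w + J₁ a b d w - J₁ a b c w) =
      G a b c d (w 1) - G a b c d (w 0)
  cocycle : ∀ a b c d f, ∀ x, x ∈ D a → x ∈ D b → x ∈ D c → x ∈ D d → x ∈ D f →
    G b c d f x - G a c d f x + G a b d f x - G a b c f x + G a b c d x = 0
  swap₁ : ∀ a b c, ∀ w ∈ ordS K 1, hull w ⊆ D a → hull w ⊆ D b → hull w ⊆ D c →
    J₁ a b c (w ∘ swap 0 1) = -J₁ a b c w

/-- The labels of the simplices of a complex are compatible with the sets `D a`. -/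
def Adapted (K : Cpx V) (D : ι → Set V) (a : Finset V → ι) : Prop := ∀ s ∈ K.faces, Δ s ⊆ D (a s)

variable {D : ι → Set V} {A : Type*} [AddCommGroup A]

/-- The action of a chain, for the labels `a`. -/
def Cochains.action (J : Cochains K D A) (T : Finset V) (c : (Fin 4 → V) → ℤ)
    (a : Finset V → ι) : A :=
  J.e (∑ v ∈ tup T 4, c v • (1 / 24 * J.J₃ (a (vertexSet v)) v
    - 1 / 6 * J.J₂ (a (vertexSet (tail v))) (a (vertexSet v)) (tail v)
    - 1 / 2 * J.J₁ (a (vertexSet (tail (tail v)))) (a (vertexSet (tail v)))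
        (a (vertexSet v)) (tail (tail v)))) +
  ∑ v ∈ tup T 4, c v • J.G (a (vertexSet (tail (tail (tail v)))))
    (a (vertexSet (tail (tail v)))) (a (vertexSet (tail v))) (a (vertexSet v)) (v 3)

/-- The transition between the labels `a` and `b`. -/
def Cochains.trans (J : Cochains K D A) (T : Finset V) (c : (Fin 3 → V) → ℤ)
    (a b : Finset V → ι) : A :=
  J.e (∑ w ∈ tup T 3, c w • (-(1 / 6 * J.J₂ (a (vertexSet w)) (b (vertexSet w)) w)
    - 1 / 2 * (J.J₁ (a (vertexSet (tail w))) (a (vertexSet w)) (b (vertexSet w)) (tail w)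
      - J.J₁ (a (vertexSet (tail w))) (b (vertexSet (tail w))) (b (vertexSet w))
          (tail w)))) +
  ∑ w ∈ tup T 3, c w •
    (J.G (a (vertexSet (tail (tail w)))) (a (vertexSet (tail w))) (a (vertexSet w))
        (b (vertexSet w)) (w 2)
    - J.G (a (vertexSet (tail (tail w)))) (a (vertexSet (tail w)))
        (b (vertexSet (tail w))) (b (vertexSet w)) (w 2)
    + J.G (a (vertexSet (tail (tail w)))) (b (vertexSet (tail (tail w))))
        (b (vertexSet (tail w))) (b (vertexSet w)) (w 2))

end Cochains

section Algebra

/-- The alternating sum over the simplices of a prism. -/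
local notation "prism[" F "," a "," b "," i "," j "," k "," v "," x "]" =>
  F (a i v) (a j v) (a k v) (b k v) x - F (a i v) (a j v) (b j v) (b k v) x +
    F (a i v) (b i v) (b j v) (b k v) x

/-- The alternating sum over the chains from `i` to `j` with three labels. -/
local notation "chain[" F "," a "," b "," c "," i "," j "," v "," x "]" =>
  F (a i v) (a j v) (b j v) (c j v) x - F (a i v) (b i v) (b j v) (c j v) x +
    F (a i v) (b i v) (c i v) (c j v) x

/-- The summand of the action. -/
local notation "real₃[" J "," a "," v "]" =>
  1 / 24 * Cochains.J₃ J (a 3 v) v - 1 / 6 * Cochains.J₂ J (a 2 v) (a 3 v) (tail v) -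
    1 / 2 * Cochains.J₁ J (a 1 v) (a 2 v) (a 3 v) (tail (tail v))

/-- The summand of the transition. -/
local notation "real₂[" J "," a "," b "," v "," w "]" =>
  -(1 / 6 * Cochains.J₂ J (a 2 v) (b 2 v) w) - 1 / 2 * (Cochains.J₁ J (a 1 v) (a 2 v) (b 2 v) (tail w)
    - Cochains.J₁ J (a 1 v) (b 1 v) (b 2 v) (tail w))

variable {ι : Type*} {D : ι → Set V} {A : Type*} [AddCommGroup A]

/-- Labels of the simplices of a flag of a 3-simplex. -/
structure FlagLabels₃ (D : ι → Set V) (c : (Fin 4 → V) → ℤ) (a : Fin 4 → (Fin 4 → V) → ι) :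
    Prop where
  perm₃ : ∀ (π : Perm (Fin 4)) v, a 3 (v ∘ π) = a 3 v
  perm₂ : ∀ (π : Perm (Fin 3)) x u, a 2 (cons x (u ∘ π)) = a 2 (cons x u)
  swap₂ : ∀ v, a 2 (v ∘ swap 1 2) = a 2 v
  swap₂' : ∀ v, a 2 (v ∘ swap 2 3) = a 2 v
  swap₁ : ∀ v, a 1 (v ∘ swap 0 1) = a 1 v
  swap₁' : ∀ v, a 1 (v ∘ swap 2 3) = a 1 v
  swap₀ : ∀ v, a 0 (v ∘ swap 0 1) = a 0 v
  swap₀' : ∀ v, a 0 (v ∘ swap 1 2) = a 0 v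
  dom₃ : ∀ v, c v ≠ 0 → hull v ⊆ D (a 3 v)
  dom₂ : ∀ v, c v ≠ 0 → hull (tail v) ⊆ D (a 2 v)
  dom₁ : ∀ v, c v ≠ 0 → hull (tail (tail v)) ⊆ D (a 1 v)
  dom₀ : ∀ v, c v ≠ 0 → v 3 ∈ D (a 0 v)

/-- The labels of the flags that belong to labels of the simplices. -/
def flagLabel₃ (a : Finset V → ι) : Fin 4 → (Fin 4 → V) → ι :=
  ![fun v => a (vertexSet (tail (tail (tail v)))),
    fun v => a (vertexSet (tail (tail v))), fun v => a (vertexSet (tail v)),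
    fun v => a (vertexSet v)]

lemma vertexSet_congr {m : ℕ} {u w : Fin m → V} (π : Perm (Fin m)) (h : ∀ i, u i = w (π i)) :
    vertexSet u = vertexSet w :=
  (funext h : u = w ∘ π) ▸ vertexSet_comp_perm w π

lemma hull_tail_le {m : ℕ} (v : Fin (m + 1) → V) : hull (tail v) ⊆ hull v :=
  convexHull_mono (range_subset_iff.2 fun i => ⟨i.succ, rfl⟩)

lemma tail_mem {m : ℕ} {v : Fin (m + 2) → V} (hv : v ∈ ordS K (m + 1)) : tail v ∈ ordS K m :=
  orderedSimplices_comp (f := Fin.succ) (Fin.succ_injective _) hv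

lemma Adapted.hull_subset {a : Finset V → ι} (ha : Adapted K D a) {m : ℕ} {v : Fin (m + 1) → V}
    (hv : v ∈ ordS K m) : hull v ⊆ D (a (vertexSet v)) := by
  have := ha _ hv.2
  rwa [convexHull_vertexSet] at this

lemma flagLabels₃ {c : (Fin 4 → V) → ℤ} (hcK : ∀ v, c v ≠ 0 → v ∈ ordS K 3)
    {a : Finset V → ι} (ha : Adapted K D a) : FlagLabels₃ D c (flagLabel₃ a) where
  perm₃ π v := congrArg a (vertexSet_comp_perm v π)
  perm₂ π x u := congrArg a (by simp only [tail_cons]; exact vertexSet_comp_perm u π)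
  swap₂ v := congrArg a (by
    rw [show tail (v ∘ swap 1 2) = tail v ∘ swap 0 1 by
      funext i; fin_cases i <;> rfl]
    exact vertexSet_comp_perm _ _)
  swap₂' v := congrArg a (by
    rw [show tail (v ∘ swap 2 3) = tail v ∘ swap 1 2 by
      funext i; fin_cases i <;> rfl]
    exact vertexSet_comp_perm _ _)
  swap₁ v := congrArg a (by
    rw [show tail (tail (v ∘ swap 0 1)) = tail (tail v) by
      funext i; fin_cases i <;> rfl])
  swap₁' v := congrArg a (by
    rw [show tail (tail (v ∘ swap 2 3)) = tail (tail v) ∘ swap 0 1 by funext i; fin_cases i <;> rfl]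
    exact vertexSet_comp_perm _ _)
  swap₀ v := congrArg a (by
    rw [show tail (tail (tail (v ∘ swap 0 1))) =
      tail (tail (tail v)) by funext i; fin_cases i; rfl])
  swap₀' v := congrArg a (vertexSet_congr 1 fun i => by fin_cases i ; rfl)
  dom₃ v hv := ha.hull_subset (hcK v hv)
  dom₂ v hv := ha.hull_subset (tail_mem (hcK v hv))
  dom₁ v hv := ha.hull_subset (tail_mem (tail_mem (hcK v hv)))
  dom₀ v hv := ha.hull_subset (tail_mem (tail_mem (tail_mem (hcK v hv))))
    (subset_convexHull ℝ _ ⟨0, rfl⟩)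

lemma sum_smul_congr {n : ℕ} {B : Type*} [AddCommGroup B] {c : (Fin n → V) → ℤ}
    {F F' : (Fin n → V) → B} (h : ∀ v, c v ≠ 0 → F v = F' v) :
    ∑ v ∈ tup T n, c v • F v = ∑ v ∈ tup T n, c v • F' v := by
  refine sum_congr rfl fun v _ => ?_
  by_cases h0 : c v = 0
  · simp [h0]
  · rw [h v h0]

variable {c : (Fin 4 → V) → ℤ} {a b : Fin 4 → (Fin 4 → V) → ι}

/-- The alternating sum of the values of 1-cochains. -/
def Cochains.δ₁ (J : Cochains K D A) (a b c d : ι) (w : Fin 2 → V) : ℝ :=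
  J.J₁ b c d w - J.J₁ a c d w + J.J₁ a b d w - J.J₁ a b c w

lemma Cochains.δ₁_swap (J : Cochains K D A) {a b c d : ι} {w : Fin 2 → V}
    (hw : w ∈ ordS K 1) (ha : hull w ⊆ D a) (hb : hull w ⊆ D b) (hc : hull w ⊆ D c)
    (hd : hull w ⊆ D d) : J.δ₁ a b c d (w ∘ swap 0 1) = -J.δ₁ a b c d w := by
  unfold δ₁
  rw [J.swap₁ b c d w hw hb hc hd, J.swap₁ a c d w hw ha hc hd, J.swap₁ a b d w hw ha hb hd,
    J.swap₁ a b c w hw ha hb hc]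
  ring

/-- The real part of the difference of two actions. -/
lemma Cochains.real_action_sub (J : Cochains K D A) (hc : IsAlternating c)
    (hcK : ∀ v, c v ≠ 0 → v ∈ ordS K 3) (ha : FlagLabels₃ D c a) (hb : FlagLabels₃ D c b) : ∑ v ∈
    tup T 4, c v • (real₃[J, a, v]) - ∑ v ∈ tup T 4, c v • (real₃[J, b, v]) = ∑ v ∈ tup T 4, c v •
    (real₂[J, a, b, v, tail v]) + ∑ v ∈ tup T 4, c v •
    (1 / 2 * (prism[J.δ₁, a, b, 1, 2, 3, v, tail (tail v)])) := by
  have h1 := hc.sum_faces₃ (T := T) (F := fun w v => J.J₂ (a 3 v) (b 3 v) w)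
    (fun π w v => by rw [ha.perm₃, hb.perm₃])
  have h2 := hc.sum_tail_faces₃ (T := T) (F := fun w v => J.J₁ (a 2 v) (a 3 v) (b 3 v) w)
    (fun π w x u => by
      rw [ha.perm₂, cons_comp_perm, ha.perm₃, hb.perm₃])
  have h3 := hc.sum_tail_faces₃ (T := T) (F := fun w v => J.J₁ (a 2 v) (b 2 v) (b 3 v) w)
    (fun π w x u => by
      rw [ha.perm₂, hb.perm₂, cons_comp_perm, hb.perm₃])
  have h4 := hc.sum_eq_zero (T := T) (i := 0) (j := 1) (by decide)
    (F := fun v => J.J₁ (a 1 v) (a 3 v) (b 3 v) (tail (tail v)))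
    (fun v => by
      rw [ha.perm₃, hb.perm₃, ha.swap₁]
      congr 1)
  have h5 := hc.sum_eq_zero (T := T) (i := 0) (j := 1) (by decide)
    (F := fun v => J.J₁ (a 1 v) (b 1 v) (b 3 v) (tail (tail v)))
    (fun v => by
      rw [hb.perm₃, ha.swap₁, hb.swap₁]
      congr 1)
  have key : ∀ v, c v ≠ 0 → (real₃[J, a, v]) - (real₃[J, b, v]) =
      -(1 / 24) * ∑ k : Fin 4, (-1) ^ (k : ℕ) * J.J₂ (a 3 v) (b 3 v) (v ∘ k.succAbove) +
      1 / 6 * J.J₂ (a 3 v) (b 3 v) (tail v) +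
      1 / 6 * ∑ k : Fin 3, (-1) ^ (k : ℕ) * J.J₁ (a 2 v) (a 3 v) (b 3 v) (tail v ∘ k.succAbove) -
      1 / 6 * ∑ k : Fin 3, (-1) ^ (k : ℕ) * J.J₁ (a 2 v) (b 2 v) (b 3 v) (tail v ∘ k.succAbove) -
      1 / 6 * J.J₂ (a 2 v) (b 2 v) (tail v) -
      1 / 2 * J.J₁ (a 1 v) (a 2 v) (a 3 v) (tail (tail v)) +
      1 / 2 * J.J₁ (b 1 v) (b 2 v) (b 3 v) (tail (tail v)) := by
    intro v hv
    have hK := hcK v hv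
    have ht := hull_tail_le v
    have e1 := J.stokes₃ _ _ v hK (ha.dom₃ v hv) (hb.dom₃ v hv)
    have e2 := J.stokes₂ _ _ _ _ (tail_mem hK) (ha.dom₂ v hv) (ht.trans (ha.dom₃ v hv))
      (ht.trans (hb.dom₃ v hv))
    have e3 := J.stokes₂ _ _ _ _ (tail_mem hK) (ha.dom₂ v hv) (hb.dom₂ v hv)
      (ht.trans (hb.dom₃ v hv))
    rw [← e1]
    linarith
  rw [← sum_sub_distrib]
  simp_rw [← smul_sub]
  rw [sum_smul_congr key]
  unfold Cochains.δ₁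
  simp only [zsmul_eq_mul, mul_add, mul_sub, sum_add_distrib, sum_sub_distrib,
    mul_neg, Finset.sum_neg_distrib, neg_mul, mul_left_comm _ (1 / 24 : ℝ),
    mul_left_comm _ (1 / 6 : ℝ), mul_left_comm _ (1 / 2 : ℝ), ← mul_sum] at h1 h2 h3 h4 h5 ⊢
  linarith

/-- The actions for two labels differ by the transition on the boundary. -/
theorem Cochains.action_eq_aux (J : Cochains K D A) (hc : IsAlternating c) (hcK : ∀ v, c v ≠ 0 → v ∈
    ordS K 3) (ha : FlagLabels₃ D c a) (hb : FlagLabels₃ D c b) : (J.e (∑ v ∈ tup T 4, c v •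
    (real₃[J, a, v])) + ∑ v ∈ tup T 4, c v • J.G (a 0 v) (a 1 v) (a 2 v) (a 3 v) (v 3)) - (J.e (∑ v
    ∈ tup T 4, c v • (real₃[J, b, v])) + ∑ v ∈ tup T 4, c v • J.G (b 0 v) (b 1 v) (b 2 v) (b 3 v) (v
    3)) = J.e (∑ v ∈ tup T 4, c v • (real₂[J, a, b, v, tail v])) + ∑ v ∈ tup T 4, c v • (prism[J.G,
    a, b, 0, 1, 2, v, v 3]) := by
  rw [add_sub_add_comm, ← map_sub, J.real_action_sub hc hcK ha hb, map_add, add_assoc]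
  congr 1
  have hsw : ∀ v : Fin 4 → V, tail (tail (v ∘ swap 2 3)) =
      tail (tail v) ∘ swap 0 1 := fun v => by funext i; fin_cases i <;> rfl
  have hsw2 : ∀ v : Fin 4 → V, (v ∘ swap 2 3) 3 = v 2 := fun v => rfl
  have hd : ∀ v, c v ≠ 0 → tail (tail v) ∈ ordS K 1 ∧
      hull (tail (tail v)) ⊆ D (a 1 v) ∧ hull (tail (tail v)) ⊆ D (a 2 v) ∧
      hull (tail (tail v)) ⊆ D (a 3 v) ∧ hull (tail (tail v)) ⊆ D (b 1 v) ∧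
      hull (tail (tail v)) ⊆ D (b 2 v) ∧ hull (tail (tail v)) ⊆ D (b 3 v) := by
    intro v hv
    have h1 := hull_tail_le (tail v)
    have h2 := h1.trans (hull_tail_le v)
    exact ⟨tail_mem (tail_mem (hcK v hv)), ha.dom₁ v hv, h1.trans (ha.dom₂ v hv),
      h2.trans (ha.dom₃ v hv), hb.dom₁ v hv, h1.trans (hb.dom₂ v hv), h2.trans (hb.dom₃ v hv)⟩
  rw [hc.map_half_sum (i := 2) (j := 3) (by decide) J.e (g := fun v =>
      prism[J.G, a, b, 1, 2, 3, v, v 3])]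
  rotate_left
  · intro v hv
    obtain ⟨h0, h1, h2, h3, h4, h5, h6⟩ := hd v hv
    rw [ha.perm₃, hb.perm₃, ha.swap₂', hb.swap₂', ha.swap₁', hb.swap₁', hsw,
      J.δ₁_swap h0 h1 h2 h3 h6, J.δ₁_swap h0 h1 h2 h5 h6, J.δ₁_swap h0 h1 h4 h5 h6]
    ring
  · intro v hv
    obtain ⟨h0, h1, h2, h3, h4, h5, h6⟩ := hd v hv
    rw [ha.perm₃, hb.perm₃, ha.swap₂', hb.swap₂', ha.swap₁', hb.swap₁', hsw2, map_add, map_sub]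
    unfold δ₁
    rw [J.stokes₁ _ _ _ _ _ h0 h1 h2 h3 h6, J.stokes₁ _ _ _ _ _ h0 h1 h2 h5 h6,
      J.stokes₁ _ _ _ _ _ h0 h1 h4 h5 h6]
    change (J.G _ _ _ _ (v 3) - J.G _ _ _ _ (v 2)) - (J.G _ _ _ _ (v 3) - J.G _ _ _ _ (v 2)) +
      (J.G _ _ _ _ (v 3) - J.G _ _ _ _ (v 2)) = _
    abel
  have e1 := hc.sum_eq_zero (T := T) (i := 1) (j := 2) (by decide) (F := fun v =>
      prism[J.G, a, b, 0, 2, 3, v, v 3]) (fun v => by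
    rw [ha.perm₃, hb.perm₃, ha.swap₂, hb.swap₂, ha.swap₀', hb.swap₀']
    rfl)
  have e2 := hc.sum_eq_zero (T := T) (i := 0) (j := 1) (by decide) (F := fun v =>
      prism[J.G, a, b, 0, 1, 3, v, v 3]) (fun v => by
    rw [ha.perm₃, hb.perm₃, ha.swap₁, hb.swap₁, ha.swap₀, hb.swap₀]
    rfl)
  rw [← sum_sub_distrib, ← sum_add_distrib]
  simp_rw [← smul_sub, ← smul_add]
  have key : ∀ v, c v ≠ 0 →
      prism[J.G, a, b, 1, 2, 3, v, v 3] + (J.G (a 0 v) (a 1 v) (a 2 v) (a 3 v) (v 3) -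
        J.G (b 0 v) (b 1 v) (b 2 v) (b 3 v) (v 3)) =
      (prism[J.G, a, b, 0, 1, 2, v, v 3]) +
      ((prism[J.G, a, b, 0, 2, 3, v, v 3]) - (prism[J.G, a, b, 0, 1, 3, v, v 3])) := by
    intro v hv
    obtain ⟨-, h1, h2, h3, h4, h5, h6⟩ := hd v hv
    have hm : v 3 ∈ hull (tail (tail v)) := subset_convexHull ℝ _ ⟨1, rfl⟩
    have h0 := ha.dom₀ v hv
    have h0' := hb.dom₀ v hv
    have d1 := J.cocycle (a 0 v) (a 1 v) (a 2 v) (a 3 v) (b 3 v) (v 3) h0 (h1 hm) (h2 hm) (h3 hm)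
      (h6 hm)
    have d2 := J.cocycle (a 0 v) (a 1 v) (a 2 v) (b 2 v) (b 3 v) (v 3) h0 (h1 hm) (h2 hm) (h5 hm)
      (h6 hm)
    have d3 := J.cocycle (a 0 v) (a 1 v) (b 1 v) (b 2 v) (b 3 v) (v 3) h0 (h1 hm) (h4 hm) (h5 hm)
      (h6 hm)
    have d4 := J.cocycle (a 0 v) (b 0 v) (b 1 v) (b 2 v) (b 3 v) (v 3) h0 h0' (h4 hm) (h5 hm)
      (h6 hm)
    have d5 := congrArg₂ (· + ·) (congrArg₂ (· - ·) d1 d2) (congrArg₂ (· - ·) d3 d4)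
    simp only [sub_self, add_zero] at d5
    rw [← sub_eq_zero, ← d5]
    abel
  rw [sum_smul_congr key]
  simp_rw [smul_add _ _ (_ - _ : A), smul_sub _ (_ - _ + _ : A) (_ - _ + _ : A)]
  rw [sum_add_distrib, sum_sub_distrib, e1, e2]
  simp

/-- The actions for two labels differ by the transition on the boundary. -/
theorem Cochains.action_sub_action (J : Cochains K D A) {c : (Fin 4 → V) → ℤ} (hc : IsAlternating c)
    (hcK : ∀ v, c v ≠ 0 → v ∈ ordS K 3) {a b : Finset V → ι} (ha : Adapted K D a)
    (hb : Adapted K D b) : J.action T c a - J.action T c b = J.trans T (chainBoundary T c) a b := by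
  refine (J.action_eq_aux hc hcK (flagLabels₃ hcK ha) (flagLabels₃ hcK hb)).trans ?_
  unfold trans
  rw [← sum_smul_tail, ← sum_smul_tail]
  rfl

/-- Labels of the simplices of a flag of a 2-simplex. -/
structure FlagLabels₂ (D : ι → Set V) (c : (Fin 3 → V) → ℤ) (a : Fin 3 → (Fin 3 → V) → ι) :
    Prop where
  perm₂ : ∀ (π : Perm (Fin 3)) v, a 2 (v ∘ π) = a 2 v
  swap₁ : ∀ v, a 1 (v ∘ swap 1 2) = a 1 v
  swap₀ : ∀ v, a 0 (v ∘ swap 0 1) = a 0 v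
  dom₂ : ∀ v, c v ≠ 0 → hull v ⊆ D (a 2 v)
  dom₁ : ∀ v, c v ≠ 0 → hull (tail v) ⊆ D (a 1 v)
  dom₀ : ∀ v, c v ≠ 0 → v 2 ∈ D (a 0 v)
  vertex : ∀ v v', tail v = tail v' → a 0 v = a 0 v'
  edge : ∀ v v', tail v = tail v' → a 1 v = a 1 v'

/-- The labels of the flags that belong to labels of the simplices. -/
def flagLabel₂ (a : Finset V → ι) : Fin 3 → (Fin 3 → V) → ι :=
  ![fun v => a (vertexSet (tail (tail v))), fun v => a (vertexSet (tail v)),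
    fun v => a (vertexSet v)]

lemma flagLabels₂ {c : (Fin 3 → V) → ℤ} (hcK : ∀ v, c v ≠ 0 → v ∈ ordS K 2)
    {a : Finset V → ι} (ha : Adapted K D a) : FlagLabels₂ D c (flagLabel₂ a) where
  perm₂ π v := congrArg a (vertexSet_comp_perm v π)
  swap₁ v := congrArg a (by
    rw [show tail (v ∘ swap 1 2) = tail v ∘ swap 0 1 by
      funext i; fin_cases i <;> rfl]
    exact vertexSet_comp_perm _ _)
  swap₀ v := congrArg a (vertexSet_congr 1 fun i => by fin_cases i ; rfl)
  dom₂ v hv := ha.hull_subset (hcK v hv)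
  dom₁ v hv := ha.hull_subset (tail_mem (hcK v hv))
  dom₀ v hv := ha.hull_subset (tail_mem (tail_mem (hcK v hv))) (subset_convexHull ℝ _ ⟨0, rfl⟩)
  vertex v v' h := by
    change a (vertexSet (tail (tail v))) = a (vertexSet (tail (tail v')))
    rw [h]
  edge v v' h := by
    change a (vertexSet (tail v)) = a (vertexSet (tail v'))
    rw [h]

/-- A sum of terms that depend only on a facet vanishes for a cycle. -/
lemma sum_smul_eq_zero_of_tail {B : Type*} [AddCommGroup B] {m : ℕ} {c : (Fin (m + 1) → V) → ℤ}
    (hc : ∀ w, chainBoundary T c w = 0) {F : (Fin (m + 1) → V) → B}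
    (hF : ∀ v v', tail v = tail v' → F v = F v') : ∑ v ∈ tup T (m + 1), c v • F v = 0 := by
  have h1 : ∀ v, F v = (fun w => F (cons 0 w)) (tail v) := fun v =>
    hF _ _ (by simp)
  rw [sum_congr rfl fun v _ => by rw [h1 v]]
  exact (sum_smul_tail c fun w => F (cons 0 w)).trans (by simp [hc])

/-- The transitions between three labels, on a closed surface. -/
theorem Cochains.trans_add_aux (J : Cochains K D A) {o : (Fin 3 → V) → ℤ}
    {a b c : Fin 3 → (Fin 3 → V) → ι} (ho : IsAlternating o)
    (hoK : ∀ v, o v ≠ 0 → v ∈ ordS K 2) (hbd : ∀ w, chainBoundary T o w = 0)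
    (ha : FlagLabels₂ D o a) (hb : FlagLabels₂ D o b) (hc : FlagLabels₂ D o c) :
    (J.e (∑ v ∈ tup T 3, o v • real₂[J, a, b, v, v]) + ∑ v ∈ tup T 3, o v • prism[J.G, a, b, 0, 1, 2, v, v 2]) +
    (J.e (∑ v ∈ tup T 3, o v • real₂[J, b, c, v, v]) + ∑ v ∈ tup T 3, o v • prism[J.G, b, c, 0, 1, 2, v, v 2]) -
    (J.e (∑ v ∈ tup T 3, o v • real₂[J, a, c, v, v]) + ∑ v ∈ tup T 3, o v • prism[J.G, a, c, 0, 1, 2, v, v 2]) = 0 := by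
  have hsw : ∀ v : Fin 3 → V, tail (v ∘ swap 1 2) =
      tail v ∘ swap 0 1 := fun v => by funext i; fin_cases i <;> rfl
  have hsw2 : ∀ v : Fin 3 → V, (v ∘ swap 1 2) 2 = v 1 := fun v => rfl
  have hd : ∀ v, o v ≠ 0 → tail v ∈ ordS K 1 ∧
      hull (tail v) ⊆ D (a 1 v) ∧ hull (tail v) ⊆ D (a 2 v) ∧
      hull (tail v) ⊆ D (b 1 v) ∧ hull (tail v) ⊆ D (b 2 v) ∧
      hull (tail v) ⊆ D (c 1 v) ∧ hull (tail v) ⊆ D (c 2 v) := by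
    intro v hv
    have h1 := hull_tail_le v
    exact ⟨tail_mem (hoK v hv), ha.dom₁ v hv, h1.trans (ha.dom₂ v hv),
      hb.dom₁ v hv, h1.trans (hb.dom₂ v hv), hc.dom₁ v hv, h1.trans (hc.dom₂ v hv)⟩
  have hreal : ∑ v ∈ tup T 3, o v • (real₂[J, a, b, v, v] + real₂[J, b, c, v, v] - real₂[J, a, c, v, v]) =
      ∑ v ∈ tup T 3, o v • (1 / 2 * (chain[J.δ₁, a, b, c, 1, 2, v, tail v])) := by
    have h1 := ho.sum_faces₂ (T := T) (F := fun w v => J.J₁ (a 2 v) (b 2 v) (c 2 v) w)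
      (fun π w v => by rw [ha.perm₂, hb.perm₂, hc.perm₂])
    have h2 := sum_smul_eq_zero_of_tail hbd
      (F := fun v => J.J₁ (a 1 v) (b 1 v) (c 1 v) (tail v))
      (fun v v' h => by rw [ha.edge v v' h, hb.edge v v' h, hc.edge v v' h, h])
    have key : ∀ v, o v ≠ 0 → real₂[J, a, b, v, v] + real₂[J, b, c, v, v] - real₂[J, a, c, v, v] =
        1 / 6 * ∑ k : Fin 3, (-1) ^ (k : ℕ) * J.J₁ (a 2 v) (b 2 v) (c 2 v) (v ∘ k.succAbove) -
        1 / 2 * J.J₁ (a 1 v) (a 2 v) (b 2 v) (tail v) +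
        1 / 2 * J.J₁ (a 1 v) (b 1 v) (b 2 v) (tail v) -
        1 / 2 * J.J₁ (b 1 v) (b 2 v) (c 2 v) (tail v) +
        1 / 2 * J.J₁ (b 1 v) (c 1 v) (c 2 v) (tail v) +
        1 / 2 * J.J₁ (a 1 v) (a 2 v) (c 2 v) (tail v) -
        1 / 2 * J.J₁ (a 1 v) (c 1 v) (c 2 v) (tail v) := by
      intro v hv
      have e2 := J.stokes₂ _ _ _ _ (hoK v hv) (ha.dom₂ v hv) (hb.dom₂ v hv) (hc.dom₂ v hv)
      linarith
    rw [sum_smul_congr key]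
    unfold δ₁
    simp only [zsmul_eq_mul, mul_add, mul_sub, sum_add_distrib, sum_sub_distrib,
      mul_left_comm _ (1 / 6 : ℝ), mul_left_comm _ (1 / 2 : ℝ), ← mul_sum] at h1 h2 ⊢
    linarith
  rw [add_add_add_comm, add_sub_add_comm, ← map_add, ← map_sub, ← sum_add_distrib,
    ← sum_sub_distrib, ← sum_add_distrib, ← sum_sub_distrib]
  simp_rw [← smul_add, ← smul_sub]
  rw [hreal, ho.map_half_sum (i := 1) (j := 2) (by decide) J.e (g := fun v =>
      chain[J.G, a, b, c, 1, 2, v, v 2])]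
  rotate_left
  · intro v hv
    obtain ⟨h0, h1, h2, h3, h4, h5, h6⟩ := hd v hv
    rw [ha.perm₂, hb.perm₂, hc.perm₂, ha.swap₁, hb.swap₁, hc.swap₁, hsw,
      J.δ₁_swap h0 h1 h2 h4 h6, J.δ₁_swap h0 h1 h3 h4 h6, J.δ₁_swap h0 h1 h3 h5 h6]
    ring
  · intro v hv
    obtain ⟨h0, h1, h2, h3, h4, h5, h6⟩ := hd v hv
    rw [ha.perm₂, hb.perm₂, hc.perm₂, ha.swap₁, hb.swap₁, hc.swap₁, hsw2, map_add, map_sub]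
    unfold δ₁
    rw [J.stokes₁ _ _ _ _ _ h0 h1 h2 h4 h6, J.stokes₁ _ _ _ _ _ h0 h1 h3 h4 h6,
      J.stokes₁ _ _ _ _ _ h0 h1 h3 h5 h6]
    change (J.G _ _ _ _ (v 2) - J.G _ _ _ _ (v 1)) - (J.G _ _ _ _ (v 2) - J.G _ _ _ _ (v 1)) +
      (J.G _ _ _ _ (v 2) - J.G _ _ _ _ (v 1)) = _
    abel
  have e1 := ho.sum_eq_zero (T := T) (i := 0) (j := 1) (by decide) (F := fun v =>
      chain[J.G, a, b, c, 0, 2, v, v 2]) (fun v => by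
    rw [ha.perm₂, hb.perm₂, hc.perm₂, ha.swap₀, hb.swap₀, hc.swap₀]
    rfl)
  have e2 := sum_smul_eq_zero_of_tail hbd (F := fun v =>
      chain[J.G, a, b, c, 0, 1, v, v 2]) (fun v v' h => by
    rw [ha.edge v v' h, hb.edge v v' h, hc.edge v v' h, ha.vertex v v' h, hb.vertex v v' h,
      hc.vertex v v' h, show v 2 = v' 2 from congrFun h 1])
  rw [← sum_add_distrib]
  simp_rw [← smul_add]
  have key : ∀ v, o v ≠ 0 →
      chain[J.G, a, b, c, 1, 2, v, v 2] + (prism[J.G, a, b, 0, 1, 2, v, v 2] + prism[J.G, b, c, 0, 1, 2, v, v 2] - prism[J.G, a, c, 0, 1, 2, v, v 2]) =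
      (chain[J.G, a, b, c, 0, 2, v, v 2]) -
      (chain[J.G, a, b, c, 0, 1, v, v 2]) := by
    intro v hv
    obtain ⟨-, h1, h2, h3, h4, h5, h6⟩ := hd v hv
    have hm : v 2 ∈ hull (tail v) := subset_convexHull ℝ _ ⟨1, rfl⟩
    have p0 := ha.dom₀ v hv
    have q0 := hb.dom₀ v hv
    have r0 := hc.dom₀ v hv
    have d1 := J.cocycle _ _ _ _ _ (v 2) p0 (h1 hm) (h2 hm) (h4 hm) (h6 hm)
    have d2 := J.cocycle _ _ _ _ _ (v 2) p0 (h1 hm) (h3 hm) (h4 hm) (h6 hm)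
    have d3 := J.cocycle _ _ _ _ _ (v 2) p0 (h1 hm) (h3 hm) (h5 hm) (h6 hm)
    have d4 := J.cocycle _ _ _ _ _ (v 2) p0 q0 (h3 hm) (h4 hm) (h6 hm)
    have d5 := J.cocycle _ _ _ _ _ (v 2) p0 q0 (h3 hm) (h5 hm) (h6 hm)
    have d6 := J.cocycle _ _ _ _ _ (v 2) p0 q0 r0 (h5 hm) (h6 hm)
    have d7 := congrArg₂ (· + ·) (congrArg₂ (· - ·) (congrArg₂ (· + ·) d1 d3) d2)
      (congrArg₂ (· - ·) (congrArg₂ (· + ·) d4 d6) d5)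
    simp only [sub_self, add_zero] at d7
    rw [← sub_eq_zero, ← d7]
    abel
  rw [sum_smul_congr key]
  simp_rw [smul_sub _ (_ - _ + _ : A) (_ - _ + _ : A)]
  rw [sum_sub_distrib, e1, e2]
  simp

/-- The transitions between three labels, on a closed surface. -/
theorem Cochains.trans_add_trans (J : Cochains K D A) {o : (Fin 3 → V) → ℤ} (ho : IsAlternating o)
    (hoK : ∀ v, o v ≠ 0 → v ∈ ordS K 2) (hbd : ∀ w, chainBoundary T o w = 0) {a b c : Finset V → ι}
    (ha : Adapted K D a) (hb : Adapted K D b) (hc : Adapted K D c) : J.trans T o a b + J.trans T o b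
    c = J.trans T o a c :=
  sub_eq_zero.1 (by
    have := J.trans_add_aux ho hoK hbd (flagLabels₂ hoK ha) (flagLabels₂ hoK hb) (flagLabels₂ hoK hc)
    rw [← this]
    rfl)

end Algebra

section Refinement

variable {p : ℕ} {κ : Type*} {B : Type*} [AddCommGroup B]

/-- The face of a simplex that is spanned by its last `p + 1` vertices. -/
def drop : (k : ℕ) → (Fin (p + k + 1) → V) → Fin (p + 1) → V
  | 0, v => v
  | k + 1, v => drop k (tail v)

/-- The largest `k + 1` simplices of the flag of `v'` are contained in those of the flag of `v`. -/
def Flag : (k : ℕ) → (Fin (p + k + 1) → V) → (Fin (p + k + 1) → V) → Prop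
  | 0, v', v => hull v' ⊆ hull v
  | k + 1, v', v => hull v' ⊆ hull v ∧ Flag k (tail v') (tail v)

/-- The labels of the largest `k + 1` simplices of a flag. -/
def labels (a : Finset V → κ) : (k : ℕ) → (Fin (p + k + 1) → V) → List κ
  | 0, v => [a (vertexSet v)]
  | k + 1, v => a (vertexSet v) :: labels a k (tail v)

/-- Two consecutive simplices of a flag have the same carrier. -/
def Degenerate (K : Cpx V) : (k : ℕ) → (Fin (p + k + 1) → V) → Prop
  | 0, _ => False
  | k + 1, v' => (∃ s, IsCarrier K (vertexSet v') s ∧ IsCarrier K (vertexSet (tail v')) s) ∨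
      Degenerate K k (tail v')

lemma Flag.hull_subset : {k : ℕ} → {v' v : Fin (p + k + 1) → V} → Flag k v' v → hull v' ⊆ hull v
  | 0, _, _, h => h
  | _ + 1, _, _, h => h.1

lemma tail_mem' {k : ℕ} {v : Fin (p + k + 1 + 1) → V} (hv : v ∈ ordS K (p + (k + 1))) :
    tail v ∈ ordS K (p + k) :=
  tail_mem hv

lemma drop_mem : {k : ℕ} → {v : Fin (p + k + 1) → V} → v ∈ ordS K (p + k) → drop k v ∈ ordS K p
  | 0, _, h => h
  | k + 1, v, h => drop_mem (k := k) (v := tail v) (tail_mem' h)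

lemma isCarrier_of_hull_subset {m : ℕ} {v' v : Fin (m + 1) → V} (hv' : v' ∈ ordS K' m)
    (hv : v ∈ ordS K m) (h : hull v' ⊆ hull v) : IsCarrier K (vertexSet v') (vertexSet v) := by
  rw [← convexHull_vertexSet, ← convexHull_vertexSet] at h
  obtain ⟨s, hs⟩ := exists_isCarrier (K'.nonempty_of_mem_faces hv'.2) hv.2 h
  have h1 := hs.2.2 _ hv.2 h
  have h2 := card_le_of_subset_convexHull (K'.indep hv'.2) ((subset_convexHull ℝ _).trans hs.2.1)
  rw [card_vertexSet hv'.1, ← card_vertexSet hv.1] at h2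
  exact eq_of_subset_of_card_le h1 h2 ▸ hs

lemma Degenerate.not_flag : {k : ℕ} → {v' v : Fin (p + k + 1) → V} → Degenerate K k v' →
    v' ∈ ordS K' (p + k) → v ∈ ordS K (p + k) → ¬Flag k v' v
  | 0, _, _, h, _, _ => h.elim
  | k + 1, v', v, h, hv', hv => by
    rintro ⟨h1, h2⟩
    rcases h with ⟨s, hs, hs'⟩ | h
    · have e := (hs.unique (isCarrier_of_hull_subset hv' hv h1)).symm.trans
        (hs'.unique (isCarrier_of_hull_subset (tail_mem' hv') (tail_mem' hv) h2.hull_subset))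
      have := congrArg Finset.card e
      rw [card_vertexSet hv.1, card_vertexSet (tail_mem' hv).1] at this
      omega
    · exact h.not_flag (tail_mem' hv') (tail_mem' hv) h2

lemma Flag.labels_eq {a a' : Finset V → κ}
    (haa : ∀ s' ∈ K'.faces, ∀ s, IsCarrier K s' s → a' s' = a s) :
    {k : ℕ} → {v' v : Fin (p + k + 1) → V} → v' ∈ ordS K' (p + k) →
    v ∈ ordS K (p + k) → Flag k v' v → labels a' k v' = labels a k v
  | 0, _, _, hv', hv, h => congrArg (fun x => [x])
      (haa _ hv'.2 _ (isCarrier_of_hull_subset hv' hv h))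
  | k + 1, _, _, hv', hv, h => congrArg₂ List.cons
      (haa _ hv'.2 _ (isCarrier_of_hull_subset hv' hv h.1))
      (h.2.labels_eq haa (tail_mem' hv') (tail_mem' hv))

lemma Degenerate.labels {a a' : Finset V → κ}
    (haa : ∀ s' ∈ K'.faces, ∀ s, IsCarrier K s' s → a' s' = a s) :
    {k : ℕ} → {v' : Fin (p + k + 1) → V} → v' ∈ ordS K' (p + k) →
    Degenerate K k v' → ¬(labels a' k v').IsChain (· ≠ ·)
  | 0, _, _, h => h.elim
  | k + 1, v', hv', h => by
    have hhead : ∃ l, ChernSimons.labels a' k (tail v') = a' (vertexSet (tail v')) :: l := by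
      cases k with
      | zero => exact ⟨[], rfl⟩
      | succ k => exact ⟨_, rfl⟩
    obtain ⟨l, hl⟩ := hhead
    intro hc
    change List.IsChain _ (a' (vertexSet v') :: ChernSimons.labels a' k (tail v')) at hc
    rcases h with ⟨s, hs, hs'⟩ | h
    · rw [hl, List.isChain_cons_cons] at hc
      exact hc.1 ((haa _ hv'.2 _ hs).trans (haa _ (tail_mem' hv').2 _ hs').symm)
    · exact h.labels haa (tail_mem' hv') hc.tail

lemma exists_isCarrier_of_inside (hin : Inside K' K) {s' : Finset V} (hs' : s' ∈ K'.faces) :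
    ∃ s, IsCarrier K s' s := by
  obtain ⟨t, ht, hst⟩ := hin s' hs'
  exact exists_isCarrier (K'.nonempty_of_mem_faces hs') ht hst

open scoped Classical in
lemma card_flags (hT : ∀ s ∈ K.faces, s ⊆ T) (hin : Inside K' K) :
    (k : ℕ) → {v' : Fin (p + k + 1) → V} → v' ∈ ordS K' (p + k) →
    (s : Finset V) → IsCarrier K (vertexSet v') s → s.card = p + k + 1 → ¬Degenerate K k v' →
    {v ∈ tup T (p + k + 1) | v ∈ ordS K (p + k) ∧ Flag k v' v}.card = (p + 1).factorial
  | 0, v', hv', s, hs, hcard, _ => by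
    rw [← card_orderings (hT s hs.1) hcard]
    congr 1
    refine Finset.filter_congr fun v _ => ⟨fun ⟨h1, h2⟩ => ⟨h1.1, ?_⟩, ?_⟩
    · exact (isCarrier_of_hull_subset hv' h1 h2).unique hs
    · rintro ⟨h1, rfl⟩
      have := hs.2.1
      rw [convexHull_vertexSet, convexHull_vertexSet] at this
      exact ⟨⟨h1, hs.1⟩, this⟩
  | k + 1, v', hv', s, hs, hcard, hdeg => by
    obtain ⟨s₁, hs₁⟩ := exists_isCarrier_of_inside hin (tail_mem' hv').2
    have h01 : s₁ ⊆ s := hs₁.2.2 s hs.1 (by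
      refine Subset.trans ?_ hs.2.1
      rw [convexHull_vertexSet, convexHull_vertexSet]
      exact hull_tail_le v')
    have hne : s₁ ≠ s := fun h => hdeg (Or.inl ⟨s, hs, h ▸ hs₁⟩)
    have hc1 := card_le_of_subset_convexHull (K'.indep (tail_mem' hv').2)
      ((subset_convexHull ℝ _).trans hs₁.2.1)
    rw [card_vertexSet (tail_mem' hv').1] at hc1
    have hc2 := Finset.card_lt_card (h01.ssubset_of_ne hne)
    rw [← card_flags hT hin k (tail_mem' hv') s₁ hs₁ (by omega) fun h => hdeg (Or.inr h)]
    obtain ⟨x, hx⟩ : ∃ x, s \ s₁ = {x} := by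
      rw [← Finset.card_eq_one, Finset.card_sdiff_of_subset h01]; omega
    have hxs : x ∈ s ∧ x ∉ s₁ := Finset.mem_sdiff.1 (hx ▸ Finset.mem_singleton_self x)
    have hset : insert x s₁ = s := by
      rw [Finset.insert_eq, ← hx, Finset.sdiff_union_of_subset h01]
    have hv0 : ∀ v, v ∈ ordS K (p + (k + 1)) ∧ Flag (k + 1) v' v → v 0 = x := by
      rintro v ⟨hv, h1, h2⟩
      have e0 := (isCarrier_of_hull_subset hv' hv h1).unique hs
      have e1 := (isCarrier_of_hull_subset (tail_mem' hv') (tail_mem' hv) h2.hull_subset).unique hs₁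
      have : v 0 ∈ s \ s₁ := by
        rw [Finset.mem_sdiff, ← e0, ← e1, mem_vertexSet, mem_vertexSet]
        exact ⟨⟨0, rfl⟩, fun ⟨i, hi⟩ => (Fin.succ_ne_zero i) (hv.1 hi)⟩
      rwa [hx, Finset.mem_singleton] at this
    refine Finset.card_bij' (fun v _ => tail v) (fun u _ => cons x u) ?_ ?_ ?_ ?_
    · intro v hv
      rw [Finset.mem_filter, mem_tup] at hv ⊢
      exact ⟨fun i => hv.1 i.succ, tail_mem' hv.2.1, hv.2.2.2⟩
    · intro u hu
      rw [Finset.mem_filter, mem_tup] at hu ⊢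
      have e1 := (isCarrier_of_hull_subset (tail_mem' hv') hu.2.1 hu.2.2.hull_subset).unique hs₁
      have e2 : vertexSet (cons x u : Fin (p + (k + 1) + 1) → V) = s := by
        rw [← hset, ← e1]
        ext y
        rw [mem_vertexSet, Fin.exists_fin_succ, Finset.mem_insert, mem_vertexSet]
        exact or_congr eq_comm Iff.rfl
      refine ⟨Fin.cases (hT s hs.1 hxs.1) hu.1, ⟨Fin.cons_injective_iff.2 ⟨?_, hu.2.1.1⟩, ?_⟩, ?_, ?_⟩
      · rintro ⟨i, hi⟩
        exact hxs.2 (e1 ▸ mem_vertexSet.2 ⟨i, hi⟩)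
      · rw [e2]; exact hs.1
      · rw [← convexHull_vertexSet, ← convexHull_vertexSet, e2]; exact hs.2.1
      · rw [tail_cons]; exact hu.2.2
    · intro v hv
      rw [← hv0 v (Finset.mem_filter.1 hv).2]
      exact Fin.cons_self_tail v
    · intro u _
      exact tail_cons _ _

open scoped Classical in
lemma sum_flags (hK' : K'.faces.Finite) (hT : ∀ s ∈ K'.faces, s ⊆ T) (hin : Inside K' K)
    (hsp : K'.space = K.space) (Y : (Fin (p + 1) → V) → B) : (k : ℕ) →
    {v : Fin (p + k + 1) → V} → v ∈ ordS K (p + k) →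
    ∑ v' ∈ tup T (p + k + 1), (if v' ∈ ordS K' (p + k) ∧ Flag k v' v then
      relSign v v' • Y (drop k v') else 0) =
    ∑ w ∈ tup T (p + 1), if w ∈ ordS K' p then relSign (drop k v) w • Y w else 0
  | 0, v, _ => sum_congr rfl fun v' _ => by
    by_cases h : v' ∈ ordS K' p
    · by_cases hf : hull v' ⊆ hull v
      · rw [if_pos h, if_pos ⟨h, hf⟩]; rfl
      · rw [if_neg fun h' => hf h'.2, if_pos h, show relSign (drop 0 v) v' = 0 from if_neg hf,
          zero_smul]
    · rw [if_neg h, if_neg fun h' => h h'.1]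
  | k + 1, v, hv => by
    refine Eq.trans ?_ (sum_flags hK' hT hin hsp Y k (tail_mem' hv))
    rw [sum_tup_succ]
    refine sum_congr rfl fun u _ => ?_
    by_cases hu : u ∈ ordS K' (p + k) ∧ Flag k u (tail v)
    · rw [if_pos hu, ← sum_relSign_cons (p := p + k) hK' hT hin hsp hv hu.1 hu.2.hull_subset, sum_smul]
      refine sum_congr rfl fun x _ => ?_
      by_cases hx : (cons x u : Fin (p + k + 1 + 1) → V) ∈ ordS K' (p + k + 1)
      · by_cases hh : hull (cons x u : Fin (p + (k + 1) + 1) → V) ⊆ hull v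
        · rw [if_pos ⟨hx, hh, by rw [tail_cons]; exact hu.2⟩, if_pos hx]
          rfl
        · rw [if_neg fun h' => hh h'.2.1, if_pos hx, relSign, if_neg hh, zero_smul]
      · rw [if_neg fun h' => hx h'.1, if_neg hx, zero_smul]
    · rw [if_neg hu]
      refine sum_eq_zero fun x _ => if_neg fun h => hu ⟨tail_mem' h.1, ?_⟩
      have := h.2.2
      rwa [tail_cons] at this

open scoped Classical in
/-- A sum over the flags of a subdivision, with induced labels, equals the sum over the flags of
the complex. -/
theorem sum_flags_subdivision (hK' : K'.faces.Finite) (hT' : ∀ s ∈ K'.faces, s ⊆ T)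
    (hT : ∀ s ∈ K.faces, s ⊆ T) (hin : Inside K' K) (hsp : K'.space = K.space) (k : ℕ)
    (hdim : ∀ s ∈ K.faces, s.card ≤ p + k + 1) {o o' : (Fin (p + k + 1) → V) → ℤ}
    (ho : ∀ v, o v ≠ 0 → v ∈ ordS K (p + k)) (ho' : ∀ v', o' v' ≠ 0 → v' ∈ ordS K' (p + k)) (hoo : ∀
    v ∈ ordS K (p + k), ∀ v' ∈ ordS K' (p + k), hull v' ⊆ hull v → o' v' = relSign v v' * o v)
    {a a' : Finset V → κ} (haa : ∀ s' ∈ K'.faces, ∀ s, IsCarrier K s' s → a' s' = a s)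
    {Y : List κ → (Fin (p + 1) → V) → B} (hdeg : ∀ v' ∈ ordS K' (p + k), ¬(labels a' k v').IsChain
    (· ≠ ·) → Y (labels a' k v') (drop k v') = 0) (hY : ∀ v ∈ ordS K (p + k), ∑ w ∈ tup T (p + 1),
    (if w ∈ ordS K' p then relSign (drop k v) w • Y (labels a k v) w else 0) = (p + 1).factorial • Y
    (labels a k v) (drop k v)) : (p + 1).factorial • ∑ v' ∈ tup T (p + k + 1), o' v' • Y
    (labels a' k v') (drop k v') = (p + 1).factorial • ∑ v ∈ tup T (p + k + 1), o v • Y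
    (labels a k v) (drop k v) := by
  have h1 : ∀ v', (p + 1).factorial • o' v' • Y (labels a' k v') (drop k v') =
      ∑ v ∈ tup T (p + k + 1), o v • if v' ∈ ordS K' (p + k) ∧ Flag k v' v then
        relSign v v' • Y (labels a k v) (drop k v') else 0 := by
    intro v'
    by_cases hv' : v' ∈ ordS K' (p + k)
    swap
    · rw [not_imp_comm.1 (ho' v') hv']
      simp [hv']
    have key : ∀ v, (o v • if v' ∈ ordS K' (p + k) ∧ Flag k v' v then
        relSign v v' • Y (labels a k v) (drop k v') else 0) =
        if v ∈ ordS K (p + k) ∧ Flag k v' v then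
          o' v' • Y (labels a' k v') (drop k v') else 0 := by
      intro v
      by_cases hv : v ∈ ordS K (p + k)
      · by_cases hf : Flag k v' v
        · rw [if_pos ⟨hv', hf⟩, if_pos ⟨hv, hf⟩, hf.labels_eq haa hv' hv,
            hoo v hv v' hv' hf.hull_subset, smul_smul, mul_comm]
        · simp [hf]
      · rw [not_imp_comm.1 (ho v) hv]
        simp [hv]
    simp_rw [key]
    obtain ⟨s, hs⟩ := exists_isCarrier_of_inside hin hv'.2
    have hc := card_le_of_subset_convexHull (K'.indep hv'.2)
      ((subset_convexHull ℝ _).trans hs.2.1)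
    rw [card_vertexSet hv'.1] at hc
    rw [← Finset.sum_filter, sum_const]
    by_cases hd : Degenerate K k v'
    · rw [hdeg v' hv' (hd.labels haa hv')]
      simp
    · rw [card_flags hT hin k hv' s hs (le_antisymm (hdim s hs.1) hc) hd]
  rw [smul_sum, sum_congr rfl fun v' _ => h1 v', sum_comm, smul_sum]
  refine sum_congr rfl fun v _ => ?_
  rw [← smul_sum]
  by_cases hv : v ∈ ordS K (p + k)
  · rw [sum_flags hK' hT' hin hsp _ k hv, hY v hv, smul_comm]
  · rw [not_imp_comm.1 (ho v) hv]
    simp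

open scoped Classical in
/-- The case of vertices in the hypothesis on the summands above. -/
lemma sum_relSign_vertex (hT' : ∀ s ∈ K'.faces, s ⊆ T) (hin : Inside K' K)
    (hsp : K'.space = K.space) {v : Fin 1 → V} (hv : v ∈ ordS K 0) (g : V → B) :
    ∑ w ∈ tup T 1, (if w ∈ ordS K' 0 then relSign v w • g (w 0) else 0) = g (v 0) := by
  have hvs : (vertexSet v : Set V) = {v 0} := by
    rw [range_vertexSet, range_unique]; rfl
  have hhull : hull v = {v 0} := by rw [← convexHull_vertexSet, hvs, convexHull_singleton]
  have hv' : v ∈ ordS K' 0 := by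
    have hx : v 0 ∈ K'.space := by
      rw [hsp]
      exact mem_space_iff.2 ⟨_, hv.2, subset_convexHull ℝ _ (by
        rw [hvs]; rfl)⟩
    obtain ⟨w, h0, hw, h1, hc⟩ := exists_weights hx
    have h2 := hin.convexHull_subset hw hv.2 h0 rfl h1 (by
      rw [hc, convexHull_vertexSet, hhull]; rfl)
    rw [convexHull_vertexSet, hhull] at h2
    have h3 : w.support = vertexSet v := eq_of_subset_of_card_le
      (Finset.coe_subset.1 (((subset_convexHull ℝ _).trans h2).trans hvs.ge)) (by
        rw [card_vertexSet hv.1]; exact (K'.nonempty_of_mem_faces hw).card_pos)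
    exact ⟨hv.1, h3 ▸ hw⟩
  rw [Finset.sum_eq_single_of_mem v (mem_tup.2 fun i => hT' _ hv'.2 (mem_vertexSet.2 ⟨i, rfl⟩)),
    if_pos hv', relSign, if_pos subset_rfl, baryDet]
  · have h := sum_baryCoord (relCoord v v 0)
    rw [Fin.sum_univ_one] at h
    simp [h]
  · intro w _ hwv
    split_ifs with h
    · rw [relSign, if_neg, zero_smul]
      intro hh
      apply hwv
      have h4 := hh (subset_convexHull ℝ _ ⟨0, rfl⟩)
      rw [hhull] at h4
      funext i
      rw [Subsingleton.elim i 0]; exact h4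
    · rfl

end Refinement

section Values

variable [IsManifold 𝓘(ℝ, E) ∞ X] {ι κ : Type*} {U : ι → Set X} {f : V → X}

lemma Form.SmoothOn.mono {p : ℕ} {η : Form E X p} {W W' : Set X} (h : η.SmoothOn W)
    (hW : W' ⊆ W) : η.SmoothOn W' :=
  fun x₀ => (h x₀).mono (inter_subset_inter_right _ (preimage_mono hW))

lemma Form.SmoothOn.sub {p : ℕ} {η θ : Form E X p} {W : Set X} (h : η.SmoothOn W)
    (h' : θ.SmoothOn W) : Form.SmoothOn (fun x => η x - θ x) W :=
  fun x₀ => ((h x₀).sub (h' x₀)).congr fun _ _ => rfl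

/-- The map `f` is smooth on the closed simplices of `K`. -/
def SmoothOnComplex (K : Cpx V) (f : V → X) : Prop :=
  ∀ p, ∀ v ∈ ordS K p, SmoothOnSimplex (E := E) f v

lemma mapsTo_of_hull_subset {p : ℕ} {v : Fin (p + 1) → V} {W : Set X} (h : hull v ⊆ f ⁻¹' W) :
    MapsTo (f ∘ ρ v) (stdSimp p) W :=
  fun _ ht => h (hull_eq_image v ▸ mem_image_of_mem _ ht)

lemma Circle.expHom_eq {x : ℝ} {a b : Circle} (h : (a : ℂ) = b * Complex.exp (Complex.I * x)) :
    Circle.expHom x = Additive.ofMul a - Additive.ofMul b := by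
  rw [eq_sub_iff_add_eq', ← ofMul_toMul (Circle.expHom x), ← ofMul_mul]
  congr 1
  ext
  rw [h, mul_comm Complex.I]
  rfl

/-- The integrals and the values of a Deligne cocycle. -/
def DeligneCocycle.cochains (μ : DeligneCocycle E U) (hU : ∀ i, IsOpen (U i))
    (hf : SmoothOnComplex (E := E) K f) :
    Cochains K (fun a => f ⁻¹' U a) (Additive Circle) where
  e := Circle.expHom
  J₃ a v := simplexIntegral f v (μ.η₃ a)
  J₂ a b v := simplexIntegral f v (μ.η₂ a b)
  J₁ a b c v := simplexIntegral f v (μ.η₁ a b c)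
  G a b c d x := Additive.ofMul (μ.g a b c d (f x))
  stokes₃ a b v hv ha hb := by
    have hm := mapsTo_of_hull_subset (f := f) (W := U a ∩ U b) (subset_inter ha hb)
    have hW := (hU a).inter (hU b)
    rw [← simplexIntegral_d (hf _ v hv) hW hm (μ.η₂_smooth a b),
      ← simplexIntegral_sub (hf _ v hv) hW hm ((μ.η₃_smooth b).mono inter_subset_right)
        ((μ.η₃_smooth a).mono inter_subset_left)]
    exact (simplexIntegral_congr_form fun t ht => μ.cocycle_η₃ a b _ (hm ht)).symm
  stokes₂ a b c v hv ha hb hc := by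
    have hm := mapsTo_of_hull_subset (f := f) (W := U a ∩ U b ∩ U c)
      (subset_inter (subset_inter ha hb) hc)
    have hW := ((hU a).inter (hU b)).inter (hU c)
    have s1 := (μ.η₂_smooth b c).mono fun x (hx : x ∈ U a ∩ U b ∩ U c) => ⟨hx.1.2, hx.2⟩
    have s2 := (μ.η₂_smooth a c).mono fun x (hx : x ∈ U a ∩ U b ∩ U c) => ⟨hx.1.1, hx.2⟩
    have s3 := (μ.η₂_smooth a b).mono fun x (hx : x ∈ U a ∩ U b ∩ U c) => hx.1
    have h := simplexIntegral_congr_form (E := E) (f := f) (v := v) (η := (μ.η₁ a b c).d)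
      (θ := fun x => (μ.η₂ a c x - μ.η₂ a b x) - μ.η₂ b c x) fun t ht =>
        (μ.cocycle_η₂ a b c _ (hm ht)).trans (by dsimp only [comp_apply]; abel)
    rw [← simplexIntegral_d (hf _ v hv) hW hm (μ.η₁_smooth a b c), h,
      simplexIntegral_sub (hf _ v hv) hW hm (s2.sub s3) s1,
      simplexIntegral_sub (hf _ v hv) hW hm s2 s3]
    ring
  stokes₁ a b c d v hv ha hb hc hd := by
    have hm := mapsTo_of_hull_subset (f := f) (W := U a ∩ U b ∩ U c ∩ U d)
      (subset_inter (subset_inter (subset_inter ha hb) hc) hd)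
    have hW := (((hU a).inter (hU b)).inter (hU c)).inter (hU d)
    have s1 := (μ.η₁_smooth b c d).mono fun x (hx : x ∈ U a ∩ U b ∩ U c ∩ U d) =>
      ⟨⟨hx.1.1.2, hx.1.2⟩, hx.2⟩
    have s2 := (μ.η₁_smooth a c d).mono fun x (hx : x ∈ U a ∩ U b ∩ U c ∩ U d) =>
      ⟨⟨hx.1.1.1, hx.1.2⟩, hx.2⟩
    have s3 := (μ.η₁_smooth a b d).mono fun x (hx : x ∈ U a ∩ U b ∩ U c ∩ U d) =>
      ⟨⟨hx.1.1.1, hx.1.1.2⟩, hx.2⟩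
    have s4 := (μ.η₁_smooth a b c).mono fun x (hx : x ∈ U a ∩ U b ∩ U c ∩ U d) => hx.1
    rw [show ∀ x y z w : ℝ, x - y + z - w = (x - y) - (w - z) by intros; ring,
      ← simplexIntegral_sub (hf _ v hv) hW hm s1 s2, ← simplexIntegral_sub (hf _ v hv) hW hm s4 s3,
      ← simplexIntegral_sub (hf _ v hv) hW hm (s1.sub s2) (s4.sub s3)]
    refine Circle.expHom_eq (eq_mul_exp_simplexIntegral (hf _ v hv) hm
      (g := fun x => (μ.g a b c d x : ℂ)) (fun x hx => ?_)
      (continuousOn_pull (hf _ v hv) hW hm ((s1.sub s2).sub (s4.sub s3)) _) fun x hx u => ?_)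
    · exact ((μ.g_smooth a b c d x hx).contMDiffAt (hW.mem_nhds hx)).mdifferentiableAt (by simp)
    · rw [μ.cocycle_η₁ a b c d x hx u, show μ.η₁ b c d x - μ.η₁ a c d x + μ.η₁ a b d x -
        μ.η₁ a b c x = (μ.η₁ b c d x - μ.η₁ a c d x) - (μ.η₁ a b c x - μ.η₁ a b d x) by abel]
  cocycle a b c d k x ha hb hc hd hk := by
    have h := congrArg Additive.ofMul (μ.cocycle_g a b c d k _ ⟨⟨⟨⟨ha, hb⟩, hc⟩, hd⟩, hk⟩)
    simpa only [ofMul_mul, ofMul_inv, ofMul_one, ← sub_eq_add_neg] using h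
  swap₁ a b c v hv _ _ _ := by
    rw [simplexIntegral_perm (hf _ v hv), Perm.sign_swap (by decide)]
    simp

open scoped Classical in
@[to_additive]
lemma finprod_orderedSimplices {n : ℕ} {B : Type*} [CommMonoid B] (hT : ∀ s ∈ K.faces, s ⊆ T)
    (F : (Fin (n + 1) → V) → B) : ∏ᶠ v ∈ ordS K n, F v =
      ∏ v ∈ tup T (n + 1), if v ∈ ordS K n then F v else 1 := by
  simp_rw [finprod_eq_if]
  refine finprod_eq_prod_of_mulSupport_subset _ fun v hv => ?_
  have hv' : v ∈ ordS K n := by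
    by_contra h
    exact hv (if_neg h)
  exact Finset.mem_coe.2 (mem_tup.2 fun i => hT _ hv'.2 (mem_vertexSet.2 ⟨i, rfl⟩))

variable [IsManifold I ∞ N]

/-- An exponential of a sum over the simplices of maximal dimension and a product of values, as a
sum over a chain. -/
lemma ofMul_exp_mul_finprod (o : ManifoldOrientation I N) (hT : ∀ s ∈ K.faces, s ⊆ T)
    (F : (Fin (n + 1) → V) → ℝ) (g : (Fin (n + 1) → V) → Circle) : Additive.ofMul (Circle.exp (∑ᶠ v
    ∈ ordS K n, (orientSign o h v : ℝ) * F v) * ∏ᶠ v ∈ ordS K n, g v ^ orientSign o h v) =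
    Circle.expHom (∑ v ∈ tup T (n + 1), orientChain o K h v • F v) + ∑ v ∈ tup T (n + 1),
    orientChain o K h v • Additive.ofMul (g v) := by
  rw [finsum_orderedSimplices hT, finprod_orderedSimplices hT, ofMul_mul, ofMul_prod]
  congr 1
  · refine congrArg Circle.expHom (sum_congr rfl fun v _ => ?_)
    rw [orientChain]
    split_ifs <;> simp
  · refine sum_congr rfl fun v _ => ?_
    rw [orientChain]
    split_ifs <;> simp

lemma Pair.Refines.adapted {A' A : Pair I P h κ} (hA : A'.Refines A) {D : κ → Set V}
    (ha : Adapted A.K D A.φ) : Adapted A'.K D A'.φ := fun s' hs' => by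
  obtain ⟨s, hs⟩ := exists_isCarrier_of_inside hA.1.inside hs'
  rw [hA.2 s' hs' s hs]
  exact hs.2.1.trans (ha s hs.1)

lemma Adapted.hull_drop_subset {p : ℕ} {D : κ → Set V} {a : Finset V → κ} (ha : Adapted K D a) :
    (k : ℕ) → {v : Fin (p + k + 1) → V} → v ∈ ordS K (p + k) →
    ∀ i ∈ labels a k v, hull (drop k v) ⊆ D i
  | 0, v, hv, i, hi => by
    rw [List.mem_singleton.1 hi]
    exact ha.hull_subset hv
  | k + 1, v, hv, i, hi => by
    have hd : ∀ (k : ℕ) (v : Fin (p + k + 1) → V), hull (drop k v) ⊆ hull v := by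
      intro k
      induction k with
      | zero => exact fun v => subset_rfl
      | succ k ih => exact fun v => (ih _).trans (hull_tail_le v)
    rcases List.mem_cons.1 hi with rfl | hi
    · exact (hd (k + 1) v).trans (ha.hull_subset hv)
    · exact ha.hull_drop_subset k (tail_mem (m := p + k) hv) i hi

lemma length_labels {p : ℕ} (a : Finset V → κ) : (k : ℕ) → (v : Fin (p + k + 1) → V) →
    (labels a k v).length = k + 1
  | 0, _ => rfl
  | k + 1, v => congrArg (· + 1) (length_labels a k (tail v))

end Values

section Refinement

variable [IsManifold 𝓘(ℝ, E) ∞ X] {κ : Type*} {W : κ → Set X} {f : V → X} {p k : ℕ}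
  {I : ModelWithCorners ℝ 𝔼 (p + k) H} [IsManifold I ∞ N]
  {A' A : Pair I P h κ}

/-- A sum of integrals over the flags does not change under subdivision. -/
lemma Pair.Refines.sum_integral (hA : A'.Refines A) (o : ManifoldOrientation I N)
    (hT : ∀ s ∈ A.K.faces, s ⊆ T) (hT' : ∀ s ∈ A'.K.faces, s ⊆ T)
    (hf : SmoothOnComplex (E := E) A.K f) (hW : ∀ i, IsOpen (W i))
    (ha : Adapted A.K (fun i => f ⁻¹' W i) A.φ) (η : List κ → Form E X p)
    (hη : ∀ L, L.length = k + 1 → (η L).SmoothOn {x | ∀ i ∈ L, x ∈ W i})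
    (hdeg : ∀ L, L.length = k + 1 → ¬L.IsChain (· ≠ ·) → ∀ x, (∀ i ∈ L, x ∈ W i) → η L x = 0) :
    ∑ v ∈ tup T (p + k + 1), orientChain o A'.K h v •
        simplexIntegral f (drop k v) (η (labels A'.φ k v)) =
      ∑ v ∈ tup T (p + k + 1), orientChain o A.K h v •
        simplexIntegral f (drop k v) (η (labels A.φ k v)) := by
  have hfin := A'.isSmoothTriangulation.finite
  have hWL : ∀ L : List κ, IsOpen {x | ∀ i ∈ L, x ∈ W i} := fun L => by
    rw [show {x | ∀ i ∈ L, x ∈ W i} = ⋂ i ∈ {i | i ∈ L}, W i by ext; simp]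
    exact L.finite_toSet.isOpen_biInter fun i _ => hW i
  have key := sum_flags_subdivision (B := ℝ)
    (Y := fun L w => simplexIntegral f w (η L)) hfin hT' hT hA.1.inside hA.1.1 k
    (fun s hs => A.isSmoothTriangulation.card_le hs) (o := orientChain o A.K h)
    (o' := orientChain o A'.K h) (fun v hv => by_contra fun h' => hv (if_neg h'))
    (fun v hv => by_contra fun h' => hv (if_neg h')) (fun v hv v' hv' hh => by
      rw [orientChain_of_mem o hv, orientChain_of_mem o hv',
        orientSign_eq_relSign_mul o A.isSmoothTriangulation hv hh]) hA.2
    (fun v' hv' hc => simplexIntegral_eq_zero fun t ht => hdeg _ (length_labels _ k v') hc _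
      fun i hi => mapsTo_of_hull_subset ((hA.adapted ha).hull_drop_subset k hv' i hi) ht)
    (fun v hv => by
      rw [nsmul_eq_mul, ← sum_relSign_mul_simplexIntegral hfin hT' hA.1.inside hA.1.1 (drop_mem hv)
        (hf _ _ (drop_mem hv)) (hWL (labels A.φ k v)) (fun t ht i hi =>
          mapsTo_of_hull_subset (ha.hull_drop_subset k hv i hi) ht) (hη _ (length_labels _ k v))]
      refine sum_congr rfl fun w _ => ?_
      split_ifs <;> simp)
  exact (smul_right_injective ℝ (Nat.factorial_ne_zero (p + 1))) key

end Refinement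

section Refinement

variable {κ : Type*} {W : κ → Set X} {f : V → X} {k : ℕ}
  {I : ModelWithCorners ℝ 𝔼 (0 + k) H} [IsManifold I ∞ N]
  {A' A : Pair I P h κ}

/-- A sum of values at the vertices of the flags does not change under subdivision. -/
lemma Pair.Refines.sum_value {B : Type*} [AddCommGroup B] (hA : A'.Refines A)
    (o : ManifoldOrientation I N) (hT : ∀ s ∈ A.K.faces, s ⊆ T) (hT' : ∀ s ∈ A'.K.faces, s ⊆ T)
    (ha : Adapted A.K (fun i => f ⁻¹' W i) A.φ) (g : List κ → X → B)
    (hdeg : ∀ L, L.length = k + 1 → ¬L.IsChain (· ≠ ·) → ∀ x, (∀ i ∈ L, x ∈ W i) → g L x = 0) :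
    ∑ v ∈ tup T (0 + k + 1), orientChain o A'.K h v • g (labels A'.φ k v) (f (drop k v 0)) =
      ∑ v ∈ tup T (0 + k + 1), orientChain o A.K h v • g (labels A.φ k v) (f (drop k v 0)) := by
  have key := sum_flags_subdivision (p := 0) (B := B)
    (Y := fun L w => g L (f (w 0))) A'.isSmoothTriangulation.finite hT' hT hA.1.inside hA.1.1 k
    (fun s hs => A.isSmoothTriangulation.card_le hs) (o := orientChain o A.K h)
    (o' := orientChain o A'.K h) (fun v hv => by_contra fun h' => hv (if_neg h'))
    (fun v hv => by_contra fun h' => hv (if_neg h')) (fun v hv v' hv' hh => by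
      rw [orientChain_of_mem o hv, orientChain_of_mem o hv',
        orientSign_eq_relSign_mul o A.isSmoothTriangulation hv hh]) hA.2
    (fun v' hv' hc => hdeg _ (length_labels _ k v') hc _
      fun i hi => (hA.adapted ha).hull_drop_subset k hv' i hi (subset_convexHull ℝ _ ⟨0, rfl⟩))
    (fun v hv => by
      rw [sum_relSign_vertex hT' hA.1.inside hA.1.1 (drop_mem hv) fun x =>
        g (labels A.φ k v) (f x)]
      simp)
  simpa using key

end Refinement

section LocalExpressions

variable [IsManifold 𝓘(ℝ, E) ∞ X] {ι : Type*} {U : ι → Set X} {μ : DeligneCocycle E U}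

lemma vec_eq_tail₂ (v : Fin 3 → V) : ![v 1, v 2] = tail v := by
  funext i; fin_cases i <;> rfl

lemma vec_eq_tail₃ (v : Fin 4 → V) : ![v 1, v 2, v 3] = tail v := by
  funext i; fin_cases i <;> rfl

lemma vec_eq_tail_tail₃ (v : Fin 4 → V) : ![v 2, v 3] = tail (tail v) := by
  funext i; fin_cases i <;> rfl

lemma vec_eq_tail_tail₂ (v : Fin 3 → V) : ![v 2] = tail (tail v) := by
  funext i; fin_cases i; rfl

lemma vec_eq_tail_tail_tail (v : Fin 4 → V) : ![v 3] = tail (tail (tail v)) := by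
  funext i; fin_cases i; rfl

section Action

variable {I : ModelWithCorners ℝ 𝔼 3 H} {M : Type*} [TopologicalSpace M]
  [ChartedSpace H M] [IsManifold I ∞ M] {h : V → M} {A A' : Pair I P h ι} {γ : M → X}
  {o : ManifoldOrientation I M}

lemma ofMul_localAction (hU : ∀ i, IsOpen (U i)) (hT : ∀ s ∈ A.K.faces, s ⊆ T)
    (hf : SmoothOnComplex (E := E) A.K (γ ∘ h)) : Additive.ofMul (localAction μ o A γ) =
      (μ.cochains hU hf).action T (orientChain o A.K h) A.φ := by
  refine (ofMul_exp_mul_finprod o hT _ _).trans ?_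
  simp_rw [vec_eq_tail₃, vec_eq_tail_tail₃, vec_eq_tail_tail_tail]
  rfl

/-- The local action does not change under subdivision. -/
theorem Pair.Refines.localAction_eq (hA : A'.Refines A) (hU : ∀ i, IsOpen (U i))
    (hf : SmoothOnComplex (E := E) A.K (γ ∘ h)) (hf' : SmoothOnComplex (E := E) A'.K (γ ∘ h))
    (hγ : γ ∈ A.Dom U) : localAction μ o A' γ = localAction μ o A γ := by
  classical
  obtain ⟨T₀, hT₀⟩ := exists_vertices_finset A.isSmoothTriangulation.finite
  obtain ⟨T₁, hT₁⟩ := exists_vertices_finset A'.isSmoothTriangulation.finite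
  have hT := fun s hs => (hT₀ s hs).trans (Finset.subset_union_left (s₂ := T₁))
  have hT' := fun s hs => (hT₁ s hs).trans (Finset.subset_union_right (s₁ := T₀))
  apply Additive.ofMul.injective
  rw [ofMul_localAction hU hT hf, ofMul_localAction hU hT' hf']
  have ha : Adapted A.K (fun i => (γ ∘ h) ⁻¹' U i) A.φ := fun s hs x hx => hγ s hs hx
  have e₃ := Pair.Refines.sum_integral (p := 3) (k := 0) hA o hT hT' hf hU ha
    (fun L => match L with | [a] => μ.η₃ a | _ => 0)
    (fun L hL => match L, hL with | [a], _ => (μ.η₃_smooth a).mono fun x hx => hx a (by simp))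
    (fun L hL => match L, hL with | [a], _ => fun h => absurd (List.isChain_singleton a) h)
  have e₂ := Pair.Refines.sum_integral (p := 2) (k := 1) hA o hT hT' hf hU ha
    (fun L => match L with | [a, b] => μ.η₂ b a | _ => 0)
    (fun L hL => match L, hL with
      | [a, b], _ => (μ.η₂_smooth b a).mono fun x hx => ⟨hx b (by simp), hx a (by simp)⟩)
    (fun L hL => match L, hL with
      | [a, b], _ => fun h x hx => by
        obtain rfl : a = b := by simpa using h
        exact μ.η₂_normalized a x (hx a (by simp)))
  have e₁ := Pair.Refines.sum_integral (p := 1) (k := 2) hA o hT hT' hf hU ha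
    (fun L => match L with | [a, b, c] => μ.η₁ c b a | _ => 0)
    (fun L hL => match L, hL with
      | [a, b, c], _ => (μ.η₁_smooth c b a).mono fun x hx =>
        ⟨⟨hx c (by simp), hx b (by simp)⟩, hx a (by simp)⟩)
    (fun L hL => match L, hL with
      | [a, b, c], _ => fun h x hx => by
        have hab : a = b ∨ b = c := by
          simp only [List.isChain_cons_cons, List.isChain_singleton] at h
          tauto
        have hx' := And.intro (hx b (by simp)) (hx c (by simp))
        rcases hab with rfl | rfl
        · exact (μ.η₁_normalized c a x hx'.symm).2
        · exact (μ.η₁_normalized b a x ⟨hx'.1, hx a (by simp)⟩).1)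
  have e₀ := Pair.Refines.sum_value (k := 3) (B := Additive Circle) hA o hT hT' ha
    (fun L x => match L with | [a, b, c, d] => Additive.ofMul (μ.g d c b a x) | _ => 0)
    (fun L hL => match L, hL with
      | [a, b, c, d], _ => fun h x hx => by
        have hab : a = b ∨ b = c ∨ c = d := by
          simp only [List.isChain_cons_cons, List.isChain_singleton] at h
          tauto
        have hx' := And.intro (hx a (by simp)) (And.intro (hx c (by simp)) (hx d (by simp)))
        have hb := hx b (by simp)
        refine congrArg Additive.ofMul (?_ : μ.g d c b a x = 1)
        rcases hab with rfl | rfl | rfl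
        · exact (μ.g_normalized d c a x ⟨⟨hx'.2.2, hx'.2.1⟩, hb⟩).2.2
        · exact (μ.g_normalized d b a x ⟨⟨hx'.2.2, hb⟩, hx'.1⟩).2.1
        · exact (μ.g_normalized c b a x ⟨⟨hx'.2.1, hb⟩, hx'.1⟩).1)
  simp only [Cochains.action, smul_sub, sum_sub_distrib, ← mul_smul_comm, ← mul_sum]
  exact congrArg₂ (· + ·) (congrArg Circle.expHom (congrArg₂ (· - ·) (congrArg₂ (· - ·)
    (congrArg (1 / 24 * ·) e₃) (congrArg (1 / 6 * ·) e₂)) (congrArg (1 / 2 * ·) e₁))) e₀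

end Action

section Transition

variable {S : Type*} [TopologicalSpace S] [ChartedSpace 𝔼 2 S]
  [IsManifold (𝓡 2) ∞ S] {h : V → S} {A₀ A₁ A₀' A₁' : Pair (𝓡 2) P h ι} {γ : S → X}
  {o : ManifoldOrientation (𝓡 2) S} {f : V → X}

lemma ofMul_transition (hU : ∀ i, IsOpen (U i)) (hT : ∀ s ∈ A₀.K.faces, s ⊆ T)
    (hf : SmoothOnComplex (E := E) K f) (hK : A₀.K.faces ⊆ K.faces)
    (hfγ : EqOn (γ ∘ h) f A₀.K.space) (ha₀ : Adapted A₀.K (fun i => f ⁻¹' U i) A₀.φ)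
    (ha₁ : Adapted A₀.K (fun i => f ⁻¹' U i) A₁.φ) :
    Additive.ofMul (transition μ o A₀ A₁ γ) =
      (μ.cochains hU hf).trans T (orientChain o A₀.K h) A₀.φ A₁.φ := by
  refine (ofMul_exp_mul_finprod o hT _ _).trans ?_
  simp_rw [vec_eq_tail₂, vec_eq_tail_tail₂, Cochains.trans]
  have key : ∀ {p : ℕ} {w : Fin (p + 1) → V}, w ∈ ordS A₀.K p → ∀ t ∈ stdSimp p,
      (γ ∘ h) (ρ w t) = f (ρ w t) := fun {p w} hw t ht => hfγ
    (convexHull_subset_space hw.2 (by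
      rw [convexHull_vertexSet]; exact simplexParam_mem_hull _ ht))
  have hmem : ∀ w, orientChain o A₀.K h w ≠ 0 → w ∈ ordS A₀.K 2 :=
    fun w hw => by_contra fun h' => hw (if_neg h')
  refine congrArg₂ (· + ·) (congrArg Circle.expHom (sum_smul_congr fun v hv => ?_))
    (sum_smul_congr fun v hv => ?_)
  · have hv := hmem v hv
    have hv' := tail_mem hv
    have s0 := ha₀.hull_subset hv'
    have s1 := (hull_tail_le v).trans (ha₁.hull_subset hv)
    have hm : MapsTo (f ∘ ρ (tail v)) (stdSimp 1)
        ((U (A₀.φ (vertexSet (tail v))) ∩ U (A₁.φ (vertexSet v))) ∩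
        (U (A₀.φ (vertexSet v)) ∩ U (A₁.φ (vertexSet (tail v))))) :=
      mapsTo_of_hull_subset (subset_inter (subset_inter s0 s1) (subset_inter
        ((hull_tail_le v).trans (ha₀.hull_subset hv)) (ha₁.hull_subset hv')))
    rw [simplexIntegral_neg, simplexIntegral_congr _ (key hv), simplexIntegral_congr _ (key hv'),
      simplexIntegral_sub (hf _ _ ⟨hv'.1, hK hv'.2⟩) (((hU _).inter (hU _)).inter
        ((hU _).inter (hU _))) hm ((μ.η₁_smooth _ _ _).mono fun x hx => ⟨⟨hx.1.1, hx.2.1⟩, hx.1.2⟩)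
        ((μ.η₁_smooth _ _ _).mono fun x hx => ⟨⟨hx.1.1, hx.2.2⟩, hx.1.2⟩), mul_neg]
    rfl
  · have hx : γ (h (v 2)) = f (v 2) := hfγ (convexHull_subset_space
      (hmem v hv).2 (subset_convexHull ℝ _ (mem_vertexSet.2 ⟨2, rfl⟩)))
    rw [hx, ofMul_mul, ofMul_mul, ofMul_inv, ← sub_eq_add_neg]
    rfl

/-- The transition functions do not change under subdivision. -/
theorem transition_eq_of_refines (hA₀ : A₀'.Refines A₀) (hA₁ : A₁'.Refines A₁)
    (hK : A₀.K = A₁.K) (hK' : A₀'.K = A₁'.K) (hU : ∀ i, IsOpen (U i))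
    (hf : SmoothOnComplex (E := E) A₀.K (γ ∘ h)) (h₀ : γ ∈ A₀.Dom U) (h₁ : γ ∈ A₁.Dom U) :
    transition μ o A₀' A₁' γ = transition μ o A₀ A₁ γ := by
  classical
  obtain ⟨T₀, hT₀⟩ := exists_vertices_finset A₀.isSmoothTriangulation.finite
  obtain ⟨T₁, hT₁⟩ := exists_vertices_finset A₀'.isSmoothTriangulation.finite
  have hT := fun s hs => (hT₀ s hs).trans (Finset.subset_union_left (s₂ := T₁))
  have hT' := fun s hs => (hT₁ s hs).trans (Finset.subset_union_right (s₁ := T₀))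
  apply Additive.ofMul.injective
  refine (ofMul_exp_mul_finprod o hT' _ _).trans
    (Eq.trans ?_ (ofMul_exp_mul_finprod o hT _ _).symm)
  simp_rw [vec_eq_tail₂, vec_eq_tail_tail₂]
  let A : Pair (𝓡 2) P h (ι × ι) := ⟨A₀.K, A₀.isSmoothTriangulation, fun s => (A₀.φ s, A₁.φ s)⟩
  let A' : Pair (𝓡 2) P h (ι × ι) := ⟨A₀'.K, A₀'.isSmoothTriangulation, fun s => (A₀'.φ s, A₁'.φ s)⟩
  have hA : A'.Refines A := ⟨hA₀.1, fun s' hs' s hs => Prod.ext (hA₀.2 s' hs' s hs)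
    (hA₁.2 s' (hK' ▸ hs') s (hK ▸ hs))⟩
  have hW : ∀ i : ι × ι, IsOpen (U i.1 ∩ U i.2) := fun i => (hU _).inter (hU _)
  have ha : Adapted A.K (fun i => (γ ∘ h) ⁻¹' (U i.1 ∩ U i.2)) A.φ :=
    fun s hs x hx => ⟨h₀ s hs hx, h₁ s (hK ▸ hs) hx⟩
  have e₂ := Pair.Refines.sum_integral (p := 2) (k := 0) hA o hT hT' hf hW ha
    (fun L => match L with | [a] => fun x => -μ.η₂ a.1 a.2 x | _ => 0)
    (fun L hL => match L, hL with
      | [a], _ => fun x₀ => ((μ.η₂_smooth a.1 a.2).mono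
          (fun x (hx : ∀ i ∈ [a], x ∈ U i.1 ∩ U i.2) => hx a (by simp)) x₀).neg)
    (fun L hL => match L, hL with | [a], _ => fun h => absurd (List.isChain_singleton a) h)
  have e₁ := Pair.Refines.sum_integral (p := 1) (k := 1) hA o hT hT' hf hW ha
    (fun L => match L with
      | [a, b] => fun x => μ.η₁ b.1 a.1 a.2 x - μ.η₁ b.1 b.2 a.2 x | _ => 0)
    (fun L hL => match L, hL with
      | [a, b], _ => ((μ.η₁_smooth b.1 a.1 a.2).mono
        fun x (hx : ∀ i ∈ [a, b], x ∈ U i.1 ∩ U i.2) => have ha := hx a (by simp); ⟨⟨(hx b (by simp)).1, ha.1⟩, ha.2⟩).sub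
        ((μ.η₁_smooth b.1 b.2 a.2).mono fun x hx => ⟨hx b (by simp), (hx a (by simp)).2⟩))
    (fun L hL => match L, hL with
      | [a, b], _ => fun h x hx => by
        obtain rfl : a = b := by simpa using h
        have hn := μ.η₁_normalized a.1 a.2 x (hx a (by simp))
        dsimp only
        rw [hn.1, hn.2, sub_zero])
  have e₀ := Pair.Refines.sum_value (k := 2) (B := Additive Circle) hA o hT hT' ha
    (fun L x => match L with
      | [a, b, c] => Additive.ofMul (μ.g c.1 b.1 a.1 a.2 x * (μ.g c.1 b.1 b.2 a.2 x)⁻¹ *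
          μ.g c.1 c.2 b.2 a.2 x)
      | _ => 0)
    (fun L hL => match L, hL with
      | [a, b, c], _ => fun h x hx => by
        have hab : a = b ∨ b = c := by
          simp only [List.isChain_cons_cons, List.isChain_singleton] at h
          tauto
        have ha := hx a (by simp)
        have hc := hx c (by simp)
        refine congrArg Additive.ofMul (?_ : _ = (1 : Circle))
        rcases hab with rfl | rfl
        · have n1 := μ.g_normalized c.1 a.1 a.2 x ⟨⟨hc.1, ha.1⟩, ha.2⟩
          have n2 := μ.g_normalized c.1 c.2 a.2 x ⟨hc, ha.2⟩
          rw [n1.2.1, n1.2.2, n2.2.2]; simp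
        · have n1 := μ.g_normalized b.1 a.1 a.2 x ⟨⟨hc.1, ha.1⟩, ha.2⟩
          have n2 := μ.g_normalized b.1 b.2 a.2 x ⟨hc, ha.2⟩
          rw [n1.1, n2.1, n2.2.1]; simp)
  simp only [smul_sub, sum_sub_distrib, ← mul_smul_comm, ← mul_sum]
  exact congrArg₂ (· + ·) (congrArg Circle.expHom (congrArg₂ (· - ·)
    (congrArg (1 / 6 * ·) e₂) (congrArg (1 / 2 * ·) e₁))) e₀

/-- The transition functions satisfy the cocycle condition. -/
theorem transition_mul_transition [T2Space S] {A₂ : Pair (𝓡 2) P h ι} (hK₁ : A₀.K = A₁.K)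
    (hK₂ : A₁.K = A₂.K) (hU : ∀ i, IsOpen (U i)) (hf : SmoothOnComplex (E := E) A₀.K (γ ∘ h))
    (h₀ : γ ∈ A₀.Dom U) (h₁ : γ ∈ A₁.Dom U) (h₂ : γ ∈ A₂.Dom U) :
    transition μ o A₀ A₁ γ * transition μ o A₁ A₂ γ = transition μ o A₀ A₂ γ := by
  obtain ⟨T, hT⟩ := exists_vertices_finset A₀.isSmoothTriangulation.finite
  have ha₀ : Adapted A₀.K (fun i => (γ ∘ h) ⁻¹' U i) A₀.φ := fun s hs x hx => h₀ s hs hx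
  have ha₁ : Adapted A₀.K (fun i => (γ ∘ h) ⁻¹' U i) A₁.φ := fun s hs x hx => h₁ s (hK₁ ▸ hs) hx
  have ha₂ : Adapted A₀.K (fun i => (γ ∘ h) ⁻¹' U i) A₂.φ :=
    fun s hs x hx => h₂ s (hK₂ ▸ hK₁ ▸ hs) hx
  apply Additive.ofMul.injective
  rw [ofMul_mul, ofMul_transition hU hT hf subset_rfl (fun _ _ => rfl) ha₀ ha₁,
    ofMul_transition hU hT hf subset_rfl (fun _ _ => rfl) ha₀ ha₂,
    ofMul_transition (A₀ := A₁) (T := T) hU (hK₁ ▸ hT) hf hK₁.ge (fun _ _ => rfl) (hK₁ ▸ ha₁)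
      (hK₁ ▸ ha₂), ← hK₁]
  exact Cochains.trans_add_trans _ (orientChain_perm o A₀.isSmoothTriangulation)
    (fun v hv => by_contra fun h' => hv (if_neg h'))
    (chainBoundary_eq_zero o A₀.isSmoothTriangulation hT) ha₀ ha₁ ha₂

end Transition

end LocalExpressions

section Coverings

variable {ι : Type*} {U : ι → Set X} {f : V → X}

lemma isCompact_space (hfin : K.faces.Finite) : IsCompact K.space :=
  hfin.isCompact_biUnion fun s _ => s.finite_toSet.isCompact_convexHull (𝕜 := ℝ)

lemma SmoothOnComplex.continuousOn (hf : SmoothOnComplex (E := E) K f) (hfin : K.faces.Finite) :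
    ContinuousOn f K.space := by
  refine continuousOn_iff_isClosed.2 fun C hC => ⟨⋃ s ∈ K.faces, f ⁻¹' C ∩ Δ s,
    hfin.isClosed_biUnion fun s hs => ?_, ?_⟩
  · obtain ⟨p, hp, v, hv, rfl⟩ := exists_ordering_of_mem hs
    rw [convexHull_vertexSet, hull_eq_image, inter_comm, ← image_inter_preimage]
    exact (((isCompact_stdSimp p).of_isClosed_subset ((hf p v ⟨hv, hs⟩).continuousOn
      |>.preimage_isClosed_of_isClosed (isCompact_stdSimp p).isClosed hC)
      inter_subset_left).image_of_continuousOn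
      (contDiff_simplexParam (n := 0) v).continuous.continuousOn).isClosed
  · ext x
    simp only [mem_inter_iff, mem_iUnion, mem_space_iff]
    tauto

lemma exists_lebesgue_number (hfin : K.faces.Finite) (hf : ContinuousOn f K.space)
    (hU : ∀ i, IsOpen (U i)) (hUcover : ⋃ i, U i = univ) :
    ∃ δ > 0, ∀ x ∈ K.space, ∃ i, Metric.ball x δ ∩ K.space ⊆ f ⁻¹' U i := by
  choose O hO hOU using fun i => continuousOn_iff'.1 hf _ (hU i)
  obtain ⟨δ, hδ, h⟩ := lebesgue_number_lemma_of_metric (isCompact_space hfin) hO fun x hx => by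
    obtain ⟨i, hi⟩ := mem_iUnion.1 (hUcover.ge (mem_univ (f x)))
    exact mem_iUnion.2 ⟨i, ((hOU i).le ⟨hi, hx⟩).1⟩
  refine ⟨δ, hδ, fun x hx => ?_⟩
  obtain ⟨i, hi⟩ := h x hx
  exact ⟨i, fun y hy => ((hOU i).ge ⟨hi hy.1, hy.2⟩).1⟩

lemma exists_subset_preimage_of_small {δ : ℝ}
    (hδ : ∀ x ∈ K.space, ∃ i, Metric.ball x δ ∩ K.space ⊆ f ⁻¹' U i) {ε : ℝ} (hε : ε < δ)
    (hL : L.space = K.space) {s : Finset V} (hs : s ∈ L.faces)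
    (hsmall : ∀ x ∈ s, ∀ y ∈ s, dist x y ≤ ε) : ∃ i, Δ s ⊆ f ⁻¹' U i := by
  obtain ⟨x, hx⟩ := L.nonempty_of_mem_faces hs
  have hsK : Δ s ⊆ K.space := hL ▸ convexHull_subset_space hs
  obtain ⟨i, hi⟩ := hδ x (hsK (subset_convexHull ℝ _ hx))
  refine ⟨i, fun y hy => hi ⟨?_, hsK hy⟩⟩
  have h := convexHull_min (fun z hz => Metric.mem_closedBall.2 (hsmall z hz x hx))
    (convex_closedBall x ε) hy
  exact lt_of_le_of_lt h hε

lemma IsSmoothTriangulation.smoothOnComplex (hK : IsSmoothTriangulation I P h K)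
    (γ : C^∞⟮I, N; 𝓘(ℝ, E), X⟯) : SmoothOnComplex (E := E) K (γ ∘ h) :=
  fun p v hv => γ.contMDiff.comp_contMDiffOn (hK.smooth p v hv)

variable [IsManifold I ∞ N]

/-- Every smooth map is adapted to some labelled triangulation. -/
theorem exists_pair [Nonempty N] (hK : IsSmoothTriangulation I P h K) (hU : ∀ i, IsOpen (U i))
    (hUcover : ⋃ i, U i = univ) (γ : C^∞⟮I, N; 𝓘(ℝ, E), X⟯) : ∃ A : Pair I P h ι, ⇑γ ∈ A.Dom U := by
  classical
  obtain ⟨δ, hδ, h1⟩ := exists_lebesgue_number hK.finite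
    ((hK.smoothOnComplex γ).continuousOn hK.finite) hU hUcover
  obtain ⟨K', hK', hsmall⟩ := exists_fine_subdivision ∅ K hK.finite (by simp) (half_pos hδ)
  have h2 := fun s hs => exists_subset_preimage_of_small h1 (half_lt_self hδ) hK'.space_eq hs
    (hsmall s hs (by simp))
  have : Nonempty ι := ⟨(mem_iUnion.1 (hUcover.ge (mem_univ (γ (Classical.arbitrary N))))).choose⟩
  choose! φ hφ using h2
  exact ⟨⟨K', hK.subdivision ⟨hK'.space_eq, hK'.inside⟩ hK'.finite, φ⟩, fun s hs _ hx => hφ s hs hx⟩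

lemma IsSmoothTriangulation.exists_common_subdivision (hK : IsSmoothTriangulation I P h K)
    (hL : IsSmoothTriangulation I P h L) :
    ∃ K', IsSmoothTriangulation I P h K' ∧ Inside K' K ∧ Inside K' L := by
  obtain ⟨K', hfin, hsp, h1, h2⟩ :=
    ChernSimons.exists_common_subdivision hK.finite hL.finite (hK.space_eq.trans hL.space_eq.symm)
  exact ⟨K', hK.subdivision ⟨hsp, h1⟩ hfin, h1, h2⟩

omit [IsManifold I ∞ N] in
lemma Pair.exists_refines (A : Pair I P h ι) (hK : IsSmoothTriangulation I P h K)
    (hin : Inside K A.K) : ∃ φ, (⟨K, hK, φ⟩ : Pair I P h ι).Refines A := by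
  classical
  choose! c hc using fun s (hs : s ∈ K.faces) => exists_isCarrier_of_inside hin hs
  exact ⟨fun s => A.φ (c s), ⟨hK.space_eq.trans A.isSmoothTriangulation.space_eq.symm, hin⟩,
    fun s' hs' s hs => congrArg A.φ ((hc s' hs').unique hs)⟩

omit [IsManifold I ∞ N] in
lemma Pair.Refines.of_refines {A B C : Pair I P h ι} (hC : C.Refines A) (hB : B.Refines A)
    (hin : Inside C.K B.K) : C.Refines B := by
  refine ⟨⟨hC.1.1.trans hB.1.1.symm, hin⟩, fun s' hs' s hs => ?_⟩
  obtain ⟨t, ht⟩ := exists_isCarrier_of_inside hB.1.inside hs.1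
  rw [hB.2 s hs.1 t ht]
  exact hC.2 s' hs' t (IsCarrier.trans hB.1.inside hs ht (C.K.nonempty_of_mem_faces hs'))

lemma Pair.Refines.mem_dom {A' A : Pair I P h ι} (hA : A'.Refines A) {γ : N → X}
    (hγ : γ ∈ A.Dom U) : γ ∈ A'.Dom U :=
  fun s hs _ hx => hA.adapted (D := fun i => (γ ∘ h) ⁻¹' U i) (fun s hs _ hx => hγ s hs hx) s hs hx

end Coverings

section Gluing

variable [IsManifold 𝓘(ℝ, E) ∞ X] {ι : Type*} {U : ι → Set X} (μ : DeligneCocycle E U) {S : Type*}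
  [TopologicalSpace S] [ChartedSpace 𝔼 2 S] [IsManifold (𝓡 2) ∞ S]
  {h : V → S} (o : ManifoldOrientation (𝓡 2) S)

lemma exists_common_refinement (A₀ A₁ : Pair (𝓡 2) P h ι) :
    ∃ B : Pair (𝓡 2) P h ι × Pair (𝓡 2) P h ι, B.1.K = B.2.K ∧ B.1.Refines A₀ ∧ B.2.Refines A₁ := by
  obtain ⟨K, hK, h₀, h₁⟩ :=
    A₀.isSmoothTriangulation.exists_common_subdivision A₁.isSmoothTriangulation
  obtain ⟨φ₀, hφ₀⟩ := A₀.exists_refines hK h₀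
  obtain ⟨φ₁, hφ₁⟩ := A₁.exists_refines hK h₁
  exact ⟨(⟨K, hK, φ₀⟩, ⟨K, hK, φ₁⟩), rfl, hφ₀, hφ₁⟩

/-- The transition function `G_{A₀A₁}(γ)`, computed on some common subdivision. -/
def gluing (A₀ A₁ : Pair (𝓡 2) P h ι) (γ : S → X) : Circle :=
  transition μ o (exists_common_refinement A₀ A₁).choose.1
    (exists_common_refinement A₀ A₁).choose.2 γ

variable {μ o} {A₀ A₁ A₂ B₀ B₁ : Pair (𝓡 2) P h ι} {γ : C^∞⟮𝓡 2, S; 𝓘(ℝ, E), X⟯}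

/-- The transition function does not depend on the common subdivision. -/
lemma transition_eq_gluing (hU : ∀ i, IsOpen (U i)) (h₀ : ⇑γ ∈ A₀.Dom U) (h₁ : ⇑γ ∈ A₁.Dom U)
    (hB : B₀.K = B₁.K) (hB₀ : B₀.Refines A₀) (hB₁ : B₁.Refines A₁) :
    transition μ o B₀ B₁ γ = gluing μ o A₀ A₁ γ := by
  obtain ⟨hC, hC₀, hC₁⟩ := (exists_common_refinement A₀ A₁).choose_spec
  unfold gluing
  set C := (exists_common_refinement A₀ A₁).choose
  obtain ⟨K, hK, hi, hi'⟩ :=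
    B₀.isSmoothTriangulation.exists_common_subdivision C.1.isSmoothTriangulation
  obtain ⟨φ₀, hφ₀⟩ := A₀.exists_refines hK (hi.trans hB₀.1.inside)
  obtain ⟨φ₁, hφ₁⟩ := A₁.exists_refines hK ((hB ▸ hi).trans hB₁.1.inside)
  rw [← transition_eq_of_refines (hφ₀.of_refines hB₀ hi) (hφ₁.of_refines hB₁ (hB ▸ hi)) hB rfl hU
      (B₀.isSmoothTriangulation.smoothOnComplex γ) (hB₀.mem_dom h₀) (hB₁.mem_dom h₁),
    ← transition_eq_of_refines (hφ₀.of_refines hC₀ hi') (hφ₁.of_refines hC₁ (hC ▸ hi')) hC rfl hU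
      (C.1.isSmoothTriangulation.smoothOnComplex γ) (hC₀.mem_dom h₀) (hC₁.mem_dom h₁)]

lemma gluing_mul_gluing [T2Space S] (hU : ∀ i, IsOpen (U i)) (h₀ : ⇑γ ∈ A₀.Dom U)
    (h₁ : ⇑γ ∈ A₁.Dom U) (h₂ : ⇑γ ∈ A₂.Dom U) : gluing μ o A₀ A₁ γ * gluing μ o A₁ A₂ γ = gluing μ o
    A₀ A₂ γ := by
  obtain ⟨L, hL, hi₀, hi₁⟩ :=
    A₀.isSmoothTriangulation.exists_common_subdivision A₁.isSmoothTriangulation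
  obtain ⟨K, hK, hi, hi₂⟩ := hL.exists_common_subdivision A₂.isSmoothTriangulation
  obtain ⟨φ₀, hφ₀⟩ := A₀.exists_refines hK (hi.trans hi₀)
  obtain ⟨φ₁, hφ₁⟩ := A₁.exists_refines hK (hi.trans hi₁)
  obtain ⟨φ₂, hφ₂⟩ := A₂.exists_refines hK hi₂
  rw [← transition_eq_gluing (B₀ := ⟨K, hK, φ₀⟩) (B₁ := ⟨K, hK, φ₁⟩) hU h₀ h₁ rfl hφ₀ hφ₁,
    ← transition_eq_gluing (B₀ := ⟨K, hK, φ₁⟩) (B₁ := ⟨K, hK, φ₂⟩) hU h₁ h₂ rfl hφ₁ hφ₂,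
    ← transition_eq_gluing (B₀ := ⟨K, hK, φ₀⟩) (B₁ := ⟨K, hK, φ₂⟩) hU h₀ h₂ rfl hφ₀ hφ₂]
  exact transition_mul_transition rfl rfl hU (hK.smoothOnComplex γ) (hφ₀.mem_dom h₀)
    (hφ₁.mem_dom h₁) (hφ₂.mem_dom h₂)

lemma Fibre.mk_eq_mk (hU : ∀ i, IsOpen (U i)) (h₀ : ⇑γ ∈ A₀.Dom U) (h₁ : ⇑γ ∈ A₁.Dom U) (z : ℂ) :
    (Fibre.mk A₀ γ h₀ (gluing μ o A₀ A₁ γ * z) : Fibre μ o P h γ) = Fibre.mk A₁ γ h₁ z := by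
  obtain ⟨B, hB, hB₀, hB₁⟩ := exists_common_refinement A₀ A₁
  exact Subtype.ext (Quot.sound ⟨rfl, B.1, B.2, hB, hB₀, hB₁, by
    rw [transition_eq_gluing hU h₀ h₁ hB hB₀ hB₁]⟩)

/-- The charts are bijective on the fibres. -/
theorem Fibre.mk_bijective [T2Space S] (hU : ∀ i, IsOpen (U i)) (h₀ : ⇑γ ∈ A₀.Dom U) :
    Function.Bijective (Fibre.mk A₀ γ h₀ : ℂ → Fibre μ o P h γ) := by
  classical
  constructor
  · let F : LineBundle μ o P h → ℂ := Quot.lift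
      (fun q => if q.γ = γ then (gluing μ o A₀ q.A γ : ℂ) * q.z else 0) fun q₀ q₁ hq => by
        obtain ⟨hγ, B₀, B₁, hB, hB₀, hB₁, hz⟩ := hq
        by_cases hg : q₀.γ = γ
        · have d₀ : ⇑γ ∈ q₀.A.Dom U := hg ▸ q₀.mem_dom
          have d₁ : ⇑γ ∈ q₁.A.Dom U := hg ▸ hγ ▸ q₁.mem_dom
          rw [if_pos hg, if_pos (hγ ▸ hg), hz, hg, transition_eq_gluing hU d₀ d₁ hB hB₀ hB₁,
            ← gluing_mul_gluing hU h₀ d₀ d₁, Circle.coe_mul, mul_assoc]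
        · rw [if_neg hg, if_neg (hγ ▸ hg)]
    have hF : ∀ z, F (Fibre.mk A₀ γ h₀ z : Fibre μ o P h γ).1 = gluing μ o A₀ A₀ γ * z :=
      fun z => if_pos rfl
    intro z w hzw
    have := congrArg (fun l => F l.1) hzw
    simp only [hF] at this
    exact mul_left_cancel₀ (Circle.coe_ne_zero _) this
  · rintro ⟨l, hl⟩
    induction l using Quot.ind with
    | mk q =>
      obtain ⟨A, γ', h', z⟩ := q
      obtain rfl : γ' = γ := hl
      exact ⟨_, Fibre.mk_eq_mk hU h₀ h' z⟩

end Gluing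

section Boundary

variable [IsManifold 𝓘(ℝ, E) ∞ X] {ι : Type*} {U : ι → Set X} {μ : DeligneCocycle E U} {M : Type*}
  [TopologicalSpace M] [ChartedSpace (EuclideanHalfSpace 3) M] [IsManifold (𝓡∂ 3) ∞ M] [T2Space M]
  {oM : ManifoldOrientation (𝓡∂ 3) M} {S : Type*} [TopologicalSpace S]
  [ChartedSpace 𝔼 2 S] [IsManifold (𝓡 2) ∞ S] [Nonempty S]
  {oS : ManifoldOrientation (𝓡 2) S} {j : C^∞⟮𝓡 2, S; 𝓡∂ 3, M⟯} {h : V → M}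
  {B B₀ B₁ : Pair (𝓡∂ 3) P h ι} {A A₀ A₁ : Pair (𝓡 2) (boundaryPoly P h) (boundaryMap h j) ι}
  {γ : C^∞⟮𝓡∂ 3, M; 𝓘(ℝ, E), X⟯}

lemma inside_boundaryComplex (hsp : (boundaryComplex h K').space = (boundaryComplex h K).space)
    (hin : Inside K' K) : Inside (boundaryComplex h K') (boundaryComplex h K) := by
  intro s' hs'
  obtain ⟨w, h0, hw, h1, hc⟩ := exists_relint s' ((boundaryComplex h K').nonempty_of_mem_faces hs')
  obtain ⟨t, ht, hxt⟩ := mem_space_iff.1 (hsp ▸ convexHull_subset_space hs' hc :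
      cmb w ∈ (boundaryComplex h K).space)
  have := hin.convexHull_subset (hw ▸ hs'.1) ht.1 h0 rfl h1 hxt
  exact ⟨t, ht, hw ▸ this⟩

lemma isCarrier_of_boundaryComplex {s' s : Finset V} (hs' : s'.Nonempty)
    (hs : IsCarrier (boundaryComplex h K) s' s) : IsCarrier K s' s := by
  obtain ⟨t, ht⟩ := exists_isCarrier hs' hs.1.1 hs.2.1
  have hts := ht.2.2 s hs.1.1 hs.2.1
  have htb : t ∈ (boundaryComplex h K).faces :=
    (boundaryComplex h K).down_closed hs.1 hts (K.nonempty_of_mem_faces ht.1)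
  rwa [Finset.Subset.antisymm (hs.2.2 t htb ht.2.1) hts]

lemma comp_boundaryMap_eqOn (hjrange : range j = (𝓡∂ 3).boundary M) :
    EqOn (⇑(restrict j γ) ∘ boundaryMap h j) (γ ∘ h) (boundaryPoly P h) :=
  fun _ hx => congrArg γ (comp_boundaryMap hjrange hx.2)

lemma IsBoundaryPair.mem_dom (hjrange : range j = (𝓡∂ 3).boundary M) (hBA : IsBoundaryPair B A)
    (hγ : ⇑γ ∈ B.Dom U) : ⇑(restrict j γ) ∈ A.Dom U := by
  intro s hs x hx
  have hsB : s ∈ (boundaryComplex h B.K).faces := hBA.1 ▸ hs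
  rw [comp_boundaryMap_eqOn hjrange (A.isSmoothTriangulation.space_eq ▸
    convexHull_subset_space hs hx), hBA.2 s hs]
  exact hγ s hsB.1 hx

variable (hj : Manifold.IsSmoothEmbedding (𝓡 2) (𝓡∂ 3) ∞ j) (hjrange : range j = (𝓡∂ 3).boundary M)

include hj hjrange

/-- The local actions of two labelled triangulations differ by the transition function of the
boundary. -/
theorem localAction_eq_gluing_mul (hor : IsBoundaryOrientation oM oS j) (hU : ∀ i, IsOpen (U i))
    (h₀ : IsBoundaryPair B₀ A₀) (h₁ : IsBoundaryPair B₁ A₁) (hγ₀ : ⇑γ ∈ B₀.Dom U)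
    (hγ₁ : ⇑γ ∈ B₁.Dom U) : localAction μ oM B₀ γ = gluing μ oS A₀ A₁ (restrict j γ) * localAction μ
    oM B₁ γ := by
  have : T2Space S := hj.isEmbedding.t2Space
  obtain ⟨K, hK, hi₀, hi₁⟩ :=
    B₀.isSmoothTriangulation.exists_common_subdivision B₁.isSmoothTriangulation
  obtain ⟨T, hT⟩ := exists_vertices_finset hK.finite
  have hbK := isSmoothTriangulation_boundary hj hjrange oM hK
  have key : ∀ {B : Pair (𝓡∂ 3) P h ι} {A : Pair (𝓡 2) (boundaryPoly P h) (boundaryMap h j) ι}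
      {φ : Finset V → ι}, Inside K B.K → IsBoundaryPair B A →
      (⟨K, hK, φ⟩ : Pair (𝓡∂ 3) P h ι).Refines B →
      (⟨boundaryComplex h K, hbK, φ⟩ : Pair (𝓡 2) (boundaryPoly P h) (boundaryMap h j) ι).Refines A
      := fun {B A φ} hi hBA hφ => by
    have hsp := hbK.space_eq.trans A.isSmoothTriangulation.space_eq.symm
    refine ⟨⟨hsp, hBA.1 ▸ inside_boundaryComplex (hBA.1 ▸ hsp) hi⟩, fun s' hs' s hs => ?_⟩
    rw [hBA.2 s hs.1]
    exact hφ.2 s' hs'.1 s (isCarrier_of_boundaryComplex (K.nonempty_of_mem_faces hs'.1)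
      (hBA.1 ▸ hs))
  obtain ⟨φ₀, hφ₀⟩ := B₀.exists_refines hK hi₀
  obtain ⟨φ₁, hφ₁⟩ := B₁.exists_refines hK hi₁
  have hf := hK.smoothOnComplex γ
  have ha₀ : Adapted K (fun i => (γ ∘ h) ⁻¹' U i) φ₀ := fun s hs _ hx => hφ₀.mem_dom hγ₀ s hs hx
  have ha₁ : Adapted K (fun i => (γ ∘ h) ⁻¹' U i) φ₁ := fun s hs _ hx => hφ₁.mem_dom hγ₁ s hs hx
  rw [← hφ₀.localAction_eq hU (B₀.isSmoothTriangulation.smoothOnComplex γ) hf hγ₀,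
    ← hφ₁.localAction_eq hU (B₁.isSmoothTriangulation.smoothOnComplex γ) hf hγ₁,
    ← transition_eq_gluing (B₀ := ⟨_, hbK, φ₀⟩) (B₁ := ⟨_, hbK, φ₁⟩) hU (h₀.mem_dom hjrange hγ₀)
      (h₁.mem_dom hjrange hγ₁) rfl (key hi₀ h₀ hφ₀) (key hi₁ h₁ hφ₁)]
  apply Additive.ofMul.injective
  rw [ofMul_mul, ofMul_localAction (A := ⟨K, hK, φ₀⟩) hU hT hf,
    ofMul_localAction (A := ⟨K, hK, φ₁⟩) hU hT hf,
    ofMul_transition (A₀ := ⟨_, hbK, φ₀⟩) (T := T) hU (fun s hs => hT s hs.1) hf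
      (fun s hs => hs.1) ((comp_boundaryMap_eqOn hjrange).mono hbK.space_eq.le)
      (fun s hs => ha₀ s hs.1) (fun s hs => ha₁ s hs.1), ← sub_eq_iff_eq_add,
    Cochains.action_sub_action _ (orientChain_perm oM hK)
      (fun v hv => by_contra fun h' => hv (if_neg h')) ha₀ ha₁,
    funext (chainBoundary_orientChain oM oS hj hjrange hor hK hT)]

/-- A labelled triangulation of the boundary that is defined on a subdivision of the boundary of a
triangulation extends. -/
theorem exists_isBoundaryPair_mem_dom (oM : ManifoldOrientation (𝓡∂ 3) M) (hU : ∀ i, IsOpen (U i))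
    (hUcover : ⋃ i, U i = univ) (hK : IsSmoothTriangulation (𝓡∂ 3) P h K)
    (hs : IsSubdivision A.K (boundaryComplex h K)) (hγ : ⇑(restrict j γ) ∈ A.Dom U) : ∃ B : Pair
    (𝓡∂ 3) P h ι, IsBoundaryPair B A ∧ ⇑γ ∈ B.Dom U := by
  classical
  have hbK := isSmoothTriangulation_boundary hj hjrange oM hK
  have hAsp := A.isSmoothTriangulation.space_eq
  have hcont := (hK.smoothOnComplex γ).continuousOn hK.finite
  obtain ⟨δ, hδ, h1⟩ := exists_lebesgue_number hK.finite hcont hU hUcover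
  have hbP : boundaryPoly P h ⊆ K.space := fun x hx => hK.space_eq.ge hx.1
  have hA : ∀ t ∈ A.K.faces, Δ t ⊆ (γ ∘ h) ⁻¹' U (A.φ t) := fun t ht x hx => by
    rw [mem_preimage, ← comp_boundaryMap_eqOn hjrange (hAsp ▸ convexHull_subset_space ht hx)]
    exact hγ t ht hx
  have h2 : ∀ t ∈ A.K.faces, ∃ ε > 0, ∀ x ∈ K.space, ∀ y ∈ Δ t,
      dist x y ≤ ε → x ∈ (γ ∘ h) ⁻¹' U (A.φ t) := fun t ht => by
    obtain ⟨O, hO, hOU⟩ := continuousOn_iff'.1 hcont _ (hU (A.φ t))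
    obtain ⟨ε, hε, hth⟩ := (t.finite_toSet.isCompact_convexHull (𝕜 := ℝ)).exists_thickening_subset_open
      hO fun x hx => (hOU.le ⟨hA t ht hx, hbP (hAsp ▸ convexHull_subset_space ht hx)⟩).1
    refine ⟨ε / 2, half_pos hε, fun x hx y hy hxy => (hOU.ge ⟨hth ?_, hx⟩).1⟩
    exact Metric.mem_thickening_iff.2 ⟨y, hy, lt_of_le_of_lt hxy (half_lt_self hε)⟩
  choose! ε hε h2 using h2
  obtain ⟨ε₀, hε₀, hεδ, hεt⟩ : ∃ ε₀ > 0, ε₀ < δ ∧ ∀ t ∈ A.K.faces, ε₀ ≤ ε t := by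
    have hfin := A.isSmoothTriangulation.finite
    have h3 : ∀ᶠ r in 𝓝[>] (0 : ℝ), r < δ ∧ ∀ t ∈ A.K.faces, r ≤ ε t :=
      Filter.Eventually.and (nhdsWithin_le_nhds (Iio_mem_nhds hδ))
        ((Filter.eventually_all_finite hfin).2 fun t ht =>
          nhdsWithin_le_nhds (Iic_mem_nhds (hε t ht)))
    obtain ⟨r, hr, hr0⟩ := (h3.and self_mem_nhdsWithin).exists
    exact ⟨r, hr0, hr⟩
  obtain ⟨K', hfin, hsp, hin, hLK, hKL, hnear⟩ := exists_relative_subdivision hK.finite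
    (L := boundaryComplex h K) (fun s hs => hs.1) A.isSmoothTriangulation.finite hs.1 hs.inside hε₀
  have hK' := hK.subdivision ⟨hsp, hin⟩ hfin
  have h4 : ∀ s ∈ K'.faces, ∃ i, Δ s ⊆ (γ ∘ h) ⁻¹' U i ∧
      (s ∈ A.K.faces → i = A.φ s) := fun s hs => by
    by_cases hsA : s ∈ A.K.faces
    · exact ⟨A.φ s, hA s hsA, fun _ => rfl⟩
    · rcases hnear s hs with hsm | ⟨t, ht, hst⟩
      · obtain ⟨i, hi⟩ := exists_subset_preimage_of_small h1 hεδ hsp hs hsm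
        exact ⟨i, hi, fun h => absurd h hsA⟩
      · refine ⟨A.φ t, fun x hx => ?_, fun h => absurd h hsA⟩
        obtain ⟨y, hy, hxy⟩ := hst x hx
        exact h2 t ht x (hsp ▸ convexHull_subset_space hs hx) y hy
          (hxy.trans (hεt t ht))
  have : Nonempty ι := ⟨A.φ ∅⟩
  choose! φ hφ hφA using h4
  refine ⟨⟨K', hK', φ⟩, ⟨?_, fun s hs => (hφA s (hLK hs) hs).symm⟩, fun s hs _ hx => hφ s hs hx⟩
  have hfaces : A.K.faces = (boundaryComplex h K').faces := Subset.antisymm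
    (fun s hs => ⟨hLK hs, fun x hx => (hAsp.le (convexHull_subset_space hs hx)).2⟩)
    fun s hs => hKL s hs.1 fun x hx => hbK.space_eq.ge
      ⟨hK'.space_eq ▸ convexHull_subset_space hs.1 hx, hs.2 hx⟩
  exact SimplicialComplex.ext hfaces

end Boundary

end
end ChernSimons

theorem mainTheorem3
    -- the target manifold with an open covering and a Deligne cocycle
    {E : Type*} [NormedAddCommGroup E] [NormedSpace ℝ E]
    {X : Type*} [TopologicalSpace X] [ChartedSpace E X] [IsManifold 𝓘(ℝ, E) ∞ X]
    {ι : Type*} (U : ι → Set X) (hU : ∀ i, IsOpen (U i)) (hUcover : ⋃ i, U i = Set.univ)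
    (μ : ChernSimons.DeligneCocycle E U)
    -- the compact oriented 3-manifold and its boundary surface
    {M : Type*} [TopologicalSpace M] [ChartedSpace (EuclideanHalfSpace 3) M]
    [IsManifold (𝓡∂ 3) ∞ M] [CompactSpace M] [T2Space M]
    (oM : ChernSimons.ManifoldOrientation (𝓡∂ 3) M)
    {S : Type*} [TopologicalSpace S] [ChartedSpace (EuclideanSpace ℝ (Fin 2)) S]
    [IsManifold (𝓡 2) ∞ S] [CompactSpace S] [Nonempty S]
    (oS : ChernSimons.ManifoldOrientation (𝓡 2) S)
    (j : C^∞⟮𝓡 2, S; 𝓡∂ 3, M⟯) (hj : Manifold.IsSmoothEmbedding (𝓡 2) (𝓡∂ 3) ∞ j)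
    (hjrange : Set.range j = (𝓡∂ 3).boundary M)
    (hor : ChernSimons.IsBoundaryOrientation oM oS j)
    -- a smooth triangulation of the 3-manifold, which fixes the polyhedron
    {V : Type*} [NormedAddCommGroup V] [NormedSpace ℝ V]
    (P : Set V) (h : V → M) (K₀ : Geometry.SimplicialComplex ℝ V)
    (hK₀ : ChernSimons.IsSmoothTriangulation (𝓡∂ 3) P h K₀) :
    let PS : Set V := ChernSimons.boundaryPoly P h
    let hS : V → S := ChernSimons.boundaryMap h j
    let r : C^∞⟮𝓡∂ 3, M; 𝓘(ℝ, E), X⟯ → C^∞⟮𝓡 2, S; 𝓘(ℝ, E), X⟯ := ChernSimons.restrict j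
    -- the Chern-Simons line bundle: its charts cover, and are bijective on each fibre
    (∀ γ : C^∞⟮𝓡 2, S; 𝓘(ℝ, E), X⟯, ∃ A : ChernSimons.Pair (𝓡 2) PS hS ι, ⇑γ ∈ A.Dom U) ∧
    (∀ (A : ChernSimons.Pair (𝓡 2) PS hS ι) (γ : C^∞⟮𝓡 2, S; 𝓘(ℝ, E), X⟯) (hγ : ⇑γ ∈ A.Dom U),
      Function.Bijective
        (ChernSimons.Fibre.mk A γ hγ : ℂ → ChernSimons.Fibre μ oS PS hS γ)) ∧
    -- the domains of the local actions cover, and every index restricts to the boundary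
    (∀ γ : C^∞⟮𝓡∂ 3, M; 𝓘(ℝ, E), X⟯, ∃ B : ChernSimons.Pair (𝓡∂ 3) P h ι, ⇑γ ∈ B.Dom U) ∧
    (∀ B : ChernSimons.Pair (𝓡∂ 3) P h ι, ∃ A : ChernSimons.Pair (𝓡 2) PS hS ι,
      ChernSimons.IsBoundaryPair B A) ∧
    -- the preimage of the domain of `A` is the union of the domains of the `B` with boundary `A`
    (∀ (B : ChernSimons.Pair (𝓡∂ 3) P h ι) (A : ChernSimons.Pair (𝓡 2) PS hS ι)
      (γ : C^∞⟮𝓡∂ 3, M; 𝓘(ℝ, E), X⟯),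
      ChernSimons.IsBoundaryPair B A → ⇑γ ∈ B.Dom U → ⇑(r γ) ∈ A.Dom U) ∧
    (∀ (K : Geometry.SimplicialComplex ℝ V) (A : ChernSimons.Pair (𝓡 2) PS hS ι)
      (γ : C^∞⟮𝓡∂ 3, M; 𝓘(ℝ, E), X⟯),
      ChernSimons.IsSmoothTriangulation (𝓡∂ 3) P h K →
      ChernSimons.IsSubdivision A.K (ChernSimons.boundaryComplex h K) → ⇑(r γ) ∈ A.Dom U →
        ∃ B : ChernSimons.Pair (𝓡∂ 3) P h ι, ChernSimons.IsBoundaryPair B A ∧ ⇑γ ∈ B.Dom U) ∧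
    -- the local action on the preimage of the domain of `A` is independent of the choice of `B`
    (∀ (B₀ B₁ : ChernSimons.Pair (𝓡∂ 3) P h ι) (A : ChernSimons.Pair (𝓡 2) PS hS ι)
      (γ : C^∞⟮𝓡∂ 3, M; 𝓘(ℝ, E), X⟯),
      ChernSimons.IsBoundaryPair B₀ A → ChernSimons.IsBoundaryPair B₁ A →
      ⇑γ ∈ B₀.Dom U → ⇑γ ∈ B₁.Dom U →
        ChernSimons.localAction μ oM B₀ γ = ChernSimons.localAction μ oM B₁ γ) ∧
    -- the local actions define a unique global section of the pulled back bundle, of norm one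
    (∃ s : (∀ γ : C^∞⟮𝓡∂ 3, M; 𝓘(ℝ, E), X⟯, ChernSimons.Fibre μ oS PS hS (r γ)),
      ChernSimons.IsActionSection μ oM oS j P h s ∧
      (∀ γ, (s γ).1.norm = 1) ∧
      ∀ s', ChernSimons.IsActionSection μ oM oS j P h s' → s' = s) := by
  intro PS hS r
  have : T2Space S := hj.isEmbedding.t2Space
  have : Nonempty M := ⟨j (Classical.arbitrary S)⟩
  have hB := fun γ : C^∞⟮𝓡∂ 3, M; 𝓘(ℝ, E), X⟯ => ChernSimons.exists_pair hK₀ hU hUcover γ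
  have hA : ∀ B : ChernSimons.Pair (𝓡∂ 3) P h ι, ∃ A : ChernSimons.Pair (𝓡 2) PS hS ι,
      ChernSimons.IsBoundaryPair B A := fun B => ⟨⟨_,
    ChernSimons.isSmoothTriangulation_boundary hj hjrange oM B.isSmoothTriangulation, B.φ⟩, rfl,
    fun _ _ => rfl⟩
  have hdom := fun (B : ChernSimons.Pair (𝓡∂ 3) P h ι) (A : ChernSimons.Pair (𝓡 2) PS hS ι)
    (γ : C^∞⟮𝓡∂ 3, M; 𝓘(ℝ, E), X⟯) (hBA : ChernSimons.IsBoundaryPair B A) (hγ : ⇑γ ∈ B.Dom U) =>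
      hBA.mem_dom hjrange hγ
  have hmk : ∀ (B₀ B₁ : ChernSimons.Pair (𝓡∂ 3) P h ι) (A₀ A₁ : ChernSimons.Pair (𝓡 2) PS hS ι)
      (γ : C^∞⟮𝓡∂ 3, M; 𝓘(ℝ, E), X⟯) (_ : ChernSimons.IsBoundaryPair B₀ A₀)
      (_ : ChernSimons.IsBoundaryPair B₁ A₁) (_ : ⇑γ ∈ B₀.Dom U) (_ : ⇑γ ∈ B₁.Dom U)
      (h₀ : ⇑(r γ) ∈ A₀.Dom U) (h₁ : ⇑(r γ) ∈ A₁.Dom U),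
      (ChernSimons.Fibre.mk A₀ (r γ) h₀ (ChernSimons.localAction μ oM B₀ γ) :
        ChernSimons.Fibre μ oS PS hS (r γ)) =
      ChernSimons.Fibre.mk A₁ (r γ) h₁ (ChernSimons.localAction μ oM B₁ γ) := by
    intro B₀ B₁ A₀ A₁ γ hb₀ hb₁ hγ₀ hγ₁ h₀ h₁
    rw [ChernSimons.localAction_eq_gluing_mul hj hjrange hor hU hb₀ hb₁ hγ₀ hγ₁, Circle.coe_mul]
    exact ChernSimons.Fibre.mk_eq_mk hU h₀ h₁ _
  have hbij := fun (A : ChernSimons.Pair (𝓡 2) PS hS ι) (γ : C^∞⟮𝓡 2, S; 𝓘(ℝ, E), X⟯)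
    (hγ : ⇑γ ∈ A.Dom U) => ChernSimons.Fibre.mk_bijective (μ := μ) (o := oS) hU hγ
  choose B hBγ using hB
  choose A hAB using hA
  refine ⟨ChernSimons.exists_pair (ChernSimons.isSmoothTriangulation_boundary hj hjrange oM hK₀) hU
    hUcover, hbij, fun γ => ⟨B γ, hBγ γ⟩, fun B => ⟨A B, hAB B⟩, hdom, fun K A' γ hK hs hγ =>
    ChernSimons.exists_isBoundaryPair_mem_dom hj hjrange oM hU hUcover hK hs hγ,
    fun B₀ B₁ A' γ h₀ h₁ hγ₀ hγ₁ => ?_, fun γ => ChernSimons.Fibre.mk (A (B γ)) (r γ)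
      (hdom _ _ γ (hAB _) (hBγ γ)) (ChernSimons.localAction μ oM (B γ) γ), ?_, ?_, ?_⟩
  · have hγ := hdom _ _ γ h₀ hγ₀
    exact Circle.ext ((hbij A' (r γ) hγ).1 (hmk _ _ _ _ γ h₀ h₁ hγ₀ hγ₁ hγ hγ))
  · exact fun B' A' γ hBA hγ hγ' => hmk _ _ _ _ γ (hAB _) hBA (hBγ γ) hγ _ hγ'
  · exact fun γ => Circle.norm_coe _
  · exact fun s' hs' => funext fun γ => hs' _ _ γ (hAB _) (hBγ γ) (hdom _ _ γ (hAB _) (hBγ γ))
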